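/- Consider the champagne bottle Hamiltonian $H=\frac12(y_1^2+y_2^2)-(x_1^2+x_2^2)+(x_1^2+x_2^2)^2$ on $\mathbb{R}^4$ with angular momentum $x_1y_2-x_2y_1=l$. Its nontrivial action is $$I(h,l)=\frac1{2\pi}\oint p_r\,dr=\frac1{\pi}\int_{\{r>0,\ 2(hr^2+r^4-r^6)\ge l^2\}}\frac{\sqrt{2(hr^2+r^4-r^6)-l^2}}{r}\,dr .$$ Put $j_2=\sqrt2\,l$ and $I_1(h,j_2)=\sqrt2\,I(h,j_2/\sqrt2)$. There is a real function $\mathcal J$, analytic near $(0,0)$, such that, as $(h,j_2)\to(0,0)$, $(h,j_2)\ne(0,0)$, $$2\pi I_1=\frac43-\pi|j_2|+j_2\arg(h+ij_2)+\mathcal J(h,j_2)\ln\frac{16}{\sqrt{h^2+j_2^2}}+h+\frac{17h^2+3j_2^2}{16}-\frac{h(118h^6+273h^4j_2^2+194h^2j_2^4+39j_2^6)}{64(h^2+j_2^2)^2}+\cdots .$$ Here $\arg\in(-\pi,\pi]$ (so $\arg(h+ij_2)=\arctan(j_2/h)$ when $h>0$). The dots mean that there are functions $c_k(h,j_2)$,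 $k\ge1$, each a homogeneous polynomial divided by a power of $h^2+j_2^2$ and homogeneous of degree $k$, with $c_1,c_2,c_3$ the last three displayed terms, such that for every $N\ge0$ the action $2\pi I_1$ equals the sum of the first four terms and of $c_1,\dots,c_N$ up to an error $O\big((h^2+j_2^2)^{(N+1)/2}\big)$. The coefficient of the logarithm satisfies $$\mathcal J=h-\frac{3h^2+j_2^2}{8}+\frac{h(35h^2+15j_2^2)}{64}-\frac{1155h^4+630h^2j_2^2+35j_2^4}{1024}+O\big((h^2+j_2^2)^{5/2}\big).$$ It is the integral over the vanishing cycle: for all small $(h,j_2)$, $$\mathcal J(h,j_2)=\frac{\sqrt2}{2\pi i}\oint_{|z|=1/2}\frac wz\,dz,\qquad w^2=-2z^3+2z^2+2hz-\tfrac12 j_2^2,$$ where $w$ is the branch with $\operatorname{Re}(w/z)>0$ on $|z|=1/2$. It is also the inverse of the Birkhoff normal form of $H$ at the origin. In the symplectic coordinates given by $x_k=2^{-1/4}(q_k-p_k)/\sqrt2$, $y_k=2^{1/4}(q_k+p_k)/\sqrt2$, put $J_1=q_1p_1+q_2p_2$ and $J_2=q_1p_2-q_2p_1$. A Birkhoff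 normal form is a formal power series $\overline H(J_1,J_2)$ without constant term into which $H$ is transformed by a Lie–Deprit series whose generating terms $W_i$ are homogeneous polynomials in $(q,p)$ of degree $i+2$ that Poisson commute with $J_2$. Such a series exists, and for every such $\overline H$ one has, for all small $(h,j_2)$, with absolute convergence of the double series, $$\overline H\big(\mathcal J(h,j_2)/\sqrt2,\ j_2/\sqrt2\big)=h .$$ -/

import Mathlib

open Filter Topology Asymptotics
open scoped Real

noncomputable section

namespace Champagne

/-! ### Action integrals -/

/-- The quantity `r² p_r²` on the level `H = h`, `p_φ = l` of
`H = (p_r² + p_φ²/r²)/2 + r⁴ - r²`. -/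
def radial (h l r : ℝ) : ℝ := 2 * (h * r ^ 2 + r ^ 4 - r ^ 6) - l ^ 2

/-- The nontrivial action `(1/2π) ∮ p_r dr` over the closed curve `H = h`, `p_φ = l` in the
`(r, p_r)` half plane `r > 0`: the curve is symmetric under `p_r ↦ -p_r`, so the integral is twice
the integral of the nonnegative branch of `p_r` over the projection of the curve to the
`r`-axis. -/
def radialAction (h l : ℝ) : ℝ :=
  (1 / (2 * π)) *
    (2 * ∫ r in {r : ℝ | 0 < r ∧ 0 ≤ radial h l r}, √(radial h l r) / r)

/-- The action in the rescaled variables `Ĩ₁ = √2 I₁`, `j₂ = √2 l` (the energy is not scaled). -/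
def action (h j : ℝ) : ℝ := √2 * radialAction h (j / √2)

/-! ### The integral over the vanishing cycle -/

/-- The cubic of the elliptic curve `w² = P(z)`, where `z = r²`. -/
def cubic (h j : ℝ) (z : ℂ) : ℂ := -2 * z ^ 3 + 2 * z ^ 2 + 2 * h * z - (j : ℂ) ^ 2 / 2

/-- The branch of `w = √P(z)` on the circle `|z| = 1/2` with `Re (w / z) > 0`. For small `h, j` it
is holomorphic near that circle, which separates the two roots of `P` close to `0` from the root
close to `1`. -/
def branch (h j : ℝ) (z : ℂ) : ℂ :=
  √2 * z * (1 - z + h / z - (j : ℂ) ^ 2 / (4 * z ^ 2)) ^ (1 / 2 : ℂ)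

theorem branch_sq (h j : ℝ) {z : ℂ} (hz : z ≠ 0) : branch h j z ^ 2 = cubic h j z := by
  have h2 : ((√2 : ℝ) : ℂ) ^ 2 = 2 := by
    rw [← Complex.ofReal_pow, Real.sq_sqrt (by norm_num)]; norm_num
  have hs : ∀ a : ℂ, (a ^ (1 / 2 : ℂ)) ^ 2 = a := fun a => by
    rw [← Complex.cpow_nat_mul]; norm_num
  unfold branch cubic
  rw [mul_pow, mul_pow, h2, hs]
  field_simp
  ring

/-- `(√2 / 2πi) ∮_α (w / z) dz`, where the vanishing cycle `α` is the lift of the circle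
`|z| = 1/2`, which encircles the segment between the two roots of `P` close to `0`. -/
def vanishingPeriod (h j : ℝ) : ℂ :=
  (√2 / (2 * π * Complex.I)) * ∮ z in C(0, 1 / 2), branch h j z / z

/-! ### The Birkhoff normal form at the equilibrium -/

/-- Polynomials on phase space; `Sum.inl i` indexes the positions, `Sum.inr i` the momenta. -/
abbrev Phase := MvPolynomial (Fin 2 ⊕ Fin 2) ℝ

/-- The position coordinates. -/
def pos (i : Fin 2) : Phase := MvPolynomial.X (Sum.inl i)

/-- The momentum coordinates. -/
def mom (i : Fin 2) : Phase := MvPolynomial.X (Sum.inr i)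

/-- The standard Poisson bracket, `{pos i, mom j} = δ i j`. -/
def poisson (f g : Phase) : Phase :=
  ∑ i : Fin 2,
    (MvPolynomial.pderiv (Sum.inl i) f * MvPolynomial.pderiv (Sum.inr i) g
      - MvPolynomial.pderiv (Sum.inr i) f * MvPolynomial.pderiv (Sum.inl i) g)

/-- The Hamiltonian of the champagne bottle in the original coordinates `(x, y)`. -/
def hamiltonian : Phase :=
  MvPolynomial.C (1 / 2) * (mom 0 ^ 2 + mom 1 ^ 2) - (pos 0 ^ 2 + pos 1 ^ 2)
    + (pos 0 ^ 2 + pos 1 ^ 2) ^ 2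

/-- The Hamiltonian in the symplectic coordinates `(q, p)` with
`x = 2^(-1/4) (q - p) / √2` and `y = 2^(1/4) (q + p) / √2`, which bring its quadratic part
to `√2 (q₁ p₁ + q₂ p₂)`. -/
def hamiltonianQP : Phase :=
  MvPolynomial.aeval
    (Sum.elim (fun i => MvPolynomial.C (1 / (√(√2) * √2)) * (pos i - mom i))
      (fun i => MvPolynomial.C (√(√2) / √2) * (pos i + mom i)))
    hamiltonian

/-- `J₁ = q₁ p₁ + q₂ p₂`. -/
def J₁ : Phase := pos 0 * mom 0 + pos 1 * mom 1

/-- `J₂ = q₁ p₂ - q₂ p₁`, the angular momentum. -/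
def J₂ : Phase := pos 0 * mom 1 - pos 1 * mom 0

/-- The Lie-Deprit triangle: `deprit H W i j` is the intermediate Hamiltonian `H_j^i` computed from
`H_j^0 = H j` and the generating function `∑ ε^i W (i+1) / i!`. -/
def deprit (H W : ℕ → Phase) : ℕ → ℕ → Phase
  | 0, j => H j
  | i + 1, j => deprit H W i (j + 1)
      + ∑ k ∈ Finset.range (j + 1),
          (j.choose k : Phase) * poisson (deprit H W i (j - k)) (W (k + 1))

/-- The formal power series `∑ ν a b J₁^a J₂^b` is a Birkhoff normal form of the champagne bottle at
the origin: a formal near-identity symplectic change of variables, generated through the Lie-Deprit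
triangle by rotation invariant homogeneous polynomials `W i` of degree `i + 2`, brings the
Hamiltonian `∑ ε^i H_i^0 / i!` (with `H_i^0 / i!` its part of degree `i + 2` in `(q, p)`) to
`∑ ε^n H_0^n / n!`, where `H_0^n / n!` is the part of degree `n + 2` of `∑ ν a b J₁^a J₂^b`. -/
def IsBirkhoffNormalForm (ν : ℕ → ℕ → ℝ) : Prop :=
  ν 0 0 = 0 ∧
  ∃ W : ℕ → Phase,
    (∀ i, 1 ≤ i → (W i).IsHomogeneous (i + 2) ∧ poisson (W i) J₂ = 0) ∧
    ∀ n : ℕ,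
      deprit
          (fun i => (i.factorial : Phase) *
            MvPolynomial.homogeneousComponent (i + 2) hamiltonianQP) W n 0
        = (n.factorial : Phase) *
          (if Even n then
            ∑ x ∈ Finset.HasAntidiagonal.antidiagonal (n / 2 + 1),
              MvPolynomial.C (ν x.1 x.2) * J₁ ^ x.1 * J₂ ^ x.2
          else 0)

end Champagne

end

noncomputable section

namespace Champagne

/-! ### Rotation invariant polynomials and the homological equation -/

section Birkhoff

open MvPolynomial

/-! With `z = r²` the action and the vanishing period are integrals of the same form `w dz / z` on
one elliptic curve: the action runs between the real turning points, the period around the two roots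
that merge at `0`. Rescaling `z = y / (1 - b)` puts the outer root at `y = 1`, and up to the common
factor `2 (1 - b)^(-3/2)` the integrand becomes `√(1 - y) R / y` with `R² = y² + b y - c² / 4`. Here
`(b, c)` are analytic coordinates near the origin whose relation to `(h, j)` is tangent to the
identity.

Expanding `√(1 - y) = ∑ s_k y^k` turns both integrals into `∑ s_k q_k`, where `q_k` is the `k`-th
moment of `R / y`. Integration by parts gives both moment sequences the same three-term recursion;
the only difference is the boundary term `R(1)³`, present for the action and absent for the closed
cycle. For small `(b, c)` the recursion is a contraction on bounded sequences, so `∑ s_k q_k = q_0 +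
q_1 μ₁ + R(1)³ μ₂` with `μ₁`, `μ₂` analytic in `(b, c)` (`sqrtPairing_eq`). The moments `q_0`, `q_1`
are elementary. For the cycle they are `b / 2` and `-(b² + c²) / 8`; for the action they contain
these very numbers times `-log √(b² + c²)`. Hence the logarithm in the action has exactly the period
as its coefficient (`actionRemainder_eq`). The arccosine in `q_0` supplies `-π |j|` and the
argument. Passing from `(b, c)` back to `(h, j)` leaves an analytic function minus `Re ((𝒥 + i j)
log ((b + i c) / (h + i j)))`. Since `b + i c` and `h + i j` agree to first order, this expands in
homogeneous polynomials over powers of `h² + j²`. Homogeneous terms are determined along rays, where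
one-variable Taylor calculus gives the first ones.

The Birkhoff part is formal first. `{J₁, ·}` is diagonal on monomials, so the homological equation
is solvable up to polynomials in `J₁`, `J₂`; this gives existence. For the inversion, rotation
invariant polynomials are restricted to `q₂ = 0`, `J₂ = l`, a plane with canonical coordinates `log
q₁`, `J₁`. There the residues of `∂_ε H · H^(-n-1)` are unchanged by Lie transforms
(`res_derivative_mul_lie`). For the original Hamiltonian they are an explicit constant-term
computation (`res_redHam`); for a normal form they determine its inverse by formal Lagrange
inversion (`coeff_sum_mul_pow_eq`). The resulting coefficients `invCoeff` coincide with those of the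
convergent residue expansion of the period (`slopeTerm_eq_invCoeff`). Thus every normal form is the
Taylor series of the analytic local inverse of the period, and converges. -/

theorem pderiv_pderiv_comm (i j : Fin 2 ⊕ Fin 2) (f : Phase) :
    pderiv i (pderiv j f) = pderiv j (pderiv i f) := by
  classical
  ext d
  simp only [coeff_pderiv]
  by_cases h : i = j
  · subst h; rfl
  · rw [add_right_comm]
    simp [h, Ne.symm h]
    ring

theorem poisson_eq (f g : Phase) : poisson f g =
    pderiv (Sum.inl 0) f * pderiv (Sum.inr 0) g - pderiv (Sum.inr 0) f * pderiv (Sum.inl 0) g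
    + (pderiv (Sum.inl 1) f * pderiv (Sum.inr 1) g
      - pderiv (Sum.inr 1) f * pderiv (Sum.inl 1) g) := by
  simp only [poisson, Fin.sum_univ_two]

theorem poisson_J₂ (f : Phase) : poisson f J₂ =
    pderiv (Sum.inl 1) f * X (Sum.inl 0) - pderiv (Sum.inl 0) f * X (Sum.inl 1)
      + (pderiv (Sum.inr 1) f * X (Sum.inr 0) - pderiv (Sum.inr 0) f * X (Sum.inr 1)) := by
  simp [poisson_eq, J₂, pos, mom, pderiv_X]
  ring

theorem J₁_poisson (f : Phase) : poisson J₁ f =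
    pderiv (Sum.inr 0) f * X (Sum.inr 0) - pderiv (Sum.inl 0) f * X (Sum.inl 0)
      + (pderiv (Sum.inr 1) f * X (Sum.inr 1) - pderiv (Sum.inl 1) f * X (Sum.inl 1)) := by
  simp [poisson_eq, J₁, pos, mom, pderiv_X]
  ring

theorem poisson_add_left (f g k : Phase) : poisson (f + g) k = poisson f k + poisson g k := by
  simp [poisson_eq]; ring

theorem poisson_sub_left (f g k : Phase) : poisson (f - g) k = poisson f k - poisson g k := by
  simp [poisson_eq]; ring

theorem poisson_sub_right (f g k : Phase) : poisson f (g - k) = poisson f g - poisson f k := by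
  simp [poisson_eq]; ring

theorem poisson_mul_left (f g k : Phase) :
    poisson (f * g) k = f * poisson g k + g * poisson f k := by
  simp [poisson_eq]; ring

theorem poisson_C_left (r : ℝ) (k : Phase) : poisson (C r) k = 0 := by
  simp [poisson_eq]

theorem poisson_sum_left {ι : Type*} (s : Finset ι) (f : ι → Phase) (k : Phase) :
    poisson (∑ i ∈ s, f i) k = ∑ i ∈ s, poisson (f i) k := by
  classical
  induction s using Finset.induction_on with
  | empty => simp [poisson_eq]
  | insert a s ha ih => rw [Finset.sum_insert ha, poisson_add_left, ih, Finset.sum_insert ha]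

theorem poisson_natCast_left (n : ℕ) (k : Phase) : poisson (n : Phase) k = 0 := by
  simp [poisson_eq]

theorem poisson_pow_left {f k : Phase} (h : poisson f k = 0) (n : ℕ) : poisson (f ^ n) k = 0 := by
  induction n with
  | zero => simpa using poisson_C_left 1 k
  | succ n ih => rw [pow_succ, poisson_mul_left, ih, h]; simp

theorem poisson_J₁_J₂ : poisson J₁ J₂ = 0 := by
  simp [poisson_eq, J₁, J₂, pos, mom, pderiv_X]
  ring

theorem poisson_J₂_J₂ : poisson J₂ J₂ = 0 := by
  simp [poisson_eq]; ring

/-- This is the Jacobi identity: bracketing with `J₂` is a derivation of the bracket, so the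
Lie-Deprit triangle stays among rotation invariant polynomials. -/
theorem poisson_poisson_J₂ (f g : Phase) :
    poisson (poisson f g) J₂ = poisson (poisson f J₂) g + poisson f (poisson g J₂) := by
  rw [poisson_J₂ (poisson f g), poisson_J₂ f, poisson_J₂ g]
  simp only [poisson_eq, map_add, map_sub, Derivation.leibniz, smul_eq_mul, pderiv_X,
    pderiv_pderiv_comm (Sum.inl 1) (Sum.inl 0), pderiv_pderiv_comm (Sum.inr 0) (Sum.inl 0),
    pderiv_pderiv_comm (Sum.inr 0) (Sum.inl 1), pderiv_pderiv_comm (Sum.inr 1) (Sum.inl 0),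
    pderiv_pderiv_comm (Sum.inr 1) (Sum.inl 1), pderiv_pderiv_comm (Sum.inr 1) (Sum.inr 0)]
  simp
  ring

/-- Each derivative lowers the degree by one. The degree is given by `m + n = k + 2` to avoid
truncated subtraction; a factor of degree `0` is constant and makes the bracket vanish. -/
theorem poisson_homogeneous {f g : Phase} {m n k : ℕ} (hf : f.IsHomogeneous m)
    (hg : g.IsHomogeneous n) (hk : m + n = k + 2) : (poisson f g).IsHomogeneous k := by
  have key : ∀ i j : Fin 2 ⊕ Fin 2, (pderiv i f * pderiv j g).IsHomogeneous k := by
    intro i j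
    rcases m with _ | m
    · obtain ⟨r, rfl⟩ : ∃ r, f = C r := ⟨_, (totalDegree_eq_zero_iff_eq_C (p := f)).1
        (Nat.le_zero.1 hf.totalDegree_le)⟩
      simpa using isHomogeneous_zero _ _ k
    rcases n with _ | n
    · obtain ⟨r, rfl⟩ : ∃ r, g = C r := ⟨_, (totalDegree_eq_zero_iff_eq_C (p := g)).1
        (Nat.le_zero.1 hg.totalDegree_le)⟩
      simpa using isHomogeneous_zero _ _ k
    have := (hf.pderiv (i := i)).mul (hg.pderiv (i := j))
    convert this using 1
    omega
  rw [poisson_eq]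
  exact ((key _ _).sub (key _ _)).add ((key _ _).sub (key _ _))

/-- The weight of a monomial under the flow of `J₁`. -/
def weight (d : (Fin 2 ⊕ Fin 2) →₀ ℕ) : ℤ :=
  d (Sum.inr 0) + d (Sum.inr 1) - d (Sum.inl 0) - d (Sum.inl 1)

/-- The operator multiplying the component of weight `w` by `φ w`. -/
def weightMultiplier (φ : ℤ → ℝ) (f : Phase) : Phase :=
  ∑ d ∈ f.support, monomial d (φ (weight d) * coeff d f)

theorem coeff_weightMultiplier (φ : ℤ → ℝ) (f : Phase) (d) :
    coeff d (weightMultiplier φ f) = φ (weight d) * coeff d f := by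
  classical
  simp only [weightMultiplier, coeff_sum, coeff_monomial, Finset.sum_ite_eq', mem_support_iff]
  split_ifs with h
  · rfl
  · simp_all

theorem coeff_pderiv_mul_X (i j : Fin 2 ⊕ Fin 2) (f : Phase) (d) :
    coeff d (pderiv i f * X j) = if d j = 0 then 0 else
      coeff (d - Finsupp.single j 1 + Finsupp.single i 1) f
        * (((d - Finsupp.single j 1 : (Fin 2 ⊕ Fin 2) →₀ ℕ) i + 1 : ℕ) : ℝ) := by
  classical
  rw [coeff_mul_X']
  simp only [Finsupp.mem_support_iff, ne_eq, coeff_pderiv, ite_not, Nat.cast_add, Nat.cast_one]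

/-- Bracketing with `J₂` trades one position for another or one momentum for another, so it
preserves the weight. -/
theorem poisson_weightMultiplier_J₂ (φ : ℤ → ℝ) (f : Phase) :
    poisson (weightMultiplier φ f) J₂ = weightMultiplier φ (poisson f J₂) := by
  ext d
  have key : ∀ i j : Fin 2 ⊕ Fin 2, (d j ≠ 0 → weight (d - Finsupp.single j 1 + Finsupp.single i 1)
        = weight d) →
      coeff d (pderiv i (weightMultiplier φ f) * X j)
        = φ (weight d) * coeff d (pderiv i f * X j) := by
    intro i j h
    rw [coeff_pderiv_mul_X, coeff_pderiv_mul_X]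
    split_ifs with hj
    · simp
    · rw [coeff_weightMultiplier, h hj]; ring
  rw [coeff_weightMultiplier, poisson_J₂, poisson_J₂]
  simp only [coeff_add, coeff_sub]
  rw [key, key, key, key]
  · ring
  all_goals
    intro h
    simp [weight]
    omega

/-- `{J₁, ·}` is a difference of Euler operators `p ∂_p` and `q ∂_q`. Monomials are therefore
eigenvectors, and the homological equation becomes diagonal. -/
theorem coeff_J₁_poisson (f : Phase) (d) :
    coeff d (poisson J₁ f) = weight d * coeff d f := by
  have key : ∀ i : Fin 2 ⊕ Fin 2, coeff d (pderiv i f * X i) = d i * coeff d f := by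
    intro i
    rw [coeff_pderiv_mul_X]
    split_ifs with h
    · simp [h]
    · have h1 : d - Finsupp.single i 1 + Finsupp.single i 1 = d :=
        tsub_add_cancel_of_le (Finsupp.single_le_iff.2 (Nat.one_le_iff_ne_zero.2 h))
      have h2 : (d - Finsupp.single i 1 : (Fin 2 ⊕ Fin 2) →₀ ℕ) i + 1 = d i := by simp; omega
      rw [h1, h2, mul_comm]
  simp only [J₁_poisson, coeff_add, coeff_sub, key, weight]
  push_cast
  ring

/-- Restriction to the gauge `q₂ = 0`. -/
def gauge : Phase →ₐ[ℝ] Phase :=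
  aeval fun i => if i = Sum.inl 1 then 0 else X i

theorem coeff_gauge (f : Phase) {d : (Fin 2 ⊕ Fin 2) →₀ ℕ} (hd : d (Sum.inl 1) = 0) :
    coeff d (gauge f) = coeff d f := by
  classical
  induction f using MvPolynomial.induction_on' with
  | add p q hp hq => simp [hp, hq]
  | monomial n a =>
    rw [gauge, aeval_monomial]
    by_cases hn : n (Sum.inl 1) = 0
    · congr 1
      rw [monomial_eq, algebraMap_eq]
      congr 1
      refine Finsupp.prod_congr fun i hi => ?_
      rw [if_neg]
      rintro rfl
      simp_all
    · rw [Finsupp.prod, Finset.prod_eq_zero (i := Sum.inl 1) (by simpa using hn) (by simp [hn])]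
      rw [coeff_monomial, if_neg]
      · simp
      · rintro rfl; exact hn hd

/-- Induction on the power of `q₂`. At the monomial obtained from `d` by replacing one `q₂` by `q₁`,
invariance expresses the coefficient at `d` through coefficients with a lower power of `q₂`. So an
invariant polynomial is determined by its restriction to `q₂ = 0`. -/
theorem eq_zero_of_gauge {f : Phase} (hf : poisson f J₂ = 0)
    (h0 : ∀ d : (Fin 2 ⊕ Fin 2) →₀ ℕ, d (Sum.inl 1) = 0 → coeff d f = 0) : f = 0 := by
  suffices H : ∀ k, ∀ d : (Fin 2 ⊕ Fin 2) →₀ ℕ, d (Sum.inl 1) = k → coeff d f = 0 by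
    ext d; simpa using H _ d rfl
  intro k
  induction k using Nat.strong_induction_on with
  | _ k ih =>
    intro d hd
    rcases k with _ | k
    · exact h0 d hd
    set e := d - Finsupp.single (Sum.inl 1) 1 + Finsupp.single (Sum.inl 0) 1 with he
    have hc : coeff e (poisson f J₂) = 0 := by rw [hf]; simp
    rw [poisson_J₂] at hc
    simp only [coeff_add, coeff_sub, coeff_pderiv_mul_X] at hc
    have e0 : e (Sum.inl 0) ≠ 0 := by simp [he]
    have e1 : e - Finsupp.single (Sum.inl 0) 1 + Finsupp.single (Sum.inl 1) 1 = d := by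
      rw [he, add_tsub_cancel_right]
      exact tsub_add_cancel_of_le (Finsupp.single_le_iff.2 (by omega))
    have e2 : e (Sum.inl 1) = k := by simp [he, hd]
    have z1 : e (Sum.inl 1) ≠ 0 → coeff (e - Finsupp.single (Sum.inl 1) 1
        + Finsupp.single (Sum.inl 0) 1) f = 0 := by
      intro h
      refine ih (k - 1) (by omega) _ ?_
      simp [e2]
    have z2 : ∀ i j : Fin 2, coeff (e - Finsupp.single (Sum.inr i) 1
        + Finsupp.single (Sum.inr j) 1) f = 0 := by
      intro i j
      refine ih k (by omega) _ ?_
      simp [e2]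
    rw [if_neg e0, e1, z2, z2] at hc
    have z3 : (if e (Sum.inl 1) = 0 then (0 : ℝ) else
        coeff (e - Finsupp.single (Sum.inl 1) 1 + Finsupp.single (Sum.inl 0) 1) f *
          (((e - Finsupp.single (Sum.inl 1) 1 : (Fin 2 ⊕ Fin 2) →₀ ℕ) (Sum.inl 0) + 1 : ℕ) : ℝ)) = 0 := by
      split_ifs with h
      · rfl
      · rw [z1 h, zero_mul]
    rw [z3] at hc
    simp only [zero_mul, ite_self, sub_zero, add_zero] at hc
    exact (mul_eq_zero.1 hc).resolve_right (Nat.cast_ne_zero.2 (Nat.succ_ne_zero _))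

/-- A rotation invariant polynomial of degree `m` in the positions and in the momenta is a
polynomial in `J₁` and `J₂`. -/
theorem exists_eq_sum_J₁_J₂ {m : ℕ} {f : Phase} (hf : poisson f J₂ = 0)
    (hh : f.IsHomogeneous (2 * m)) (hw : ∀ d, weight d ≠ 0 → coeff d f = 0) :
    ∃ c : ℕ → ℕ → ℝ, f = ∑ x ∈ Finset.HasAntidiagonal.antidiagonal m,
      C (c x.1 x.2) * J₁ ^ x.1 * J₂ ^ x.2 := by
  classical
  -- On `q₂ = 0` one has `J₁ = q₁ p₁` and `J₂ = q₁ p₂`, so `J₁ ^ a * J₂ ^ b` restricts to the single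
  -- monomial with exponent `mon a b`.
  let mon : ℕ → ℕ → ((Fin 2 ⊕ Fin 2) →₀ ℕ) := fun a b =>
    Finsupp.single (Sum.inl 0) (a + b) + Finsupp.single (Sum.inr 0) a
      + Finsupp.single (Sum.inr 1) b
  refine ⟨fun a b => coeff (mon a b) f, sub_eq_zero.1 (eq_zero_of_gauge ?_ ?_)⟩
  · rw [poisson_sub_left, hf, poisson_sum_left, Finset.sum_eq_zero, sub_zero]
    intro x _
    rw [poisson_mul_left, poisson_mul_left, poisson_C_left, poisson_pow_left poisson_J₁_J₂,
      poisson_pow_left poisson_J₂_J₂]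
    simp
  · intro d hd
    have hJ : ∀ (r : ℝ) (a b : ℕ),
        coeff d (C r * J₁ ^ a * J₂ ^ b) = if mon a b = d then r else 0 := by
      intro r a b
      rw [← coeff_gauge _ hd, ← coeff_monomial]
      congr 1
      simp only [gauge, J₁, J₂, pos, mom, map_mul, map_pow, map_add, map_sub, aeval_X, aeval_C]
      simp only [mon, monomial_eq, reduceCtorEq, if_false, Sum.inl.injEq, zero_ne_one,
        if_true, zero_mul, add_zero, sub_zero, algebraMap_eq, Finsupp.prod_add_index', pow_add,
        Finsupp.prod_single_index, pow_zero, implies_true]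
      ring
    rw [coeff_sub, coeff_sum, sub_eq_zero]
    simp only [hJ]
    -- Weight zero and degree `2 m` make the `q₁`-exponent the sum of the `p₁`- and `p₂`-exponents,
    -- so `d` is one of the `mon a b`. For every other `d` both sides vanish.
    by_cases h : weight d = 0 ∧ d.degree = 2 * m
    · obtain ⟨h1, h2⟩ := h
      rw [Finsupp.degree_eq_sum] at h2
      simp [Fin.sum_univ_two] at h2
      simp only [weight] at h1
      have hmon : mon (d (Sum.inr 0)) (d (Sum.inr 1)) = d := by
        ext i
        rcases i with i | i <;> fin_cases i <;> simp [mon] <;> omega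
      rw [Finset.sum_eq_single (d (Sum.inr 0), d (Sum.inr 1))]
      · simp [hmon]
      · rintro ⟨a, b⟩ _ hne
        rw [if_neg]
        rintro h
        apply hne
        rw [← h]
        simp [mon]
      · intro h
        exact absurd (by simp; omega) h
    · have : coeff d f = 0 := by
        by_contra h'
        apply h
        refine ⟨by by_contra h1; exact h' (hw d h1), by
          by_contra h1; exact h' (hh.coeff_eq_zero h1)⟩
      rw [this, Finset.sum_eq_zero]
      rintro ⟨a, b⟩ _
      split_ifs with hm
      · rw [hm, this]
      · rfl

/-- In the eigenbasis of `{J₁, ·}`, division by the eigenvalue removes every component of nonzero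
weight. What remains has weight zero: a polynomial in `J₁`, `J₂` in even degree, and nothing in odd
degree. -/
theorem exists_homological_solution (n : ℕ) {G : Phase} (hG : G.IsHomogeneous (n + 2))
    (hr : poisson G J₂ = 0) {lam : ℝ} (hlam : lam ≠ 0) :
    ∃ W : Phase, W.IsHomogeneous (n + 2) ∧ poisson W J₂ = 0 ∧ ∃ c : ℕ → ℕ → ℝ,
      G + poisson (C lam * J₁) W = if Even n then
        ∑ x ∈ Finset.HasAntidiagonal.antidiagonal (n / 2 + 1),
          C (c x.1 x.2) * J₁ ^ x.1 * J₂ ^ x.2 else 0 := by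
  classical
  have hom : ∀ φ, (weightMultiplier φ G).IsHomogeneous (n + 2) := by
    intro φ d hd
    rw [coeff_weightMultiplier] at hd
    exact hG (right_ne_zero_of_mul hd)
  have rot : ∀ φ, poisson (weightMultiplier φ G) J₂ = 0 := by
    intro φ
    rw [poisson_weightMultiplier_J₂, hr]
    ext d; simp [coeff_weightMultiplier]
  -- At weight `0` the convention `0⁻¹ = 0` keeps that component out of `W`.
  refine ⟨weightMultiplier (fun w => - (lam * w)⁻¹) G, hom _, rot _, ?_⟩
  have key : G + poisson (C lam * J₁) (weightMultiplier (fun w => - (lam * w)⁻¹) G)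
      = weightMultiplier (fun w => if w = 0 then 1 else 0) G := by
    ext d
    have : poisson (C lam * J₁) (weightMultiplier (fun w => - (lam * w)⁻¹) G)
        = C lam * poisson J₁ (weightMultiplier (fun w => - (lam * w)⁻¹) G) := by
      rw [poisson_mul_left, poisson_C_left]; simp
    rw [this, coeff_add, coeff_C_mul, coeff_J₁_poisson, coeff_weightMultiplier,
      coeff_weightMultiplier]
    by_cases h : weight d = 0
    · simp [h]
    · have : (weight d : ℝ) ≠ 0 := by exact_mod_cast h
      simp only [h, if_false]
      field_simp
      ring
  rw [key]
  by_cases hn : Even n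
  · simp only [hn, if_true]
    refine exists_eq_sum_J₁_J₂ (rot _) ?_ ?_
    · convert hom _ using 1
      obtain ⟨k, rfl⟩ := hn
      omega
    · intro d hd
      simp [coeff_weightMultiplier, hd]
  · refine ⟨0, ?_⟩
    simp only [hn, if_false]
    ext d
    rw [coeff_weightMultiplier, coeff_zero]
    by_cases hd : weight d = 0
    · rw [hG.coeff_eq_zero, mul_zero]
      intro h
      rw [Finsupp.degree_eq_sum] at h
      simp [Fin.sum_univ_two] at h
      simp only [weight] at hd
      apply hn
      rw [Nat.even_iff]
      omega
    · simp [hd]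

end Birkhoff

/-! ### Existence of a Birkhoff normal form by successive normalisation. -/

section BirkhoffExistence

open MvPolynomial

/-- `x₁² + x₂²` in the coordinates `(q, p)`. -/
def radiusSq : Phase :=
  C (1 / (2 * √2)) * ((pos 0 - mom 0) ^ 2 + (pos 1 - mom 1) ^ 2)

/-- The factors `2^(±1/4)` give `½ |y|²` and `|x|²` the same coefficient `√2 / 4` in front of `|q +
p|²` and `|q - p|²`, whose difference polarises to `4 (q₁ p₁ + q₂ p₂)`. -/
theorem hamiltonianQP_eq : hamiltonianQP = C √2 * J₁ + radiusSq ^ 2 := by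
  have h0 : √(√2) ^ 2 = √2 := Real.sq_sqrt (Real.sqrt_nonneg _)
  have h1 : √2 ^ 2 = 2 := Real.sq_sqrt (by norm_num)
  have h2 : √2 ≠ 0 := by positivity
  have h3 : √(√2) ≠ 0 := by positivity
  have e1 : (C (1 / (√(√2) * √2)) : Phase) ^ 2 = C (1 / (2 * √2)) := by
    rw [← C_pow]; congr 1; rw [div_pow, mul_pow, h0, h1]; ring
  have e2 : (C (√(√2) / √2) : Phase) ^ 2 = C (√2 / 2) := by
    rw [← C_pow, div_pow, h0, h1]
  have e3 : (C (1 / 2) : Phase) * C (√2 / 2) = C (1 / (2 * √2)) := by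
    rw [← C_mul]; congr 1; field_simp; rw [h1]
  have e4 : (4 : Phase) * C (1 / (2 * √2)) = C √2 := by
    rw [show (4 : Phase) = C 4 from rfl, ← C_mul]; congr 1; field_simp; rw [h1]; norm_num
  have hX : aeval (Sum.elim (fun i => C (1 / (√(√2) * √2)) * (pos i - mom i))
      (fun i => C (√(√2) / √2) * (pos i + mom i))) (pos 0 ^ 2 + pos 1 ^ 2) = radiusSq := by
    simp only [pos, mom, map_add, map_pow, aeval_X, Sum.elim_inl, radiusSq, mul_pow, e1]
    ring
  have hY : aeval (Sum.elim (fun i => C (1 / (√(√2) * √2)) * (pos i - mom i))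
      (fun i => C (√(√2) / √2) * (pos i + mom i))) (mom 0 ^ 2 + mom 1 ^ 2)
      = C (√2 / 2) * ((pos 0 + mom 0) ^ 2 + (pos 1 + mom 1) ^ 2) := by
    simp only [pos, mom, map_add, map_pow, aeval_X, Sum.elim_inr, mul_pow, e2]
    ring
  rw [hamiltonianQP, hamiltonian, map_add, map_sub, map_mul, map_pow, hX, hY, aeval_C,
    algebraMap_eq, ← mul_assoc, e3, ← e4, radiusSq, J₁]
  ring

theorem isHomogeneous_pos (i : Fin 2) : (pos i).IsHomogeneous 1 := isHomogeneous_X _ _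

theorem isHomogeneous_mom (i : Fin 2) : (mom i).IsHomogeneous 1 := isHomogeneous_X _ _

theorem isHomogeneous_J₁ : J₁.IsHomogeneous 2 :=
  ((isHomogeneous_pos 0).mul (isHomogeneous_mom 0)).add
    ((isHomogeneous_pos 1).mul (isHomogeneous_mom 1))

theorem isHomogeneous_radiusSq : radiusSq.IsHomogeneous 2 :=
  ((((isHomogeneous_pos 0).sub (isHomogeneous_mom 0)).pow 2).add
    (((isHomogeneous_pos 1).sub (isHomogeneous_mom 1)).pow 2)).C_mul _

theorem poisson_radiusSq_J₂ : poisson radiusSq J₂ = 0 := by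
  simp [poisson_J₂, radiusSq, pos, mom, pderiv_X, Derivation.leibniz_pow]
  ring

/-- The sequence of the terms `H_i^0` of the champagne bottle Hamiltonian. -/
def levels (i : ℕ) : Phase := (i.factorial : Phase) * homogeneousComponent (i + 2) hamiltonianQP

theorem homogeneousComponent_hamiltonianQP (i : ℕ) :
    homogeneousComponent (i + 2) hamiltonianQP
      = if i = 0 then C √2 * J₁ else if i = 2 then radiusSq ^ 2 else 0 := by
  rw [hamiltonianQP_eq, map_add,
    homogeneousComponent_of_mem (isHomogeneous_J₁.C_mul √2),
    homogeneousComponent_of_mem (isHomogeneous_radiusSq.pow 2)]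
  rcases i with _ | _ | _ | i <;> simp

theorem levels_zero : levels 0 = C √2 * J₁ := by
  simp [levels, homogeneousComponent_hamiltonianQP]

theorem isHomogeneous_natCast_mul {f : Phase} {n : ℕ} (hf : f.IsHomogeneous n) (k : ℕ) :
    ((k : Phase) * f).IsHomogeneous n := by
  simpa using hf.C_mul (k : ℝ)

theorem poisson_natCast_mul_left (k : ℕ) (f g : Phase) :
    poisson ((k : Phase) * f) g = k * poisson f g := by
  rw [poisson_mul_left, poisson_natCast_left]; simp

theorem isHomogeneous_levels (i : ℕ) : (levels i).IsHomogeneous (i + 2) :=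
  isHomogeneous_natCast_mul (homogeneousComponent_isHomogeneous (i + 2) hamiltonianQP) i.factorial

theorem poisson_levels_J₂ (i : ℕ) : poisson (levels i) J₂ = 0 := by
  rw [levels, poisson_natCast_mul_left, homogeneousComponent_hamiltonianQP]
  split_ifs
  · rw [poisson_mul_left, poisson_C_left, poisson_J₁_J₂]; simp
  · rw [poisson_pow_left poisson_radiusSq_J₂]; simp
  · simp [poisson_eq]

theorem deprit_succ (H W : ℕ → Phase) (i j : ℕ) :
    deprit H W (i + 1) j = deprit H W i (j + 1)
      + ∑ k ∈ Finset.range (j + 1),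
          (j.choose k : Phase) * poisson (deprit H W i (j - k)) (W (k + 1)) := rfl

theorem deprit_congr {H W W' : ℕ → Phase} (i j : ℕ) (h : ∀ k, k ≤ i + j → W k = W' k) :
    deprit H W i j = deprit H W' i j := by
  induction i generalizing j with
  | zero => rfl
  | succ i ih =>
    rw [deprit_succ, deprit_succ, ih _ fun k hk => h k (by omega)]
    refine congrArg _ (Finset.sum_congr rfl fun k hk => ?_)
    rw [Finset.mem_range] at hk
    rw [ih _ fun k' hk' => h k' (by omega), h (k + 1) (by omega)]

/-- The last generator enters only through the term `k = j` of the first row, which is `{H 0, W (j +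
1)}` with coefficient `1`. The first summand of the recursion carries it unchanged along the
antidiagonal; all other terms involve earlier generators. -/
theorem deprit_sub_of_agree {H W W' : ℕ → Phase} (i j : ℕ)
    (h : ∀ k, k < i + 1 + j → W k = W' k) :
    deprit H W (i + 1) j = deprit H W' (i + 1) j
      + poisson (H 0) (W (i + 1 + j) - W' (i + 1 + j)) := by
  induction i generalizing j with
  | zero =>
    simp only [deprit]
    rw [Finset.sum_range_succ, Finset.sum_range_succ, poisson_sub_right]
    have hs : ∀ k ∈ Finset.range j, (j.choose k : Phase) * poisson (H (j - k)) (W (k + 1))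
        = j.choose k * poisson (H (j - k)) (W' (k + 1)) := fun k hk => by
      rw [Finset.mem_range] at hk
      rw [h (k + 1) (by omega)]
    rw [Finset.sum_congr rfl hs]
    simp only [Nat.choose_self, Nat.cast_one, one_mul, tsub_self, zero_add]
    rw [add_comm 1 j]
    ring
  | succ i ih =>
    rw [deprit, ih (j + 1) fun k hk => h k (by omega), deprit_succ H W' (i + 1)]
    have hs : ∀ k ∈ Finset.range (j + 1),
        (j.choose k : Phase) * poisson (deprit H W (i + 1) (j - k)) (W (k + 1))
        = j.choose k * poisson (deprit H W' (i + 1) (j - k)) (W' (k + 1)) := fun k hk => by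
      rw [Finset.mem_range] at hk
      rw [deprit_congr (i + 1) (j - k) fun k' hk' => h k' (by omega), h (k + 1) (by omega)]
    rw [Finset.sum_congr rfl hs]
    rw [show i + 1 + (j + 1) = i + 1 + 1 + j by ring]
    ring

theorem deprit_homogeneous {W : ℕ → Phase} (i j : ℕ)
    (hW : ∀ k, 1 ≤ k → k ≤ i + j → (W k).IsHomogeneous (k + 2) ∧ poisson (W k) J₂ = 0) :
    IsHomogeneous (deprit levels W i j) (i + j + 2)
      ∧ poisson (deprit levels W i j) J₂ = 0 := by
  induction i generalizing j with
  | zero =>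
    simpa [deprit] using ⟨isHomogeneous_levels j, poisson_levels_J₂ j⟩
  | succ i ih =>
    simp only [deprit]
    constructor
    · refine IsHomogeneous.add ?_ (IsHomogeneous.sum _ _ _ fun k hk => ?_)
      · convert (ih (j + 1) fun k h1 hk => hW k h1 (by omega)).1 using 1
        ring
      · rw [Finset.mem_range] at hk
        refine isHomogeneous_natCast_mul (poisson_homogeneous
          (ih (j - k) fun k h1 hk => hW k h1 (by omega)).1 (hW (k + 1) (by omega) (by omega)).1
          (by omega)) _
    · rw [poisson_add_left, (ih (j + 1) fun k h1 hk => hW k h1 (by omega)).2, zero_add,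
        poisson_sum_left]
      refine Finset.sum_eq_zero fun k hk => ?_
      rw [Finset.mem_range] at hk
      rw [poisson_natCast_mul_left, poisson_poisson_J₂,
        (ih (j - k) fun k h1 hk => hW k h1 (by omega)).2,
        (hW (k + 1) (by omega) (by omega)).2]
      simp [poisson_eq]

/-- `f` is `n!` times the part of degree `n + 2` of a power series in `J₁` and `J₂`. -/
def IsNormal (n : ℕ) (f : Phase) (c : ℕ → ℕ → ℝ) : Prop :=
  f = (n.factorial : Phase) * (if Even n then
    ∑ x ∈ Finset.HasAntidiagonal.antidiagonal (n / 2 + 1),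
      C (c x.1 x.2) * J₁ ^ x.1 * J₂ ^ x.2 else 0)

/-- Inserting `w` in the vacant place `n` changes the entry of order `n` exactly by `{√2 J₁, w}`,
which leaves a homological equation. -/
theorem exists_normalizing_term {W : ℕ → Phase} (n : ℕ)
    (hW : ∀ k, 1 ≤ k → (W k).IsHomogeneous (k + 2) ∧ poisson (W k) J₂ = 0) (hn : 1 ≤ n)
    (h0 : W n = 0) :
    ∃ w : Phase, w.IsHomogeneous (n + 2) ∧ poisson w J₂ = 0 ∧
      ∃ c, IsNormal n (deprit levels (Function.update W n w) n 0) c := by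
  obtain ⟨hG, hr⟩ := deprit_homogeneous n 0 fun k h1 _ => hW k h1
  obtain ⟨w, h1, h2, c, hc⟩ := exists_homological_solution n hG hr
    (lam := √2) (by positivity)
  refine ⟨w, h1, h2, fun a b => (n.factorial : ℝ)⁻¹ * c a b, ?_⟩
  obtain ⟨m, rfl⟩ : ∃ m, n = m + 1 := ⟨n - 1, by omega⟩
  rw [IsNormal, deprit_sub_of_agree (W' := W) m 0 fun k hk => by
    rw [Function.update_of_ne (by omega)]]
  rw [add_zero, Function.update_self, h0, sub_zero, levels_zero, hc]
  split_ifs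
  · rw [Finset.mul_sum]
    refine Finset.sum_congr rfl fun x _ => ?_
    rw [show (((m + 1).factorial : ℕ) : Phase) = C ((m + 1).factorial : ℝ) by simp, ← mul_assoc,
      ← mul_assoc, ← C_mul, ← mul_assoc, mul_inv_cancel₀ (by positivity), one_mul]
  · simp

/-- The generators are chosen one order at a time. Order `n` of the triangle sees only `W 1, …, W
n`, so the successive finite lists stabilise and their diagonal normalises every order. -/
theorem exists_isBirkhoffNormalForm : ∃ ν, IsBirkhoffNormalForm ν := by
  classical
  let Good : (ℕ → Phase) → Prop := fun W =>
    ∀ k, 1 ≤ k → (W k).IsHomogeneous (k + 2) ∧ poisson (W k) J₂ = 0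
  have step : ∀ (n : ℕ) (W : {W : ℕ → Phase // Good W ∧ ∀ k, n < k → W k = 0}),
      ∃ W' : {W : ℕ → Phase // Good W ∧ ∀ k, n + 1 < k → W k = 0},
        (∀ k, k ≤ n → W'.1 k = W.1 k) ∧ ∃ c, IsNormal (n + 1) (deprit levels W'.1 (n + 1) 0) c := by
    rintro n ⟨W, hW, h0⟩
    obtain ⟨w, h1, h2, h3⟩ := exists_normalizing_term (n + 1) hW (by omega) (h0 _ (by omega))
    refine ⟨⟨Function.update W (n + 1) w, ?_, ?_⟩, ?_, h3⟩
    · intro k hk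
      by_cases h : k = n + 1
      · subst h; simpa using ⟨h1, h2⟩
      · rw [Function.update_of_ne h]; exact hW k hk
    · intro k hk
      rw [Function.update_of_ne (by omega)]; exact h0 k (by omega)
    · intro k hk
      exact Function.update_of_ne (by omega) _ _
  choose next hnext hnormal using step
  have good0 : Good 0 := fun k _ => ⟨isHomogeneous_zero _ _ _, by simp [poisson_eq]⟩
  let F : ∀ n : ℕ, {W : ℕ → Phase // Good W ∧ ∀ k, n < k → W k = 0} := fun n =>
    Nat.rec ⟨0, good0, fun _ _ => rfl⟩ (fun n W => next n W) n
  have hF : ∀ n, F (n + 1) = next n (F n) := fun n => rfl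
  have hstab : ∀ d n, ∀ k, k ≤ n → (F (n + d)).1 k = (F n).1 k := by
    intro d
    induction d with
    | zero => intros; rfl
    | succ d ih =>
      intro n k hk
      rw [← add_assoc, hF, hnext _ _ _ (by omega), ih n k hk]
  let W : ℕ → Phase := fun n => (F n).1 n
  have hW : Good W := fun k hk => (F k).2.1 k hk
  have hnf : ∀ n, ∃ c, IsNormal n (deprit levels W n 0) c := by
    intro n
    rcases n with _ | n
    · refine ⟨fun a _ => if a = 1 then √2 else 0, ?_⟩
      simp [IsNormal, deprit, levels_zero, Finset.Nat.antidiagonal_succ]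
    · obtain ⟨c, hc⟩ := hnormal n (F n)
      refine ⟨c, ?_⟩
      rw [deprit_congr (W' := (next n (F n)).1) (n + 1) 0]
      · exact hc
      · intro k hk
        rw [← hF]
        have := hstab (n + 1 - k) k k le_rfl
        rw [show k + (n + 1 - k) = n + 1 by omega] at this
        exact this.symm
  choose c hc using hnf
  -- Order `n` only uses coefficients with `a + b = n / 2 + 1`, so the orders involve disjoint sets
  -- of pairs and fit into one double sequence.
  refine ⟨fun a b => if a + b = 0 then 0 else c (2 * (a + b - 1)) a b, by simp, W, hW, fun n => ?_⟩
  have := hc n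
  rw [IsNormal] at this
  refine this.trans ?_
  split_ifs with h
  · congr 1
    refine Finset.sum_congr rfl fun x hx => ?_
    rw [Finset.HasAntidiagonal.mem_antidiagonal] at hx
    obtain ⟨m, rfl⟩ := h
    simp only
    rw [if_neg (by omega), show 2 * (x.1 + x.2 - 1) = m + m by omega]
  · rfl

end BirkhoffExistence

/-! ### Formal residues and Lie transforms -/

section Coefficientwise

open PowerSeries

variable {A : Type*} [CommRing A] [Algebra ℝ A]

/-- The coefficientwise extension of a derivation to power series. -/
def coeffDeriv (θ : Derivation ℝ A A) : Derivation ℝ A⟦X⟧ A⟦X⟧ :=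
  Derivation.mk'
    { toFun := fun f => PowerSeries.mk fun n => θ (coeff n f)
      map_add' := fun f g => by ext n; simp
      map_smul' := fun r f => by ext n; simp }
    (fun f g => by
      ext n
      simp only [LinearMap.coe_mk, AddHom.coe_mk, coeff_mk, coeff_mul, map_sum, map_add,
        smul_eq_mul, Derivation.leibniz]
      rw [Finset.sum_add_distrib]
      congr 1
      rw [← Finset.Nat.sum_antidiagonal_swap]
      rfl)

@[simp]
theorem coeff_coeffDeriv (θ : Derivation ℝ A A) (f : A⟦X⟧) (n : ℕ) :
    coeff n (coeffDeriv θ f) = θ (coeff n f) := by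
  simp [coeffDeriv]

theorem derivative_coeffDeriv (θ : Derivation ℝ A A) (f : A⟦X⟧) :
    derivative A (coeffDeriv θ f) = coeffDeriv θ (derivative A f) := by
  ext n
  simp only [coeff_derivative, coeff_coeffDeriv, Derivation.leibniz, smul_eq_mul]
  have : θ ((n : A) + 1) = 0 := by rw [map_add]; simp
  rw [this]; ring

theorem coeffDeriv_comm {θ₁ θ₂ : Derivation ℝ A A} (h : ∀ a, θ₁ (θ₂ a) = θ₂ (θ₁ a)) (f : A⟦X⟧) :
    coeffDeriv θ₁ (coeffDeriv θ₂ f) = coeffDeriv θ₂ (coeffDeriv θ₁ f) := by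
  ext n; simp [h]

theorem eq_neg_of_inverse_pow {D : Derivation ℝ A⟦X⟧ A⟦X⟧} {n : ℕ} {G H : A⟦X⟧}
    (h : G * H ^ (n + 1) = 1) : D G = - ((n + 1 : ℕ) * G ^ 2 * H ^ n * D H) := by
  have h1 : D (G * H ^ (n + 1)) = 0 := by rw [h]; simp
  rw [Derivation.leibniz, Derivation.leibniz_pow] at h1
  simp only [smul_eq_mul, Nat.add_sub_cancel, nsmul_eq_mul] at h1
  linear_combination G * h1 - D G * h

end Coefficientwise

/-- An algebra with logarithmic canonical coordinates: a unit `u` with inverse `v`, two commuting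
derivations and a trace killing their images. -/
structure LogCanonical (A : Type*) [CommRing A] [Algebra ℝ A] where
  /-- the second momentum -/
  u : A
  /-- the inverse of `u` -/
  v : A
  u_mul_v : u * v = 1
  /-- the first logarithmic derivation -/
  θ₁ : Derivation ℝ A A
  /-- the second logarithmic derivation -/
  θ₂ : Derivation ℝ A A
  comm : ∀ a, θ₁ (θ₂ a) = θ₂ (θ₁ a)
  /-- the trace -/
  t : A →ₗ[ℝ] ℝ
  t_θ₁ : ∀ a, t (θ₁ a) = 0
  t_θ₂ : ∀ a, t (θ₂ a) = 0

namespace LogCanonical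

open PowerSeries

variable {A : Type*} [CommRing A] [Algebra ℝ A] (L : LogCanonical A)

/-- The Poisson bracket. -/
def bracket (f g : A) : A := L.v * (L.θ₁ f * L.θ₂ g - L.θ₂ f * L.θ₁ g)

/-- The residue of a power series, coefficientwise. -/
def res (k : ℕ) (F : A⟦X⟧) : ℝ := L.t (L.u * coeff k F)

/-- The generator of the Lie transform. -/
def generator (W F : A⟦X⟧) : A⟦X⟧ :=
  derivative A F + C L.v * (coeffDeriv L.θ₁ F * coeffDeriv L.θ₂ W
    - coeffDeriv L.θ₂ F * coeffDeriv L.θ₁ W)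

theorem generator_mul (W F G : A⟦X⟧) :
    L.generator W (F * G) = F * L.generator W G + G * L.generator W F := by
  simp only [generator, Derivation.leibniz, smul_eq_mul]
  ring

/-- The Lie transform. -/
def lie (W F : A⟦X⟧) : A⟦X⟧ :=
  PowerSeries.mk fun n => (n.factorial : ℝ)⁻¹ • coeff 0 ((L.generator W)^[n] F)

/-- The coefficients of `lie` are the Taylor coefficients at `ε = 0` of the flow of the generator,
so shifting the index replaces `∂_ε` by the generator. With agreement at `ε = 0`, this intertwining
gives multiplicativity and the invariance of residues. -/
theorem derivative_lie (W F : A⟦X⟧) :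
    derivative A (L.lie W F) = L.lie W (L.generator W F) := by
  ext n
  rw [coeff_derivative, lie, lie, coeff_mk, coeff_mk, ← Function.iterate_succ_apply]
  rw [show ((n : A) + 1) = algebraMap ℝ A (n + 1) by simp, mul_comm, ← Algebra.smul_def, smul_smul,
    Nat.factorial_succ]
  congr 1
  push_cast
  field_simp

theorem coeff_zero_lie (W F : A⟦X⟧) : coeff 0 (L.lie W F) = coeff 0 F := by
  simp [lie]

theorem coeff_succ_eq {f : A⟦X⟧} {n : ℕ} :
    coeff (n + 1) f = ((n : ℝ) + 1)⁻¹ • coeff n (derivative A f) := by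
  rw [coeff_derivative, show ((n : A) + 1) = algebraMap ℝ A (n + 1) by simp, mul_comm,
    ← Algebra.smul_def, smul_smul, inv_mul_cancel₀ (by positivity), one_smul]

theorem lie_add (W F G : A⟦X⟧) : L.lie W (F + G) = L.lie W F + L.lie W G := by
  have hD : ∀ n, (L.generator W)^[n] (F + G) = (L.generator W)^[n] F + (L.generator W)^[n] G := by
    intro n
    induction n with
    | zero => rfl
    | succ n ih =>
      simp only [Function.iterate_succ_apply', ih]
      simp only [generator, map_add]
      ring
  ext n
  simp [lie, hD]

/-- Induction on the order in `ε`: the two sides agree at `ε = 0`, and because the generator is a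
derivation their `ε`-derivatives satisfy the same identity one order lower. -/
theorem lie_mul (W F G : A⟦X⟧) : L.lie W (F * G) = L.lie W F * L.lie W G := by
  ext n
  induction n using Nat.strong_induction_on generalizing F G with
  | _ n ih =>
    rcases n with _ | n
    · rw [coeff_zero_lie, coeff_mul, coeff_mul]
      simp [coeff_zero_lie]
    · rw [coeff_succ_eq, coeff_succ_eq]
      congr 1
      rw [derivative_lie, Derivation.leibniz, derivative_lie, derivative_lie, generator_mul,
        lie_add, map_add, map_add, ih n (by omega), ih n (by omega)]
      rfl

theorem lie_one (W : A⟦X⟧) : L.lie W 1 = 1 := by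
  have h : L.generator W 1 = 0 := by simp [generator]
  have h0 : ∀ n, (L.generator W)^[n] 0 = 0 := by
    intro n
    induction n with
    | zero => rfl
    | succ n ih => rw [Function.iterate_succ_apply', ih]; simp [generator]
  ext n
  rcases n with _ | n
  · simp [coeff_zero_lie]
  · simp [lie, Function.iterate_succ_apply, h, h0, PowerSeries.coeff_one]

theorem lie_pow (W F : A⟦X⟧) (n : ℕ) : L.lie W (F ^ n) = L.lie W F ^ n := by
  induction n with
  | zero => simp [lie_one]
  | succ n ih => rw [pow_succ, pow_succ, lie_mul, ih]

theorem res_add (k : ℕ) (F G : A⟦X⟧) : L.res k (F + G) = L.res k F + L.res k G := by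
  simp [res, mul_add]

theorem res_C_v_mul (k : ℕ) (F : A⟦X⟧) : L.res k (C L.v * F) = L.t (coeff k F) := by
  rw [res, coeff_C_mul, ← mul_assoc, u_mul_v, one_mul]

theorem res_derivative (k : ℕ) (F : A⟦X⟧) :
    L.res k (derivative A F) = (k + 1) * L.res (k + 1) F := by
  rw [res, res, coeff_derivative, show ((k : A) + 1) = algebraMap ℝ A (k + 1) by simp,
    mul_comm (coeff (k + 1) F), ← Algebra.smul_def, mul_smul_comm, map_smul]
  rfl

theorem t_coeff_coeffDeriv₁ (k : ℕ) (F : A⟦X⟧) : L.t (coeff k (coeffDeriv L.θ₁ F)) = 0 := by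
  simp [t_θ₁]

theorem t_coeff_coeffDeriv₂ (k : ℕ) (F : A⟦X⟧) : L.t (coeff k (coeffDeriv L.θ₂ F)) = 0 := by
  simp [t_θ₂]

/-- If the form with logarithmic components `(P, Q)` is closed, its wedge with `dW` is exact: it is
a difference of total derivatives, which the trace kills. The components of `dF` give the bracket
`{F, W}`. -/
theorem res_closed (k : ℕ) {P Q W : A⟦X⟧} (h : coeffDeriv L.θ₂ P = coeffDeriv L.θ₁ Q) :
    L.res k (C L.v * (P * coeffDeriv L.θ₂ W - Q * coeffDeriv L.θ₁ W)) = 0 := by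
  rw [res_C_v_mul]
  have : P * coeffDeriv L.θ₂ W - Q * coeffDeriv L.θ₁ W
      = coeffDeriv L.θ₂ (P * W) - coeffDeriv L.θ₁ (Q * W) := by
    simp only [Derivation.leibniz, smul_eq_mul, h]
    ring
  rw [this, map_sub, map_sub, t_coeff_coeffDeriv₁, t_coeff_coeffDeriv₂, sub_zero]

theorem res_generator (k : ℕ) (W F : A⟦X⟧) :
    L.res k (L.generator W F) = (k + 1) * L.res (k + 1) F := by
  rw [generator, res_add, res_derivative, res_closed, add_zero]
  rw [coeffDeriv_comm L.comm]

/-- Canonical changes of variables preserve the residue. The induction uses that, on residues, the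
generator and `∂_ε` both shift the order with the same factor, because a bracket has no residue. -/
theorem res_lie (k : ℕ) (W F : A⟦X⟧) : L.res k (L.lie W F) = L.res k F := by
  induction k generalizing F with
  | zero => rw [res, coeff_zero_lie, res]
  | succ k ih =>
    have h := L.res_derivative k (L.lie W F)
    rw [derivative_lie, ih, res_generator] at h
    have : (k : ℝ) + 1 ≠ 0 := by positivity
    exact (mul_left_cancel₀ this h).symm

/-- The residues of the powers of a power series are invariant under Lie transforms. -/
theorem res_derivative_mul_lie (k n : ℕ) {W H G G' : A⟦X⟧} (hG : G * H ^ (n + 1) = 1)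
    (hG' : G' * L.lie W H ^ (n + 1) = 1) :
    L.res k (derivative A (L.lie W H) * G') = L.res k (derivative A H * G) := by
  have h1 : G' = L.lie W G := by
    have h2 : L.lie W G * L.lie W H ^ (n + 1) = 1 := by
      rw [← lie_pow, ← lie_mul, hG, lie_one]
    linear_combination L.lie W G * hG' - G' * h2
  rw [h1, derivative_lie, ← lie_mul, res_lie, generator, add_mul, res_add]
  -- With `G = H^(-n-1)` the form `G dH` is closed, so the part of the generator containing `{H, W}`
  -- contributes no residue.
  have h3 := L.res_closed k (P := G * coeffDeriv L.θ₁ H) (Q := G * coeffDeriv L.θ₂ H) (W := W) (by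
    rw [Derivation.leibniz, Derivation.leibniz, eq_neg_of_inverse_pow hG,
      eq_neg_of_inverse_pow hG, coeffDeriv_comm L.comm]
    simp only [smul_eq_mul]
    ring)
  rw [show C L.v * (coeffDeriv L.θ₁ H * coeffDeriv L.θ₂ W - coeffDeriv L.θ₂ H * coeffDeriv L.θ₁ W)
      * G = C L.v * (G * coeffDeriv L.θ₁ H * coeffDeriv L.θ₂ W
        - G * coeffDeriv L.θ₂ H * coeffDeriv L.θ₁ W) by ring, h3, add_zero]

/-- The Lie transform computes the Lie-Deprit triangle. -/
theorem factorial_smul_coeff_iterate_generator {w : ℕ → A} {d : ℕ → ℕ → A} {W H : A⟦X⟧}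
    (hH : ∀ j, (j.factorial : ℝ) • coeff j H = d 0 j)
    (hW : ∀ k, (k.factorial : ℝ) • coeff k W = w (k + 1))
    (hd : ∀ i j, d (i + 1) j = d i (j + 1)
      + ∑ k ∈ Finset.range (j + 1), (j.choose k : A) * L.bracket (d i (j - k)) (w (k + 1)))
    (i j : ℕ) : (j.factorial : ℝ) • coeff j ((L.generator W)^[i] H) = d i j := by
  induction i generalizing j with
  | zero => exact hH j
  | succ i ih =>
    rw [Function.iterate_succ_apply', hd, generator, map_add, smul_add, coeff_derivative, ← ih]
    congr 1
    · rw [show ((j : A) + 1) = algebraMap ℝ A (j + 1) by simp, mul_comm, ← Algebra.smul_def,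
        smul_smul, Nat.factorial_succ]
      push_cast
      rw [mul_comm]
    · rw [coeff_C_mul, map_sub, coeff_mul, coeff_mul, ← Finset.sum_sub_distrib, Finset.mul_sum,
        Finset.smul_sum, ← Finset.Nat.sum_antidiagonal_swap,
        Finset.Nat.sum_antidiagonal_eq_sum_range_succ_mk]
      refine Finset.sum_congr rfl fun k hk => ?_
      have hk' : k ≤ j := Nat.lt_succ_iff.1 (Finset.mem_range.1 hk)
      simp only [Prod.swap, coeff_coeffDeriv]
      rw [← hW k, ← ih (j - k)]
      simp only [bracket, Derivation.map_smul]
      simp only [Algebra.smul_def]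
      have hf : (j.factorial : ℝ) = j.choose k * k.factorial * (j - k).factorial := by
        exact_mod_cast (Nat.choose_mul_factorial_mul_factorial hk').symm
      rw [hf]
      simp only [map_mul, map_natCast]
      ring

end LogCanonical

/-! ### Formal Lagrange inversion through residues. -/

namespace LogCanonical

open PowerSeries

variable {A : Type*} [CommRing A]

theorem coeff_mul_eq_zero {F G : A⟦X⟧} {i : ℕ} (h : ∀ j ≤ i, coeff j G = 0) :
    coeff i (F * G) = 0 := by
  rw [coeff_mul]
  refine Finset.sum_eq_zero fun x hx => ?_
  rw [h x.2 (by rw [Finset.HasAntidiagonal.mem_antidiagonal] at hx; omega), mul_zero]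

theorem coeff_zero_mul' (F G : A⟦X⟧) : coeff 0 (F * G) = coeff 0 F * coeff 0 G := by
  simp

variable [Algebra ℝ A] (L : LogCanonical A)

theorem coeff_zero_inverse {lam : ℝ} (hlam : lam ≠ 0) {N Ni : A⟦X⟧} (hN : N * Ni = 1)
    (hN0 : coeff 0 N = lam • L.u) : coeff 0 Ni = lam⁻¹ • L.v := by
  have h := congrArg (coeff 0) hN
  rw [coeff_zero_mul', hN0, coeff_zero_one] at h
  calc coeff 0 Ni = lam⁻¹ • (L.v * (lam • L.u * coeff 0 Ni)) := by
        rw [smul_mul_assoc, mul_smul_comm, smul_smul, inv_mul_cancel₀ hlam, one_smul, ← mul_assoc,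
          mul_comm L.v, L.u_mul_v, one_mul]
    _ = _ := by rw [h, mul_one]

theorem t_coeff_eq_zero_of_nsmul {m k : ℕ} {F G : A⟦X⟧}
    (h : ((m + 1 : ℕ) : A⟦X⟧) * F = coeffDeriv L.θ₂ G) : L.t (coeff k F) = 0 := by
  have h1 := L.t_coeff_coeffDeriv₂ k G
  rw [← h, ← nsmul_eq_mul, map_nsmul, map_nsmul, nsmul_eq_mul] at h1
  exact (mul_eq_zero.1 h1).resolve_left (Nat.cast_ne_zero.2 (Nat.succ_ne_zero m))

/-- The residue of `N ^ (a - n - 1) dN`. -/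
theorem t_coeff_pow_mul_coeffDeriv (hone : L.t 1 = 1) (hu : L.θ₂ L.u = L.u) {lam : ℝ}
    (hlam : lam ≠ 0) {N Ni : A⟦X⟧} (hN : N * Ni = 1) (hN0 : coeff 0 N = lam • L.u) (a n k : ℕ) :
    L.t (coeff k (N ^ a * Ni ^ (n + 1) * coeffDeriv L.θ₂ N)) = if a = n ∧ k = 0 then 1 else 0 := by
  have hNip : ∀ m, Ni ^ m * N ^ m = 1 := fun m => by
    rw [← mul_pow, mul_comm Ni, hN, one_pow]
  have hDNi : ∀ D : Derivation ℝ A⟦X⟧ A⟦X⟧, D Ni = - (Ni ^ 2 * D N) := fun D => by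
    rw [eq_neg_of_inverse_pow (n := 0) (H := N) (by simpa using hNip 1)]
    simp
  have hN0i := L.coeff_zero_inverse hlam hN hN0
  -- For `a ≠ n` the form `N^(a-n-1) dN` is exact. For `a = n` it is the logarithmic differential
  -- `dN / N`, whose residue is `1` and independent of `ε`.
  rcases lt_trichotomy a n with h | h | h
  · obtain ⟨m, rfl⟩ := Nat.exists_eq_add_of_lt h
    rw [if_neg (by omega)]
    refine L.t_coeff_eq_zero_of_nsmul (m := m) (G := - Ni ^ (m + 1)) ?_
    rw [map_neg, Derivation.leibniz_pow, hDNi, show a + m + 1 + 1 = a + (m + 2) by ring, pow_add]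
    simp only [Nat.add_sub_cancel, smul_eq_mul, nsmul_eq_mul]
    have := hNip a
    linear_combination (((m + 1 : ℕ) : A⟦X⟧) * Ni ^ (m + 2) * coeffDeriv L.θ₂ N) * this
  · subst h
    have e : N ^ a * Ni ^ (a + 1) * coeffDeriv L.θ₂ N = Ni * coeffDeriv L.θ₂ N := by
      rw [pow_succ]; linear_combination (Ni * coeffDeriv L.θ₂ N) * hNip a
    rw [e]
    rcases k with _ | k
    · rw [coeff_zero_mul', coeff_coeffDeriv, hN0, hN0i]
      rw [Derivation.map_smul, hu, smul_mul_smul_comm, inv_mul_cancel₀ hlam, one_smul,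
        mul_comm, L.u_mul_v, hone]
      simp
    · rw [coeff_succ_eq, map_smul]
      -- The derivative of `dN / N` in `ε` is `d (∂_ε N / N)`, hence exact.
      have : (derivative A) (Ni * coeffDeriv L.θ₂ N) = coeffDeriv L.θ₂ (Ni * derivative A N) := by
        have h1 : derivative A Ni = - (Ni ^ 2 * derivative A N) := by
          have h := congrArg (derivative A) hN
          rw [Derivation.leibniz] at h
          simp only [smul_eq_mul, Derivation.map_one_eq_zero] at h
          linear_combination Ni * h - derivative A Ni * hN
        rw [Derivation.leibniz, Derivation.leibniz, hDNi, h1, derivative_coeffDeriv]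
        simp only [smul_eq_mul]
        ring
      rw [this, t_coeff_coeffDeriv₂]
      simp
  · obtain ⟨m, rfl⟩ := Nat.exists_eq_add_of_lt h
    rw [if_neg (by omega)]
    refine L.t_coeff_eq_zero_of_nsmul (m := m) (G := N ^ (m + 1)) ?_
    rw [Derivation.leibniz_pow, show n + m + 1 = (n + 1) + m by ring, pow_add]
    simp only [Nat.add_sub_cancel, smul_eq_mul, nsmul_eq_mul]
    have := hNip (n + 1)
    linear_combination (((m + 1 : ℕ) : A⟦X⟧) * N ^ m * coeffDeriv L.θ₂ N) * this

theorem coeffDeriv_map_algebraMap (θ : Derivation ℝ A A) (f : ℝ⟦X⟧) :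
    coeffDeriv θ (PowerSeries.map (algebraMap ℝ A) f) = 0 := by
  ext n; simp

theorem derivative_map_algebraMap (f : ℝ⟦X⟧) :
    derivative A (PowerSeries.map (algebraMap ℝ A) f)
      = PowerSeries.map (algebraMap ℝ A) (derivative ℝ f) := by
  ext n; simp [coeff_derivative]

/-- The power series with coefficients in a subalgebra. -/
def coeffSubalgebra (S : Subalgebra ℝ A) : Subalgebra ℝ A⟦X⟧ where
  carrier := {f | ∀ n, coeff n f ∈ S}
  mul_mem' := fun {f g} hf hg n => by
    rw [coeff_mul]
    exact S.sum_mem fun x _ => S.mul_mem (hf _) (hg _)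
  add_mem' := fun {f g} hf hg n => by
    rw [map_add]; exact S.add_mem (hf _) (hg _)
  algebraMap_mem' := fun r n => by
    rw [PowerSeries.algebraMap_apply, coeff_C]
    split_ifs
    · exact S.algebraMap_mem r
    · exact S.zero_mem

/-- Formal Lagrange inversion: if the residues of `dN / N ^ (n + 1)` are those of the formal inverse
`h ↦ ∑ κ a h ^ a` of `u ↦ N`, then it is the inverse of `N`. -/
theorem coeff_sum_mul_pow_eq (hone : L.t 1 = 1) (hu : L.θ₂ L.u = L.u) {lam : ℝ} (hlam : lam ≠ 0)
    {N Ni : A⟦X⟧} (hN : N * Ni = 1) (hN0 : coeff 0 N = lam • L.u) (S : Subalgebra ℝ A)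
    (hSθ : ∀ f ∈ S, L.v * L.θ₂ f ∈ S)
    (hSinj : ∀ f ∈ S, (∀ n : ℕ, L.t (L.u * (f * L.v ^ (n + 1))) = 0) → f = 0)
    (hSN : ∀ k, coeff k N ∈ S) {κ : ℕ → ℝ⟦X⟧} (hκ : ∀ n i, i + 1 < n → coeff i (κ n) = 0)
    (hκ0 : coeff 0 (κ 0) = 0) (hκ1 : coeff 0 (κ 1) * lam = 1)
    (hres : ∀ n k, L.res k (derivative A N * Ni ^ (n + 1)) = - ((k + 1) * coeff (k + 1) (κ n)))
    {d i : ℕ} (hi : i < d) :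
    coeff i (∑ a ∈ Finset.range (d + 1), PowerSeries.map (algebraMap ℝ A) (κ a) * N ^ a)
      = coeff i (C L.u) := by
  set K : ℕ → A⟦X⟧ := fun a => PowerSeries.map (algebraMap ℝ A) (κ a) with hK
  set Kε : A⟦X⟧ := ∑ a ∈ Finset.range (d + 1), derivative A (K a) * N ^ a with hKε
  set Kh : A⟦X⟧ := ∑ a ∈ Finset.range (d + 1), K a * ((a : A⟦X⟧) * N ^ (a - 1)) with hKh
  -- Write `K(h, ε) = ∑ κ a h^a`. Differentiating the desired identity `K(N, ε) = u` gives `K_ε +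
  -- K_h N_ε = 0` and `K_h N_u = 1`; multiplying the first by `N_u` gives `K_ε N_u + N_ε = 0`. `F`
  -- is this left side, with `N_u = v θ₂ N`.
  set F : A⟦X⟧ := Kε * (C L.v * coeffDeriv L.θ₂ N) + derivative A N with hF
  have hNi0 := L.coeff_zero_inverse hlam hN hN0
  have hFS : ∀ k, coeff k F ∈ S := by
    have h1 : N ∈ coeffSubalgebra S := hSN
    have h2 : derivative A N ∈ coeffSubalgebra S := fun k => by
      rw [coeff_derivative]
      exact S.mul_mem (hSN _) (S.add_mem (natCast_mem S k) S.one_mem)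
    have h3 : C L.v * coeffDeriv L.θ₂ N ∈ coeffSubalgebra S := fun k => by
      rw [coeff_C_mul, coeff_coeffDeriv]; exact hSθ _ (hSN _)
    have h4 : Kε ∈ coeffSubalgebra S := by
      refine Subalgebra.sum_mem _ fun a _ => Subalgebra.mul_mem _ (fun k => ?_)
        (Subalgebra.pow_mem _ h1 _)
      rw [hK, derivative_map_algebraMap, coeff_map]
      exact S.algebraMap_mem _
    exact (coeffSubalgebra S).add_mem (Subalgebra.mul_mem _ h4 h3) h2
  -- The residues of `N^(a-n-1) dN` select `∂_ε κ n`, and this cancels the assumed residue of `N_ε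
  -- N^(-n-1)`. The terms beyond the truncation at `d` have too high an order in `ε`.
  have hFres : ∀ n k, k + 1 < d → L.res k (F * Ni ^ (n + 1)) = 0 := by
    intro n k hk
    have e : F * Ni ^ (n + 1) = (∑ a ∈ Finset.range (d + 1), C L.v * (derivative A (K a)
        * (N ^ a * Ni ^ (n + 1) * coeffDeriv L.θ₂ N))) + derivative A N * Ni ^ (n + 1) := by
      rw [hF, hKε, add_mul, Finset.sum_mul, Finset.sum_mul]
      congr 1
      refine Finset.sum_congr rfl fun a _ => ?_
      ring
    have hterm : ∀ a, L.res k (C L.v * (derivative A (K a)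
        * (N ^ a * Ni ^ (n + 1) * coeffDeriv L.θ₂ N)))
        = if a = n then (k + 1) * coeff (k + 1) (κ n) else 0 := by
      intro a
      rw [res_C_v_mul, hK, derivative_map_algebraMap, coeff_mul, map_sum]
      have h1 : ∀ x : ℕ × ℕ, L.t (coeff x.1 (PowerSeries.map (algebraMap ℝ A) (derivative ℝ (κ a)))
          * coeff x.2 (N ^ a * Ni ^ (n + 1) * coeffDeriv L.θ₂ N))
          = coeff x.1 (derivative ℝ (κ a)) * if a = n ∧ x.2 = 0 then 1 else 0 := by
        intro x
        rw [coeff_map, ← Algebra.smul_def, map_smul,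
          L.t_coeff_pow_mul_coeffDeriv hone hu hlam hN hN0, smul_eq_mul]
      rw [Finset.sum_congr rfl fun x _ => h1 x]
      split_ifs with h
      · subst h
        rw [Finset.sum_eq_single (k, 0)]
        · simp [coeff_derivative]; ring
        · rintro ⟨x, y⟩ hx hne
          rw [Finset.HasAntidiagonal.mem_antidiagonal] at hx
          have : y ≠ 0 := by rintro rfl; exact hne (by simp at hx; simp [hx])
          simp [this]
        · intro h; exact absurd (by simp) h
      · exact Finset.sum_eq_zero fun x _ => by simp [h]
    have hsum : ∀ s : Finset ℕ, ∀ f : ℕ → A⟦X⟧, L.res k (∑ a ∈ s, f a) = ∑ a ∈ s, L.res k (f a) := by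
      intro s f
      simp [res, Finset.mul_sum]
    rw [e, res_add, hsum, Finset.sum_congr rfl fun a _ => hterm a, hres, Finset.sum_ite_eq']
    split_ifs with h
    · ring
    · rw [hκ n (k + 1) (by simp at h; omega)]; simp
  -- At the lowest surviving order of `F` only the leading term `(lam u)^(-n-1)` of `N^(-n-1)`
  -- contributes. An element of `S` all of whose residues against these powers vanish is zero.
  have hF0 : ∀ k, k + 1 < d → coeff k F = 0 := by
    intro k
    induction k using Nat.strong_induction_on with
    | _ k ih =>
      intro hk
      refine hSinj _ (hFS k) fun n => ?_
      have h1 := hFres n k hk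
      have h2 : coeff k (F * Ni ^ (n + 1)) = coeff k F * (lam⁻¹ • L.v) ^ (n + 1) := by
        rw [coeff_mul, Finset.sum_eq_single (k, 0)]
        · rw [← hNi0]; simp
        · rintro ⟨x, y⟩ hx hne
          rw [Finset.HasAntidiagonal.mem_antidiagonal] at hx
          have : y ≠ 0 := by rintro rfl; exact hne (by simp at hx; simp [hx])
          rw [ih x (by simp at hx; omega) (by simp at hx; omega), zero_mul]
        · intro h; exact absurd (by simp) h
      rw [res, h2, smul_pow, mul_smul_comm, mul_smul_comm, map_smul, smul_eq_mul] at h1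
      exact (mul_eq_zero.1 h1).resolve_left (by positivity)
  set E : A⟦X⟧ := ∑ a ∈ Finset.range (d + 1), K a * N ^ a - C L.u with hE
  -- The defect `E = K(N, ε) - u` satisfies a linear transport equation with source `K_h F`. Since
  -- `E` vanishes at `ε = 0` and `F` to the required order, `E` vanishes to that order too.
  have hE' : derivative A E = Kh * F - Kε * C L.v * coeffDeriv L.θ₂ E := by
    have h1 : derivative A E = Kε + Kh * derivative A N := by
      rw [hE, map_sub, map_sum, derivative_C, sub_zero, hKε, hKh, Finset.sum_mul,
        ← Finset.sum_add_distrib]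
      refine Finset.sum_congr rfl fun a _ => ?_
      rw [Derivation.leibniz, Derivation.leibniz_pow]
      simp only [smul_eq_mul, nsmul_eq_mul]
      ring
    have h2 : coeffDeriv L.θ₂ E = Kh * coeffDeriv L.θ₂ N - C L.u := by
      have hC : coeffDeriv L.θ₂ (C L.u) = C L.u := by
        ext n
        rw [coeff_coeffDeriv, coeff_C]
        split_ifs
        · exact hu
        · simp
      rw [hE, map_sub, map_sum, hC, hKh, Finset.sum_mul]
      congr 1
      refine Finset.sum_congr rfl fun a _ => ?_
      rw [Derivation.leibniz, Derivation.leibniz_pow, hK, coeffDeriv_map_algebraMap]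
      simp only [smul_eq_mul, nsmul_eq_mul]
      ring
    have h3 : (C L.v : A⟦X⟧) * C L.u = 1 := by
      rw [← map_mul, mul_comm, L.u_mul_v, map_one]
    rw [h1, h2, hF]
    linear_combination -Kε * h3
  have hE0 : ∀ i, i < d → coeff i E = 0 := by
    intro i
    induction i using Nat.strong_induction_on with
    | _ i ih =>
      intro hi
      rcases i with _ | i
      · rw [hE, map_sub, map_sum, Finset.sum_eq_single 1]
        · simp only [hK, pow_one]
          rw [coeff_zero_mul', coeff_map, hN0, coeff_zero_C]
          rw [← Algebra.smul_def, smul_smul, hκ1, one_smul, sub_self]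
        · intro a _ ha
          rw [mul_comm]
          refine coeff_mul_eq_zero fun j hj => ?_
          obtain rfl : j = 0 := by omega
          rw [hK, coeff_map]
          rcases a with _ | a
          · rw [hκ0, map_zero]
          · rw [hκ _ _ (by omega), map_zero]
        · intro h; exact absurd (by simp; omega) h
      · rw [coeff_succ_eq, hE', map_sub, coeff_mul_eq_zero, coeff_mul_eq_zero, sub_zero, smul_zero]
        · intro j hj
          rw [coeff_coeffDeriv, ih j (by omega) (by omega), map_zero]
        · intro j hj
          exact hF0 j (by omega)
  have := hE0 i hi
  rw [hE, map_sub, sub_eq_zero] at this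
  exact this

end LogCanonical

/-! ### The reduced phase space in the gauge `q₂ = 0` -/

/-- Laurent polynomials in `s = q₁` and `u = J₁`. -/
abbrev Lau := AddMonoidAlgebra ℝ (ℤ × ℤ)

section Reduced

/-- The Laurent monomial `s ^ a u ^ b`. -/
def lmon (a b : ℤ) : Lau := AddMonoidAlgebra.single (a, b) 1

theorem lmon_mul (a b a' b' : ℤ) : lmon a b * lmon a' b' = lmon (a + a') (b + b') := by
  simp [lmon, AddMonoidAlgebra.single_mul_single]

theorem lmon_zero : lmon 0 0 = 1 := rfl

theorem lmon_pow (a b : ℤ) (n : ℕ) : lmon a b ^ n = lmon (n * a) (n * b) := by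
  induction n with
  | zero => simp [lmon_zero]
  | succ n ih => rw [pow_succ, ih, lmon_mul]; congr 1 <;> push_cast <;> ring

theorem coeff_lmon (a b : ℤ) (m : ℤ × ℤ) : (lmon a b).coeff m = if (a, b) = m then 1 else 0 := by
  classical
  simp [lmon, Finsupp.single_apply]

/-- The logarithmic derivation with weights `φ`, as a linear map. -/
def lauScale (φ : ℤ × ℤ →+ ℤ) : Lau →ₗ[ℝ] Lau where
  toFun f := ⟨Finsupp.onFinset f.coeff.support (fun m => (φ m : ℝ) * f.coeff m)
    (fun m h => by
      rw [Finsupp.mem_support_iff]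
      exact right_ne_zero_of_mul h)⟩
  map_add' f g := by ext m; simp [mul_add]
  map_smul' r f := by ext m; simp; ring

theorem coeff_lauScale (φ : ℤ × ℤ →+ ℤ) (f : Lau) (m : ℤ × ℤ) :
    (lauScale φ f).coeff m = φ m * f.coeff m := rfl

theorem lauScale_single (φ : ℤ × ℤ →+ ℤ) (m : ℤ × ℤ) (r : ℝ) :
    lauScale φ (AddMonoidAlgebra.single m r) = AddMonoidAlgebra.single m (φ m * r) := by
  classical
  ext k
  by_cases h : m = k
  · subst h; simp [coeff_lauScale]
  · simp [coeff_lauScale, h]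

theorem lauScale_mul (φ : ℤ × ℤ →+ ℤ) (f g : Lau) :
    lauScale φ (f * g) = f • lauScale φ g + g • lauScale φ f := by
  induction f using AddMonoidAlgebra.induction_linear with
  | zero => simp
  | add f₁ f₂ h₁ h₂ =>
    rw [add_mul, map_add, h₁, h₂, map_add]; simp [add_mul, mul_add]; abel
  | single m r =>
    induction g using AddMonoidAlgebra.induction_linear with
    | zero => simp
    | add g₁ g₂ h₁ h₂ =>
      rw [mul_add, map_add, h₁, h₂, map_add]; simp [add_mul, mul_add]; abel
    | single m' r' =>
      simp only [smul_eq_mul, AddMonoidAlgebra.single_mul_single, lauScale_single]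
      rw [add_comm m' m, ← AddMonoidAlgebra.single_add]
      congr 1
      rw [map_add]
      push_cast
      ring

/-- The logarithmic derivation with weights `φ`. -/
def lauDeriv (φ : ℤ × ℤ →+ ℤ) : Derivation ℝ Lau Lau :=
  Derivation.mk' (lauScale φ) (lauScale_mul φ)

@[simp]
theorem coeff_lauDeriv (φ : ℤ × ℤ →+ ℤ) (f : Lau) (m : ℤ × ℤ) :
    (lauDeriv φ f).coeff m = φ m * f.coeff m := rfl

theorem lauDeriv_lmon (φ : ℤ × ℤ →+ ℤ) (a b : ℤ) :
    lauDeriv φ (lmon a b) = (φ (a, b) : ℝ) • lmon a b := by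
  ext m
  rw [coeff_lauDeriv, AddMonoidAlgebra.coeff_smul_apply, coeff_lmon]
  split_ifs with h
  · rw [h]; simp
  · simp

/-- The constant coefficient. -/
def lauTrace : Lau →ₗ[ℝ] ℝ where
  toFun f := f.coeff (0, 0)
  map_add' _ _ := rfl
  map_smul' _ _ := rfl

theorem lauTrace_apply (f : Lau) : lauTrace f = f.coeff (0, 0) := rfl

theorem lauTrace_lmon (a b : ℤ) : lauTrace (lmon a b) = if a = 0 ∧ b = 0 then 1 else 0 := by
  rw [lauTrace_apply, coeff_lmon]
  simp

/-- The logarithmic canonical structure of the reduced phase space. -/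
def lauCanonical : LogCanonical Lau where
  u := lmon 0 1
  v := lmon 0 (-1)
  u_mul_v := by rw [lmon_mul]; rfl
  θ₁ := lauDeriv (AddMonoidHom.fst ℤ ℤ)
  θ₂ := lauDeriv (AddMonoidHom.snd ℤ ℤ)
  comm := fun a => by ext m; simp; ring
  t := lauTrace
  t_θ₁ := fun a => by rw [lauTrace_apply, coeff_lauDeriv]; simp
  t_θ₂ := fun a => by rw [lauTrace_apply, coeff_lauDeriv]; simp

open MvPolynomial

/-- The reduction to the gauge `q₂ = 0` on the level `J₂ = l`. -/
def reduce (l : ℝ) : Phase →ₐ[ℝ] Lau :=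
  aeval (Sum.elim ![lmon 1 0, 0] ![lmon (-1) 1, l • lmon (-1) 0])

theorem lauDeriv_reduce (φ : ℤ × ℤ →+ ℤ) (l : ℝ) (f : Phase) :
    lauDeriv φ (reduce l f) =
      reduce l (pderiv (Sum.inl 0) f) * ((φ (1, 0) : ℝ) • lmon 1 0)
      + reduce l (pderiv (Sum.inr 0) f) * ((φ (-1, 1) : ℝ) • lmon (-1) 1)
      + reduce l (pderiv (Sum.inr 1) f) * (l • (φ (-1, 0) : ℝ) • lmon (-1) 0) := by
  induction f using MvPolynomial.induction_on with
  | C r =>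
    rw [show reduce l (C r) = algebraMap ℝ Lau r from aeval_C _ r, Derivation.map_algebraMap]
    simp
  | add f g hf hg => simp only [map_add, hf, hg]; ring
  | mul_X f i hf =>
    simp only [map_mul, Derivation.leibniz, hf, map_add, smul_eq_mul]
    rcases i with i | i <;> fin_cases i <;>
      simp [reduce, pderiv_X, lauDeriv_lmon] <;> simp only [Algebra.smul_def] <;> ring

/-- Invariance under `J₂`, restricted to `q₂ = 0`, eliminates the derivatives in `q₂`. What remains
is the bracket of the canonical pair `log q₁`, `J₁` on the level `J₂ = l`. -/
theorem reduce_poisson (l : ℝ) {f g : Phase} (hf : poisson f J₂ = 0) (hg : poisson g J₂ = 0) :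
    reduce l (poisson f g) = lauCanonical.bracket (reduce l f) (reduce l g) := by
  have h1 : lmon 1 0 * lmon (-1) 0 = 1 := by rw [lmon_mul]; rfl
  have h2 : lmon 0 1 * lmon 0 (-1) = 1 := by rw [lmon_mul]; rfl
  have h3 : lmon (-1) 1 = lmon (-1) 0 * lmon 0 1 := by rw [lmon_mul]; rfl
  have hq0 : reduce l (X (Sum.inl 0)) = lmon 1 0 := by simp [reduce]
  have hq1 : reduce l (X (Sum.inl 1)) = 0 := by simp [reduce]
  have hp0 : reduce l (X (Sum.inr 0)) = lmon (-1) 0 * lmon 0 1 := by simp [reduce, h3]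
  have hp1 : reduce l (X (Sum.inr 1)) = algebraMap ℝ Lau l * lmon (-1) 0 := by
    simp [reduce, Algebra.smul_def]
  have rf := congrArg (reduce l) hf
  have rg := congrArg (reduce l) hg
  rw [poisson_J₂] at rf rg
  simp only [map_add, map_sub, map_mul, hq0, hq1, hp0, hp1, map_zero] at rf rg
  rw [poisson_eq, LogCanonical.bracket]
  simp only [lauCanonical]
  simp only [map_add, map_sub, map_mul, lauDeriv_reduce, h3]
  simp only [AddMonoidHom.coe_fst, AddMonoidHom.coe_snd, Int.cast_one, Int.cast_zero, Int.cast_neg,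
    one_smul, zero_smul, neg_smul, smul_zero, mul_zero, add_zero, zero_add, smul_neg, mul_neg]
  simp only [Algebra.smul_def]
  set s := lmon 1 0
  set si := lmon (-1) 0
  set u := lmon 0 1
  set v := lmon 0 (-1)
  set L := algebraMap ℝ Lau l
  set f0 := reduce l (pderiv (Sum.inl 0) f)
  set f1 := reduce l (pderiv (Sum.inl 1) f)
  set f2 := reduce l (pderiv (Sum.inr 0) f)
  set f3 := reduce l (pderiv (Sum.inr 1) f)
  set g0 := reduce l (pderiv (Sum.inl 0) g)
  set g1 := reduce l (pderiv (Sum.inl 1) g)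
  set g2 := reduce l (pderiv (Sum.inr 0) g)
  set g3 := reduce l (pderiv (Sum.inr 1) g)
  linear_combination si * g3 * rf - si * f3 * rg
    + (- f1 * g3 + f3 * g1 - (f0 * g2 - f2 * g0)) * h1
    + (-(f0 * s - f3 * L * si) * si * g2 + f2 * si * (g0 * s - g3 * L * si)) * h2

end Reduced

/-! ### Explicit coefficients of the formal inverse and constant terms of the reduced quartic. -/

section InverseSeries

open PowerSeries

/-- The coefficient of `h ^ a l ^ c` of the action `K(h, l)` of the vanishing cycle. -/
def invCoeff (a c : ℕ) : ℝ :=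
  if Even c then √2 * (-1) ^ (a + c - 1) * (a + (a + c - 1)).choose a / (a + (a + c - 1) : ℕ)
    * (1 / 2) ^ (a + c / 2) * (1 / 8) ^ (a + c - 1) * (2 * (a + c - 1)).choose (c / 2)
    * (4 * (a + c - 1) - c).choose (2 * (a + c - 1)) else 0

/-- The coefficient of `h ^ a` of `ε ^ (-2) K(ε ^ 2 h, ε ^ 2 l)` as a power series in `ε`. -/
def invSeries (l : ℝ) (a : ℕ) : ℝ⟦X⟧ :=
  PowerSeries.mk fun i => if Even i ∧ a ≤ i / 2 + 1 then
    invCoeff a (i / 2 + 1 - a) * l ^ (i / 2 + 1 - a) else 0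

/-- The inverse of `(1 + w X²) ^ (n + 1)`. -/
def invOneAddPow {A : Type*} [CommRing A] (w : A) (n : ℕ) : A⟦X⟧ :=
  PowerSeries.mk fun k => if Even k then (-w) ^ (k / 2) * ((n + k / 2).choose n : A) else 0

theorem coeff_mul_one_add {A : Type*} [CommRing A] (w : A) (F : A⟦X⟧) (k : ℕ) :
    coeff (k + 2) (F * (1 + C w * X ^ 2)) = coeff (k + 2) F + w * coeff k F := by
  rw [mul_add, mul_one, map_add, show F * (C w * X ^ 2) = C w * (F * X ^ 2) by ring, coeff_C_mul,
    coeff_mul_X_pow]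

theorem coeff_mul_one_add_of_lt {A : Type*} [CommRing A] (w : A) (F : A⟦X⟧) {k : ℕ} (hk : k < 2) :
    coeff k (F * (1 + C w * X ^ 2)) = coeff k F := by
  rw [mul_add, mul_one, map_add, show F * (C w * X ^ 2) = C w * (F * X ^ 2) by ring, coeff_C_mul,
    coeff_mul_X_pow', if_neg (by omega), mul_zero, add_zero]

/-- One factor `1 + w X²` lowers `n` by one, by Pascal's rule. -/
theorem invOneAddPow_mul {A : Type*} [CommRing A] (w : A) (n : ℕ) :
    invOneAddPow w n * (1 + C w * X ^ 2) ^ (n + 1) = 1 := by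
  induction n with
  | zero =>
    rw [zero_add, pow_one]
    ext k
    rcases k with _ | _ | k
    · rw [coeff_mul_one_add_of_lt _ _ (by omega)]; simp [invOneAddPow]
    · rw [coeff_mul_one_add_of_lt _ _ (by omega)]; simp [invOneAddPow, PowerSeries.coeff_one]
    · rw [coeff_mul_one_add, PowerSeries.coeff_one, if_neg (by omega)]
      simp only [invOneAddPow, coeff_mk]
      rw [show (k + 1 + 1) / 2 = k / 2 + 1 by omega]
      have he : Even (k + 1 + 1) ↔ Even k := by simp [Nat.even_add]
      simp only [he]
      split_ifs <;> simp [pow_succ]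
      ring
  | succ n ih =>
    rw [pow_succ', ← mul_assoc]
    convert ih using 2
    ext k
    rcases k with _ | _ | k
    · rw [coeff_mul_one_add_of_lt _ _ (by omega)]; simp [invOneAddPow]
    · rw [coeff_mul_one_add_of_lt _ _ (by omega)]; simp [invOneAddPow]
    · rw [coeff_mul_one_add]
      simp only [invOneAddPow, coeff_mk]
      rw [show (k + 1 + 1) / 2 = k / 2 + 1 by omega]
      have he : Even (k + 1 + 1) ↔ Even k := by simp [Nat.even_add]
      simp only [he]
      split_ifs
      · rw [show n + 1 + (k / 2 + 1) = (n + (k / 2 + 1)) + 1 by ring, Nat.choose_succ_succ,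
          show n + (k / 2 + 1) = n + 1 + k / 2 by ring]
        push_cast
        ring
      · simp

/-- The square of the reduced radius squared. -/
def redQuartic (l : ℝ) : Lau := reduce l (radiusSq ^ 2)

theorem redQuartic_eq (l : ℝ) : redQuartic l = (1 / 8 : ℝ) •
    (lmon (-4) 0 * ((lmon 2 0 - lmon 0 1) ^ 2 + algebraMap ℝ Lau (l ^ 2)) ^ 2) := by
  have h3 : lmon (-1) 1 = lmon (-1) 0 * lmon 0 1 := by rw [lmon_mul]; rfl
  have h1 : lmon 1 0 * lmon (-1) 0 = 1 := by rw [lmon_mul]; rfl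
  have h4 : lmon (-4) 0 = lmon (-1) 0 ^ 4 := by rw [lmon_pow]; rfl
  have h5 : lmon 2 0 = lmon 1 0 ^ 2 := by rw [lmon_pow]; rfl
  have hc : (algebraMap ℝ Lau (1 / (2 * √2))) ^ 2 = algebraMap ℝ Lau (1 / 8) := by
    rw [← map_pow]; congr 1
    rw [div_pow, mul_pow, Real.sq_sqrt (by norm_num)]; norm_num
  simp only [redQuartic, radiusSq, reduce, pos, mom, map_pow, map_mul, map_add, map_sub,
    MvPolynomial.aeval_X, MvPolynomial.aeval_C, Sum.elim_inl, Sum.elim_inr, Matrix.cons_val_zero,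
    Matrix.cons_val_one, h3, h4, h5, Algebra.smul_def, mul_pow, hc]
  set s := lmon 1 0
  set si := lmon (-1) 0
  set u := lmon 0 1
  set L := algebraMap ℝ Lau l
  set c := algebraMap ℝ Lau (1 / 8)
  have key : (s - si * u) ^ 2 + (0 - L * si) ^ 2 = si ^ 2 * ((s ^ 2 - u) ^ 2 + L ^ 2) := by
    linear_combination (-(s * si + 1) * s ^ 2 + 2 * s * si * u) * h1
  rw [key]
  ring

/-- Expand `((s² - u)² + l²)^(2M)` first in `l²`, then in `s²`. The prefactor `s^(-4M)` selects
`(s²)^(2M)`, and the remaining power `u^(2M-2b)` must cancel `u^(-p)`. -/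
theorem lauTrace_redQuartic_pow (l : ℝ) (M p : ℕ) :
    lauTrace (redQuartic l ^ M * lmon 0 (-1) ^ p) = ∑ b ∈ Finset.range (2 * M + 1),
      if 2 * M = p + 2 * b then (1 / 8) ^ M * (l ^ (2 * b) * ((2 * M).choose b
        * (4 * M - 2 * b).choose (2 * M))) else 0 := by
  have hb : ∀ n : ℕ, (lmon 2 0 - lmon 0 1) ^ n = ∑ i ∈ Finset.range (n + 1),
      ((-1) ^ (n - i) * (n.choose i : ℝ)) • lmon (2 * i) (n - i : ℕ) := by
    intro n
    rw [sub_eq_add_neg, add_pow]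
    refine Finset.sum_congr rfl fun i _ => ?_
    rw [neg_pow, lmon_pow, lmon_pow, Algebra.smul_def, map_mul, map_pow, map_neg, map_one,
      map_natCast]
    have : lmon (2 * (i : ℤ)) ((n - i : ℕ) : ℤ) = lmon (i * 2) (i * 0) *
        lmon ((n - i : ℕ) * 0) ((n - i : ℕ) * 1) := by
      rw [lmon_mul]; congr 1 <;> ring
    rw [this]
    ring
  rw [redQuartic_eq, smul_pow, mul_pow, ← pow_mul, add_pow, smul_mul_assoc, map_smul,
    Finset.mul_sum, Finset.sum_mul, map_sum, Finset.smul_sum, ← Finset.sum_flip]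
  refine Finset.sum_congr rfl fun b hb' => ?_
  have hb'' : b ≤ 2 * M := Nat.lt_succ_iff.1 (Finset.mem_range.1 hb')
  rw [show 2 * M - (2 * M - b) = b by omega, ← pow_mul, hb, Finset.sum_mul, Finset.sum_mul,
    Finset.mul_sum, Finset.sum_mul, map_sum]
  have hterm : ∀ i ∈ Finset.range (2 * (2 * M - b) + 1), lauTrace (lmon (-4) 0 ^ M *
      (((-1) ^ (2 * (2 * M - b) - i) * ((2 * (2 * M - b)).choose i : ℝ)) •
        lmon (2 * i) (2 * (2 * M - b) - i : ℕ) * algebraMap ℝ Lau (l ^ 2) ^ b *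
          ((2 * M).choose (2 * M - b) : Lau)) * lmon 0 (-1) ^ p)
      = if i = 2 * M then (if 2 * M = p + 2 * b then l ^ (2 * b) * ((2 * M).choose b
        * (4 * M - 2 * b).choose (2 * M)) else 0) else 0 := by
    intro i hi
    have hi' : i ≤ 2 * (2 * M - b) := Nat.lt_succ_iff.1 (Finset.mem_range.1 hi)
    have e : lmon (-4) 0 ^ M *
      (((-1) ^ (2 * (2 * M - b) - i) * ((2 * (2 * M - b)).choose i : ℝ)) •
        lmon (2 * i) (2 * (2 * M - b) - i : ℕ) * algebraMap ℝ Lau (l ^ 2) ^ b *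
          ((2 * M).choose (2 * M - b) : Lau)) * lmon 0 (-1) ^ p
      = ((-1) ^ (2 * (2 * M - b) - i) * ((2 * (2 * M - b)).choose i : ℝ) * l ^ (2 * b)
          * (2 * M).choose (2 * M - b)) •
          lmon (-4 * M + 2 * i) ((2 * (2 * M - b) - i : ℕ) - p) := by
      have : lmon (-4 * M + 2 * i) ((2 * (2 * M - b) - i : ℕ) - p) = lmon (M * (-4)) (M * 0) *
        lmon (2 * i) (2 * (2 * M - b) - i : ℕ) * lmon (p * 0) (p * (-1)) := by
        rw [lmon_mul, lmon_mul]; congr 1 <;> ring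
      rw [this, lmon_pow, lmon_pow]
      simp only [Algebra.smul_def, map_mul, map_natCast, map_pow, pow_mul]
      ring
    rw [e, map_smul, lauTrace_lmon, smul_eq_mul]
    by_cases h1 : i = 2 * M
    · subst h1
      rw [if_pos rfl]
      by_cases h2 : 2 * M = p + 2 * b
      · rw [if_pos h2, if_pos (by omega), Nat.choose_symm hb'',
          show 2 * (2 * M - b) = 4 * M - 2 * b by omega, Even.neg_one_pow ⟨M - b, by omega⟩]
        ring
      · rw [if_neg h2, if_neg (by omega), mul_zero]
    · rw [if_neg h1, if_neg (by omega), mul_zero]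
  rw [Finset.sum_congr rfl hterm, Finset.sum_ite_eq']
  simp only [Finset.mem_range, smul_eq_mul]
  by_cases h : 2 * M < 2 * (2 * M - b) + 1
  · rw [if_pos h]
    split_ifs <;> simp
  · rw [if_neg h, Nat.choose_eq_zero_of_lt (show 4 * M - 2 * b < 2 * M by omega)]
    simp

end InverseSeries

/-! ### A normal form as the formal inverse of the vanishing action. -/

section FormalInverse

open PowerSeries

/-- The Hamiltonian in the gauge `q₂ = 0`, as a power series in `ε`. -/
def redHam (l : ℝ) : Lau⟦X⟧ :=
  PowerSeries.mk fun j => (j.factorial : ℝ)⁻¹ • reduce l (levels j)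

theorem redHam_eq (l : ℝ) : redHam l = C (√2 • lmon 0 1) + C (redQuartic l) * X ^ 2 := by
  have h : ∀ j, (j.factorial : ℝ)⁻¹ • reduce l (levels j)
      = reduce l (MvPolynomial.homogeneousComponent (j + 2) hamiltonianQP) := by
    intro j
    rw [levels, map_mul, map_natCast, ← map_natCast (algebraMap ℝ Lau), ← Algebra.smul_def,
      smul_smul, inv_mul_cancel₀ (by positivity), one_smul]
  have h1 : lmon 1 0 * lmon (-1) 1 = lmon 0 1 := by rw [lmon_mul]; rfl
  have hJ : reduce l (MvPolynomial.C √2 * J₁) = √2 • lmon 0 1 := by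
    simp [reduce, J₁, pos, mom, h1, MvPolynomial.C_mul']
  ext j
  rw [redHam, coeff_mk, h, homogeneousComponent_hamiltonianQP, map_add, coeff_C, coeff_C_mul,
    coeff_X_pow]
  split_ifs with h1 h2
  · omega
  · simp [hJ]
  · simp [redQuartic]
  · simp

/-- The expansion of a normal form on the level `J₂ = l` as a power series in `ε`. -/
def normalSeries (ν : ℕ → ℕ → ℝ) (l : ℝ) : (Polynomial ℝ)⟦X⟧ :=
  PowerSeries.mk fun n => if Even n then
    ∑ x ∈ Finset.HasAntidiagonal.antidiagonal (n / 2 + 1),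
      Polynomial.C (ν x.1 x.2 * l ^ x.2) * Polynomial.X ^ x.1 else 0

theorem reduce_J₁ (l : ℝ) : reduce l J₁ = lmon 0 1 := by
  have h1 : lmon 1 0 * lmon (-1) 1 = lmon 0 1 := by rw [lmon_mul]; rfl
  simp [reduce, J₁, pos, mom, h1]

theorem reduce_J₂ (l : ℝ) : reduce l J₂ = algebraMap ℝ Lau l := by
  have h1 : lmon 1 0 * lmon (-1) 0 = 1 := by rw [lmon_mul]; rfl
  simp only [reduce, J₂, pos, mom, map_sub, map_mul, MvPolynomial.aeval_X, Sum.elim_inl,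
    Sum.elim_inr, Matrix.cons_val_zero, Matrix.cons_val_one, zero_mul, sub_zero, mul_smul_comm, h1]
  rw [Algebra.smul_def, mul_one]

/-- Reduction respects the bracket of invariant polynomials, so the reduced Lie-Deprit triangle is
the Lie transform of `redHam l`. Since `J₁` restricts to `u` and `J₂` to the constant `l`, the
normalised series involves only polynomials in `u`. -/
theorem exists_lie_redHam {ν : ℕ → ℕ → ℝ} (hν : IsBirkhoffNormalForm ν) (l : ℝ) :
    ∃ W : Lau⟦X⟧, lauCanonical.lie W (redHam l)
      = PowerSeries.map (Polynomial.aeval (lmon 0 1) : Polynomial ℝ →ₐ[ℝ] Lau).toRingHom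
          (normalSeries ν l) := by
  obtain ⟨_, W, hW, hn⟩ := hν
  have hrot : ∀ i j, poisson (deprit levels W i j) J₂ = 0 := fun i j =>
    (deprit_homogeneous i j fun k h _ => hW k h).2
  refine ⟨PowerSeries.mk fun k => (k.factorial : ℝ)⁻¹ • reduce l (W (k + 1)), ?_⟩
  ext1 n
  have key := lauCanonical.factorial_smul_coeff_iterate_generator
    (w := fun k => reduce l (W k)) (d := fun i j => reduce l (deprit levels W i j))
    (W := PowerSeries.mk fun k => (k.factorial : ℝ)⁻¹ • reduce l (W (k + 1))) (H := redHam l)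
    (fun j => by
      rw [redHam, coeff_mk, smul_smul, mul_inv_cancel₀ (by positivity), one_smul]; rfl)
    (fun k => by
      rw [coeff_mk, smul_smul, mul_inv_cancel₀ (by positivity), one_smul])
    (fun i j => by
      rw [deprit_succ, map_add, map_sum]
      congr 1
      refine Finset.sum_congr rfl fun k _ => ?_
      rw [map_mul, map_natCast, reduce_poisson l (hrot _ _) (hW (k + 1) (by omega)).2])
    n 0
  rw [LogCanonical.lie, coeff_mk]
  simp only [Nat.factorial_zero, Nat.cast_one, one_smul] at key
  rw [key, show levels = fun i => (i.factorial : Phase) *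
    MvPolynomial.homogeneousComponent (i + 2) hamiltonianQP from rfl, hn, map_mul, map_natCast,
    ← map_natCast (algebraMap ℝ Lau), ← Algebra.smul_def, smul_smul,
    inv_mul_cancel₀ (by positivity), one_smul, coeff_map, normalSeries, coeff_mk]
  split_ifs
  · rw [map_sum, map_sum]
    refine Finset.sum_congr rfl fun x _ => ?_
    rw [map_mul, map_mul, map_pow, map_pow, reduce_J₁, reduce_J₂]
    simp only [AlgHom.toRingHom_eq_coe, RingHom.coe_coe, map_mul, map_pow, Polynomial.aeval_X,
      Polynomial.aeval_C]
    rw [show reduce l (MvPolynomial.C (ν x.1 x.2)) = algebraMap ℝ Lau (ν x.1 x.2) from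
      MvPolynomial.aeval_C _ _]
    ring
  · simp

/-- With `H = √2 u + ε² Q`, the power `H^(-n-1)` is a negative binomial series in `ε² Q / (√2 u)`,
and each order of the residue is one constant term of `Q^(m+1) u^(-n-m)`. This is the origin of the
closed form `invCoeff`. -/
theorem res_redHam (l : ℝ) (n k : ℕ) :
    ∃ G : Lau⟦X⟧, G * redHam l ^ (n + 1) = 1 ∧
      lauCanonical.res k (derivative Lau (redHam l) * G)
        = - ((k + 1) * coeff (k + 1) (invSeries l n)) := by
  have huv : lmon 0 1 * lmon 0 (-1) = 1 := by rw [lmon_mul]; rfl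
  have h2 : (√2)⁻¹ * √2 = 1 := inv_mul_cancel₀ (by positivity)
  set iv : Lau := (√2)⁻¹ • lmon 0 (-1) with hiv
  have hi : (√2 • lmon 0 1) * iv = 1 := by
    rw [hiv, smul_mul_smul_comm, huv, mul_comm, h2, one_smul]
  set w : Lau := redQuartic l * iv with hw
  have hH : redHam l = C (√2 • lmon 0 1) * (1 + C w * X ^ 2) := by
    rw [redHam_eq, mul_add, mul_one, ← mul_assoc, ← map_mul]
    congr 3
    rw [hw]
    linear_combination (-redQuartic l) * hi
  refine ⟨C (iv ^ (n + 1)) * invOneAddPow w n, ?_, ?_⟩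
  · rw [hH, mul_pow, ← map_pow]
    calc _ = (C (iv ^ (n + 1)) * C ((√2 • lmon 0 1) ^ (n + 1))) *
        (invOneAddPow w n * (1 + C w * X ^ 2) ^ (n + 1)) := by ring
      _ = 1 := by rw [invOneAddPow_mul, mul_one, ← map_mul, ← mul_pow, mul_comm iv, hi]; simp
  · have hD : derivative Lau (redHam l) = C (2 * redQuartic l) * X := by
      rw [redHam_eq, map_add, derivative_C, zero_add, Derivation.leibniz, derivative_C,
        Derivation.leibniz_pow, derivative_X, map_mul, show (C (2 : Lau) : Lau⟦X⟧) = 2 from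
          map_ofNat _ 2]
      simp
      ring
    rw [hD, LogCanonical.res, show C (2 * redQuartic l) * X * (C (iv ^ (n + 1)) * invOneAddPow w n)
      = C (2 * redQuartic l * iv ^ (n + 1)) * (invOneAddPow w n * X) by
        rw [map_mul C (2 * redQuartic l) (iv ^ (n + 1))]; ring,
      coeff_C_mul]
    rcases k with _ | k
    · simp [invSeries]
    rw [coeff_succ_mul_X, invOneAddPow, coeff_mk, invSeries, coeff_mk]
    have he : Even (k + 1 + 1) ↔ Even k := by simp [Nat.even_add]
    by_cases hk : Even k
    swap
    · rw [if_neg hk, if_neg fun h => hk (he.1 h.1)]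
      simp
    obtain ⟨m, rfl⟩ := hk
    rw [if_pos ⟨m, rfl⟩, show (m + m) / 2 = m by omega,
      show (m + m + 1 + 1) / 2 = m + 1 by omega]
    have e1 : lauCanonical.u * (2 * redQuartic l * iv ^ (n + 1) * ((-w) ^ m * ((n + m).choose n)))
        = (2 * (-1) ^ m * (n + m).choose n * (√2)⁻¹ ^ (n + 1 + m)) •
          (redQuartic l ^ (m + 1) * lmon 0 (-1) ^ (n + m)) := by
      rw [hw, hiv, neg_pow, mul_pow, smul_pow, smul_pow]
      have hlc : lauCanonical.u = lmon 0 1 := rfl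
      rw [hlc]
      simp only [Algebra.smul_def, map_mul, map_pow, map_neg, map_one, map_natCast]
      rw [show (algebraMap ℝ Lau) 2 = 2 from map_ofNat _ 2]
      have : lmon 0 1 * lmon 0 (-1) ^ (n + 1) = lmon 0 (-1) ^ n := by
        rw [pow_succ, mul_left_comm, huv, mul_one]
      linear_combination (2 * redQuartic l * algebraMap ℝ Lau (√2)⁻¹ ^ (n + 1) * (-1) ^ m *
        redQuartic l ^ m * algebraMap ℝ Lau (√2)⁻¹ ^ m * lmon 0 (-1) ^ m *
        ((n + m).choose n : Lau)) * this
    rw [e1, map_smul, smul_eq_mul,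
      show lauCanonical.t (redQuartic l ^ (m + 1) * lmon 0 (-1) ^ (n + m))
        = lauTrace (redQuartic l ^ (m + 1) * lmon 0 (-1) ^ (n + m)) from rfl,
      lauTrace_redQuartic_pow]
    -- The power of `l` is `m + 2 - n`. It must be an even number `2b`, and then exactly one summand
    -- survives.
    by_cases hn : n ≤ m + 2 ∧ Even (m + 2 - n)
    · obtain ⟨hn1, b, hb⟩ := hn
      rw [Finset.sum_eq_single b]
      · rw [if_pos (by omega), if_pos (⟨⟨m + 1, by ring⟩, by omega⟩), invCoeff,
          show m + 1 + 1 - n = b + b by omega, if_pos ⟨b, rfl⟩,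
          show n + (b + b) - 1 = m + 1 by omega, show (b + b) / 2 = b by omega,
          show b + b = 2 * b by ring]
        -- The absorption identity for binomial coefficients produces the denominator in `invCoeff`.
        have hch : ((n + (m + 1) : ℕ) : ℝ) * (n + m).choose n
            = (n + (m + 1)).choose n * (m + 1) := by
          have := Nat.add_one_mul_choose_eq (n + m) m
          rw [Nat.choose_symm_add, show n + (m + 1) = n + m + 1 by ring,
            show (n + m + 1).choose n = (n + m + 1).choose (m + 1) from
              Nat.choose_symm_of_eq_add (by ring)]
          exact_mod_cast this
        have hs : (√2)⁻¹ ^ (n + 1 + m) = √2 * (1 / 2) ^ (n + b) := by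
          have : n + 1 + m = 2 * (n + b) - 1 := by omega
          obtain ⟨q, hq⟩ : ∃ q, n + b = q + 1 := ⟨n + b - 1, by omega⟩
          rw [this, hq, show 2 * (q + 1) - 1 = 2 * q + 1 by omega, pow_succ, pow_mul, inv_pow,
            Real.sq_sqrt (by norm_num), pow_succ, inv_eq_one_div 2]
          have h22 : √2 * √2 = 2 := Real.mul_self_sqrt (by norm_num)
          field_simp
          rw [pow_two, h22]
        have hne : ((n + (m + 1) : ℕ) : ℝ) ≠ 0 := by positivity
        rw [hs]
        field_simp
        push_cast at hch ⊢
        rw [pow_succ (-1 : ℝ) m]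
        linear_combination (2 * (-1) ^ m * l ^ (2 * b) * ((2 * (m + 1)).choose b : ℝ)
          * ((4 * (m + 1) - 2 * b).choose (2 * (m + 1)) : ℝ)) * hch
      · intro b' _ hb'
        rw [if_neg (by omega)]
      · intro h
        exact absurd (Finset.mem_range.2 (by omega)) h
    · rw [Finset.sum_eq_zero, mul_zero]
      · split_ifs with h
        · rw [invCoeff, if_neg]
          · simp
          · intro h'
            exact hn ⟨h.2, h'⟩
        · simp
      · intro b _
        rw [if_neg]
        intro h
        exact hn ⟨by omega, b, by omega⟩

theorem adjoin_lmon_closed {f : Lau} (hf : f ∈ Algebra.adjoin ℝ {lmon 0 1}) :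
    lauCanonical.v * lauCanonical.θ₂ f ∈ Algebra.adjoin ℝ {lmon 0 1} := by
  rw [Algebra.adjoin_singleton_eq_range_aeval] at hf ⊢
  obtain ⟨p, rfl⟩ := hf
  refine ⟨Polynomial.derivative p, ?_⟩
  have h : lauCanonical.θ₂ (lmon 0 1) = lauCanonical.u := by
    rw [lauCanonical, lauDeriv_lmon]; simp
  have huv := lauCanonical.u_mul_v
  change Polynomial.aeval (lmon 0 1) (Polynomial.derivative p)
    = lauCanonical.v * lauCanonical.θ₂ (Polynomial.aeval (lmon 0 1) p)
  rw [Derivation.map_aeval, h, smul_eq_mul]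
  linear_combination (-(Polynomial.aeval (lmon 0 1) (Polynomial.derivative p))) * huv

theorem lauTrace_aeval_mul (p : Polynomial ℝ) (n : ℕ) :
    lauTrace (Polynomial.aeval (lmon 0 1) p * lmon 0 (-1) ^ n) = p.coeff n := by
  induction p using Polynomial.induction_on' with
  | add p q hp hq => rw [map_add, add_mul, map_add, hp, hq, Polynomial.coeff_add]
  | monomial k r =>
    rw [Polynomial.aeval_monomial, mul_assoc, ← Algebra.smul_def, map_smul, lmon_pow, lmon_pow,
      lmon_mul, lauTrace_lmon, Polynomial.coeff_monomial, smul_eq_mul]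
    by_cases h : k = n
    · rw [if_pos h, if_pos (by constructor <;> [ring; (subst h; ring)]), mul_one]
    · rw [if_neg h, if_neg (by omega), mul_zero]

theorem aeval_lmon_injective :
    Function.Injective (Polynomial.aeval (lmon 0 1) : Polynomial ℝ →ₐ[ℝ] Lau) := by
  intro p q h
  ext n
  rw [← lauTrace_aeval_mul, h, lauTrace_aeval_mul]

/-- The expansion of a normal form along the ray through `(x, l)`. -/
def raySeries (ν : ℕ → ℕ → ℝ) (x l : ℝ) : ℝ⟦X⟧ :=
  PowerSeries.mk fun n => if Even n then
    ∑ y ∈ Finset.HasAntidiagonal.antidiagonal (n / 2 + 1), ν y.1 y.2 * x ^ y.1 * l ^ y.2 else 0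

/-- A Birkhoff normal form is, as a formal power series, the inverse of the action of the vanishing
cycle. -/
theorem IsBirkhoffNormalForm.coeff_sum_invSeries {ν : ℕ → ℕ → ℝ} (hν : IsBirkhoffNormalForm ν)
    (x l : ℝ) {d i : ℕ} (hi : i < d) :
    coeff i (∑ a ∈ Finset.range (d + 1), invSeries l a * raySeries ν x l ^ a)
      = coeff i (C x) := by
  obtain ⟨W, hW⟩ := exists_lie_redHam hν l
  set ι : Polynomial ℝ →ₐ[ℝ] Lau := Polynomial.aeval (lmon 0 1) with hι
  set N := lauCanonical.lie W (redHam l) with hN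
  have hu : lauCanonical.u = lmon 0 1 := rfl
  have h22 : √2 ≠ 0 := by positivity
  have hN0 : coeff 0 N = √2 • lauCanonical.u := by
    rw [hN, LogCanonical.coeff_zero_lie, redHam_eq, hu]
    simp
  obtain ⟨Ni, hNi⟩ : ∃ Ni, N * Ni = 1 := by
    have : IsUnit N := by
      rw [PowerSeries.isUnit_iff_constantCoeff, ← PowerSeries.coeff_zero_eq_constantCoeff_apply,
        hN0]
      refine IsUnit.of_mul_eq_one ((√2)⁻¹ • lauCanonical.v) ?_
      rw [smul_mul_smul_comm, lauCanonical.u_mul_v, mul_inv_cancel₀ h22, one_smul]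
    exact this.exists_right_inv
  have key := lauCanonical.coeff_sum_mul_pow_eq (lam := √2) (N := N) (Ni := Ni)
    (κ := invSeries l) (d := d) (i := i)
    (S := Algebra.adjoin ℝ {lmon 0 1})
    (by rw [← lmon_zero]; exact (lauTrace_lmon 0 0).trans (by simp))
    (by rw [lauCanonical, lauDeriv_lmon]; simp) h22 hNi hN0
    (fun f hf => adjoin_lmon_closed hf)
    (fun f hf h => by
      rw [Algebra.adjoin_singleton_eq_range_aeval] at hf
      obtain ⟨p, rfl⟩ := hf
      have : p = 0 := by
        ext n
        have h3 := lauCanonical.u_mul_v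
        rw [← lauTrace_aeval_mul, Polynomial.coeff_zero, ← h n]
        change lauTrace _ = lauTrace _
        congr 1
        change ι p * lauCanonical.v ^ n = _
        simp only [AlgHom.toRingHom_eq_coe, RingHom.coe_coe]
        linear_combination (-(ι p * lauCanonical.v ^ n)) * h3
      rw [this]; simp)
    (fun k => by
      rw [hW, coeff_map, Algebra.adjoin_singleton_eq_range_aeval]
      exact ⟨_, rfl⟩)
    (fun n i hi => by
      rw [invSeries, coeff_mk, if_neg]
      rintro ⟨_, h⟩
      omega)
    (by simp [invSeries, invCoeff])
    (by
      have h2 := Real.mul_self_sqrt (show (0 : ℝ) ≤ 2 by norm_num)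
      simp [invSeries, invCoeff]
      linear_combination h2 / 2)
    (fun n k => by
      obtain ⟨G, hG, hres⟩ := res_redHam l n k
      rw [← hres]
      refine lauCanonical.res_derivative_mul_lie k n hG ?_
      rw [← hN, ← mul_pow, mul_comm, hNi, one_pow])
    hi
  -- Substituting `u` into real polynomials is injective, so the identity descends from Laurent
  -- polynomials to polynomials, where the variable may be specialised to `x`.
  have hpoly : coeff i (∑ a ∈ Finset.range (d + 1),
      PowerSeries.map (algebraMap ℝ (Polynomial ℝ)) (invSeries l a) * normalSeries ν l ^ a)
      = coeff i (C Polynomial.X) := by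
    apply aeval_lmon_injective
    have e : ∀ F : (Polynomial ℝ)⟦X⟧, ι (coeff i F) = coeff i (PowerSeries.map ι.toRingHom F) := by
      intro F; rw [coeff_map]; rfl
    rw [← hι, e, e, map_sum]
    rw [hu] at key
    convert key using 2
    · refine Finset.sum_congr rfl fun a _ => ?_
      rw [map_mul, map_pow, hW]
      congr 1
      ext1 n
      rw [coeff_map, coeff_map, coeff_map]
      exact Polynomial.aeval_C (R := ℝ) (lmon 0 1) _
    · rw [PowerSeries.map_C]
      congr 1
      simp [hι]
  have e : ∀ F : (Polynomial ℝ)⟦X⟧, Polynomial.evalRingHom x (coeff i F)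
      = coeff i (PowerSeries.map (Polynomial.evalRingHom x) F) := by
    intro F; rw [coeff_map]
  have := congrArg (Polynomial.evalRingHom x) hpoly
  rw [e, e, map_sum, PowerSeries.map_C] at this
  convert this using 2
  · refine Finset.sum_congr rfl fun a _ => ?_
    rw [map_mul, map_pow]
    congr 1
    · ext n; simp
    · congr 1
      ext n
      simp only [raySeries, normalSeries, coeff_mk, coeff_map]
      split_ifs
      · rw [map_sum]
        refine Finset.sum_congr rfl fun y _ => ?_
        simp
        ring
      · simp
  · simp

end FormalInverse

/-! ### Convergent double series -/

section DoubleSeries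

theorem summable_prod_of_antidiagonal {g : ℕ × ℕ → ℝ} (hg : ∀ n, 0 ≤ g n)
    (h : Summable fun n => ∑ y ∈ Finset.HasAntidiagonal.antidiagonal n, g y) : Summable g := by
  rw [← Finset.HasAntidiagonal.sigmaAntidiagonalEquivProd.summable_iff,
    summable_sigma_of_nonneg fun x => by exact hg (Finset.HasAntidiagonal.sigmaAntidiagonalEquivProd x)]
  refine ⟨fun n => (hasSum_fintype _).summable, ?_⟩
  refine h.congr fun n => ?_
  rw [tsum_fintype]
  exact (Finset.sum_coe_sort (Finset.HasAntidiagonal.antidiagonal n) g).symm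

theorem hasSum_antidiagonal {E : Type*} [NormedAddCommGroup E] [CompleteSpace E]
    {g : ℕ × ℕ → E} {s : E} (h : HasSum g s) :
    HasSum (fun n => ∑ y ∈ Finset.HasAntidiagonal.antidiagonal n, g y) s := by
  rw [← Finset.HasAntidiagonal.sigmaAntidiagonalEquivProd.hasSum_iff] at h
  refine h.sigma fun n => ?_
  rw [← Finset.sum_coe_sort]
  exact hasSum_fintype _

theorem hasSum_prod_of_antidiagonal {E : Type*} [NormedAddCommGroup E] [CompleteSpace E]
    {g : ℕ × ℕ → E} {s : E} (hg : Summable g)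
    (h : HasSum (fun n => ∑ y ∈ Finset.HasAntidiagonal.antidiagonal n, g y) s) : HasSum g s := by
  rw [← (hasSum_antidiagonal hg.hasSum).unique h]
  exact hg.hasSum

/-- `f` is the sum of the double power series with coefficients `C` on the square of side `2r`. -/
structure HasDoubleSeries (f : ℝ → ℝ → ℝ) (C : ℕ → ℕ → ℝ) (r : ℝ) : Prop where
  pos : 0 < r
  summable : Summable fun n : ℕ × ℕ => |C n.1 n.2| * r ^ (n.1 + n.2)
  hasSum : ∀ x y, |x| < r → |y| < r →
    HasSum (fun n : ℕ × ℕ => C n.1 n.2 * x ^ n.1 * y ^ n.2) (f x y)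

/-- The homogeneous parts of a double series. -/
def homPart (C : ℕ → ℕ → ℝ) (m : ℕ) (x y : ℝ) : ℝ :=
  ∑ n ∈ Finset.HasAntidiagonal.antidiagonal m, C n.1 n.2 * x ^ n.1 * y ^ n.2

theorem homPart_smul (C : ℕ → ℕ → ℝ) (m : ℕ) (t x y : ℝ) :
    homPart C m (t * x) (t * y) = t ^ m * homPart C m x y := by
  rw [homPart, homPart, Finset.mul_sum]
  refine Finset.sum_congr rfl fun n hn => ?_
  rw [← Finset.HasAntidiagonal.mem_antidiagonal.1 hn]
  ring

theorem HasDoubleSeries.isBigO {f : ℝ → ℝ → ℝ} {C : ℕ → ℕ → ℝ} {r : ℝ}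
    (hf : HasDoubleSeries f C r) (N : ℕ) :
    (fun x : ℝ × ℝ => f x.1 x.2 - ∑ m ∈ Finset.range N, homPart C m x.1 x.2)
      =O[𝓝 (0, 0)] fun x => ‖x‖ ^ N := by
  have hr := hf.pos
  set A : ℕ → ℝ := fun m => ∑ n ∈ Finset.HasAntidiagonal.antidiagonal m,
    |C n.1 n.2| * r ^ (n.1 + n.2) with hA
  have hA0 : ∀ m, 0 ≤ A m := fun m => Finset.sum_nonneg fun n _ => by positivity
  have hAs : Summable A := (hasSum_antidiagonal hf.summable.hasSum).summable
  refine IsBigO.of_bound ((∑' m, A m) * (r⁻¹) ^ N) ?_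
  filter_upwards [Metric.ball_mem_nhds ((0 : ℝ), (0 : ℝ)) hr] with x hx
  have hx' : ‖x‖ < r := by simpa [← Prod.zero_eq_mk] using hx
  have h1 : |x.1| ≤ ‖x‖ := norm_fst_le x
  have h2 : |x.2| ≤ ‖x‖ := norm_snd_le x
  have hsum := hasSum_antidiagonal (hf.hasSum x.1 x.2 (h1.trans_lt hx') (h2.trans_lt hx'))
  have hb : ∀ m, |homPart C m x.1 x.2| ≤ A m * (‖x‖ / r) ^ m := fun m => by
    rw [homPart, hA, Finset.sum_mul]
    refine (Finset.abs_sum_le_sum_abs _ _).trans (Finset.sum_le_sum fun n hn => ?_)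
    rw [← Finset.HasAntidiagonal.mem_antidiagonal.1 hn, mul_assoc, mul_assoc, ← mul_pow,
      mul_div_cancel₀ _ hr.ne', abs_mul, abs_mul, abs_pow, abs_pow, pow_add]
    gcongr
  have hq : ‖x‖ / r ≤ 1 := (div_le_one hr).2 hx'.le
  have hq0 : 0 ≤ ‖x‖ / r := by positivity
  have e : f x.1 x.2 - ∑ m ∈ Finset.range N, homPart C m x.1 x.2
      = ∑' m, homPart C (m + N) x.1 x.2 := by
    have := hsum.summable.sum_add_tsum_nat_add N
    rw [hsum.tsum_eq] at this
    rw [← this]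
    simp [homPart]
  rw [e, norm_pow, norm_norm]
  have hAN : Summable fun m => A (m + N) := (summable_nat_add_iff N).2 hAs
  calc ‖∑' m, homPart C (m + N) x.1 x.2‖ ≤ ∑' m, A (m + N) * (‖x‖ / r) ^ N := by
        refine tsum_of_norm_bounded (hAN.mul_right _).hasSum fun m => (hb _).trans ?_
        rw [pow_add]
        have := pow_le_one₀ (n := m) hq0 hq
        have h3 : (‖x‖ / r) ^ m * (‖x‖ / r) ^ N ≤ 1 * (‖x‖ / r) ^ N := by gcongr
        rw [one_mul] at h3
        exact mul_le_mul_of_nonneg_left h3 (hA0 _)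
    _ = (∑' m, A (m + N)) * (‖x‖ / r) ^ N := tsum_mul_right
    _ ≤ (∑' m, A m) * (‖x‖ / r) ^ N := by
        refine mul_le_mul_of_nonneg_right ?_ (by positivity)
        have := hAs.sum_add_tsum_nat_add N
        rw [← this]
        linarith [Finset.sum_nonneg fun m (_ : m ∈ Finset.range N) => hA0 m]
    _ = (∑' m, A m) * (r⁻¹) ^ N * ‖x‖ ^ N := by rw [div_eq_inv_mul, mul_pow]; ring

/-- The coefficients of the double series of a formal multilinear series in two variables. -/
def multilinearCoeff (p : FormalMultilinearSeries ℝ (ℝ × ℝ) ℝ) (n a : ℕ) : ℝ :=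
  ∑ s ∈ Finset.powersetCard a (Finset.univ : Finset (Fin n)),
    p n (s.piecewise (fun _ => ((1, 0) : ℝ × ℝ)) (fun _ => (0, 1)))

/-- Each argument is split as `x (1, 0) + y (0, 1)`; the subset of slots receiving `(1, 0)` records
the power of `x`. -/
theorem multilinear_apply_eq (p : FormalMultilinearSeries ℝ (ℝ × ℝ) ℝ) (n : ℕ) (x y : ℝ) :
    p n (fun _ => (x, y)) = homPart (fun a b => multilinearCoeff p (a + b) a) n x y := by
  have h : (fun _ : Fin n => (x, y))
      = (fun _ => x • ((1, 0) : ℝ × ℝ)) + fun _ => y • ((0, 1) : ℝ × ℝ) := by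
    ext i <;> simp
  rw [h, ContinuousMultilinearMap.map_add_univ, ← Finset.powerset_univ, Finset.sum_powerset,
    homPart, Finset.Nat.sum_antidiagonal_eq_sum_range_succ
      (fun a b => multilinearCoeff p (a + b) a * x ^ a * y ^ b), Finset.card_univ, Fintype.card_fin]
  refine Finset.sum_congr rfl fun a ha => ?_
  have ha' : a ≤ n := by simpa [Nat.lt_succ_iff] using ha
  rw [Nat.add_sub_cancel' ha', multilinearCoeff, mul_assoc, Finset.sum_mul]
  refine Finset.sum_congr rfl fun s hs => ?_
  have hs' := (Finset.mem_powersetCard.1 hs).2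
  have e : s.piecewise (fun _ => x • ((1, 0) : ℝ × ℝ)) (fun _ => y • ((0, 1) : ℝ × ℝ))
      = fun i => (s.piecewise (fun _ => x) (fun _ => y) i) •
        (s.piecewise (fun _ => ((1, 0) : ℝ × ℝ)) (fun _ => (0, 1)) i) := by
    funext i
    by_cases hi : i ∈ s <;> simp [hi]
  rw [e, ContinuousMultilinearMap.map_smul_univ, smul_eq_mul, mul_comm]
  congr 1
  rw [Finset.prod_piecewise]
  simp [← Finset.compl_eq_univ_sdiff, Finset.card_compl, hs']

theorem norm_multilinearCoeff_le (p : FormalMultilinearSeries ℝ (ℝ × ℝ) ℝ) (n a : ℕ) :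
    |multilinearCoeff p n a| ≤ n.choose a * ‖p n‖ := by
  refine (Finset.abs_sum_le_sum_abs _ _).trans ?_
  have := Finset.sum_le_card_nsmul (Finset.powersetCard a (Finset.univ : Finset (Fin n)))
    (fun s => |p n (s.piecewise (fun _ => ((1, 0) : ℝ × ℝ)) (fun _ => (0, 1)))|) ‖p n‖
    (fun s _ => by
      refine ((p n).le_opNorm _).trans ?_
      refine mul_le_of_le_one_right (norm_nonneg _) (Finset.prod_le_one (fun _ _ => norm_nonneg _)
        fun i _ => ?_)
      by_cases hi : i ∈ s <;> simp [hi, Prod.norm_def])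
  refine this.trans ?_
  rw [Finset.card_powersetCard, Finset.card_univ, Fintype.card_fin, nsmul_eq_mul]

/-- In degree `n` there are `2^n` subsets of slots, and halving the radius absorbs this factor. -/
theorem exists_hasDoubleSeries {f : ℝ → ℝ → ℝ}
    (hf : AnalyticAt ℝ (fun x : ℝ × ℝ => f x.1 x.2) (0, 0)) :
    ∃ C r, HasDoubleSeries f C r := by
  obtain ⟨p, R, hp⟩ := hf
  obtain ⟨s, hs0, hsR⟩ := ENNReal.lt_iff_exists_nnreal_btwn.1 hp.r_pos
  have hs0' : 0 < (s : ℝ) := by exact_mod_cast hs0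
  have hps := p.summable_norm_mul_pow (hsR.trans_le hp.r_le)
  have hsum : Summable fun n : ℕ × ℕ => |multilinearCoeff p (n.1 + n.2) n.1| * ((s : ℝ) / 2)
      ^ (n.1 + n.2) := by
    refine summable_prod_of_antidiagonal (fun n => by positivity) ?_
    refine Summable.of_nonneg_of_le (fun n => Finset.sum_nonneg fun y _ => by positivity)
      (fun n => ?_) hps
    rw [Finset.Nat.sum_antidiagonal_eq_sum_range_succ
      (fun a b => |multilinearCoeff p (a + b) a| * ((s : ℝ) / 2) ^ (a + b))]
    calc _ ≤ ∑ a ∈ Finset.range (n + 1), (n.choose a : ℝ) * (‖p n‖ * ((s : ℝ) / 2) ^ n) := by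
          refine Finset.sum_le_sum fun a ha => ?_
          rw [Nat.add_sub_cancel' (by simpa [Nat.lt_succ_iff] using ha), ← mul_assoc]
          gcongr
          exact norm_multilinearCoeff_le p n a
      _ = ‖p n‖ * (s : ℝ) ^ n := by
          rw [← Finset.sum_mul]
          have := Nat.sum_range_choose n
          rw [← Nat.cast_sum, this, div_pow]
          push_cast
          field_simp
  refine ⟨fun a b => multilinearCoeff p (a + b) a, s / 2, by positivity, hsum, fun x y hx hy => ?_⟩
  refine hasSum_prod_of_antidiagonal ?_ ?_
  · refine Summable.of_norm_bounded hsum fun n => ?_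
    rw [Real.norm_eq_abs, abs_mul, abs_mul, abs_pow, abs_pow, mul_assoc, pow_add]
    gcongr
  · have := hp.hasSum (y := (x, y)) (by
      rw [Metric.mem_eball, edist_zero_right]
      refine lt_of_le_of_lt ?_ hsR
      rw [← ofReal_norm, ← ENNReal.ofReal_coe_nnreal]
      refine ENNReal.ofReal_le_ofReal ?_
      rw [Prod.norm_def]
      exact max_le (hx.le.trans (by simp)) (hy.le.trans (by simp)))
    simp only [multilinear_apply_eq, Prod.mk_add_mk, zero_add] at this
    exact this

/-- A polynomial of degree less than `N` that is `O(t ^ N)` vanishes. -/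
theorem eq_zero_of_sum_isBigO {N : ℕ} : ∀ {a : ℕ → ℝ},
    (fun t : ℝ => ∑ k ∈ Finset.range N, a k * t ^ k) =O[𝓝[>] 0] (fun t => t ^ N) →
    ∀ k < N, a k = 0 := by
  induction N with
  | zero => intro a _ k hk; omega
  | succ N ih =>
    intro a h
    have h0 : a 0 = 0 := by
      have h1 : Tendsto (fun t : ℝ => ∑ k ∈ Finset.range (N + 1), a k * t ^ k) (𝓝[>] 0) (𝓝 0) := by
        refine h.trans_tendsto ?_
        refine Tendsto.mono_left ?_ nhdsWithin_le_nhds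
        exact Continuous.tendsto' (by fun_prop) _ _ (by simp)
      have h2 : Tendsto (fun t : ℝ => ∑ k ∈ Finset.range (N + 1), a k * t ^ k) (𝓝[>] 0)
          (𝓝 (a 0)) := by
        refine Tendsto.mono_left ?_ nhdsWithin_le_nhds
        exact Continuous.tendsto' (by fun_prop) _ _ (by simp [Finset.sum_range_succ'])
      exact tendsto_nhds_unique h2 h1
    have h3 := ih (a := fun k => a (k + 1)) (by
      obtain ⟨c, hc⟩ := h.bound
      refine IsBigO.of_bound c ?_
      filter_upwards [hc, self_mem_nhdsWithin] with t ht ht0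
      have ht0' : (0 : ℝ) < t := ht0
      rw [Finset.sum_range_succ', h0, zero_mul, add_zero] at ht
      have e : ∑ k ∈ Finset.range N, a (k + 1) * t ^ (k + 1)
          = t * ∑ k ∈ Finset.range N, a (k + 1) * t ^ k := by
        rw [Finset.mul_sum]
        exact Finset.sum_congr rfl fun k _ => by ring
      rw [e, pow_succ', norm_mul, norm_mul] at ht
      have : 0 < ‖t‖ := by simpa using ht0'.ne'
      nlinarith)
    intro k hk
    rcases k with _ | k
    · exact h0
    · exact h3 k (by omega)

theorem eq_of_homPart_eq {C D : ℕ → ℕ → ℝ} (h : ∀ m x y, homPart C m x y = homPart D m x y) :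
    C = D := by
  funext a b
  have := eq_zero_of_sum_isBigO (N := a + b + 1) (a := fun k => C k (a + b - k) - D k (a + b - k))
    (by
      have e : (fun t : ℝ => ∑ k ∈ Finset.range (a + b + 1),
          (C k (a + b - k) - D k (a + b - k)) * t ^ k) = fun _ => 0 := by
        funext t
        have h1 := h (a + b) t 1
        rw [homPart, homPart, Finset.Nat.sum_antidiagonal_eq_sum_range_succ
            (fun a b => C a b * t ^ a * 1 ^ b), Finset.Nat.sum_antidiagonal_eq_sum_range_succ
            (fun a b => D a b * t ^ a * 1 ^ b), ← sub_eq_zero, ← Finset.sum_sub_distrib] at h1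
        rw [← h1]
        exact Finset.sum_congr rfl fun k _ => by simp; ring
      rw [e]
      exact isBigO_zero _ _) a (by omega)
  simpa [sub_eq_zero] using this

end DoubleSeries

/-! ### Convergence of the Birkhoff normal form -/

section NormalFormConvergence

theorem X_pow_dvd_sub_of_coeff {F : PowerSeries ℝ} {f : ℕ → ℝ}
    (hF : ∀ i, PowerSeries.coeff i F = if Even i then f (i / 2) else 0) (D : ℕ) :
    (PowerSeries.X : PowerSeries ℝ) ^ (2 * D) ∣ F -
      ((∑ m ∈ Finset.range D, Polynomial.C (f m) * Polynomial.X ^ (2 * m) : Polynomial ℝ) :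
        PowerSeries ℝ) := by
  rw [PowerSeries.X_pow_dvd_iff]
  intro i hi
  rw [map_sub, hF, Polynomial.coeff_coe, Polynomial.finsetSum_coeff]
  simp only [Polynomial.coeff_C_mul_X_pow]
  split_ifs with h
  · obtain ⟨m, rfl⟩ := h
    rw [Finset.sum_eq_single m]
    · rw [if_pos (by ring), show (m + m) / 2 = m by omega, sub_self]
    · intro b _ hb
      rw [if_neg (by omega)]
    · intro h'
      exact absurd (Finset.mem_range.2 (by omega)) h'
  · rw [Finset.sum_eq_zero, sub_self]
    intro b _
    rw [if_neg]
    rintro rfl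
    exact h (even_two_mul b)

/-- The inversion of the normal form, in terms of truncations. -/
theorem IsBirkhoffNormalForm.exists_eval {ν : ℕ → ℕ → ℝ} (hν : IsBirkhoffNormalForm ν)
    (x l : ℝ) (D : ℕ) :
    ∃ Q : Polynomial ℝ, ∀ s : ℝ,
      ∑ m ∈ Finset.range D, homPart invCoeff (m + 1)
          (∑ k ∈ Finset.range D, homPart ν (k + 1) x l * s ^ (2 * k)) l * s ^ (2 * m)
        = x + s ^ (2 * D) * Q.eval s := by
  set P : Polynomial ℝ := ∑ k ∈ Finset.range D, Polynomial.C (homPart ν (k + 1) x l) *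
    Polynomial.X ^ (2 * k) with hP
  set f : ℕ → ℕ → ℝ := fun a m =>
    if a ≤ m + 1 then invCoeff a (m + 1 - a) * l ^ (m + 1 - a) else 0 with hf
  set A : ℕ → Polynomial ℝ := fun a => ∑ m ∈ Finset.range D, Polynomial.C (f a m) *
    Polynomial.X ^ (2 * m) with hA
  have h1 : (PowerSeries.X : PowerSeries ℝ) ^ (2 * D) ∣ raySeries ν x l - (P : PowerSeries ℝ) :=
    X_pow_dvd_sub_of_coeff (f := fun m => homPart ν (m + 1) x l) (fun i => by
      rw [raySeries, PowerSeries.coeff_mk, homPart]) D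
  have h2 : ∀ a, (PowerSeries.X : PowerSeries ℝ) ^ (2 * D) ∣ invSeries l a - (A a : PowerSeries ℝ) :=
    fun a => X_pow_dvd_sub_of_coeff (f := f a) (fun i => by
      rw [invSeries, PowerSeries.coeff_mk, hf]
      by_cases h : Even i
      · simp [h]
      · simp [h]) D
  -- Modulo `ε^(2D)` each series may be replaced by its polynomial truncation.
  set φ := Ideal.Quotient.mk (Ideal.span {(PowerSeries.X : PowerSeries ℝ) ^ (2 * D)}) with hφ
  have hφ' : ∀ F G : PowerSeries ℝ, φ F = φ G ↔ (PowerSeries.X : PowerSeries ℝ) ^ (2 * D) ∣ F - G :=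
    fun F G => by rw [hφ, Ideal.Quotient.eq, Ideal.mem_span_singleton]
  have h3 : φ (∑ a ∈ Finset.range (2 * D + 1), invSeries l a * raySeries ν x l ^ a)
      = φ (PowerSeries.C x) := by
    rw [hφ', PowerSeries.X_pow_dvd_iff]
    intro i hi
    rw [map_sub, hν.coeff_sum_invSeries x l hi, sub_self]
  have h4 : φ ((∑ a ∈ Finset.range (2 * D + 1), A a * P ^ a : Polynomial ℝ) : PowerSeries ℝ)
      = φ ((Polynomial.C x : Polynomial ℝ) : PowerSeries ℝ) := by
    rw [Polynomial.coe_C, ← h3, ← Polynomial.coeToPowerSeries.ringHom_apply, map_sum, map_sum,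
      map_sum]
    refine Finset.sum_congr rfl fun a _ => ?_
    rw [map_mul, map_pow, map_mul, map_pow, map_mul, map_pow,
      Polynomial.coeToPowerSeries.ringHom_apply, Polynomial.coeToPowerSeries.ringHom_apply,
      (hφ' _ _).2 h1, (hφ' _ _).2 (h2 a)]
  rw [hφ', PowerSeries.X_pow_dvd_iff] at h4
  have h5 : (Polynomial.X : Polynomial ℝ) ^ (2 * D) ∣
      ∑ a ∈ Finset.range (2 * D + 1), A a * P ^ a - Polynomial.C x := by
    rw [Polynomial.X_pow_dvd_iff]
    intro i hi
    have := h4 i hi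
    rw [map_sub, Polynomial.coeff_coe, Polynomial.coeff_coe] at this
    rw [Polynomial.coeff_sub, this]
  obtain ⟨Q, hQ⟩ := h5
  refine ⟨Q, fun s => ?_⟩
  have h6 := congrArg (Polynomial.eval s) hQ
  simp only [Polynomial.eval_sub, Polynomial.eval_finsetSum, Polynomial.eval_mul,
    Polynomial.eval_pow, Polynomial.eval_C, Polynomial.eval_X, hA, hP] at h6
  rw [← h6, add_sub_cancel]
  set n := ∑ k ∈ Finset.range D, homPart ν (k + 1) x l * s ^ (2 * k)
  simp only [Finset.sum_mul]
  rw [Finset.sum_comm]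
  refine Finset.sum_congr rfl fun m hm => ?_
  have hm' := Finset.mem_range.1 hm
  rw [homPart, Finset.Nat.sum_antidiagonal_eq_sum_range_succ
    (fun a b => invCoeff a b * n ^ a * l ^ b), Finset.sum_mul]
  refine (Finset.sum_subset (Finset.range_mono (by omega : m + 1 + 1 ≤ 2 * D + 1))
    fun a _ ha => ?_).symm.trans ?_ |>.symm
  · rw [hf]
    dsimp only
    rw [if_neg (by simpa using ha)]
    ring
  · refine Finset.sum_congr rfl fun a ha => ?_
    rw [hf]
    dsimp only
    rw [if_pos (by have := Finset.mem_range.1 ha; omega)]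
    ring

/-- A Birkhoff normal form converges, to the inverse of the action of the vanishing cycle. -/
theorem IsBirkhoffNormalForm.hasDoubleSeries {ν : ℕ → ℕ → ℝ} (hν : IsBirkhoffNormalForm ν)
    {K Y : ℝ → ℝ → ℝ} {r : ℝ} (hK : HasDoubleSeries K invCoeff r)
    (hY : AnalyticAt ℝ (fun x : ℝ × ℝ => Y x.1 x.2) (0, 0))
    (hinv : ∀ᶠ x : ℝ × ℝ in 𝓝 (0, 0), Y (K x.1 x.2) x.2 = x.1) :
    ∃ r, HasDoubleSeries Y ν r := by
  obtain ⟨C, s, hC⟩ := exists_hasDoubleSeries hY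
  suffices h : ν = C from ⟨s, h ▸ hC⟩
  refine eq_of_homPart_eq fun D x l => ?_
  obtain ⟨Q, hQ⟩ := hν.exists_eval x l D
  -- `t * n t` is the truncated normal form at `(t x, t l)`: the part of degree `k + 1` carries
  -- `t^(k+1)`.
  set n : ℝ → ℝ := fun t => ∑ k ∈ Finset.range D, homPart ν (k + 1) x l * t ^ k with hn
  have hnc : Continuous n := by fun_prop
  set w : ℝ → ℝ × ℝ := fun t => (t * n t, t * l) with hw
  have hwc : Continuous w := by fun_prop
  have hw0 : Tendsto w (𝓝[>] 0) (𝓝 (0, 0)) :=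
    (hwc.tendsto' 0 (0, 0) (by simp [hw])).mono_left nhdsWithin_le_nhds
  have hwO : w =O[𝓝[>] 0] (fun t => t) := by
    have h1 : (fun t => t * n t) =O[𝓝[>] 0] (fun t : ℝ => t) := by
      have : n =O[𝓝[>] 0] (fun _ => (1 : ℝ)) :=
        ((hnc.tendsto 0).mono_left nhdsWithin_le_nhds).isBigO_one ℝ
      simpa using (isBigO_refl (fun t : ℝ => t) _).mul this
    have h2 : (fun t => t * l) =O[𝓝[>] 0] (fun t : ℝ => t) := by
      simpa using (isBigO_refl (fun t : ℝ => t) _).mul (isBigO_const_const l one_ne_zero _)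
    exact h1.prod_left h2
  -- the value of `K` along the truncated normal form
  have hKw : (fun t => K (w t).1 (w t).2 - t * x) =O[𝓝[>] 0] (fun t => t ^ (D + 1)) := by
    have h1 := (hK.isBigO (D + 1)).comp_tendsto hw0
    have h2 : (fun t => ‖w t‖ ^ (D + 1)) =O[𝓝[>] 0] (fun t : ℝ => t ^ (D + 1)) :=
      hwO.norm_left.pow _
    have h3 : (fun t => t ^ (D + 1) * Q.eval √t) =O[𝓝[>] 0] (fun t : ℝ => t ^ (D + 1)) := by
      have hc : Continuous fun t : ℝ => Q.eval √t := by
        exact Q.continuous.comp Real.continuous_sqrt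
      have : (fun t : ℝ => Q.eval √t) =O[𝓝[>] 0] (fun _ => (1 : ℝ)) :=
        ((hc.tendsto 0).mono_left nhdsWithin_le_nhds).isBigO_one ℝ
      simpa using (isBigO_refl (fun t : ℝ => t ^ (D + 1)) _).mul this
    refine ((h1.trans h2).add h3).congr' ?_ EventuallyEq.rfl
    filter_upwards [self_mem_nhdsWithin] with t ht
    have ht0 : (0 : ℝ) < t := ht
    have hs : ∀ k, √t ^ (2 * k) = t ^ k := fun k => by rw [pow_mul, Real.sq_sqrt ht0.le]
    -- The formal parameter is `√t`, because a homogeneous part of degree `m + 1` carries `ε^(2m)`.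
    have h4 := hQ √t
    simp only [hs] at h4
    have h5 : ∑ m ∈ Finset.range (D + 1), homPart invCoeff m (t * n t) (t * l)
        = t * (x + t ^ D * Q.eval √t) := by
      have h0 : homPart invCoeff 0 (t * n t) (t * l) = 0 := by simp [homPart, invCoeff]
      rw [Finset.sum_range_succ', h0, add_zero, ← h4]
      refine (Finset.sum_congr rfl fun m _ => ?_).trans (Finset.mul_sum _ _ _).symm
      rw [homPart_smul]
      ring
    simp only [Function.comp_apply, hw]
    rw [h5]
    ring
  have hpair : Tendsto (fun t : ℝ => (t * x, t * l)) (𝓝[>] 0) (𝓝 (0, 0)) :=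
    (Continuous.tendsto' (by fun_prop) 0 (0, 0) (by simp)).mono_left nhdsWithin_le_nhds
  have ht0 : Tendsto (fun t : ℝ => t ^ (D + 1)) (𝓝[>] 0) (𝓝 0) :=
    (Continuous.tendsto' (by fun_prop) 0 0 (by simp)).mono_left nhdsWithin_le_nhds
  have hpair' : Tendsto (fun t : ℝ => (K (w t).1 (w t).2, t * l)) (𝓝[>] 0) (𝓝 (0, 0)) := by
    have h1 := (hKw.trans_tendsto ht0).add (hpair.fst_nhds)
    have h2 : Tendsto (fun t => K (w t).1 (w t).2) (𝓝[>] 0) (𝓝 0) := by simpa using h1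
    exact h2.prodMk_nhds hpair.snd_nhds
  -- Strict differentiability makes `Y` locally Lipschitz, so the error `O(t^(D+1))` in the argument
  -- `K (w t)` passes to the value. That value is `t * n t`, and comparison with the Taylor series
  -- of `Y` identifies the part of degree `D`.
  have hlip : (fun t => Y (K (w t).1 (w t).2) (t * l) - Y (t * x) (t * l))
      =O[𝓝[>] 0] (fun t : ℝ => t ^ (D + 1)) := by
    have h1 := hY.hasStrictFDerivAt.isBigO_sub
    have h2 := h1.comp_tendsto (hpair'.prodMk_nhds hpair)
    refine IsBigO.trans (h2.congr_left fun _ => rfl) ?_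
    refine (hKw.prod_left (isBigO_zero (E' := ℝ) _ _)).congr_left fun t => ?_
    simp
  have hYw : ∀ᶠ t in 𝓝[>] (0 : ℝ), Y (K (w t).1 (w t).2) (t * l) = t * n t := by
    filter_upwards [hw0.eventually hinv] with t ht using ht
  have hYx := (hC.isBigO (D + 1)).comp_tendsto hpair
  have hYx' : (fun t => ‖((t * x, t * l) : ℝ × ℝ)‖ ^ (D + 1)) =O[𝓝[>] 0]
      (fun t : ℝ => t ^ (D + 1)) := by
    refine IsBigO.pow (IsBigO.norm_left ?_) _
    refine IsBigO.prod_left ?_ ?_ <;>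
      simpa using (isBigO_refl (fun t : ℝ => t) _).mul (isBigO_const_const _ one_ne_zero _)
  have htot := hlip.add (hYx.trans hYx')
  have h0 : homPart ν 0 x l = 0 := by simp [homPart, hν.1]
  have hfin : (fun t => ∑ k ∈ Finset.range (D + 1), (homPart ν k x l - homPart C k x l) * t ^ k)
      =O[𝓝[>] 0] (fun t : ℝ => t ^ (D + 1)) := by
    refine htot.congr' ?_ EventuallyEq.rfl
    filter_upwards [hYw] with t ht
    simp only [Function.comp_apply]
    rw [ht, sub_add_sub_cancel]
    simp only [homPart_smul, sub_mul, Finset.sum_sub_distrib]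
    congr 1
    · rw [Finset.sum_range_succ', h0, zero_mul, add_zero, hn, Finset.mul_sum]
      exact Finset.sum_congr rfl fun k _ => by ring
    · exact Finset.sum_congr rfl fun k _ => by ring
  have := eq_zero_of_sum_isBigO hfin D (by omega)
  linarith

end NormalFormConvergence

/-! ### Analytic local inverses of maps tangent to the identity -/

theorem exists_analytic_inverse {F : ℝ × ℝ → ℝ × ℝ} (hF : AnalyticAt ℝ F (0, 0))
    (h0 : F (0, 0) = (0, 0)) (hd : HasFDerivAt F (ContinuousLinearMap.id ℝ (ℝ × ℝ)) (0, 0)) :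
    ∃ G : ℝ × ℝ → ℝ × ℝ, AnalyticAt ℝ G (0, 0) ∧ G (0, 0) = (0, 0) ∧
      (∀ᶠ x in 𝓝 (0, 0), F (G x) = x) ∧ (∀ᶠ x in 𝓝 (0, 0), G (F x) = x) ∧
      HasFDerivAt G (ContinuousLinearMap.id ℝ (ℝ × ℝ)) (0, 0) := by
  have hs : HasStrictFDerivAt F
      ((ContinuousLinearEquiv.refl ℝ (ℝ × ℝ) : (ℝ × ℝ) ≃L[ℝ] (ℝ × ℝ)) : (ℝ × ℝ) →L[ℝ] (ℝ × ℝ))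
      (0, 0) := by
    have := hF.hasStrictFDerivAt
    rwa [hd.fderiv] at this
  set R := hs.toOpenPartialHomeomorph F with hR
  have hRF : (R : ℝ × ℝ → ℝ × ℝ) = F := rfl
  have hsrc : ((0, 0) : ℝ × ℝ) ∈ R.source := hs.mem_toOpenPartialHomeomorph_source
  have htgt : ((0, 0) : ℝ × ℝ) ∈ R.target := by
    have := R.map_source hsrc
    rwa [hRF, h0] at this
  have hG0 : R.symm (0, 0) = (0, 0) := by
    have := R.left_inv hsrc
    rwa [hRF, h0] at this
  refine ⟨R.symm, ?_, hG0, ?_, ?_, ?_⟩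
  · refine R.analyticAt_symm (i := ContinuousLinearEquiv.refl ℝ (ℝ × ℝ)) htgt ?_ ?_
    · rw [hG0]; exact hF
    · rw [hG0, hRF, hd.fderiv]; rfl
  · filter_upwards [R.open_target.mem_nhds htgt] with x hx using R.right_inv hx
  · filter_upwards [R.open_source.mem_nhds hsrc] with x hx using R.left_inv hx
  · exact R.hasFDerivAt_symm (f' := ContinuousLinearEquiv.refl ℝ (ℝ × ℝ)) htgt (by
      rw [hG0]; exact hd)

/-! ### The binomial series of the square root -/

section SqrtSeries

/-- The Taylor coefficients of `√(1 - y)`. -/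
def sqrtCoeff : ℕ → ℝ
  | 0 => 1
  | k + 1 => sqrtCoeff k * (k - 1 / 2) / (k + 1)

theorem sqrtCoeff_eq_choose (k : ℕ) : sqrtCoeff k = (-1) ^ k * Ring.choose (1 / 2 : ℝ) k := by
  induction k with
  | zero => simp [sqrtCoeff]
  | succ k ih =>
    have h : Ring.choose (1 / 2 : ℝ) (k + 1) = Ring.choose (1 / 2 : ℝ) k * (1 / 2 - k) / (k + 1) := by
      rw [Ring.choose_eq_smul, Ring.choose_eq_smul, descPochhammer_succ_right,
        Polynomial.smeval_mul, Nat.factorial_succ]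
      simp [Polynomial.smeval_natCast]
      field_simp
    rw [sqrtCoeff, ih, h, pow_succ]
    ring

theorem hasSum_sqrtCoeff {x : ℂ} (hx : ‖x‖ < 1) :
    HasSum (fun k => (sqrtCoeff k : ℂ) * x ^ k) ((1 - x) ^ (1 / 2 : ℂ)) := by
  have h := Complex.one_add_cpow_hasFPowerSeriesOnBall_zero (a := 1 / 2).hasSum (y := -x) (by
    rw [← ENNReal.ofReal_one, Metric.eball_ofReal]
    simpa using hx)
  simp only [binomialSeries_apply, List.ofFn_const, List.prod_replicate, zero_add, smul_eq_mul]
    at h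
  rw [← sub_eq_add_neg] at h
  refine h.congr_fun fun k => ?_
  rw [sqrtCoeff_eq_choose, neg_pow]
  push_cast [Complex.ofReal_choose]
  ring

theorem sqrtCoeff_succ_neg (k : ℕ) : sqrtCoeff (k + 1) < 0 := by
  induction k with
  | zero => norm_num [sqrtCoeff]
  | succ k ih =>
    rw [sqrtCoeff]
    have : (0 : ℝ) < (((k + 1 : ℕ) : ℝ) - 1 / 2) := by push_cast; linarith [(Nat.cast_nonneg k : (0 : ℝ) ≤ k)]
    exact div_neg_of_neg_of_pos (mul_neg_of_neg_of_pos ih this) (by positivity)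

/-- The partial sums are the coefficients of `√(1 - y) / (1 - y) = (1 - y)^(-1/2)`, which is `-2`
times the derivative of `√(1 - y)`. -/
theorem sum_sqrtCoeff (n : ℕ) :
    ∑ k ∈ Finset.range (n + 1), sqrtCoeff k = -2 * (n + 1) * sqrtCoeff (n + 1) := by
  induction n with
  | zero => norm_num [sqrtCoeff]
  | succ n ih =>
    have h : sqrtCoeff (n + 1 + 1) = sqrtCoeff (n + 1) * (((n + 1 : ℕ) : ℝ) - 1 / 2)
        / (((n + 1 : ℕ) : ℝ) + 1) := rfl
    rw [Finset.sum_range_succ, ih, h]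
    push_cast
    field_simp
    ring

/-- The partial sums are positive and only the first coefficient `1` is positive, so the negative
ones add up to at most `1` in absolute value. -/
theorem sum_abs_sqrtCoeff_le (n : ℕ) : ∑ k ∈ Finset.range n, |sqrtCoeff k| ≤ 2 := by
  rcases n with _ | n
  · simp
  rw [Finset.sum_range_succ', Finset.sum_congr rfl fun k _ => abs_of_neg (sqrtCoeff_succ_neg k),
    Finset.sum_neg_distrib]
  have h := sum_sqrtCoeff n
  rw [Finset.sum_range_succ'] at h
  have h0 : sqrtCoeff 0 = 1 := rfl
  have := sqrtCoeff_succ_neg n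
  rw [h0] at h ⊢
  have : (0 : ℝ) < -2 * (n + 1) * sqrtCoeff (n + 1) := by nlinarith
  norm_num
  linarith

theorem summable_abs_sqrtCoeff : Summable fun k => |sqrtCoeff k| :=
  summable_of_sum_range_le (fun _ => abs_nonneg _) sum_abs_sqrtCoeff_le

theorem abs_sqrtCoeff_le (k : ℕ) : |sqrtCoeff k| ≤ 1 := by
  induction k with
  | zero => simp [sqrtCoeff]
  | succ k ih =>
    rw [sqrtCoeff, abs_div, abs_mul, abs_of_pos (by positivity : (0 : ℝ) < k + 1),
      div_le_one (by positivity)]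
    have : |(k : ℝ) - 1 / 2| ≤ k + 1 := by
      rw [abs_le]; constructor <;> linarith [(Nat.cast_nonneg k : (0 : ℝ) ≤ k)]
    calc _ ≤ 1 * ((k : ℝ) + 1) := by gcongr
      _ = _ := one_mul _

theorem sqrtCoeff_succ_eq (n : ℕ) :
    sqrtCoeff (n + 1) = - ((2 * n).factorial / (2 ^ (2 * n + 1) * n.factorial * (n + 1).factorial)) := by
  induction n with
  | zero => norm_num [sqrtCoeff]
  | succ n ih =>
    rw [sqrtCoeff, ih, show 2 * (n + 1) = 2 * n + 1 + 1 by ring, Nat.factorial_succ (2 * n + 1),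
      Nat.factorial_succ (2 * n), Nat.factorial_succ (n + 1), Nat.factorial_succ n]
    push_cast
    field_simp
    ring

end SqrtSeries

/-! ### Residues on circles -/

section Residue

/-- The normalised integral over the circle of radius `R`. -/
def circRes (R : ℝ) (f : ℂ → ℂ) : ℂ := (2 * π * Complex.I)⁻¹ * ∮ z in C(0, R), f z

theorem circRes_zpow {R : ℝ} (hR : R ≠ 0) (m : ℤ) :
    circRes R (fun z => z ^ m) = if m = -1 then 1 else 0 := by
  have hpi : (2 * π * Complex.I : ℂ) ≠ 0 := Complex.two_pi_I_ne_zero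
  split_ifs with h
  · subst h
    have := circleIntegral.integral_sub_center_inv 0 hR
    simp only [sub_zero] at this
    simp only [circRes, zpow_neg_one, this]
    exact inv_mul_cancel₀ hpi
  · have := circleIntegral.integral_sub_zpow_of_ne h 0 0 R
    simp only [sub_zero] at this
    rw [circRes, this, mul_zero]

theorem circRes_sum_zpow {ι : Type*} (s : Finset ι) (a : ι → ℂ) (m : ι → ℤ) {R : ℝ} (hR : R ≠ 0) :
    circRes R (fun z => ∑ i ∈ s, a i * z ^ m i) = ∑ i ∈ s, if m i = -1 then a i else 0 := by
  have hint : ∀ i ∈ s, CircleIntegrable (fun z => a i * z ^ m i) 0 R := fun i _ => by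
    have : CircleIntegrable (fun z : ℂ => z ^ m i) 0 R := by
      have := (circleIntegrable_sub_zpow_iff (c := 0) (w := 0) (R := R) (n := m i)).2
        (Or.inr (Or.inr (by simpa [eq_comm] using hR)))
      simpa using this
    simpa using this.const_fun_smul (a := a i)
  rw [circRes, circleIntegral.integral_fun_sum hint, Finset.mul_sum]
  refine Finset.sum_congr rfl fun i _ => ?_
  rw [circleIntegral.integral_const_mul]
  have := circRes_zpow hR (m i)
  rw [circRes] at this
  rw [mul_left_comm, this]
  split_ifs <;> simp

theorem hasSum_circRes {ι : Type*} [Countable ι] {R : ℝ} (hR : 0 ≤ R) {F : ι → ℂ → ℂ} {f : ℂ → ℂ}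
    {B : ι → ℝ} (hB : Summable B) (hc : ∀ i, ContinuousOn (F i) (Metric.sphere 0 R))
    (hb : ∀ i, ∀ z ∈ Metric.sphere (0 : ℂ) R, ‖F i z‖ ≤ B i)
    (hs : ∀ z ∈ Metric.sphere (0 : ℂ) R, HasSum (fun i => F i z) (f z)) :
    HasSum (fun i => circRes R (F i)) (circRes R f) := by
  refine HasSum.mul_left _ ?_
  have hm : ∀ θ, circleMap 0 R θ ∈ Metric.sphere (0 : ℂ) R := circleMap_mem_sphere _ hR
  refine intervalIntegral.hasSum_integral_of_dominated_convergence (fun i _ => R * B i)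
    (fun i => ?_) (fun i => ?_) ?_ ?_ ?_
  · refine Continuous.aestronglyMeasurable ?_
    have h1 := (hc i).comp_continuous (continuous_circleMap 0 R) hm
    have h2 : Continuous fun θ => deriv (circleMap 0 R) θ := by
      simp only [deriv_circleMap]
      exact (continuous_circleMap 0 R).mul continuous_const
    exact h2.smul h1
  · refine MeasureTheory.ae_of_all _ fun θ _ => ?_
    rw [norm_smul, deriv_circleMap]
    have : ‖circleMap 0 R θ * Complex.I‖ = R := by simp [abs_of_nonneg hR]
    rw [this]
    exact mul_le_mul_of_nonneg_left (hb i _ (hm θ)) hR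
  · exact MeasureTheory.ae_of_all _ fun θ _ => hB.mul_left R
  · exact intervalIntegrable_const
  · exact MeasureTheory.ae_of_all _ fun θ _ => (hs _ (hm θ)).const_smul _

theorem circRes_congr {R : ℝ} (hR : 0 ≤ R) {f g : ℂ → ℂ}
    (h : ∀ z ∈ Metric.sphere (0 : ℂ) R, f z = g z) : circRes R f = circRes R g := by
  rw [circRes, circRes, circleIntegral.integral_congr hR h]

end Residue

/-! ### The series of the integral over the vanishing cycle -/

section VanishingSeries

/-- The integrand of the vanishing cycle, up to the factor `√2`. -/
def cycleIntegrand (h j : ℝ) (z : ℂ) : ℂ := (1 - z + h / z - (j : ℂ) ^ 2 / (4 * z ^ 2)) ^ (1 / 2 : ℂ)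

theorem vanishingPeriod_eq (h j : ℝ) :
    vanishingPeriod h j = 2 * circRes (1 / 2) (cycleIntegrand h j) := by
  have h2 : ((√2 : ℝ) : ℂ) * (√2 : ℝ) = 2 := by
    rw [← Complex.ofReal_mul, Real.mul_self_sqrt (by norm_num)]; norm_num
  have : ∮ z in C(0, 1 / 2), branch h j z / z = ∮ z in C(0, 1 / 2), √2 * cycleIntegrand h j z := by
    refine circleIntegral.integral_congr (by norm_num) fun z hz => ?_
    have hz0 : z ≠ 0 := by
      rintro rfl
      simp at hz
    simp only [branch, cycleIntegrand]
    field_simp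
  rw [vanishingPeriod, this, circleIntegral.integral_const_mul, circRes]
  linear_combination ((2 * π * Complex.I : ℂ)⁻¹ * ∮ z in C(0, 1 / 2), cycleIntegrand h j z) * h2

/-- The terms of the double series of the integral over the vanishing cycle, in `h` and `j² / 4`. -/
def slopeTerm (h g : ℝ) (k : ℕ) (y : ℕ × ℕ) : ℝ :=
  if (k : ℤ) - y.1 - 2 * y.2 = -1 then
    sqrtCoeff (y.1 + y.2 + k) * (y.1 + y.2 + k).choose (y.1 + y.2) * (y.1 + y.2).choose y.1 *
      (-h) ^ y.1 * g ^ y.2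
  else 0

/-- Binomial coefficients are bounded by powers of two. With `k = y.1 + 2 y.2 - 1` the exponents
total at most `3 y.1 + 4 y.2`, hence the factors `8` and `16`. -/
theorem abs_slopeTerm_le (h g : ℝ) (y : ℕ × ℕ) :
    |slopeTerm h g (y.1 + 2 * y.2 - 1) y| ≤ (8 * |h|) ^ y.1 * (16 * |g|) ^ y.2 := by
  rw [slopeTerm]
  split_ifs with hk
  · set n := y.1 + y.2 + (y.1 + 2 * y.2 - 1)
    have h1 : ((n.choose (y.1 + y.2) : ℕ) : ℝ) ≤ 2 ^ (2 * y.1 + 3 * y.2) := by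
      have h1 : n.choose (y.1 + y.2) ≤ 2 ^ n := Nat.choose_le_two_pow _ _
      have h2 : 2 ^ n ≤ 2 ^ (2 * y.1 + 3 * y.2) := Nat.pow_le_pow_right (by norm_num) (by omega)
      exact_mod_cast h1.trans h2
    have h2 : (((y.1 + y.2).choose y.1 : ℕ) : ℝ) ≤ 2 ^ (y.1 + y.2) := by
      exact_mod_cast Nat.choose_le_two_pow _ _
    rw [abs_mul, abs_mul, abs_mul, abs_mul, abs_pow, abs_pow, abs_neg, Nat.abs_cast, Nat.abs_cast]
    calc _ ≤ 1 * 2 ^ (2 * y.1 + 3 * y.2) * 2 ^ (y.1 + y.2) * |h| ^ y.1 * |g| ^ y.2 := by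
          gcongr
          exact abs_sqrtCoeff_le n
      _ = _ := by
          have e8 : (8 : ℝ) ^ y.1 = 2 ^ (3 * y.1) := by rw [pow_mul]; norm_num
          have e16 : (16 : ℝ) ^ y.2 = 2 ^ (4 * y.2) := by rw [pow_mul]; norm_num
          rw [mul_pow, mul_pow, e8, e16]
          ring
  · rw [abs_zero]
    positivity

/-- On `|z| = 1/2` the terms `-h / z + j² / (4 z²)` have norm at most `1/4`, so the binomial series
is dominated by powers of `1/4 + 1/2` and may be integrated termwise. Only `z⁻¹` has a residue,
which fixes `k = y.1 + 2 y.2 - 1`. At `y = (0, 0)` the subtraction truncates, but the integer test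
in `slopeTerm` fails and the term is `0`. -/
theorem hasSum_cycleIntegrand {h j : ℝ} (hh : |h| ≤ 1 / 16) (hj : |j| ≤ 1 / 4) :
    HasSum (fun y : ℕ × ℕ => ((slopeTerm h (j ^ 2 / 4) (y.1 + 2 * y.2 - 1) y : ℝ) : ℂ))
      (circRes (1 / 2) (cycleIntegrand h j)) := by
  have hj2 : j ^ 2 ≤ 1 / 16 := by
    rw [← sq_abs]; nlinarith [abs_nonneg j]
  set g : ℝ := j ^ 2 / 4 with hg
  set F : ℕ × ℕ → ℂ → ℂ := fun n z => (sqrtCoeff (n.1 + n.2) : ℂ) * (n.1 + n.2).choose n.1 *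
    (-h / z + g / z ^ 2) ^ n.1 * z ^ n.2 with hF
  have hsph : ∀ z ∈ Metric.sphere (0 : ℂ) (1 / 2), ‖z‖ = 1 / 2 := fun z hz => by simpa using hz
  have hne : ∀ z ∈ Metric.sphere (0 : ℂ) (1 / 2), z ≠ 0 := fun z hz h0 => by
    have := hsph z hz
    rw [h0, norm_zero] at this
    norm_num at this
  have hu : ∀ z ∈ Metric.sphere (0 : ℂ) (1 / 2), ‖-h / z + g / z ^ 2‖ ≤ 1 / 4 := fun z hz => by
    refine (norm_add_le _ _).trans ?_
    rw [norm_div, norm_div, norm_pow, hsph z hz, norm_neg, Complex.norm_real, Complex.norm_real,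
      Real.norm_eq_abs, Real.norm_eq_abs, hg, abs_of_nonneg (show 0 ≤ j ^ 2 / 4 by positivity)]
    norm_num
    linarith
  have hB : Summable fun n : ℕ × ℕ => ((n.1 + n.2).choose n.1 : ℝ) * (1 / 4) ^ n.1 * (1 / 2) ^ n.2 := by
    refine summable_prod_of_antidiagonal (fun n => by positivity) ?_
    have h1 : Summable fun n : ℕ => (3 / 4 : ℝ) ^ n :=
      summable_geometric_of_lt_one (by norm_num) (by norm_num)
    refine h1.congr fun n => ?_
    rw [show (3 / 4 : ℝ) = 1 / 4 + 1 / 2 by norm_num, (Commute.all _ _).add_pow']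
    refine Finset.sum_congr rfl fun y hy => ?_
    rw [Finset.HasAntidiagonal.mem_antidiagonal.1 hy, nsmul_eq_mul, mul_assoc]
  have hbF : ∀ n, ∀ z ∈ Metric.sphere (0 : ℂ) (1 / 2),
      ‖F n z‖ ≤ ((n.1 + n.2).choose n.1 : ℝ) * (1 / 4) ^ n.1 * (1 / 2) ^ n.2 := fun n z hz => by
    rw [hF]
    simp only
    rw [norm_mul, norm_mul, norm_mul, norm_pow, norm_pow, hsph z hz, Complex.norm_real,
      Complex.norm_natCast, Real.norm_eq_abs]
    calc _ ≤ 1 * ((n.1 + n.2).choose n.1 : ℝ) * (1 / 4) ^ n.1 * (1 / 2) ^ n.2 := by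
          gcongr
          · exact abs_sqrtCoeff_le _
          · exact hu z hz
      _ = _ := by rw [one_mul]
  have h1 := hasSum_circRes (R := 1 / 2) (by norm_num) (F := F) (f := cycleIntegrand h j) hB
    (fun n => by
      intro z hz
      have hz0 := hne z hz
      refine ContinuousAt.continuousWithinAt ?_
      rw [hF]
      fun_prop (disch := simp [hz0])) hbF
    (fun z hz => by
      refine hasSum_prod_of_antidiagonal (Summable.of_norm_bounded hB fun n => hbF n z hz) ?_
      have hz0 := hne z hz
      have hx : ‖(-h / z + g / z ^ 2) + z‖ < 1 := by
        refine (norm_add_le _ _).trans_lt ?_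
        rw [hsph z hz]
        linarith [hu z hz]
      have h2 := hasSum_sqrtCoeff hx
      have hz' : cycleIntegrand h j z = (1 - ((-h / z + g / z ^ 2) + z)) ^ (1 / 2 : ℂ) := by
        rw [cycleIntegrand, hg]
        congr 1
        push_cast
        field_simp
        ring
      rw [hz']
      refine h2.congr_fun fun n => ?_
      rw [(Commute.all _ _).add_pow', Finset.mul_sum]
      refine Finset.sum_congr rfl fun y hy => ?_
      rw [hF]
      simp only
      rw [Finset.HasAntidiagonal.mem_antidiagonal.1 hy, nsmul_eq_mul]
      ring)
  -- the residue of each term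
  have hterm : ∀ n : ℕ × ℕ, circRes (1 / 2) (F n)
      = ∑ y ∈ Finset.HasAntidiagonal.antidiagonal n.1, ((slopeTerm h g n.2 y : ℝ) : ℂ) := fun n => by
    have e : circRes (1 / 2) (F n) = circRes (1 / 2) (fun z =>
        ∑ y ∈ Finset.HasAntidiagonal.antidiagonal n.1,
          (((sqrtCoeff (y.1 + y.2 + n.2) * (y.1 + y.2 + n.2).choose (y.1 + y.2) *
            (y.1 + y.2).choose y.1 * (-h) ^ y.1 * g ^ y.2 : ℝ)) : ℂ)
            * z ^ ((n.2 : ℤ) - y.1 - 2 * y.2)) := by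
      refine circRes_congr (by norm_num) fun z hz => ?_
      have hz0 := hne z hz
      rw [hF]
      simp only
      rw [(Commute.all _ _).add_pow', Finset.mul_sum, Finset.sum_mul]
      refine Finset.sum_congr rfl fun y hy => ?_
      rw [Finset.HasAntidiagonal.mem_antidiagonal.1 hy, nsmul_eq_mul, zpow_sub₀ hz0, zpow_sub₀ hz0,
        zpow_natCast, zpow_natCast, zpow_mul, zpow_natCast, zpow_ofNat]
      push_cast
      rw [div_pow, div_pow]
      field_simp
    rw [e, circRes_sum_zpow _ _ _ (by norm_num)]
    refine Finset.sum_congr rfl fun y hy => ?_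
    rw [slopeTerm]
    split_ifs <;> simp
  simp only [hterm] at h1
  -- For fixed `y` at most one `k` gives a residue, so the sum over `k` collapses.
  have h3 := h1.prod_fiberwise (g := fun m => ∑ y ∈ Finset.HasAntidiagonal.antidiagonal m,
      ((slopeTerm h g (y.1 + 2 * y.2 - 1) y : ℝ) : ℂ)) fun m => by
    refine hasSum_sum fun y _ => ?_
    refine hasSum_single _ fun k hk => ?_
    rw [slopeTerm, if_neg]
    · simp
    · intro h'
      omega
  refine hasSum_prod_of_antidiagonal ?_ h3
  have hsum : Summable fun y : ℕ × ℕ => (8 * |h|) ^ y.1 * (16 * |g|) ^ y.2 := by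
    refine Summable.mul_of_nonneg (summable_geometric_of_lt_one (by positivity) (by linarith))
      (summable_geometric_of_lt_one (by positivity) ?_) (fun _ => by positivity)
      (fun _ => by positivity)
    rw [hg, abs_of_nonneg (by positivity)]
    linarith
  refine Summable.of_norm_bounded hsum fun y => ?_
  rw [Complex.norm_real, Real.norm_eq_abs]
  exact abs_slopeTerm_le h g y

/-- This links the analytic and the formal side: the residue of the cycle integrand and the constant
term of the reduced Hamiltonian are the same quotient of factorials. The rescaling `j = √2 l` turns
`j² / 4` into `l² / 2`. -/
theorem slopeTerm_eq_invCoeff (h l : ℝ) (y : ℕ × ℕ) :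
    √2 * slopeTerm h (l ^ 2 / 2) (y.1 + 2 * y.2 - 1) y
      = invCoeff y.1 (2 * y.2) * h ^ y.1 * l ^ (2 * y.2) := by
  obtain ⟨a, b⟩ := y
  simp only
  rw [slopeTerm, invCoeff, if_pos (even_two_mul b)]
  simp only
  rcases Nat.eq_zero_or_pos (a + 2 * b) with h0 | h0
  · obtain rfl : a = 0 := by omega
    obtain rfl : b = 0 := by omega
    simp
  · obtain ⟨k, hk⟩ : ∃ k, a + 2 * b = k + 1 := ⟨a + 2 * b - 1, by omega⟩
    obtain ⟨s, hs⟩ : ∃ s, a + k = s + 1 := ⟨a + k - 1, by omega⟩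
    have hsk : 2 * k = s + 2 * b := by omega
    rw [hk, Nat.add_sub_cancel, if_pos (by omega), show 2 * b / 2 = b by omega,
      show a + b + k = (s + b) + 1 by omega, sqrtCoeff_succ_eq, hs, hsk,
      show 4 * k - 2 * b = s + 2 * b + s by omega]
    have c1 : ((s + b + 1).choose (a + b) : ℝ) = (s + b + 1).factorial
        / ((a + b).factorial * k.factorial) := by
      rw [show s + b + 1 = (a + b) + k by omega, Nat.cast_add_choose]
    have c2 : ((a + b).choose a : ℝ) = (a + b).factorial / (a.factorial * b.factorial) :=
      Nat.cast_add_choose ℝ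
    have c3 : ((s + 1).choose a : ℝ) = (s + 1).factorial / (a.factorial * k.factorial) := by
      rw [← hs, Nat.cast_add_choose]
    have c4 : ((s + 2 * b).choose b : ℝ) = (s + 2 * b).factorial
        / (b.factorial * (s + b).factorial) := by
      rw [show s + 2 * b = b + (s + b) by ring, Nat.cast_add_choose]
    have c5 : ((s + 2 * b + s).choose (s + 2 * b) : ℝ) = (2 * (s + b)).factorial
        / ((s + 2 * b).factorial * s.factorial) := by
      rw [Nat.cast_add_choose, show s + 2 * b + s = 2 * (s + b) by ring]
    have hpow : (1 / 2 : ℝ) ^ (a + b) * (1 / 8) ^ k * 2 ^ (2 * (s + b) + 1) = (1 / 2) ^ b := by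
      rw [show (1 / 8 : ℝ) = (1 / 2) ^ 3 by norm_num, ← pow_mul, ← pow_add,
        show a + b + 3 * k = b + (2 * (s + b) + 1) by omega, pow_add (1 / 2 : ℝ) b, mul_assoc,
        ← mul_pow]
      norm_num
    have hsign : (-1 : ℝ) ^ k = -(-1) ^ a := by
      have : (-1 : ℝ) ^ (a + 2 * b) = (-1) ^ (k + 1) := by rw [hk]
      rw [pow_add, pow_mul, neg_one_sq, one_pow, mul_one, pow_succ] at this
      linarith
    have hl : (l ^ 2 / 2) ^ b = l ^ (2 * b) * (1 / 2) ^ b := by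
      rw [div_eq_mul_one_div, mul_pow, pow_mul]
    rw [c1, c2, c3, c4, c5, hsign, Nat.factorial_succ s, neg_pow h, hl, ← hpow]
    push_cast
    field_simp

/-- The integral over the vanishing cycle as a real function. -/
def vanishingAction (h j : ℝ) : ℝ := (vanishingPeriod h j).re

/-- The residue series has real terms. -/
theorem vanishingPeriod_eq_ofReal {h j : ℝ} (hh : |h| ≤ 1 / 16) (hj : |j| ≤ 1 / 4) :
    vanishingPeriod h j = vanishingAction h j := by
  have h1 := hasSum_cycleIntegrand hh hj
  have h2 := (Complex.hasSum_re h1)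
  simp only [Complex.ofReal_re] at h2
  have h3 := h1.unique ((Complex.hasSum_ofReal (f := fun y : ℕ × ℕ =>
    slopeTerm h (j ^ 2 / 4) (y.1 + 2 * y.2 - 1) y)).2 h2)
  rw [vanishingAction, vanishingPeriod_eq, h3]
  simp

theorem hasSum_vanishingAction {h l : ℝ} (hh : |h| ≤ 1 / 16) (hl : |l| ≤ 1 / 16) :
    HasSum (fun n : ℕ × ℕ => invCoeff n.1 n.2 * h ^ n.1 * l ^ n.2)
      (vanishingAction h (√2 * l) / √2) := by
  have h2 : √2 * √2 = 2 := Real.mul_self_sqrt (by norm_num)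
  have hs2 : √2 ≤ 2 := by
    rw [Real.sqrt_le_left (by norm_num)]; norm_num
  have hj : |√2 * l| ≤ 1 / 4 := by
    rw [abs_mul, abs_of_nonneg (Real.sqrt_nonneg 2)]
    nlinarith [abs_nonneg l]
  have h1 := Complex.hasSum_re (hasSum_cycleIntegrand hh hj)
  simp only [Complex.ofReal_re] at h1
  have hinj : Function.Injective fun y : ℕ × ℕ => (y.1, 2 * y.2) := fun x y hxy => by
    simp only [Prod.mk.injEq] at hxy
    exact Prod.ext hxy.1 (by omega)
  rw [← hinj.hasSum_iff]
  · convert! h1.mul_left √2 using 1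
    · funext y
      simp only [Function.comp_apply]
      rw [← slopeTerm_eq_invCoeff, show (√2 * l) ^ 2 / 4 = l ^ 2 / 2 by
        rw [mul_pow, pow_two √2, h2]; ring]
    · rw [vanishingAction, vanishingPeriod_eq]
      have : (0 : ℝ) < √2 := by positivity
      field_simp
      simp only [Complex.mul_re, Complex.re_ofNat, Complex.im_ofNat]
      rw [pow_two, h2]
      ring
  · rintro ⟨a, c⟩ hc
    have : ¬ Even c := by
      rintro ⟨b, rfl⟩
      exact hc ⟨(a, b), by simp [two_mul]⟩
    simp [invCoeff, this]

theorem hasDoubleSeries_vanishingAction :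
    HasDoubleSeries (fun h l => vanishingAction h (√2 * l) / √2) invCoeff (1 / 16) where
  pos := by norm_num
  summable := by
    have h1 := (hasSum_vanishingAction (h := 1 / 16) (l := 1 / 16) (by norm_num [abs_of_pos])
      (by norm_num [abs_of_pos])).summable.abs
    refine h1.congr fun n => ?_
    rw [mul_assoc, ← pow_add, abs_mul, abs_of_pos (a := (1 / 16 : ℝ) ^ (n.1 + n.2)) (by positivity)]
  hasSum x y hx hy := hasSum_vanishingAction hx.le hy.le

theorem vanishingAction_isBigO :
    (fun x : ℝ × ℝ => vanishingAction x.1 x.2 -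
          (x.1 - (3 * x.1 ^ 2 + x.2 ^ 2) / 8 + x.1 * (35 * x.1 ^ 2 + 15 * x.2 ^ 2) / 64
            - (1155 * x.1 ^ 4 + 630 * x.1 ^ 2 * x.2 ^ 2 + 35 * x.2 ^ 4) / 1024))
        =O[𝓝 (0, 0)] (fun x : ℝ × ℝ => √(x.1 ^ 2 + x.2 ^ 2) ^ 5) := by
  have h2 : √2 * √2 = 2 := Real.mul_self_sqrt (by norm_num)
  have hp : (0 : ℝ) < √2 := by positivity
  have ht : Tendsto (fun x : ℝ × ℝ => (x.1, x.2 / √2)) (𝓝 (0, 0)) (𝓝 (0, 0)) :=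
    Continuous.tendsto' (by fun_prop) _ _ (by simp)
  have h1 := ((hasDoubleSeries_vanishingAction.isBigO 5).comp_tendsto ht).const_mul_left √2
  refine (h1.congr_left fun x => ?_).trans ?_
  · simp only [Function.comp_apply]
    rw [mul_div_cancel₀ _ hp.ne', mul_sub, mul_div_cancel₀ _ hp.ne']
    congr 1
    simp only [homPart, Finset.sum_range_succ, Finset.range_zero, Finset.sum_empty,
      Finset.Nat.antidiagonal_succ]
    simp [invCoeff]
    norm_num [Nat.choose, show ¬ Odd 4 by decide, show ¬ Even 1 by decide, show ¬ Even 3 by decide,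
      show Even 4 by decide]
    have e2 : (x.2 / √2) ^ 2 = x.2 ^ 2 / 2 := by rw [div_pow, pow_two √2, h2]
    have e4 : (x.2 / √2) ^ 4 = x.2 ^ 4 / 4 := by
      rw [show 4 = 2 * 2 by norm_num, pow_mul, e2]; ring
    rw [e2, e4]
    linear_combination ((x.1 - (3 * x.1 ^ 2 + x.2 ^ 2) / 8 + x.1 * (35 * x.1 ^ 2 + 15 * x.2 ^ 2) / 64
      - (1155 * x.1 ^ 4 + 630 * x.1 ^ 2 * x.2 ^ 2 + 35 * x.2 ^ 4) / 1024) / 2) * h2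
  · refine IsBigO.pow ?_ 5
    refine IsBigO.of_bound 1 (Eventually.of_forall fun x => ?_)
    simp only [norm_norm, one_mul]
    rw [Real.norm_of_nonneg (Real.sqrt_nonneg _), Prod.norm_def]
    refine max_le ?_ ?_
    · exact Real.abs_le_sqrt (by nlinarith [sq_nonneg x.2])
    · refine Real.abs_le_sqrt ?_
      rw [div_pow, pow_two √2, h2]
      nlinarith [sq_nonneg x.1, sq_nonneg x.2]

end VanishingSeries

/-! ### Solving the moment recursion among bounded sequences -/

section Resolvent

variable {E : Type*} [NormedAddCommGroup E] [NormedSpace ℝ E] [CompleteSpace E]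

theorem isUnit_one_sub_pencil {U V : E →L[ℝ] E} (hU : ‖U‖ ≤ 1) (hV : ‖V‖ ≤ 1) {b c : ℝ}
    (h : |b| + c ^ 2 < 1) : IsUnit (1 - (b • U + c ^ 2 • V)) := by
  refine (Units.oneSub (b • U + c ^ 2 • V) ?_).isUnit
  refine (norm_add_le _ _).trans_lt ?_
  rw [norm_smul, norm_smul, Real.norm_eq_abs, Real.norm_eq_abs, abs_of_nonneg (sq_nonneg c)]
  nlinarith [abs_nonneg b, sq_nonneg c, norm_nonneg U, norm_nonneg V]

theorem analyticAt_inverse_pencil (U V : E →L[ℝ] E) (φ : E →L[ℝ] ℝ) (v : E) :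
    AnalyticAt ℝ (fun x : ℝ × ℝ => φ (Ring.inverse (1 - (x.1 • U + x.2 ^ 2 • V)) v)) (0, 0) := by
  have h1 : AnalyticAt ℝ (fun x : ℝ × ℝ => 1 - (x.1 • U + x.2 ^ 2 • V)) (0, 0) :=
    analyticAt_const.sub ((analyticAt_fst.smul analyticAt_const).add
      ((analyticAt_snd.pow 2).smul analyticAt_const))
  have h2 : (1 : E →L[ℝ] E) - ((0 : ℝ) • U + (0 : ℝ) ^ 2 • V) = ((1 : (E →L[ℝ] E)ˣ) : E →L[ℝ] E) := by
    simp
  have h3 := analyticAt_inverse (𝕜 := ℝ) (A := E →L[ℝ] E) 1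
  rw [← h2] at h3
  have h4 := AnalyticAt.fun_comp (f := fun x : ℝ × ℝ => 1 - (x.1 • U + x.2 ^ 2 • V)) (x := (0, 0))
    h3 h1
  exact AnalyticAt.fun_comp (f := fun x : ℝ × ℝ => Ring.inverse (1 - (x.1 • U + x.2 ^ 2 • V)))
    (x := (0, 0)) ((φ.comp (ContinuousLinearMap.apply ℝ E v)).analyticAt _) h4

end Resolvent

/-! ### The recursion as an operator on bounded sequences, and its resolvent coefficients. -/

section MomentRecursion

open BoundedContinuousFunction

/-- The operator `(T q) n = w n * q (σ n)` on bounded sequences. -/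
def weightedShift (w : ℕ → ℝ) (hw : ∀ n, |w n| ≤ 1) (σ : ℕ → ℕ) : (ℕ →ᵇ ℝ) →L[ℝ] (ℕ →ᵇ ℝ) :=
  LinearMap.mkContinuous
    { toFun := fun q => BoundedContinuousFunction.ofNormedAddCommGroupDiscrete
        (fun n => w n * q (σ n)) ‖q‖ fun n => by
          rw [norm_mul]
          calc _ ≤ 1 * ‖q‖ := by
                gcongr
                · exact hw n
                · exact q.norm_coe_le_norm _
            _ = _ := one_mul _
      map_add' := fun p q => by ext n; simp [mul_add]
      map_smul' := fun a q => by ext n; simp [mul_left_comm] } 1 fun q => by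
    rw [one_mul]
    refine BoundedContinuousFunction.norm_ofNormedAddCommGroup_le _ (norm_nonneg _) fun n => ?_
    rw [norm_mul]
    calc _ ≤ 1 * ‖q‖ := by
          gcongr
          · exact hw n
          · exact q.norm_coe_le_norm _
      _ = _ := one_mul _

@[simp]
theorem weightedShift_apply (w : ℕ → ℝ) (hw : ∀ n, |w n| ≤ 1) (σ : ℕ → ℕ) (q : ℕ →ᵇ ℝ) (n : ℕ) :
    weightedShift w hw σ q n = w n * q (σ n) := rfl

theorem norm_weightedShift_le (w : ℕ → ℝ) (hw : ∀ n, |w n| ≤ 1) (σ : ℕ → ℕ) :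
    ‖weightedShift w hw σ‖ ≤ 1 :=
  LinearMap.mkContinuous_norm_le _ zero_le_one _

/-- The weights of the linear term of the moment recursion. -/
def shiftWeight₁ : ℕ → ℝ
  | 0 => 0
  | 1 => 0
  | m + 2 => -((m + 3 / 2) / (m + 3))

/-- The weights of the quadratic term of the moment recursion. -/
def shiftWeight₂ : ℕ → ℝ
  | 0 => 0
  | 1 => 0
  | m + 2 => m / (4 * (m + 3))

theorem abs_shiftWeight₁_le : ∀ n, |shiftWeight₁ n| ≤ 1
  | 0 => by simp [shiftWeight₁]
  | 1 => by simp [shiftWeight₁]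
  | m + 2 => by
    rw [shiftWeight₁, abs_neg, abs_of_nonneg (by positivity), div_le_one (by positivity)]
    linarith

theorem abs_shiftWeight₂_le : ∀ n, |shiftWeight₂ n| ≤ 1
  | 0 => by simp [shiftWeight₂]
  | 1 => by simp [shiftWeight₂]
  | m + 2 => by
    rw [shiftWeight₂, abs_of_nonneg (by positivity), div_le_one (by positivity)]
    linarith [(Nat.cast_nonneg m : (0 : ℝ) ≤ m)]

/-- The linear term of the moment recursion. -/
def shift₁ : (ℕ →ᵇ ℝ) →L[ℝ] (ℕ →ᵇ ℝ) := weightedShift shiftWeight₁ abs_shiftWeight₁_le (· - 1)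

/-- The quadratic term of the moment recursion. -/
def shift₂ : (ℕ →ᵇ ℝ) →L[ℝ] (ℕ →ᵇ ℝ) := weightedShift shiftWeight₂ abs_shiftWeight₂_le (· - 2)

/-- The operator of the moment recursion. -/
def momentOp (b c : ℝ) : (ℕ →ᵇ ℝ) →L[ℝ] (ℕ →ᵇ ℝ) := 1 - (b • shift₁ + c ^ 2 • shift₂)

/-- The bounded sequence of a bounded function. -/
def bseq (f : ℕ → ℝ) (C : ℝ) (h : ∀ n, ‖f n‖ ≤ C) : ℕ →ᵇ ℝ :=
  BoundedContinuousFunction.ofNormedAddCommGroupDiscrete f C h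

@[simp]
theorem bseq_apply (f : ℕ → ℝ) (C : ℝ) (h : ∀ n, ‖f n‖ ≤ C) (n : ℕ) : bseq f C h n = f n := rfl

/-- The inhomogeneous term of the moment recursion with initial values `x`, `y`. -/
def momentSource (x y s : ℝ) : ℕ →ᵇ ℝ :=
  bseq (fun n => match n with
    | 0 => x
    | 1 => y
    | m + 2 => s / (m + 3)) (|x| + |y| + |s|) fun n => by
    match n with
    | 0 => simp only [Real.norm_eq_abs]; linarith [abs_nonneg y, abs_nonneg s]
    | 1 => simp only [Real.norm_eq_abs]; linarith [abs_nonneg x, abs_nonneg s]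
    | m + 2 =>
      simp only [Real.norm_eq_abs]
      rw [abs_div, abs_of_pos (by positivity : (0 : ℝ) < m + 3)]
      have : |s| / ((m : ℝ) + 3) ≤ |s| := div_le_self (abs_nonneg s) (by
        linarith [(Nat.cast_nonneg m : (0 : ℝ) ≤ m)])
      linarith [abs_nonneg x, abs_nonneg y]

theorem momentSource_eq (x y s : ℝ) :
    momentSource x y s = x • momentSource 1 0 0 + y • momentSource 0 1 0 + s • momentSource 0 0 1 := by
  ext n
  match n with
  | 0 => simp [momentSource]
  | 1 => simp [momentSource]
  | m + 2 => simp [momentSource, div_eq_mul_inv]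

/-- Dividing by `m + 3` solves the recursion for `q (m + 2)`. This normalisation makes all shift
weights at most `1` in absolute value. -/
theorem momentOp_eq_source {b c s : ℝ} {q : ℕ →ᵇ ℝ}
    (hq : ∀ m : ℕ, (m + 3) * q (m + 2) + (m + 3 / 2) * b * q (m + 1) - m * (c ^ 2 / 4) * q m = s) :
    momentOp b c q = momentSource (q 0) (q 1) s := by
  ext n
  match n with
  | 0 => simp [momentOp, momentSource, shift₁, shift₂, shiftWeight₁, shiftWeight₂]
  | 1 => simp [momentOp, momentSource, shift₁, shift₂, shiftWeight₁, shiftWeight₂]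
  | m + 2 =>
    have := hq m
    simp [momentOp, momentSource, shift₁, shift₂, shiftWeight₁, shiftWeight₂]
    field_simp
    linear_combination 8 * this

/-- The pairing of a bounded sequence with the Taylor coefficients of `√(1 - y)`. -/
def sqrtPairing : (ℕ →ᵇ ℝ) →L[ℝ] ℝ :=
  LinearMap.mkContinuous
    { toFun := fun q => ∑' k, sqrtCoeff k * q k
      map_add' := fun p q => by
        have h : ∀ q : ℕ →ᵇ ℝ, Summable fun k => sqrtCoeff k * q k := fun q =>
          Summable.of_norm_bounded (summable_abs_sqrtCoeff.mul_right ‖q‖) fun k => by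
            rw [norm_mul]; gcongr
            · exact le_rfl
            · exact q.norm_coe_le_norm _
        rw [← (h p).tsum_add (h q)]
        simp [mul_add]
      map_smul' := fun a q => by
        rw [RingHom.id_apply, smul_eq_mul, ← tsum_mul_left]
        simp [mul_left_comm] } (∑' k, |sqrtCoeff k|) fun q => by
    rw [← tsum_mul_right]
    refine tsum_of_norm_bounded (summable_abs_sqrtCoeff.mul_right ‖q‖).hasSum fun k => ?_
    rw [norm_mul]
    gcongr
    · exact le_rfl
    · exact q.norm_coe_le_norm _

theorem sqrtPairing_apply (q : ℕ →ᵇ ℝ) : sqrtPairing q = ∑' k, sqrtCoeff k * q k := rfl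

theorem isUnit_momentOp {b c : ℝ} (h : |b| + c ^ 2 < 1) : IsUnit (momentOp b c) := by
  exact isUnit_one_sub_pencil (norm_weightedShift_le _ _ _) (norm_weightedShift_le _ _ _) h

/-- The resolvent coefficient of the initial value. -/
def momentCoeff₁ (b c : ℝ) : ℝ := sqrtPairing (Ring.inverse (momentOp b c) (momentSource 0 1 0))

/-- The resolvent coefficient of the inhomogeneity. -/
def momentCoeff₂ (b c : ℝ) : ℝ := sqrtPairing (Ring.inverse (momentOp b c) (momentSource 0 0 1))

theorem inverse_momentOp_apply {b c : ℝ} (h : |b| + c ^ 2 < 1) {q v : ℕ →ᵇ ℝ}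
    (hq : momentOp b c q = v) : Ring.inverse (momentOp b c) v = q := by
  rw [← hq, ← mul_apply_eq_comp, Ring.inverse_mul_cancel _ (isUnit_momentOp h)]
  rfl

theorem sqrtPairing_delta : sqrtPairing (momentSource 1 0 0) = 1 := by
  rw [sqrtPairing_apply, tsum_eq_single 0]
  · simp [sqrtCoeff, momentSource]
  · intro k hk
    match k, hk with
    | 1, _ => simp [momentSource]
    | k + 2, _ => simp [momentSource]

/-- The factor `m` removes `q 0` from the recursion at `m = 0`. Hence the sequence `1, 0, 0, …`
solves the homogeneous recursion, and the initial value `x` contributes exactly `x`, without an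
analytic factor. -/
theorem sqrtPairing_inverse_source {b c : ℝ} (h : |b| + c ^ 2 < 1) (x y s : ℝ) :
    sqrtPairing (Ring.inverse (momentOp b c) (momentSource x y s))
      = x + y * momentCoeff₁ b c + s * momentCoeff₂ b c := by
  have h0 : Ring.inverse (momentOp b c) (momentSource 1 0 0) = momentSource 1 0 0 := by
    refine inverse_momentOp_apply h ?_
    refine momentOp_eq_source fun m => ?_
    match m with
    | 0 => simp [momentSource]
    | 1 => simp [momentSource]
    | m + 2 => simp [momentSource]
  rw [momentSource_eq, momentCoeff₁, momentCoeff₂]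
  simp only [map_add, map_smul, h0, sqrtPairing_delta, smul_eq_mul, mul_one]

/-- The pairing of a solution of the moment recursion. -/
theorem sqrtPairing_eq {b c s : ℝ} (h : |b| + c ^ 2 < 1) {q : ℕ →ᵇ ℝ}
    (hq : ∀ m : ℕ, (m + 3) * q (m + 2) + (m + 3 / 2) * b * q (m + 1) - m * (c ^ 2 / 4) * q m = s) :
    sqrtPairing q = q 0 + q 1 * momentCoeff₁ b c + s * momentCoeff₂ b c := by
  rw [← sqrtPairing_inverse_source h, inverse_momentOp_apply h (momentOp_eq_source hq)]

theorem analyticAt_momentCoeff₁ :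
    AnalyticAt ℝ (fun x : ℝ × ℝ => momentCoeff₁ x.1 x.2) (0, 0) :=
  analyticAt_inverse_pencil shift₁ shift₂ sqrtPairing _

theorem analyticAt_momentCoeff₂ :
    AnalyticAt ℝ (fun x : ℝ × ℝ => momentCoeff₂ x.1 x.2) (0, 0) :=
  analyticAt_inverse_pencil shift₁ shift₂ sqrtPairing _

end MomentRecursion

/-! ### The vanishing action in normalised parameters -/

section NormalisedCycle

theorem mul_cpow_half {x y : ℂ} (hx : 0 < x.re) (hy : 0 < y.re) :
    (x * y) ^ (1 / 2 : ℂ) = x ^ (1 / 2 : ℂ) * y ^ (1 / 2 : ℂ) := by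
  have hx0 : x ≠ 0 := by rintro rfl; simp at hx
  have hy0 : y ≠ 0 := by rintro rfl; simp at hy
  have h1 := abs_lt.1 (Complex.abs_arg_lt_pi_div_two_iff.2 (Or.inl hx))
  have h2 := abs_lt.1 (Complex.abs_arg_lt_pi_div_two_iff.2 (Or.inl hy))
  rw [Complex.cpow_def_of_ne_zero (mul_ne_zero hx0 hy0), Complex.cpow_def_of_ne_zero hx0,
    Complex.cpow_def_of_ne_zero hy0, ← Complex.exp_add,
    Complex.log_mul hx0 hy0 ⟨by linarith, by linarith⟩, add_mul]

theorem ofReal_cpow_half {a : ℝ} (ha : 0 ≤ a) : (a : ℂ) ^ (1 / 2 : ℂ) = (√a : ℝ) := by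
  rw [Real.sqrt_eq_rpow, Complex.ofReal_cpow ha]
  norm_num

theorem circRes_add {R : ℝ} (hR : 0 ≤ R) {f g : ℂ → ℂ} (hf : ContinuousOn f (Metric.sphere 0 R))
    (hg : ContinuousOn g (Metric.sphere 0 R)) :
    circRes R (fun z => f z + g z) = circRes R f + circRes R g := by
  rw [circRes, circleIntegral.integral_add (hf.circleIntegrable hR) (hg.circleIntegrable hR),
    mul_add, circRes, circRes]

theorem circRes_const_mul (R : ℝ) (a : ℂ) (f : ℂ → ℂ) :
    circRes R (fun z => a * f z) = a * circRes R f := by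
  rw [circRes, circleIntegral.integral_const_mul, circRes, mul_left_comm]

theorem circRes_mul_left (a R : ℝ) (f : ℂ → ℂ) :
    circRes (a * R) f = a * circRes R (fun y => f (a * y)) := by
  have h : (∮ z in C(0, a * R), f z) = a * ∮ y in C(0, R), f (a * y) := by
    simp only [circleIntegral]
    rw [← intervalIntegral.integral_const_mul]
    refine intervalIntegral.integral_congr fun θ _ => ?_
    simp only [deriv_circleMap, circleMap, smul_eq_mul, zero_add]
    push_cast
    rw [mul_assoc (a : ℂ) R]
    ring
  rw [circRes, circRes, h, mul_left_comm]

theorem norm_circRes_le {R C : ℝ} (hR : 0 ≤ R) {f : ℂ → ℂ}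
    (h : ∀ z ∈ Metric.sphere (0 : ℂ) R, ‖f z‖ ≤ C) : ‖circRes R f‖ ≤ R * C := by
  have := circleIntegral.norm_two_pi_i_inv_smul_integral_le_of_norm_le_const hR h
  simpa [circRes] using this

/-- `√(1 + b / y - c² / (4 y²))`. -/
def cycleRoot (b c : ℝ) (y : ℂ) : ℂ := (1 - (-b / y + c ^ 2 / 4 / y ^ 2)) ^ (1 / 2 : ℂ)

variable {b c r : ℝ}

/-- The parameters and circles used below. -/
structure CycleBounds (b c r : ℝ) : Prop where
  hb : |b| ≤ 1 / 32
  hc : |c| ≤ 1 / 8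
  hr : 1 / 4 ≤ r
  hr' : r ≤ 3 / 4

namespace CycleBounds

theorem r_pos (H : CycleBounds b c r) : 0 < r := by linarith [H.hr]

theorem ne_zero (H : CycleBounds b c r) {y : ℂ} (hy : y ∈ Metric.sphere (0 : ℂ) r) : y ≠ 0 := by
  rintro rfl
  have : ‖(0 : ℂ)‖ = r := by simpa using hy
  have := H.r_pos
  simp_all

theorem norm_le (H : CycleBounds b c r) {y : ℂ} (hy : y ∈ Metric.sphere (0 : ℂ) r) :
    ‖-b / y + c ^ 2 / 4 / y ^ 2‖ ≤ 1 / 4 := by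
  have hy' : ‖y‖ = r := by simpa using hy
  have hr := H.hr
  have hc2 : c ^ 2 ≤ 1 / 64 := by
    rw [← sq_abs]; nlinarith [abs_nonneg c, H.hc]
  refine (norm_add_le _ _).trans ?_
  have e1 : ‖(-b / y : ℂ)‖ = |b| / r := by
    rw [norm_div, norm_neg, hy', Complex.norm_real, Real.norm_eq_abs]
  have e2 : ‖((c : ℂ) ^ 2 / 4 / y ^ 2)‖ = c ^ 2 / 4 / r ^ 2 := by
    rw [norm_div, norm_div, norm_pow, norm_pow, hy', Complex.norm_real, Real.norm_eq_abs, sq_abs]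
    norm_num
  rw [e1, e2]
  have h1 : |b| / r ≤ (1 / 32) / (1 / 4) := by gcongr; exact H.hb
  have h2 : c ^ 2 / 4 / r ^ 2 ≤ (1 / 64) / 4 / (1 / 4) ^ 2 := by gcongr
  norm_num at h1 h2
  linarith

theorem re_pos (H : CycleBounds b c r) {y : ℂ} (hy : y ∈ Metric.sphere (0 : ℂ) r) :
    0 < (1 - (-b / y + c ^ 2 / 4 / y ^ 2)).re := by
  have h1 := (Complex.abs_re_le_norm (-b / y + c ^ 2 / 4 / y ^ 2)).trans (H.norm_le hy)
  rw [Complex.sub_re, Complex.one_re]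
  linarith [(abs_le.1 h1).2]

theorem continuousOn (H : CycleBounds b c r) :
    ContinuousOn (cycleRoot b c) (Metric.sphere 0 r) := by
  intro y hy
  have hy0 := H.ne_zero hy
  refine ContinuousAt.continuousWithinAt ?_
  refine ContinuousAt.cpow ?_ continuousAt_const (Or.inl (H.re_pos hy))
  fun_prop (disch := simp [hy0])

theorem norm_cycleRoot_le (H : CycleBounds b c r) {y : ℂ} (hy : y ∈ Metric.sphere (0 : ℂ) r) :
    ‖cycleRoot b c y‖ ≤ 2 := by
  have hsq : cycleRoot b c y ^ 2 = 1 - (-b / y + c ^ 2 / 4 / y ^ 2) := by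
    rw [cycleRoot, ← Complex.cpow_nat_mul]; norm_num
  have h1 : ‖cycleRoot b c y‖ ^ 2 ≤ 2 := by
    rw [← norm_pow, hsq]
    refine (norm_sub_le _ _).trans ?_
    rw [norm_one]
    linarith [H.norm_le hy]
  nlinarith [norm_nonneg (cycleRoot b c y)]

end CycleBounds

/-- The moments of the normalised cycle. -/
def cycleMoment (b c r : ℝ) (k : ℕ) : ℂ := circRes r fun y => y ^ k * cycleRoot b c y

theorem CycleBounds.hasSum_cycleMoment (H : CycleBounds b c r) (k : ℕ) :
    HasSum (fun n : ℕ => ∑ y ∈ Finset.HasAntidiagonal.antidiagonal n,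
      if (k : ℤ) - y.1 - 2 * y.2 = -1 then
        (sqrtCoeff n : ℂ) * (n.choose y.1) * (-b : ℂ) ^ y.1 * ((c : ℂ) ^ 2 / 4) ^ y.2 else 0)
      (cycleMoment b c r k) := by
  have hr := H.r_pos
  have h1 := hasSum_circRes (R := r) hr.le (B := fun n => r ^ k * (1 / 4) ^ n)
    (F := fun n y => y ^ k * ((sqrtCoeff n : ℂ) * (-b / y + c ^ 2 / 4 / y ^ 2) ^ n))
    (f := fun y => y ^ k * cycleRoot b c y)
    ((summable_geometric_of_lt_one (by norm_num) (by norm_num)).mul_left _)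
    (fun n y hy => by
      have hy0 := H.ne_zero hy
      refine ContinuousAt.continuousWithinAt ?_
      fun_prop (disch := simp [hy0]))
    (fun n y hy => by
      have hy' : ‖y‖ = r := by simpa using hy
      rw [norm_mul, norm_mul, norm_pow, norm_pow, hy', Complex.norm_real, Real.norm_eq_abs]
      gcongr
      calc _ ≤ 1 * (1 / 4 : ℝ) ^ n := by
            gcongr
            · exact abs_sqrtCoeff_le n
            · exact H.norm_le hy
        _ = _ := one_mul _)
    (fun y hy => (hasSum_sqrtCoeff (lt_of_le_of_lt (H.norm_le hy) (by norm_num))).mul_left _)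
  refine h1.congr_fun fun n => ?_
  rw [← circRes_sum_zpow (R := r) _ (fun y : ℕ × ℕ => (sqrtCoeff n : ℂ) * (n.choose y.1) *
    (-b : ℂ) ^ y.1 * ((c : ℂ) ^ 2 / 4) ^ y.2) (fun y => (k : ℤ) - y.1 - 2 * y.2) hr.ne']
  refine circRes_congr hr.le fun z hz => ?_
  have hz0 := H.ne_zero hz
  rw [(Commute.all _ _).add_pow', Finset.mul_sum, Finset.mul_sum]
  refine Finset.sum_congr rfl fun y hy => ?_
  rw [nsmul_eq_mul, zpow_sub₀ hz0, zpow_sub₀ hz0, zpow_natCast, zpow_natCast, zpow_mul,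
    zpow_natCast, zpow_ofNat, div_pow _ z, div_pow _ (z ^ 2)]
  field_simp

theorem CycleBounds.cycleMoment_zero (H : CycleBounds b c r) : cycleMoment b c r 0 = b / 2 := by
  refine (H.hasSum_cycleMoment 0).unique ?_
  convert hasSum_single 1 ?_ using 1
  · simp [Finset.Nat.antidiagonal_succ, sqrtCoeff]
    ring
  · intro n hn
    refine Finset.sum_eq_zero fun y hy => if_neg ?_
    have := Finset.HasAntidiagonal.mem_antidiagonal.1 hy
    push_cast
    omega

theorem CycleBounds.cycleMoment_one (H : CycleBounds b c r) :
    cycleMoment b c r 1 = -(b ^ 2 + c ^ 2) / 8 := by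
  refine (H.hasSum_cycleMoment 1).unique ?_
  convert hasSum_sum_of_ne_finset_zero (s := {1, 2}) ?_ using 1
  · rw [Finset.sum_pair (by norm_num)]
    simp [Finset.Nat.antidiagonal_succ, sqrtCoeff]
    ring
  · intro n hn
    refine Finset.sum_eq_zero fun y hy => if_neg ?_
    have := Finset.HasAntidiagonal.mem_antidiagonal.1 hy
    have h1 : n ≠ 1 := fun h => hn (by simp [h])
    have h2 : n ≠ 2 := fun h => hn (by simp [h])
    push_cast
    omega
  · infer_instance

/-- With `S = 1 + b / y - c² / (4 y²)`, the combination of integrands is the derivative of `y^(m+3)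
S^(3/2)`, whose integral over a closed circle is `0`. -/
theorem CycleBounds.cycleMoment_rec (H : CycleBounds b c r) (m : ℕ) :
    (m + 3) * cycleMoment b c r (m + 2) + (m + 3 / 2) * b * cycleMoment b c r (m + 1)
      - m * (c ^ 2 / 4) * cycleMoment b c r m = 0 := by
  have hr := H.r_pos
  have hcont : ∀ (a : ℂ) (k : ℕ), ContinuousOn (fun y => a * (y ^ k * cycleRoot b c y))
      (Metric.sphere 0 r) := fun a k =>
    continuousOn_const.mul (((continuous_pow k).continuousOn).mul H.continuousOn)
  have h0 : circRes r (fun y => ((m + 3 : ℂ) * (y ^ (m + 2) * cycleRoot b c y)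
      + ((m + 3 / 2) * b : ℂ) * (y ^ (m + 1) * cycleRoot b c y))
      + (-(m * (c ^ 2 / 4)) : ℂ) * (y ^ m * cycleRoot b c y)) = 0 := by
    rw [circRes, circleIntegral.integral_eq_zero_of_hasDerivWithinAt hr.le
      (f := fun y => y ^ (m + 3) * ((1 - (-b / y + c ^ 2 / 4 / y ^ 2)) * cycleRoot b c y)), mul_zero]
    intro y hy
    have hy0 := H.ne_zero hy
    have hre := H.re_pos hy
    set s : ℂ → ℂ := fun y => 1 - (-b / y + c ^ 2 / 4 / y ^ 2) with hs
    have hs0 : s y ≠ 0 := fun h => by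
      have : 0 < (s y).re := hre
      rw [h] at this
      simp at this
    have ds : HasDerivAt s (-b / y ^ 2 + c ^ 2 / 2 / y ^ 3) y := by
      have h1 : HasDerivAt (fun y : ℂ => (-b : ℂ) / y) (b / y ^ 2) y := by
        have := (hasDerivAt_inv hy0).const_mul (-b : ℂ)
        exact this.congr_deriv (by field_simp)
      have h2 : HasDerivAt (fun y : ℂ => (c ^ 2 / 4 : ℂ) / y ^ 2) (-(c ^ 2 / 2 / y ^ 3)) y := by
        have := ((hasDerivAt_pow 2 y).inv (pow_ne_zero 2 hy0)).const_mul (c ^ 2 / 4 : ℂ)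
        exact this.congr_deriv (by push_cast; field_simp; ring)
      exact ((h1.add h2).const_sub 1).congr_deriv (by ring)
    have dw := ds.cpow_const (c := (1 / 2 : ℂ)) (Or.inl hre)
    have hw : s y ^ (1 / 2 - 1 : ℂ) * s y = s y ^ (1 / 2 : ℂ) := by
      rw [Complex.cpow_sub _ _ hs0, Complex.cpow_one, div_mul_cancel₀ _ hs0]
    have := (hasDerivAt_pow (m + 3) y).mul (ds.mul dw)
    refine (this.congr_deriv ?_).hasDerivWithinAt
    have e : ∀ u, cycleRoot b c u = s u ^ (1 / 2 : ℂ) := fun u => rfl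
    rw [e]
    set w := s y ^ (1 / 2 : ℂ) with hwdef
    have hsy : s y = 1 - (-b / y + c ^ 2 / 4 / y ^ 2) := rfl
    have e2 : s y * (1 / 2 * s y ^ (1 / 2 - 1 : ℂ) * (-b / y ^ 2 + c ^ 2 / 2 / y ^ 3))
        = 1 / 2 * w * (-b / y ^ 2 + c ^ 2 / 2 / y ^ 3) := by
      rw [← hw]; ring
    change ((m + 3 : ℕ) : ℂ) * y ^ (m + 3 - 1) * (s y * w) + y ^ (m + 3) *
      ((-b / y ^ 2 + c ^ 2 / 2 / y ^ 3) * w + s y * (1 / 2 * s y ^ (1 / 2 - 1 : ℂ) *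
        (-b / y ^ 2 + c ^ 2 / 2 / y ^ 3))) = _
    rw [e2, show m + 3 - 1 = m + 2 by omega]
    clear_value w
    rw [hsy]
    push_cast
    field_simp
    ring
  have hlin : ∀ (a₁ a₂ a₃ : ℂ) (k₁ k₂ k₃ : ℕ), circRes r (fun y => (a₁ * (y ^ k₁ * cycleRoot b c y)
      + a₂ * (y ^ k₂ * cycleRoot b c y)) + a₃ * (y ^ k₃ * cycleRoot b c y))
      = a₁ * cycleMoment b c r k₁ + a₂ * cycleMoment b c r k₂ + a₃ * cycleMoment b c r k₃ :=
    fun a₁ a₂ a₃ k₁ k₂ k₃ => by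
      rw [circRes_add (f := fun y => a₁ * (y ^ k₁ * cycleRoot b c y)
          + a₂ * (y ^ k₂ * cycleRoot b c y)) hr.le ((hcont _ _).add (hcont _ _)) (hcont _ _),
        circRes_add hr.le (hcont _ _) (hcont _ _), circRes_const_mul, circRes_const_mul,
        circRes_const_mul]
      rfl
  rw [hlin] at h0
  linear_combination h0

theorem CycleBounds.norm_cycleMoment_le (H : CycleBounds b c r) (k : ℕ) :
    ‖cycleMoment b c r k‖ ≤ 2 := by
  have hr := H.r_pos
  refine (norm_circRes_le (C := 2) hr.le fun y hy => ?_).trans (by linarith [H.hr'])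
  have hy' : ‖y‖ = r := by simpa using hy
  rw [norm_mul, norm_pow, hy']
  have := pow_le_one₀ (n := k) hr.le (by linarith [H.hr'])
  nlinarith [H.norm_cycleRoot_le hy, norm_nonneg (cycleRoot b c y)]

/-- Under `z = y / (1 - b)` the radicand factors as `(1 - b)⁻¹ (1 - y) (1 + b / y - c² / (4 y²))`,
and `|z| = 1/2` becomes `|y| = (1 - b) / 2`. Expanding `√(1 - y)` pairs its coefficients with the
cycle moments. These solve the recursion with `s = 0` and start with `b / 2` and `-(b² + c²) / 8`.
-/
theorem vanishingAction_eq (hb : |b| ≤ 1 / 32) (hc : |c| ≤ 1 / 8) :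
    vanishingAction ((b + c ^ 2 / 4) / (1 - b) ^ 2) (c / ((1 - b) * √(1 - b)))
      = (b - (b ^ 2 + c ^ 2) / 4 * momentCoeff₁ b c) / ((1 - b) * √(1 - b)) := by
  have hb' := abs_le.1 hb
  have hb1 : 0 < 1 - b := by linarith
  set r : ℝ := (1 - b) / 2 with hr
  have H : CycleBounds b c r := ⟨hb, hc, by rw [hr]; linarith, by rw [hr]; linarith⟩
  have hr0 := H.r_pos
  set z₁ : ℝ := (1 - b)⁻¹ with hz
  have hz0 : 0 < z₁ := by positivity
  have hz1 : z₁ * (1 - b) = 1 := inv_mul_cancel₀ hb1.ne'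
  have hsz : √z₁ * √(1 - b) = 1 := by rw [← Real.sqrt_mul hz0.le, hz1, Real.sqrt_one]
  have hsz2 : √z₁ ^ 2 = z₁ := Real.sq_sqrt hz0.le
  have hh : (b + c ^ 2 / 4) / (1 - b) ^ 2 = (b + c ^ 2 / 4) * z₁ ^ 2 := by
    rw [hz, inv_pow]; rfl
  have hinv : ((1 - b) * √(1 - b))⁻¹ = z₁ * √z₁ := by
    rw [mul_inv, ← hz, hz, Real.sqrt_inv]
  have hj : c / ((1 - b) * √(1 - b)) = c * (z₁ * √z₁) := by rw [div_eq_mul_inv, hinv]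
  rw [hh, hj, div_eq_mul_inv _ ((1 - b) * √(1 - b)), hinv]
  have key : circRes (1 / 2) (cycleIntegrand ((b + c ^ 2 / 4) * z₁ ^ 2) (c * (z₁ * √z₁)))
      = z₁ * (√z₁ * circRes r (fun y => (1 - y) ^ (1 / 2 : ℂ) * cycleRoot b c y)) := by
    rw [show (1 / 2 : ℝ) = z₁ * r by rw [hr]; linear_combination -hz1 / 2,
      circRes_mul_left]
    congr 1
    rw [← circRes_const_mul]
    refine circRes_congr hr0.le fun y hy => ?_
    have hy0 := H.ne_zero hy
    have hy' : ‖y‖ = r := by simpa using hy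
    have hzc : (z₁ : ℂ) ≠ 0 := by exact_mod_cast hz0.ne'
    have hre1 : 0 < (1 - y).re := by
      have := (Complex.abs_re_le_norm y)
      rw [Complex.sub_re, Complex.one_re]
      linarith [(abs_le.1 this).2, H.hr']
    have hre2 : 0 < ((z₁ : ℂ) * (1 - y)).re := by
      rw [Complex.re_ofReal_mul]; positivity
    rw [← ofReal_cpow_half hz0.le, ← mul_assoc ((z₁ : ℂ) ^ (1 / 2 : ℂ)),
      ← mul_cpow_half (x := (z₁ : ℂ)) (by simpa using hz0) hre1,
      cycleRoot, ← mul_cpow_half hre2 (H.re_pos hy), cycleIntegrand]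
    congr 1
    have hz1c : (z₁ : ℂ) * (1 - b) = 1 := by exact_mod_cast hz1
    have hszc : ((√z₁ : ℝ) : ℂ) ^ 2 = z₁ := by exact_mod_cast hsz2
    push_cast
    rw [mul_pow (c : ℂ), mul_pow (z₁ : ℂ), hszc]
    field_simp
    linear_combination (-4 * y ^ 2) * hz1c
  have hsum : HasSum (fun k => (sqrtCoeff k : ℂ) * cycleMoment b c r k)
      (circRes r (fun y => (1 - y) ^ (1 / 2 : ℂ) * cycleRoot b c y)) := by
    have h1 := hasSum_circRes (R := r) hr0.le (B := fun k => (3 / 4 : ℝ) ^ k * 2)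
      (F := fun k y => (sqrtCoeff k : ℂ) * (y ^ k * cycleRoot b c y))
      (f := fun y => (1 - y) ^ (1 / 2 : ℂ) * cycleRoot b c y)
      ((summable_geometric_of_lt_one (by norm_num) (by norm_num)).mul_right _)
      (fun k => continuousOn_const.mul (((continuous_pow k).continuousOn).mul H.continuousOn))
      (fun k y hy => by
        have hy' : ‖y‖ = r := by simpa using hy
        rw [norm_mul, norm_mul, norm_pow, hy', Complex.norm_real, Real.norm_eq_abs]
        calc _ ≤ 1 * ((3 / 4 : ℝ) ^ k * 2) := by
              gcongr
              · exact abs_sqrtCoeff_le k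
              · exact H.hr'
              · exact H.norm_cycleRoot_le hy
          _ = _ := one_mul _)
      (fun y hy => by
        have hy' : ‖y‖ = r := by simpa using hy
        have := (hasSum_sqrtCoeff (x := y) (by linarith [H.hr'])).mul_right (cycleRoot b c y)
        exact this.congr_fun fun k => by ring)
    exact h1.congr_fun fun k => (circRes_const_mul _ _ _).symm
  set q : BoundedContinuousFunction ℕ ℝ := bseq (fun k => (cycleMoment b c r k).re) 2 fun k =>
    (Complex.abs_re_le_norm _).trans (H.norm_cycleMoment_le k) with hq
  have hrec := sqrtPairing_eq (b := b) (c := c) (s := 0) (q := q) (by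
      rw [← sq_abs c]; nlinarith [abs_nonneg c]) (fun m => by
    have := congrArg Complex.re (H.cycleMoment_rec m)
    have e : ∀ (a : ℝ) (w : ℂ), ((a : ℂ) * w).re = a * w.re := Complex.re_ofReal_mul
    rw [hq]
    simp only [bseq_apply]
    rw [← e, ← e, ← e, ← Complex.add_re, ← Complex.sub_re]
    rw [Complex.zero_re] at this
    rw [← this]
    congr 1
    push_cast
    ring)
  have hre : (circRes r (fun y => (1 - y) ^ (1 / 2 : ℂ) * cycleRoot b c y)).re = sqrtPairing q := by
    rw [sqrtPairing_apply]
    refine ((Complex.hasSum_re hsum).tsum_eq.symm.trans ?_)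
    refine tsum_congr fun k => ?_
    rw [Complex.re_ofReal_mul, hq, bseq_apply]
  have hq0 : q 0 = b / 2 := by
    rw [hq, bseq_apply, H.cycleMoment_zero]
    simp
  have hq1 : q 1 = -(b ^ 2 + c ^ 2) / 8 := by
    rw [hq, bseq_apply, H.cycleMoment_one]
    have : (-((b : ℂ) ^ 2 + c ^ 2) / 8) = ((-(b ^ 2 + c ^ 2) / 8 : ℝ) : ℂ) := by push_cast; ring
    rw [this, Complex.ofReal_re]
  have h2re : ∀ w : ℂ, (2 * w).re = 2 * w.re := fun w => by simp
  rw [vanishingAction, vanishingPeriod_eq, key, h2re, Complex.re_ofReal_mul, Complex.re_ofReal_mul, hre, hrec, hq0, hq1]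
  ring

end NormalisedCycle

/-! ### The action integral in normalised parameters -/

section ActionIntegral

open MeasureTheory intervalIntegral

/-- `√(y² + b y - c² / 4)`. -/
def quadRoot (b c y : ℝ) : ℝ := √(y ^ 2 + b * y - c ^ 2 / 4)

/-- The larger root of `y² + b y - c² / 4`. -/
def innerRoot (b c : ℝ) : ℝ := (-b + √(b ^ 2 + c ^ 2)) / 2

/-- The moments of the normalised action integral. -/
def actionMoment (b c : ℝ) (k : ℕ) : ℝ :=
  ∫ y in innerRoot b c..1, y ^ k * (quadRoot b c y / y)

/-- The parameter range of the normalised action integral. -/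
structure ActionBounds (b c : ℝ) : Prop where
  hb : |b| ≤ 1 / 32
  hc0 : 0 ≤ c
  hc : c ≤ 1 / 8
  ne : 0 < b ^ 2 + c ^ 2

namespace ActionBounds

variable {b c : ℝ}

theorem rho_pos (H : ActionBounds b c) : 0 < √(b ^ 2 + c ^ 2) := Real.sqrt_pos.2 H.ne

theorem rho_sq (H : ActionBounds b c) : √(b ^ 2 + c ^ 2) ^ 2 = b ^ 2 + c ^ 2 := Real.sq_sqrt H.ne.le

theorem abs_le_rho : |b| ≤ √(b ^ 2 + c ^ 2) := Real.abs_le_sqrt (by nlinarith [sq_nonneg c])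

theorem rho_le (H : ActionBounds b c) : √(b ^ 2 + c ^ 2) ≤ 1 / 4 := by
  refine Real.sqrt_le_iff.2 ⟨by norm_num, ?_⟩
  have := H.hb
  have := H.hc
  have := H.hc0
  rw [← sq_abs b]
  nlinarith [abs_nonneg b]

theorem innerRoot_nonneg : 0 ≤ innerRoot b c := by
  have := abs_le.1 (abs_le_rho (b := b) (c := c))
  rw [innerRoot]
  linarith

theorem innerRoot_lt_one (H : ActionBounds b c) : innerRoot b c < 1 := by
  have := abs_le.1 H.hb
  have := H.rho_le
  rw [innerRoot]
  linarith

theorem innerRoot_pos (hc : c ≠ 0) : 0 < innerRoot b c := by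
  have h1 : |b| < √(b ^ 2 + c ^ 2) := by
    rw [← Real.sqrt_sq_eq_abs]
    exact Real.sqrt_lt_sqrt (sq_nonneg b) (by have := sq_pos_of_ne_zero hc; linarith)
  have := abs_lt.1 h1
  rw [innerRoot]
  linarith

theorem quad_eq (H : ActionBounds b c) (y : ℝ) :
    y ^ 2 + b * y - c ^ 2 / 4
      = (y - innerRoot b c) * (y + b / 2 + √(b ^ 2 + c ^ 2) / 2) := by
  rw [innerRoot]
  linear_combination (1 / 4) * H.rho_sq

theorem quad_pos (H : ActionBounds b c) {y : ℝ} (hy : innerRoot b c < y) :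
    0 < y ^ 2 + b * y - c ^ 2 / 4 := by
  rw [H.quad_eq]
  refine mul_pos (by linarith) ?_
  have := H.rho_pos
  rw [innerRoot] at hy
  linarith

theorem quadRoot_innerRoot (H : ActionBounds b c) : quadRoot b c (innerRoot b c) = 0 := by
  rw [quadRoot, H.quad_eq, sub_self, zero_mul, Real.sqrt_zero]

theorem continuous_quadRoot : Continuous (quadRoot b c) := by
  unfold quadRoot
  fun_prop

theorem quadRoot_nonneg (y : ℝ) : 0 ≤ quadRoot b c y := Real.sqrt_nonneg _

theorem quadRoot_pos (H : ActionBounds b c) {y : ℝ} (hy : innerRoot b c < y) :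
    0 < quadRoot b c y := Real.sqrt_pos.2 (H.quad_pos hy)

theorem quadRoot_sq (H : ActionBounds b c) {y : ℝ} (hy : innerRoot b c < y) :
    quadRoot b c y ^ 2 = y ^ 2 + b * y - c ^ 2 / 4 := Real.sq_sqrt (H.quad_pos hy).le

theorem hasDerivAt_quadRoot (H : ActionBounds b c) {y : ℝ} (hy : innerRoot b c < y) :
    HasDerivAt (quadRoot b c) ((2 * y + b) / (2 * quadRoot b c y)) y := by
  have h1 : HasDerivAt (fun y : ℝ => y ^ 2 + b * y - c ^ 2 / 4) (2 * y + b) y := by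
    have := ((hasDerivAt_pow 2 y).add ((hasDerivAt_id y).const_mul b)).sub_const (c ^ 2 / 4)
    exact this.congr_deriv (by simp)
  exact h1.sqrt (H.quad_pos hy).ne'

/-- `log (2 y + b + 2 R)`. -/
def logTerm (b c y : ℝ) : ℝ := Real.log (2 * y + b + 2 * quadRoot b c y)

theorem logArg_pos (H : ActionBounds b c) {y : ℝ} (hy : innerRoot b c ≤ y) :
    0 < 2 * y + b + 2 * quadRoot b c y := by
  have := H.rho_pos
  have := quadRoot_nonneg (b := b) (c := c) y
  rw [innerRoot] at hy
  linarith

theorem hasDerivAt_logTerm (H : ActionBounds b c) {y : ℝ} (hy : innerRoot b c < y) :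
    HasDerivAt (logTerm b c) (1 / quadRoot b c y) y := by
  have hR := H.quadRoot_pos hy
  have hL := H.logArg_pos hy.le
  have h1 : HasDerivAt (fun y => 2 * y + b + 2 * quadRoot b c y)
      (2 + 2 * ((2 * y + b) / (2 * quadRoot b c y))) y := by
    have := (((hasDerivAt_id y).const_mul 2).add_const b).add
      ((H.hasDerivAt_quadRoot hy).const_mul 2)
    exact this.congr_deriv (by simp)
  refine (h1.log hL.ne').congr_deriv ?_
  field_simp
  ring

theorem continuousOn_logTerm (H : ActionBounds b c) :
    ContinuousOn (logTerm b c) (Set.Icc (innerRoot b c) 1) := by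
  refine ContinuousOn.log ?_ fun y hy => (H.logArg_pos hy.1).ne'
  have := (continuous_quadRoot (b := b) (c := c))
  exact Continuous.continuousOn (by fun_prop)

/-- At the inner turning point `R = 0` and `2 y + b = √(b² + c²)`. This endpoint value is the source
of the logarithmic singularity. -/
theorem logTerm_innerRoot (H : ActionBounds b c) :
    logTerm b c (innerRoot b c) = Real.log √(b ^ 2 + c ^ 2) := by
  rw [logTerm, H.quadRoot_innerRoot, innerRoot]
  congr 1
  ring

/-- The angular part of the antiderivative of `R / y`. -/
def angleTerm (b c y : ℝ) : ℝ := c / 2 * Real.arccos ((b * y - c ^ 2 / 2) / (y * √(b ^ 2 + c ^ 2)))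

theorem hasDerivAt_angleTerm (H : ActionBounds b c) {y : ℝ} (hy : innerRoot b c < y) :
    HasDerivAt (angleTerm b c) (-(c ^ 2 / (4 * y * quadRoot b c y))) y := by
  have hy0 : 0 < y := innerRoot_nonneg.trans_lt hy
  have hR := H.quadRoot_pos hy
  have hρ := H.rho_pos
  rcases H.hc0.eq_or_lt with hc | hc
  · subst hc
    have : angleTerm b 0 = fun _ => 0 := by funext y; simp [angleTerm]
    rw [this]
    exact (hasDerivAt_const y (0 : ℝ)).congr_deriv (by simp)
  set ρ := √(b ^ 2 + c ^ 2) with hρdef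
  set u : ℝ → ℝ := fun y => (b * y - c ^ 2 / 2) / (y * ρ) with hu
  -- The identity behind this is `y² (b² + c²) - (b y - c² / 2)² = c² (y² + b y - c² / 4)`.
  have hu1 : 1 - u y ^ 2 = (c * quadRoot b c y / (y * ρ)) ^ 2 := by
    have h1 := H.quadRoot_sq hy
    have h2 := H.rho_sq
    rw [hu]
    simp only
    rw [div_pow, div_pow, mul_pow c, h1, eq_div_iff (by positivity), sub_mul, one_mul,
      div_mul_cancel₀ _ (by positivity), mul_pow y, h2]
    ring
  have hsq : √(1 - u y ^ 2) = c * quadRoot b c y / (y * ρ) := by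
    rw [hu1, Real.sqrt_sq (by positivity)]
  have hpos : 0 < 1 - u y ^ 2 := by rw [hu1]; positivity
  have hne1 : u y ≠ -1 := fun h => by rw [h] at hpos; norm_num at hpos
  have hne2 : u y ≠ 1 := fun h => by rw [h] at hpos; norm_num at hpos
  have du : HasDerivAt u (c ^ 2 / 2 / (y ^ 2 * ρ)) y := by
    have h1 : HasDerivAt (fun y => b * y - c ^ 2 / 2) b y := by
      have := ((hasDerivAt_id y).const_mul b).sub_const (c ^ 2 / 2)
      exact this.congr_deriv (by simp)
    have h2 : HasDerivAt (fun y => y * ρ) ρ y := by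
      have := (hasDerivAt_id y).mul_const ρ
      exact this.congr_deriv (by simp)
    refine (h1.div h2 (by positivity)).congr_deriv ?_
    field_simp
    ring
  have := (((Real.hasDerivAt_arccos hne1 hne2).comp y du).const_mul (c / 2))
  refine this.congr_deriv ?_
  rw [hsq]
  field_simp
  norm_num

theorem continuousOn_angleTerm (H : ActionBounds b c) :
    ContinuousOn (angleTerm b c) (Set.Icc (innerRoot b c) 1) := by
  by_cases hc : c = 0
  · subst hc
    have : angleTerm b 0 = fun _ => 0 := by funext y; simp [angleTerm]
    rw [this]
    exact continuousOn_const
  · refine ContinuousOn.mul continuousOn_const (Real.continuous_arccos.comp_continuousOn ?_)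
    refine ContinuousOn.div (by fun_prop) (by fun_prop) fun y hy => ?_
    have := innerRoot_pos (b := b) hc
    have := H.rho_pos
    have : 0 < y := by linarith [hy.1]
    positivity

/-- The inner turning point is where the argument of the arccosine is `-1` if `c ≠ 0`. The value `π`
there becomes the term `-π |j|` of the action. -/
theorem angleTerm_innerRoot (H : ActionBounds b c) :
    angleTerm b c (innerRoot b c) = c / 2 * π := by
  by_cases hc : c = 0
  · simp [angleTerm, hc]
  have h0 := innerRoot_pos (b := b) hc
  have hρ := H.rho_pos
  have : (b * innerRoot b c - c ^ 2 / 2) / (innerRoot b c * √(b ^ 2 + c ^ 2)) = -1 := by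
    rw [div_eq_iff (by positivity), innerRoot]
    linear_combination (1 / 2) * H.rho_sq
  rw [angleTerm, this, Real.arccos_neg_one]

/-- An antiderivative of `R / y`. -/
def primitive₀ (b c y : ℝ) : ℝ := quadRoot b c y + b / 2 * logTerm b c y + angleTerm b c y

theorem hasDerivAt_primitive₀ (H : ActionBounds b c) {y : ℝ} (hy : innerRoot b c < y) :
    HasDerivAt (primitive₀ b c) (quadRoot b c y / y) y := by
  have hy0 : 0 < y := innerRoot_nonneg.trans_lt hy
  have hR := H.quadRoot_pos hy
  refine (((H.hasDerivAt_quadRoot hy).add ((H.hasDerivAt_logTerm hy).const_mul (b / 2))).add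
    (H.hasDerivAt_angleTerm hy)).congr_deriv ?_
  field_simp
  linear_combination (-8) * H.quadRoot_sq hy

theorem continuousOn_primitive₀ (H : ActionBounds b c) :
    ContinuousOn (primitive₀ b c) (Set.Icc (innerRoot b c) 1) :=
  (continuous_quadRoot.continuousOn.add (continuousOn_const.mul H.continuousOn_logTerm)).add
    H.continuousOn_angleTerm

/-- For `c = 0 < b` the inner root is `0` and `R / y` is unbounded there. Integrability holds
because `R / y` is nonnegative and has a continuous primitive. -/
theorem intervalIntegrable (H : ActionBounds b c) :
    IntervalIntegrable (fun y => quadRoot b c y / y) volume (innerRoot b c) 1 := by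
  have h1 := H.innerRoot_lt_one.le
  refine intervalIntegrable_deriv_of_nonneg (g := primitive₀ b c) ?_ ?_ ?_
  · rw [Set.uIcc_of_le h1]
    exact H.continuousOn_primitive₀
  · intro y hy
    rw [min_eq_left h1, max_eq_right h1] at hy
    exact H.hasDerivAt_primitive₀ hy.1
  · intro y hy
    rw [min_eq_left h1, max_eq_right h1] at hy
    exact div_nonneg (quadRoot_nonneg _) (innerRoot_nonneg.trans hy.1.le)

theorem intervalIntegrable_moment (H : ActionBounds b c) (k : ℕ) :
    IntervalIntegrable (fun y => y ^ k * (quadRoot b c y / y)) volume (innerRoot b c) 1 :=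
  H.intervalIntegrable.continuousOn_mul (continuous_pow k).continuousOn

theorem actionMoment_zero (H : ActionBounds b c) :
    actionMoment b c 0 = quadRoot b c 1
      + b / 2 * (Real.log (2 + b + 2 * quadRoot b c 1) - Real.log √(b ^ 2 + c ^ 2))
      - c / 2 * (π - Real.arccos ((b - c ^ 2 / 2) / √(b ^ 2 + c ^ 2))) := by
  have h := integral_eq_sub_of_hasDerivAt_of_le H.innerRoot_lt_one.le H.continuousOn_primitive₀
    (fun y hy => H.hasDerivAt_primitive₀ hy.1) H.intervalIntegrable
  rw [actionMoment]
  simp only [pow_zero, one_mul]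
  rw [h, primitive₀, primitive₀, H.quadRoot_innerRoot, H.logTerm_innerRoot, H.angleTerm_innerRoot,
    logTerm, angleTerm]
  simp only [mul_one, one_mul]
  ring

theorem actionMoment_one (H : ActionBounds b c) :
    actionMoment b c 1 = (2 + b) * quadRoot b c 1 / 4
      - (b ^ 2 + c ^ 2) / 8 *
        (Real.log (2 + b + 2 * quadRoot b c 1) - Real.log √(b ^ 2 + c ^ 2)) := by
  have h := integral_eq_sub_of_hasDerivAt_of_le
    (f := fun y => (2 * y + b) * quadRoot b c y / 4 - (b ^ 2 + c ^ 2) / 8 * logTerm b c y)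
    (f' := fun y => y ^ 1 * (quadRoot b c y / y)) H.innerRoot_lt_one.le
    (by
      have := continuous_quadRoot (b := b) (c := c)
      exact ContinuousOn.sub (Continuous.continuousOn (by fun_prop))
        (continuousOn_const.mul H.continuousOn_logTerm))
    (fun y hy => by
      have hy0 : 0 < y := innerRoot_nonneg.trans_lt hy.1
      have hR := H.quadRoot_pos hy.1
      have h1 : HasDerivAt (fun y => 2 * y + b) 2 y := by
        have := ((hasDerivAt_id y).const_mul 2).add_const b
        exact this.congr_deriv (by simp)
      refine (((h1.mul (H.hasDerivAt_quadRoot hy.1)).div_const 4).sub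
        ((H.hasDerivAt_logTerm hy.1).const_mul _)).congr_deriv ?_
      field_simp
      linear_combination (-32) * H.quadRoot_sq hy.1)
    (H.intervalIntegrable_moment 1)
  rw [actionMoment, h, H.quadRoot_innerRoot, H.logTerm_innerRoot, logTerm]
  simp only [mul_one]
  ring

/-- The combination of integrands is the derivative of `y^m R³`. The term at the inner root vanishes
and the one at `y = 1` stays as the inhomogeneity. -/
theorem actionMoment_rec (H : ActionBounds b c) (m : ℕ) :
    (m + 3) * actionMoment b c (m + 2) + (m + 3 / 2) * b * actionMoment b c (m + 1)
      - m * (c ^ 2 / 4) * actionMoment b c m = quadRoot b c 1 ^ 3 := by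
  have hI := H.intervalIntegrable_moment
  have h := integral_eq_sub_of_hasDerivAt_of_le (f := fun y => y ^ m * quadRoot b c y ^ 3)
    (f' := fun y => (m + 3) * (y ^ (m + 2) * (quadRoot b c y / y))
      + (m + 3 / 2) * b * (y ^ (m + 1) * (quadRoot b c y / y))
      - m * (c ^ 2 / 4) * (y ^ m * (quadRoot b c y / y))) H.innerRoot_lt_one.le
    (by
      have := continuous_quadRoot (b := b) (c := c)
      exact Continuous.continuousOn (by fun_prop))
    (fun y hy => by
      have hy0 : 0 < y := innerRoot_nonneg.trans_lt hy.1
      have hR := H.quadRoot_pos hy.1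
      refine ((hasDerivAt_pow m y).mul ((H.hasDerivAt_quadRoot hy.1).pow 3)).congr_deriv ?_
      have e : (m : ℝ) * y ^ (m - 1) = m * y ^ m / y := by
        rcases m with _ | m
        · simp
        · rw [Nat.add_sub_cancel, pow_succ]; field_simp
      simp only [Pi.pow_apply]
      rw [e]
      field_simp
      push_cast
      linear_combination (8 * (m : ℝ) * y ^ m * quadRoot b c y ^ 2) * H.quadRoot_sq hy.1)
    ((((hI (m + 2)).const_mul _).add ((hI (m + 1)).const_mul _)).sub ((hI m).const_mul _))
  rw [integral_sub (((hI (m + 2)).const_mul _).add ((hI (m + 1)).const_mul _))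
    ((hI m).const_mul _), integral_add ((hI (m + 2)).const_mul _) ((hI (m + 1)).const_mul _),
    intervalIntegral.integral_const_mul, intervalIntegral.integral_const_mul,
    intervalIntegral.integral_const_mul, H.quadRoot_innerRoot] at h
  rw [actionMoment, actionMoment, actionMoment, h]
  simp

theorem abs_actionMoment_le (H : ActionBounds b c) (k : ℕ) :
    |actionMoment b c k| ≤ actionMoment b c 0 := by
  have h1 := H.innerRoot_lt_one.le
  have h0 : 0 ≤ actionMoment b c k := by
    refine integral_nonneg h1 fun y hy => ?_
    have : 0 ≤ y := innerRoot_nonneg.trans hy.1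
    have := quadRoot_nonneg (b := b) (c := c) y
    positivity
  rw [abs_of_nonneg h0]
  refine integral_mono_on h1 (H.intervalIntegrable_moment k) (H.intervalIntegrable_moment 0)
    fun y hy => ?_
  have h2 : 0 ≤ y := innerRoot_nonneg.trans hy.1
  have := quadRoot_nonneg (b := b) (c := c) y
  rw [pow_zero]
  gcongr
  exact pow_le_one₀ h2 hy.2

theorem hasSum_actionMoment (H : ActionBounds b c) :
    HasSum (fun k => sqrtCoeff k * actionMoment b c k)
      (∫ y in innerRoot b c..1, √(1 - y) * (quadRoot b c y / y)) := by
  have h1 := H.innerRoot_lt_one.le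
  have h := hasSum_integral_of_dominated_convergence (μ := volume) (a := innerRoot b c) (b := 1)
    (F := fun k y => sqrtCoeff k * (y ^ k * (quadRoot b c y / y)))
    (f := fun y => √(1 - y) * (quadRoot b c y / y))
    (fun k y => |sqrtCoeff k| * (quadRoot b c y / y))
    (fun k => by
      have := ((H.intervalIntegrable_moment k).const_mul (sqrtCoeff k)).aestronglyMeasurable
      rwa [Set.uIoc_of_le h1])
    (fun k => by
      refine ae_of_all _ fun y hy => ?_
      rw [Set.uIoc_of_le h1] at hy
      have h2 : 0 ≤ y := innerRoot_nonneg.trans hy.1.le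
      have := quadRoot_nonneg (b := b) (c := c) y
      have h3 : 0 ≤ quadRoot b c y / y := by positivity
      rw [norm_mul, norm_mul, norm_pow, Real.norm_of_nonneg h2, Real.norm_of_nonneg h3,
        Real.norm_eq_abs]
      gcongr
      have := mul_le_mul_of_nonneg_right (pow_le_one₀ (n := k) h2 hy.2) h3
      rwa [one_mul] at this)
    (ae_of_all _ fun y _ => summable_abs_sqrtCoeff.mul_right _)
    (by
      simp only [tsum_mul_right]
      exact H.intervalIntegrable.const_mul _)
    (by
      have hne : ∀ᵐ y : ℝ, y ≠ 1 := by
        rw [ae_iff]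
        simp
      filter_upwards [hne] with y hy1 hy
      rw [Set.uIoc_of_le h1] at hy
      have h2 : 0 ≤ y := innerRoot_nonneg.trans hy.1.le
      have h3 : y < 1 := lt_of_le_of_ne hy.2 hy1
      have h4 := hasSum_sqrtCoeff (x := y) (by
        rw [Complex.norm_real, Real.norm_of_nonneg h2]; exact h3)
      have h6 : (1 : ℂ) - (y : ℂ) = ((1 - y : ℝ) : ℂ) := by push_cast; rfl
      rw [h6, ofReal_cpow_half (by linarith)] at h4
      have h5 : HasSum (fun k => sqrtCoeff k * y ^ k) √(1 - y) := by
        rw [← Complex.hasSum_ofReal]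
        exact_mod_cast h4
      exact (h5.mul_right _).congr_fun fun k => by ring)
  refine h.congr_fun fun k => ?_
  rw [actionMoment, intervalIntegral.integral_const_mul]

/-- The resolvent coefficients are those of the vanishing cycle, since the recursion is the same;
only the initial values and the inhomogeneity differ. -/
theorem integral_eq (H : ActionBounds b c) :
    ∫ y in innerRoot b c..1, √(1 - y) * (quadRoot b c y / y)
      = actionMoment b c 0 + actionMoment b c 1 * momentCoeff₁ b c
        + quadRoot b c 1 ^ 3 * momentCoeff₂ b c := by
  set q : BoundedContinuousFunction ℕ ℝ := bseq (actionMoment b c) (actionMoment b c 0)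
    H.abs_actionMoment_le
  have h := sqrtPairing_eq (b := b) (c := c) (q := q) (s := quadRoot b c 1 ^ 3) (by
    have := H.hb; have := H.hc; have := H.hc0; nlinarith) H.actionMoment_rec
  rw [← H.hasSum_actionMoment.tsum_eq]
  exact h

end ActionBounds

end ActionIntegral

/-! ### The action in normalised parameters and the split into singular and regular parts. -/

section ActionFormula

open MeasureTheory

/-- The energy in terms of the normalised parameters. -/
def energy (b c : ℝ) : ℝ := (b + c ^ 2 / 4) / (1 - b) ^ 2

/-- The rescaled angular momentum in terms of the normalised parameters. -/
def angMom (b c : ℝ) : ℝ := c / ((1 - b) * √(1 - b))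

variable {b c : ℝ}

theorem radial_eq (hb : b < 1) {y : ℝ} (hy : 0 ≤ y) :
    radial (energy b c) (angMom b c / √2) √((1 - b)⁻¹ * y)
      = 2 * (1 - b)⁻¹ ^ 3 * ((1 - y) * (y ^ 2 + b * y - c ^ 2 / 4)) := by
  have hb1 : 0 < 1 - b := by linarith
  have h2 : √2 ^ 2 = 2 := Real.sq_sqrt (by norm_num)
  have h3 : √(1 - b) ^ 2 = 1 - b := Real.sq_sqrt hb1.le
  have hr : √((1 - b)⁻¹ * y) ^ 2 = (1 - b)⁻¹ * y := Real.sq_sqrt (mul_nonneg (by positivity) hy)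
  rw [radial, show 4 = 2 * 2 by norm_num, show 6 = 2 * 3 by norm_num, pow_mul, pow_mul, hr, energy,
    angMom, div_pow, h2, div_pow, mul_pow (1 - b) √(1 - b), h3]
  field_simp
  ring

/-- The substitution is `r = √(y / (1 - b))`. The condition `0 < r` excludes `y = 0` from `T`, which
matters only if the inner root is `0` and changes the domain by a null set. -/
theorem action_energy_angMom (H : ActionBounds b c) :
    2 * π * action (energy b c) (angMom b c)
      = 2 * ((1 - b) * √(1 - b))⁻¹ *
        ∫ y in innerRoot b c..1, √(1 - y) * (quadRoot b c y / y) := by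
  have hb1 : 0 < 1 - b := by linarith [(abs_le.1 H.hb).2]
  set z : ℝ := (1 - b)⁻¹ with hz
  have hz0 : 0 < z := by positivity
  set T : Set ℝ := {y | 0 < y ∧ innerRoot b c ≤ y ∧ y ≤ 1} with hT
  set φ : ℝ → ℝ := fun y => √(z * y) with hφ
  have hTm : MeasurableSet T :=
    (measurableSet_Ioi (a := (0 : ℝ))).inter (measurableSet_Icc (a := innerRoot b c) (b := 1))
  have hrad : ∀ y, 0 < y → (0 ≤ radial (energy b c) (angMom b c / √2) (φ y) ↔
      innerRoot b c ≤ y ∧ y ≤ 1) := fun y hy => by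
    rw [hφ]
    simp only
    rw [radial_eq (by linarith) hy.le, H.quad_eq]
    have h1 : 0 < y + b / 2 + √(b ^ 2 + c ^ 2) / 2 := by
      have := (abs_le.1 (ActionBounds.abs_le_rho (b := b) (c := c))).1
      linarith
    have h2 : (0 : ℝ) < 2 * z ^ 3 := by positivity
    have h3 := H.innerRoot_lt_one
    rw [mul_nonneg_iff_of_pos_left h2, ← mul_assoc, mul_nonneg_iff_of_pos_right h1]
    constructor
    · intro h
      rcases mul_nonneg_iff.1 h with ⟨h4, h5⟩ | ⟨h4, h5⟩
      · constructor <;> linarith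
      · constructor <;> linarith
    · rintro ⟨h4, h5⟩
      exact mul_nonneg (by linarith) (by linarith)
  have hset : {r : ℝ | 0 < r ∧ 0 ≤ radial (energy b c) (angMom b c / √2) r} = φ '' T := by
    ext r
    constructor
    · rintro ⟨hr, hr2⟩
      have hy : φ (r ^ 2 / z) = r := by
        rw [hφ]
        simp only
        rw [mul_div_cancel₀ _ hz0.ne', Real.sqrt_sq hr.le]
      have hy0 : 0 < r ^ 2 / z := by positivity
      exact ⟨r ^ 2 / z, ⟨hy0, (hrad _ hy0).1 (by rw [hy]; exact hr2)⟩, hy⟩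
    · rintro ⟨y, ⟨hy0, hy⟩, rfl⟩
      exact ⟨Real.sqrt_pos.2 (by positivity), (hrad y hy0).2 hy⟩
  have hinj : Set.InjOn φ T := by
    intro x hx y hy hxy
    have := (Real.sqrt_inj (mul_pos hz0 hx.1).le (mul_pos hz0 hy.1).le).1 hxy
    exact mul_left_cancel₀ hz0.ne' this
  have hder : ∀ y ∈ T, HasDerivWithinAt φ (z / (2 * √(z * y))) T y := fun y hy => by
    have h1 : HasDerivAt (fun y => z * y) z y := by
      simpa using (hasDerivAt_id y).const_mul z
    exact (h1.sqrt (mul_pos hz0 hy.1).ne').hasDerivWithinAt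
  have key := integral_image_eq_integral_abs_deriv_smul hTm hder hinj
    (fun r => √(radial (energy b c) (angMom b c / √2) r) / r)
  have hsz : √(1 - b) = (√z)⁻¹ := by rw [hz, Real.sqrt_inv, inv_inv]
  have hsz2 : √z ^ 2 = z := Real.sq_sqrt hz0.le
  have hsz0 : 0 < √z := Real.sqrt_pos.2 hz0
  have hcongr : ∫ y in T, |z / (2 * √(z * y))| •
      (√(radial (energy b c) (angMom b c / √2) (φ y)) / φ y)
      = ∫ y in T, √2 / 2 * (z * √z) * (√(1 - y) * (quadRoot b c y / y)) := by
    refine setIntegral_congr_fun hTm fun y hy => ?_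
    have hy0 : 0 < y := hy.1
    have h1 : 0 ≤ 1 - y := by linarith [hy.2.2]
    simp only [hφ]
    have hs0 : 0 < √y := Real.sqrt_pos.2 hy0
    have hs2 : √y ^ 2 = y := Real.sq_sqrt hy0.le
    have hR := ActionBounds.quadRoot_nonneg (b := b) (c := c) y
    have hR2 : quadRoot b c y ^ 2 = y ^ 2 + b * y - c ^ 2 / 4 := by
      rcases hy.2.1.eq_or_lt with h | h
      · rw [← h, H.quadRoot_innerRoot, H.quad_eq]; ring
      · exact H.quadRoot_sq h
    have h4 : √(2 * z ^ 3 * ((1 - y) * (y ^ 2 + b * y - c ^ 2 / 4)))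
        = √2 * (z * √z) * (√(1 - y) * quadRoot b c y) := by
      rw [← Real.sqrt_sq (by positivity : 0 ≤ √2 * (z * √z) * (√(1 - y) * quadRoot b c y))]
      congr 1
      rw [mul_pow, mul_pow, mul_pow, mul_pow, hsz2, hR2, Real.sq_sqrt h1, Real.sq_sqrt (by norm_num)]
      ring
    rw [radial_eq (by linarith) hy0.le, smul_eq_mul, ← hz, h4, abs_of_nonneg (by positivity),
      Real.sqrt_mul hz0.le]
    field_simp
    rw [hsz2, hs2]
  have hT2 : ∫ y in T, √2 / 2 * (z * √z) * (√(1 - y) * (quadRoot b c y / y))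
      = √2 / 2 * (z * √z) * ∫ y in innerRoot b c..1, √(1 - y) * (quadRoot b c y / y) := by
    rw [MeasureTheory.integral_const_mul, intervalIntegral.integral_of_le H.innerRoot_lt_one.le]
    congr 1
    refine setIntegral_congr_set ?_
    have h1 : T ⊆ Set.Icc (innerRoot b c) 1 := fun y hy => hy.2
    have h2 : Set.Ioc (innerRoot b c) 1 ⊆ T := fun y hy =>
      ⟨ActionBounds.innerRoot_nonneg.trans_lt hy.1, hy.1.le, hy.2⟩
    have h3 : (Set.Ioc (innerRoot b c) 1 : Set ℝ) =ᵐ[volume] Set.Icc (innerRoot b c) 1 :=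
      Ioc_ae_eq_Icc
    exact ((LE.le.eventuallyLE h1).trans h3.symm.le).antisymm
      (LE.le.eventuallyLE h2)
  rw [action, radialAction, hset, key, hcongr, hT2, hsz, mul_inv, ← hz, inv_inv]
  have hs : √2 * √2 = 2 := Real.mul_self_sqrt (by norm_num)
  have hpi := Real.pi_pos
  generalize ∫ y in innerRoot b c..1, √(1 - y) * (quadRoot b c y / y) = I
  field_simp
  linear_combination I * hs

/-- The root of the quadratic factor at the outer turning point. -/
abbrev outerRoot (b c : ℝ) : ℝ := quadRoot b c 1

theorem outerRoot_sq (hb : |b| ≤ 1 / 32) (hc : |c| ≤ 1 / 8) :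
    outerRoot b c ^ 2 = 1 + b - c ^ 2 / 4 := by
  have := abs_le.1 hb
  rw [outerRoot, quadRoot, Real.sq_sqrt]
  · ring
  · have : c ^ 2 ≤ 1 := by rw [← sq_abs]; nlinarith [abs_nonneg c]
    linarith

theorem outerRoot_pos (hb : |b| ≤ 1 / 32) (hc : |c| ≤ 1 / 8) : 0 < outerRoot b c := by
  have := abs_le.1 hb
  refine Real.sqrt_pos.2 ?_
  have : c ^ 2 ≤ 1 := by rw [← sq_abs]; nlinarith [abs_nonneg c]
  linarith

/-- The difference of the arguments of `b - c² / 2 + i c R` and `b + i c`. -/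
def angleShift (b c : ℝ) : ℝ := 2 * Real.arctan (c / (2 * (outerRoot b c + 1)))

/-- Rotation by `angleShift b c` takes `b + i c` to `b - c² / 2 + i c R`. With `t = c / (2 (R + 1))`
the tangent of the half angle, this is a rational identity modulo `R² = 1 + b - c² / 4`. -/
theorem arccos_eq (H : ActionBounds b c) (hc : 0 < c) :
    Real.arccos ((b - c ^ 2 / 2) / √(b ^ 2 + c ^ 2))
      = Complex.arg ⟨b, c⟩ + angleShift b c := by
  have hρ := H.rho_pos
  have hc8 : |c| ≤ 1 / 8 := by rw [abs_of_pos hc]; exact H.hc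
  have hR := outerRoot_pos H.hb hc8
  have hR2 := outerRoot_sq H.hb hc8
  set R := outerRoot b c with hRdef
  set t : ℝ := c / (2 * (R + 1)) with ht
  have ht0 : 0 < t := by positivity
  set α := Complex.arg ⟨b, c⟩ with hα
  set ρ := √(b ^ 2 + c ^ 2) with hρdef
  have hn : ‖(⟨b, c⟩ : ℂ)‖ = ρ := by
    rw [Complex.norm_eq_sqrt_sq_add_sq]
  have hcos : ρ * Real.cos α = b := by
    have := Complex.norm_mul_cos_arg ⟨b, c⟩
    rwa [hn] at this
  have hsin : ρ * Real.sin α = c := by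
    have := Complex.norm_mul_sin_arg ⟨b, c⟩
    rwa [hn] at this
  have hθ : angleShift b c = 2 * Real.arctan t := rfl
  have ht2 : 0 < 1 + t ^ 2 := by positivity
  have c1 : Real.cos (angleShift b c) = (1 - t ^ 2) / (1 + t ^ 2) := by
    rw [hθ, Real.cos_two_mul, Real.cos_sq_arctan]
    field_simp
    ring
  have s1 : Real.sin (angleShift b c) = 2 * t / (1 + t ^ 2) := by
    rw [hθ, Real.sin_two_mul, Real.sin_arctan, Real.cos_arctan]
    have hs := Real.mul_self_sqrt ht2.le
    have h : t / √(1 + t ^ 2) * (1 / √(1 + t ^ 2)) = t / (1 + t ^ 2) := by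
      rw [div_mul_div_comm, mul_one, hs]
    linear_combination 2 * h
  have hcs : ρ * Real.cos (α + angleShift b c) = b - c ^ 2 / 2 := by
    rw [Real.cos_add, mul_sub, ← mul_assoc, ← mul_assoc, hcos, hsin, c1, s1, ht]
    field_simp
    linear_combination (4 * c ^ 2) * hR2
  have hsn : ρ * Real.sin (α + angleShift b c) = c * R := by
    rw [Real.sin_add, mul_add, ← mul_assoc, ← mul_assoc, hcos, hsin, c1, s1, ht]
    field_simp
    linear_combination (-4 * (R + 1)) * hR2
  have hα0 : 0 ≤ α := Complex.arg_nonneg_iff.2 hc.le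
  have hαπ : α ≤ π := Complex.arg_le_pi _
  have hθ0 : 0 < angleShift b c := by
    rw [hθ]; have := Real.arctan_pos.2 ht0; linarith
  have hθπ : angleShift b c < π := by
    rw [hθ]; have := Real.arctan_lt_pi_div_two t; linarith
  -- The sum of the angles lies between `0` and `2π` and its sine is positive, so it is below `π`
  -- and `arccos` recovers it.
  have hle : α + angleShift b c ≤ π := by
    by_contra! h
    have h1 : Real.sin (α + angleShift b c) < 0 := by
      have := Real.sin_pos_of_pos_of_lt_pi (x := α + angleShift b c - π) (by linarith) (by linarith)
      rw [Real.sin_sub_pi] at this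
      linarith
    have h2 : 0 < c * R := by positivity
    rw [← hsn] at h2
    nlinarith
  rw [← hcs, mul_div_cancel_left₀ _ hρ.ne', Real.arccos_cos (by linarith) hle]

/-- The analytic part of the action that comes from the outer turning point. -/
def outerPart (b c : ℝ) : ℝ :=
  2 * (outerRoot b c + (2 + b) * outerRoot b c / 4 * momentCoeff₁ b c
    + outerRoot b c ^ 3 * momentCoeff₂ b c)

/-- The difference of the action and the leading terms of its expansion. -/
def actionRemainder (h j : ℝ) : ℝ :=
  2 * π * action h j - (4 / 3 - π * |j| + j * Complex.arg ⟨h, j⟩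
    + vanishingAction h j * Real.log (16 / √(h ^ 2 + j ^ 2)))

/-- The analytic part of the remainder. -/
def regularPart (b c : ℝ) : ℝ :=
  ((1 - b) * √(1 - b))⁻¹ * outerPart b c - 4 / 3
    + vanishingAction (energy b c) (angMom b c) * Real.log ((2 + b + 2 * outerRoot b c) / 16)
    + angMom b c * angleShift b c

/-- The logarithm of the ratio of the normalised and the physical parameters. -/
def ratioLog (b c : ℝ) : ℂ := Complex.log (⟨b, c⟩ / ⟨energy b c, angMom b c⟩)

theorem vanishingAction_neg (h j : ℝ) : vanishingAction h (-j) = vanishingAction h j := by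
  simp [vanishingAction, vanishingPeriod, branch]

theorem action_neg (h j : ℝ) : action h (-j) = action h j := by
  simp [action, radialAction, radial, neg_div]

theorem quadRoot_neg (b c y : ℝ) : quadRoot b (-c) y = quadRoot b c y := by
  simp [quadRoot]

theorem momentCoeff₁_neg (b c : ℝ) : momentCoeff₁ b (-c) = momentCoeff₁ b c := by
  simp [momentCoeff₁, momentOp]

theorem momentCoeff₂_neg (b c : ℝ) : momentCoeff₂ b (-c) = momentCoeff₂ b c := by
  simp [momentCoeff₂, momentOp]

/-- In the upper half plane both arguments lie in `[0, π)`, so their difference stays in `(-π, π)`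
and no multiple of `2π` intervenes. -/
theorem arg_sub_arg {b c h j : ℝ} (hc : 0 < c) (hj : 0 < j) :
    (Complex.log ((⟨b, c⟩ : ℂ) / ⟨h, j⟩)).im = Complex.arg ⟨b, c⟩ - Complex.arg ⟨h, j⟩ := by
  have hx : (⟨b, c⟩ : ℂ) ≠ 0 := fun h => hc.ne' (congrArg Complex.im h)
  have hy : (⟨h, j⟩ : ℂ) ≠ 0 := fun h => hj.ne' (congrArg Complex.im h)
  have h1 := Complex.arg_div_coe_angle hx hy
  have h2 : 0 ≤ Complex.arg ⟨b, c⟩ := Complex.arg_nonneg_iff.2 hc.le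
  have h3 : 0 ≤ Complex.arg ⟨h, j⟩ := Complex.arg_nonneg_iff.2 hj.le
  have h4 : Complex.arg ⟨b, c⟩ < π := lt_of_le_of_ne (Complex.arg_le_pi _) fun h => by
    have := (Complex.arg_eq_pi_iff.1 h).2
    exact hc.ne' this
  have h5 : Complex.arg ⟨h, j⟩ < π := lt_of_le_of_ne (Complex.arg_le_pi _) fun h => by
    have := (Complex.arg_eq_pi_iff.1 h).2
    exact hj.ne' this
  rw [← Real.Angle.coe_sub] at h1
  have h6 := congrArg Real.Angle.toReal h1
  rw [Complex.arg_coe_angle_toReal_eq_arg, Real.Angle.toReal_coe_eq_self_iff.2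
    ⟨by linarith, by linarith⟩] at h6
  rw [Complex.log_im, h6]

/-- With `Z = (1 - b)^(-3/2)` the factor of `-log √(b² + c²)` in the action is `2 Z (b / 2 - (b² +
c²) / 8 · μ₁)`, which is the vanishing action. Replacing modulus and argument of `b + i c` by those
of `h + i j` costs the real and imaginary part of `ratioLog`; everything else belongs to the outer
turning point. -/
theorem actionRemainder_eq_of_nonneg (H : ActionBounds b c) :
    actionRemainder (energy b c) (angMom b c) = regularPart b c
      - (vanishingAction (energy b c) (angMom b c) * (ratioLog b c).re
        - angMom b c * (ratioLog b c).im) := by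
  have hb1 : 0 < 1 - b := by linarith [(abs_le.1 H.hb).2]
  have hc8 : |c| ≤ 1 / 8 := by rw [abs_of_nonneg H.hc0]; exact H.hc
  have hR := outerRoot_pos H.hb hc8
  have hρ := H.rho_pos
  have hj0 : 0 ≤ angMom b c := div_nonneg H.hc0 (by positivity)
  set j := angMom b c with hj
  set h := energy b c with hh
  have hne : 0 < √(h ^ 2 + j ^ 2) := by
    refine Real.sqrt_pos.2 ?_
    rcases H.hc0.eq_or_lt with hc | hc
    · have hb0 : b ≠ 0 := by
        rintro rfl
        have := H.ne
        rw [← hc] at this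
        simp at this
      have : h ≠ 0 := by
        rw [hh, energy, ← hc]
        simp only [ne_eq, OfNat.ofNat_ne_zero, not_false_eq_true, zero_pow, zero_div, add_zero]
        positivity
      positivity
    · have : 0 < j := div_pos hc (by positivity)
      positivity
  have hre : (ratioLog b c).re = Real.log √(b ^ 2 + c ^ 2) - Real.log √(h ^ 2 + j ^ 2) := by
    rw [ratioLog, Complex.log_re, norm_div, Complex.norm_eq_sqrt_sq_add_sq,
      Complex.norm_eq_sqrt_sq_add_sq, Real.log_div hρ.ne' hne.ne']
  -- For `c = 0` the arguments may jump, but the factor `j` vanishes.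
  have him : j * (Complex.arg ⟨h, j⟩ + (ratioLog b c).im) + j * angleShift b c
      = j * Real.arccos ((b - c ^ 2 / 2) / √(b ^ 2 + c ^ 2)) := by
    rcases H.hc0.eq_or_lt with hc | hc
    · have : j = 0 := by rw [hj, angMom, ← hc, zero_div]
      simp [this]
    · have hj' : 0 < angMom b c := div_pos hc (by positivity)
      rw [ratioLog, arg_sub_arg hc hj', arccos_eq H hc]
      ring
  have hv : vanishingAction h j
      = (b - (b ^ 2 + c ^ 2) / 4 * momentCoeff₁ b c) / ((1 - b) * √(1 - b)) :=
    vanishingAction_eq H.hb hc8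
  have hlog1 : Real.log (16 / √(h ^ 2 + j ^ 2)) = Real.log 16 - Real.log √(h ^ 2 + j ^ 2) :=
    Real.log_div (by norm_num) hne.ne'
  have hL : 0 < 2 + b + 2 * outerRoot b c := by linarith [(abs_le.1 H.hb).1]
  have hlog2 : Real.log ((2 + b + 2 * outerRoot b c) / 16)
      = Real.log (2 + b + 2 * outerRoot b c) - Real.log 16 := Real.log_div hL.ne' (by norm_num)
  have hjc : j = c * ((1 - b) * √(1 - b))⁻¹ := by rw [hj, angMom, div_eq_mul_inv]
  rw [actionRemainder, regularPart, hlog1, hlog2, hh, hj, action_energy_angMom H, H.integral_eq,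
    H.actionMoment_zero, H.actionMoment_one, ← hh, ← hj, abs_of_nonneg hj0, hre, outerPart]
  rw [div_eq_mul_inv] at hv
  generalize ((1 - b) * √(1 - b))⁻¹ = Z at *
  generalize Real.log (2 + b + 2 * quadRoot b c 1) = L₁ at *
  generalize Real.log √(b ^ 2 + c ^ 2) = L₂ at *
  generalize Real.arccos ((b - c ^ 2 / 2) / √(b ^ 2 + c ^ 2)) = θ at *
  linear_combination (L₂ - L₁) * hv - him + (π - θ) * hjc

/-- Reflection in `c` leaves the action and the regular part unchanged and conjugates `ratioLog`, so
`c < 0` follows from `c > 0`, where neither argument is `π`. -/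
theorem actionRemainder_eq (hb : |b| ≤ 1 / 32) (hc : |c| ≤ 1 / 8) (hne : 0 < b ^ 2 + c ^ 2) :
    actionRemainder (energy b c) (angMom b c) = regularPart b c
      - (vanishingAction (energy b c) (angMom b c) * (ratioLog b c).re
        - angMom b c * (ratioLog b c).im) := by
  rcases le_total 0 c with h0 | h0
  · exact actionRemainder_eq_of_nonneg ⟨hb, h0, (le_abs_self c).trans hc, hne⟩
  rcases h0.eq_or_lt with rfl | h0
  · exact actionRemainder_eq_of_nonneg ⟨hb, le_rfl, (le_abs_self _).trans hc, hne⟩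
  have hb1 : 0 < 1 - b := by linarith [(abs_le.1 hb).2]
  have h := actionRemainder_eq_of_nonneg (b := b) (c := -c) ⟨hb, by linarith,
    (neg_le_abs c).trans hc, by rwa [neg_sq]⟩
  have e1 : energy b (-c) = energy b c := by simp [energy]
  have e2 : angMom b (-c) = -angMom b c := by simp [angMom, neg_div]
  have hj : angMom b c < 0 := div_neg_of_neg_of_pos h0 (by positivity)
  have e3 : actionRemainder (energy b c) (-angMom b c) = actionRemainder (energy b c) (angMom b c) := by
    have harg : Complex.arg ⟨energy b c, -angMom b c⟩ = -Complex.arg ⟨energy b c, angMom b c⟩ := by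
      have := Complex.arg_conj ⟨energy b c, angMom b c⟩
      rw [if_neg] at this
      · exact this
      · intro h
        exact hj.ne (Complex.arg_eq_pi_iff.1 h).2
    rw [actionRemainder, actionRemainder, action_neg, vanishingAction_neg, abs_neg, neg_sq, harg]
    ring
  have hR : outerRoot b (-c) = outerRoot b c := quadRoot_neg b c 1
  have e4 : regularPart b (-c) = regularPart b c := by
    rw [regularPart, regularPart, e1, e2, vanishingAction_neg, outerPart, outerPart, hR,
      momentCoeff₁_neg, momentCoeff₂_neg, angleShift, angleShift, hR, neg_div, Real.arctan_neg]
    ring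
  have e5 : ratioLog b (-c) = (starRingEnd ℂ) (ratioLog b c) := by
    rw [ratioLog, ratioLog, e1, e2, ← Complex.log_conj]
    · congr 1
      rw [map_div₀]
      rfl
    · intro h
      have h1 := arg_sub_arg (b := b) (c := -c) (h := energy b c) (j := -angMom b c) (by linarith)
        (by linarith)
      have hq : (⟨b, -c⟩ / ⟨energy b c, -angMom b c⟩ : ℂ)
          = (starRingEnd ℂ) (⟨b, c⟩ / ⟨energy b c, angMom b c⟩) := by
        rw [map_div₀]
        rfl
      have h2 : Complex.arg (⟨b, -c⟩ / ⟨energy b c, -angMom b c⟩) = π := by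
        rw [hq, Complex.arg_conj, if_pos h]
      rw [Complex.log_im, h2] at h1
      have h3 : 0 ≤ Complex.arg ⟨energy b c, -angMom b c⟩ :=
        Complex.arg_nonneg_iff.2 (by simp; linarith)
      have h4 : Complex.arg ⟨b, -c⟩ < π := lt_of_le_of_ne (Complex.arg_le_pi _) fun h => by
        have := (Complex.arg_eq_pi_iff.1 h).2
        simp at this
        linarith
      linarith
  rw [e1, e2, e3, e4, e5, vanishingAction_neg] at h
  rw [h]
  simp

end ActionFormula

/-! ### Analytic change between normalised and physical parameters, and convergence of the normal
form. -/

section AnalyticParameters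

open scoped ContDiff

theorem hasFDerivAt_mul_of_eq_one {E : Type*} [NormedAddCommGroup E] [NormedSpace ℝ E]
    {f g : E → ℝ} {x : E} {f' : E →L[ℝ] ℝ} (hf : HasFDerivAt f f' x) (hg : DifferentiableAt ℝ g x)
    (hf0 : f x = 0) (hg1 : g x = 1) : HasFDerivAt (fun y => f y * g y) f' x := by
  have := hf.mul hg.hasFDerivAt
  rw [hf0, hg1, zero_smul, one_smul, zero_add] at this
  exact this

/-- The physical parameters as a function of the normalised ones. -/
def paramMap (x : ℝ × ℝ) : ℝ × ℝ := (energy x.1 x.2, angMom x.1 x.2)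

theorem paramMap_zero : paramMap (0, 0) = (0, 0) := by simp [paramMap, energy, angMom]

theorem contDiffAt_inv_scale :
    ContDiffAt ℝ ω (fun x : ℝ × ℝ => ((1 - x.1) * √(1 - x.1))⁻¹) (0, 0) := by
  have h1 : ContDiffAt ℝ ω (fun x : ℝ × ℝ => 1 - x.1) (0, 0) := by fun_prop
  exact (h1.mul (h1.sqrt (by norm_num))).inv (by norm_num)

theorem contDiffAt_inv_sq :
    ContDiffAt ℝ ω (fun x : ℝ × ℝ => ((1 - x.1) ^ 2)⁻¹) (0, 0) := by
  have h1 : ContDiffAt ℝ ω (fun x : ℝ × ℝ => (1 - x.1) ^ 2) (0, 0) := by fun_prop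
  exact h1.inv (by norm_num)

theorem contDiffAt_paramMap : ContDiffAt ℝ ω paramMap (0, 0) := by
  refine ContDiffAt.prodMk ?_ ?_
  · have h1 : ContDiffAt ℝ ω (fun x : ℝ × ℝ => x.1 + x.2 ^ 2 / 4) (0, 0) := by fun_prop
    exact (h1.mul contDiffAt_inv_sq).congr_of_eventuallyEq
      (Eventually.of_forall fun x => div_eq_mul_inv _ _)
  · have h1 : ContDiffAt ℝ ω (fun x : ℝ × ℝ => x.2) (0, 0) := by fun_prop
    exact (h1.mul contDiffAt_inv_scale).congr_of_eventuallyEq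
      (Eventually.of_forall fun x => div_eq_mul_inv _ _)

theorem hasFDerivAt_paramMap :
    HasFDerivAt paramMap (ContinuousLinearMap.id ℝ (ℝ × ℝ)) (0, 0) := by
  have h1 : HasFDerivAt (fun x : ℝ × ℝ => x.1 + x.2 ^ 2 / 4) (ContinuousLinearMap.fst ℝ ℝ ℝ)
      (0, 0) := by
    have h := (hasFDerivAt_fst (𝕜 := ℝ) (p := ((0, 0) : ℝ × ℝ))).add
      (((hasFDerivAt_snd (𝕜 := ℝ) (p := ((0, 0) : ℝ × ℝ))).pow 2).mul_const (1 / 4 : ℝ))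
    refine (h.congr_fderiv ?_).congr_of_eventuallyEq (Eventually.of_forall fun x => ?_)
    · ext <;> simp
    · simp [div_eq_mul_inv]
  have h2 := hasFDerivAt_mul_of_eq_one h1
    (contDiffAt_inv_sq.differentiableAt (by simp)) (by norm_num) (by norm_num)
  have h3 := hasFDerivAt_mul_of_eq_one (hasFDerivAt_snd (𝕜 := ℝ) (p := ((0, 0) : ℝ × ℝ)))
    (contDiffAt_inv_scale.differentiableAt (by simp)) rfl (by norm_num)
  exact h2.prodMk h3

theorem exists_paramInv : ∃ G : ℝ × ℝ → ℝ × ℝ, AnalyticAt ℝ G (0, 0) ∧ G (0, 0) = (0, 0) ∧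
    (∀ᶠ x in 𝓝 (0, 0), paramMap (G x) = x) ∧ (∀ᶠ x in 𝓝 (0, 0), G (paramMap x) = x) ∧
    HasFDerivAt G (ContinuousLinearMap.id ℝ (ℝ × ℝ)) (0, 0) :=
  exists_analytic_inverse contDiffAt_paramMap.analyticAt paramMap_zero hasFDerivAt_paramMap

/-- The normalised parameters as a function of the physical ones. -/
def paramInv : ℝ × ℝ → ℝ × ℝ := exists_paramInv.choose

theorem analyticAt_paramInv : AnalyticAt ℝ paramInv (0, 0) := exists_paramInv.choose_spec.1

theorem paramInv_zero : paramInv (0, 0) = (0, 0) := exists_paramInv.choose_spec.2.1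

theorem eventually_paramMap_paramInv : ∀ᶠ x in 𝓝 (0, 0), paramMap (paramInv x) = x :=
  exists_paramInv.choose_spec.2.2.1

theorem hasFDerivAt_paramInv :
    HasFDerivAt paramInv (ContinuousLinearMap.id ℝ (ℝ × ℝ)) (0, 0) :=
  exists_paramInv.choose_spec.2.2.2.2

theorem tendsto_paramInv : Tendsto paramInv (𝓝 (0, 0)) (𝓝 (0, 0)) := by
  have := analyticAt_paramInv.continuousAt.tendsto
  rwa [paramInv_zero] at this

theorem eventually_abs_le {r : ℝ} (hr : 0 < r) :
    ∀ᶠ x : ℝ × ℝ in 𝓝 (0, 0), |x.1| ≤ r ∧ |x.2| ≤ r := by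
  filter_upwards [Metric.closedBall_mem_nhds ((0, 0) : ℝ × ℝ) hr] with x hx
  rw [show ((0, 0) : ℝ × ℝ) = 0 from rfl, mem_closedBall_zero_iff] at hx
  exact ⟨(norm_fst_le x).trans hx, (norm_snd_le x).trans hx⟩

/-- The vanishing period in the normalised parameters. -/
def normalisedAction (x : ℝ × ℝ) : ℝ :=
  (x.1 - (x.1 ^ 2 + x.2 ^ 2) / 4 * momentCoeff₁ x.1 x.2) * ((1 - x.1) * √(1 - x.1))⁻¹

theorem vanishingAction_eventuallyEq :
    (fun x : ℝ × ℝ => vanishingAction x.1 x.2) =ᶠ[𝓝 (0, 0)]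
      fun x => normalisedAction (paramInv x) := by
  filter_upwards [eventually_paramMap_paramInv,
    tendsto_paramInv.eventually (eventually_abs_le (r := 1 / 32) (by norm_num))] with x hx hs
  have h := vanishingAction_eq hs.1 (hs.2.trans (by norm_num))
  have h1 := congrArg Prod.fst hx
  have h2 := congrArg Prod.snd hx
  simp only [paramMap, energy, angMom] at h1 h2
  rw [h1, h2] at h
  rw [h, normalisedAction, div_eq_mul_inv]

theorem contDiffAt_sq_add_sq :
    ContDiffAt ℝ ω (fun x : ℝ × ℝ => (x.1 ^ 2 + x.2 ^ 2) / 4) (0, 0) := by fun_prop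

theorem analyticAt_normalisedAction : AnalyticAt ℝ normalisedAction (0, 0) :=
  (analyticAt_fst.sub (contDiffAt_sq_add_sq.analyticAt.mul analyticAt_momentCoeff₁)).mul
    contDiffAt_inv_scale.analyticAt

theorem hasFDerivAt_normalisedAction :
    HasFDerivAt normalisedAction (ContinuousLinearMap.fst ℝ ℝ ℝ) (0, 0) := by
  have h1 : HasFDerivAt (fun x : ℝ × ℝ => (x.1 ^ 2 + x.2 ^ 2) / 4) (0 : ℝ × ℝ →L[ℝ] ℝ) (0, 0) := by
    have h := (((hasFDerivAt_fst (𝕜 := ℝ) (p := ((0, 0) : ℝ × ℝ))).pow 2).add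
      ((hasFDerivAt_snd (𝕜 := ℝ) (p := ((0, 0) : ℝ × ℝ))).pow 2)).mul_const (1 / 4 : ℝ)
    refine (h.congr_fderiv ?_).congr_of_eventuallyEq (Eventually.of_forall fun x => ?_)
    · ext <;> simp
    · simp [div_eq_mul_inv]
  have h2 : HasFDerivAt (fun x : ℝ × ℝ => (x.1 ^ 2 + x.2 ^ 2) / 4 * momentCoeff₁ x.1 x.2)
      (0 : ℝ × ℝ →L[ℝ] ℝ) (0, 0) := by
    have h := h1.mul analyticAt_momentCoeff₁.differentiableAt.hasFDerivAt
    refine h.congr_fderiv ?_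
    simp
  have h3 := (hasFDerivAt_fst (𝕜 := ℝ) (p := ((0, 0) : ℝ × ℝ))).sub h2
  rw [sub_zero] at h3
  exact hasFDerivAt_mul_of_eq_one h3 (contDiffAt_inv_scale.differentiableAt (by simp))
    (by norm_num) (by norm_num)

/-- Analyticity comes from the resolvent formula in `(b, c)`, composed with the analytic inverse
`paramInv`. -/
theorem analyticAt_vanishingAction :
    AnalyticAt ℝ (fun x : ℝ × ℝ => vanishingAction x.1 x.2) (0, 0) := by
  have h0 := analyticAt_normalisedAction
  rw [← paramInv_zero] at h0
  exact (h0.fun_comp analyticAt_paramInv).congr vanishingAction_eventuallyEq.symm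

theorem hasFDerivAt_vanishingAction :
    HasFDerivAt (fun x : ℝ × ℝ => vanishingAction x.1 x.2) (ContinuousLinearMap.fst ℝ ℝ ℝ)
      (0, 0) := by
  have h0 := hasFDerivAt_normalisedAction
  rw [← paramInv_zero] at h0
  have h1 := h0.comp _ hasFDerivAt_paramInv
  rw [ContinuousLinearMap.comp_id] at h1
  exact h1.congr_of_eventuallyEq vanishingAction_eventuallyEq

theorem vanishingAction_zero : vanishingAction 0 0 = 0 := by
  have := vanishingAction_eventuallyEq.self_of_nhds
  simpa [normalisedAction, paramInv_zero] using this

/-- The inverse of the Birkhoff normal form. -/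
theorem IsBirkhoffNormalForm.hasSum_vanishingAction {ν : ℕ → ℕ → ℝ}
    (hν : IsBirkhoffNormalForm ν) :
    ∀ᶠ x : ℝ × ℝ in 𝓝 (0, 0), HasSum (fun n : ℕ × ℕ =>
      ν n.1 n.2 * (vanishingAction x.1 x.2 / √2) ^ n.1 * (x.2 / √2) ^ n.2) x.1 := by
  have hp : (0 : ℝ) < √2 := by positivity
  set S : ℝ × ℝ →L[ℝ] ℝ × ℝ := (ContinuousLinearMap.fst ℝ ℝ ℝ).prod
    (√2 • ContinuousLinearMap.snd ℝ ℝ ℝ) with hS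
  have hSx : ∀ x : ℝ × ℝ, S x = (x.1, √2 * x.2) := fun x => by simp [hS]
  have hS0 : S (0, 0) = (0, 0) := by simp [hSx]
  -- The inverse function theorem is applied to a map tangent to the identity. The factor `√2`
  -- between the vanishing action and the first argument of the normal form is restored below by
  -- `M`.
  set F : ℝ × ℝ → ℝ × ℝ := fun x => (vanishingAction x.1 (√2 * x.2), x.2) with hF
  have hFS : F = fun x : ℝ × ℝ => ((fun y : ℝ × ℝ => vanishingAction y.1 y.2) (S x), x.2) := by
    funext x; rw [hSx]
  have hFa : AnalyticAt ℝ F (0, 0) := by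
    rw [hFS]
    have h0 := analyticAt_vanishingAction
    rw [← hS0] at h0
    exact (h0.fun_comp (S.analyticAt _)).prod analyticAt_snd
  have hFd : HasFDerivAt F (ContinuousLinearMap.id ℝ (ℝ × ℝ)) (0, 0) := by
    rw [hFS]
    have h0 := hasFDerivAt_vanishingAction
    rw [← hS0] at h0
    have h1 := (h0.comp _ S.hasFDerivAt).prodMk (hasFDerivAt_snd (𝕜 := ℝ) (p := ((0, 0) : ℝ × ℝ)))
    refine h1.congr_fderiv ?_
    ext <;> simp [hSx]
  have hF0 : F (0, 0) = (0, 0) := by simp [hF, vanishingAction_zero]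
  obtain ⟨G, hGa, hG0, -, hGF, -⟩ := exists_analytic_inverse hFa hF0 hFd
  set M : ℝ × ℝ →L[ℝ] ℝ × ℝ := (√2 • ContinuousLinearMap.fst ℝ ℝ ℝ).prod
    (ContinuousLinearMap.snd ℝ ℝ ℝ) with hM
  have hMx : ∀ x : ℝ × ℝ, M x = (√2 * x.1, x.2) := fun x => by simp [hM]
  have hM0 : M (0, 0) = (0, 0) := by simp [hMx]
  have hYa : AnalyticAt ℝ (fun x : ℝ × ℝ => (fun a b => (G (M (a, b))).1) x.1 x.2) (0, 0) := by
    rw [← hM0] at hGa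
    exact analyticAt_fst.comp (hGa.fun_comp (M.analyticAt _))
  have hinv : ∀ᶠ x : ℝ × ℝ in 𝓝 (0, 0),
      (fun a b => (G (M (a, b))).1) ((fun h l => vanishingAction h (√2 * l) / √2) x.1 x.2) x.2
        = x.1 := by
    filter_upwards [hGF] with x hx
    simp only [hMx]
    rw [mul_div_cancel₀ _ hp.ne']
    exact congrArg Prod.fst hx
  obtain ⟨r, hr⟩ := hν.hasDoubleSeries (Y := fun a b => (G (M (a, b))).1)
    hasDoubleSeries_vanishingAction hYa hinv
  have ht : Tendsto (fun x : ℝ × ℝ => (vanishingAction x.1 x.2 / √2, x.2 / √2)) (𝓝 (0, 0))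
      (𝓝 (0, 0)) := by
    have h1 := analyticAt_vanishingAction.continuousAt.tendsto
    simp only [vanishingAction_zero] at h1
    have h2 := h1.div_const √2
    rw [zero_div] at h2
    exact h2.prodMk_nhds (Continuous.tendsto' (by fun_prop) _ _ (by simp))
  have ht2 : Tendsto (fun x : ℝ × ℝ => (x.1, x.2 / √2)) (𝓝 (0, 0)) (𝓝 (0, 0)) :=
    Continuous.tendsto' (by fun_prop) _ _ (by simp)
  filter_upwards [ht.eventually (eventually_abs_le (r := r / 2) (by linarith [hr.pos])),
    ht2.eventually hinv] with x hx hi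
  have h := hr.hasSum _ _ (hx.1.trans_lt (by linarith [hr.pos])) (hx.2.trans_lt (by linarith [hr.pos]))
  simp only [mul_div_cancel₀ x.2 hp.ne'] at hi
  rwa [hi] at h

theorem contDiffAt_outerRoot : ContDiffAt ℝ ω (fun x : ℝ × ℝ => outerRoot x.1 x.2) (0, 0) := by
  have h1 : ContDiffAt ℝ ω (fun x : ℝ × ℝ => (1 : ℝ) ^ 2 + x.1 * 1 - x.2 ^ 2 / 4) (0, 0) := by
    fun_prop
  exact h1.sqrt (by norm_num)

theorem outerRoot_zero : outerRoot 0 0 = 1 := by simp [outerRoot, quadRoot]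

theorem contDiffAt_angleShift : ContDiffAt ℝ ω (fun x : ℝ × ℝ => angleShift x.1 x.2) (0, 0) := by
  have h0 := contDiffAt_outerRoot
  have h1 : ContDiffAt ℝ ω (fun x : ℝ × ℝ => x.2 / (2 * (outerRoot x.1 x.2 + 1))) (0, 0) := by
    refine ContDiffAt.div (by fun_prop) (by fun_prop) ?_
    norm_num [outerRoot_zero]
  exact contDiffAt_const.mul (Real.contDiff_arctan.contDiffAt.comp _ h1)

theorem contDiffAt_outerLog : ContDiffAt ℝ ω
    (fun x : ℝ × ℝ => Real.log ((2 + x.1 + 2 * outerRoot x.1 x.2) / 16)) (0, 0) := by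
  have h0 := contDiffAt_outerRoot
  refine ContDiffAt.log (by fun_prop) ?_
  norm_num [outerRoot_zero]

theorem analyticAt_outerPart : AnalyticAt ℝ (fun x : ℝ × ℝ => outerPart x.1 x.2) (0, 0) := by
  have h0 := contDiffAt_outerRoot
  have h1 : ContDiffAt ℝ ω (fun x : ℝ × ℝ => (2 + x.1) * outerRoot x.1 x.2 / 4) (0, 0) := by
    fun_prop
  have h2 : ContDiffAt ℝ ω (fun x : ℝ × ℝ => outerRoot x.1 x.2 ^ 3) (0, 0) := by fun_prop
  exact analyticAt_const.mul ((h0.analyticAt.add (h1.analyticAt.mul analyticAt_momentCoeff₁)).add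
    (h2.analyticAt.mul analyticAt_momentCoeff₂))

/-- The regular part of the remainder in the physical parameters. -/
def regularRemainder (x : ℝ × ℝ) : ℝ :=
  ((1 - (paramInv x).1) * √(1 - (paramInv x).1))⁻¹ * outerPart (paramInv x).1 (paramInv x).2 - 4 / 3
    + vanishingAction x.1 x.2
      * Real.log ((2 + (paramInv x).1 + 2 * outerRoot (paramInv x).1 (paramInv x).2) / 16)
    + x.2 * angleShift (paramInv x).1 (paramInv x).2

/-- The logarithm of the ratio of the two pairs of parameters. -/
def paramLog (x : ℝ × ℝ) : ℂ :=
  Complex.log (⟨(paramInv x).1, (paramInv x).2⟩ / ⟨x.1, x.2⟩)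

theorem analyticAt_regularRemainder : AnalyticAt ℝ regularRemainder (0, 0) := by
  have key : ∀ {f : ℝ × ℝ → ℝ}, AnalyticAt ℝ f (0, 0) →
      AnalyticAt ℝ (fun x => f (paramInv x)) (0, 0) := fun {f} hf => by
    rw [← paramInv_zero] at hf
    exact hf.fun_comp analyticAt_paramInv
  exact ((((key contDiffAt_inv_scale.analyticAt).mul (key analyticAt_outerPart)).sub
    analyticAt_const).add (analyticAt_vanishingAction.mul (key contDiffAt_outerLog.analyticAt))).add
    (analyticAt_snd.mul (key contDiffAt_angleShift.analyticAt))

theorem actionRemainder_eventuallyEq : ∀ᶠ x : ℝ × ℝ in 𝓝[≠] (0, 0),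
    actionRemainder x.1 x.2 = regularRemainder x
      - (vanishingAction x.1 x.2 * (paramLog x).re - x.2 * (paramLog x).im) := by
  have hl : 𝓝[≠] ((0, 0) : ℝ × ℝ) ≤ 𝓝 (0, 0) := nhdsWithin_le_nhds
  filter_upwards [hl eventually_paramMap_paramInv, hl
    (tendsto_paramInv.eventually (eventually_abs_le (r := 1 / 32) (by norm_num))),
    self_mem_nhdsWithin] with x hx hs hne
  have hne' : 0 < (paramInv x).1 ^ 2 + (paramInv x).2 ^ 2 := by
    rcases (by positivity : 0 ≤ (paramInv x).1 ^ 2 + (paramInv x).2 ^ 2).eq_or_lt with h | h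
    · exfalso
      have h1 : (paramInv x).1 = 0 := by nlinarith [sq_nonneg (paramInv x).1, sq_nonneg (paramInv x).2]
      have h2 : (paramInv x).2 = 0 := by nlinarith [sq_nonneg (paramInv x).1, sq_nonneg (paramInv x).2]
      have h3 : paramInv x = (0, 0) := Prod.ext h1 h2
      rw [h3, paramMap_zero] at hx
      exact hne hx.symm
    · exact h
  have h := actionRemainder_eq hs.1 (hs.2.trans (by norm_num)) hne'
  have h1 : energy (paramInv x).1 (paramInv x).2 = x.1 := congrArg Prod.fst hx
  have h2 : angMom (paramInv x).1 (paramInv x).2 = x.2 := congrArg Prod.snd hx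
  rw [regularPart, ratioLog, h1, h2] at h
  exact h

end AnalyticParameters

/-! ### Calculus of asymptotic expansions in homogeneous rational functions. -/

section HomogeneousExpansions

/-- Homogeneous functions of degree `k` that are polynomials divided by a power of
`x² + y²`. -/
def HomRat (k : ℕ) (f : ℝ × ℝ → ℝ) : Prop :=
  ∃ (p : MvPolynomial (Fin 2) ℝ) (m : ℕ), p.IsHomogeneous (k + 2 * m) ∧
    ∀ x : ℝ × ℝ, x ≠ (0, 0) →
      f x = MvPolynomial.eval ![x.1, x.2] p / (x.1 ^ 2 + x.2 ^ 2) ^ m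

theorem sq_add_sq_pos {x : ℝ × ℝ} (hx : x ≠ (0, 0)) : 0 < x.1 ^ 2 + x.2 ^ 2 := by
  by_contra! h
  have h1 : x.1 = 0 := by nlinarith [sq_nonneg x.1, sq_nonneg x.2]
  have h2 : x.2 = 0 := by nlinarith [sq_nonneg x.1, sq_nonneg x.2]
  exact hx (Prod.ext h1 h2)

/-- The polynomial `x² + y²`. -/
def sqPoly : MvPolynomial (Fin 2) ℝ := MvPolynomial.X 0 ^ 2 + MvPolynomial.X 1 ^ 2

theorem sqPoly_isHomogeneous : sqPoly.IsHomogeneous 2 :=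
  (MvPolynomial.isHomogeneous_X_pow _ _).add (MvPolynomial.isHomogeneous_X_pow _ _)

theorem eval_sqPoly (x y : ℝ) : MvPolynomial.eval ![x, y] sqPoly = x ^ 2 + y ^ 2 := by
  simp [sqPoly]

theorem HomRat.congr {k : ℕ} {f g : ℝ × ℝ → ℝ} (hf : HomRat k f)
    (h : ∀ x, x ≠ (0, 0) → f x = g x) : HomRat k g := by
  obtain ⟨p, m, hp, hx⟩ := hf
  exact ⟨p, m, hp, fun x h0 => by rw [← h x h0, hx x h0]⟩

theorem HomRat.add {k : ℕ} {f g : ℝ × ℝ → ℝ} (hf : HomRat k f) (hg : HomRat k g) :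
    HomRat k (fun x => f x + g x) := by
  obtain ⟨p, m, hp, hpx⟩ := hf
  obtain ⟨q, n, hq, hqx⟩ := hg
  refine ⟨p * sqPoly ^ n + q * sqPoly ^ m, m + n, ?_, fun x hx => ?_⟩
  · refine MvPolynomial.IsHomogeneous.add ?_ ?_
    · convert hp.mul (sqPoly_isHomogeneous.pow n) using 1; ring
    · convert hq.mul (sqPoly_isHomogeneous.pow m) using 1; ring
  · have := (sq_add_sq_pos hx).ne'
    simp only
    rw [hpx x hx, hqx x hx, map_add, map_mul, map_mul, map_pow, map_pow, eval_sqPoly]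
    field_simp
    ring

theorem HomRat.mul {k l : ℕ} {f g : ℝ × ℝ → ℝ} (hf : HomRat k f) (hg : HomRat l g) :
    HomRat (k + l) (fun x => f x * g x) := by
  obtain ⟨p, m, hp, hpx⟩ := hf
  obtain ⟨q, n, hq, hqx⟩ := hg
  refine ⟨p * q, m + n, ?_, fun x hx => ?_⟩
  · convert hp.mul hq using 1; ring
  · simp only
    rw [hpx x hx, hqx x hx, map_mul, pow_add, div_mul_div_comm]

theorem HomRat.const_mul {k : ℕ} {f : ℝ × ℝ → ℝ} (a : ℝ) (hf : HomRat k f) :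
    HomRat k (fun x => a * f x) := by
  obtain ⟨p, m, hp, hpx⟩ := hf
  refine ⟨MvPolynomial.C a * p, m, ?_, fun x hx => ?_⟩
  · convert (MvPolynomial.isHomogeneous_C _ a).mul hp using 1; ring
  · simp only
    rw [hpx x hx, map_mul, MvPolynomial.eval_C, mul_div_assoc]

theorem HomRat.zero (k : ℕ) : HomRat k (fun _ => 0) :=
  ⟨0, 0, MvPolynomial.isHomogeneous_zero _ _ _, fun x _ => by simp⟩

theorem HomRat.one : HomRat 0 (fun _ => 1) :=
  ⟨1, 0, MvPolynomial.isHomogeneous_one _ _, fun x _ => by simp⟩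

theorem HomRat.sum {k : ℕ} {ι : Type*} (s : Finset ι) {f : ι → ℝ × ℝ → ℝ}
    (hf : ∀ i ∈ s, HomRat k (f i)) : HomRat k (fun x => ∑ i ∈ s, f i x) := by
  classical
  induction s using Finset.induction_on with
  | empty => simpa using HomRat.zero k
  | insert a s ha ih =>
    simp only [Finset.sum_insert ha]
    exact (hf a (Finset.mem_insert_self _ _)).add
      (ih fun i hi => hf i (Finset.mem_insert_of_mem hi))

theorem homRat_monomial (a : ℝ) (i j : ℕ) :
    HomRat (i + j) (fun x => a * x.1 ^ i * x.2 ^ j) := by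
  refine ⟨MvPolynomial.C a * MvPolynomial.X 0 ^ i * MvPolynomial.X 1 ^ j, 0, ?_, fun x _ => ?_⟩
  · convert ((MvPolynomial.isHomogeneous_C (Fin 2) a).mul
      (MvPolynomial.isHomogeneous_X_pow 0 i)).mul (MvPolynomial.isHomogeneous_X_pow 1 j) using 1
    ring
  · simp

theorem homRat_homPart (C : ℕ → ℕ → ℝ) (k : ℕ) : HomRat k (fun x => homPart C k x.1 x.2) := by
  refine HomRat.sum _ fun n hn => ?_
  rw [← Finset.HasAntidiagonal.mem_antidiagonal.1 hn]
  exact homRat_monomial _ _ _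

theorem norm_sq_le (x : ℝ × ℝ) : ‖x‖ ^ 2 ≤ x.1 ^ 2 + x.2 ^ 2 := by
  rcases max_choice ‖x.1‖ ‖x.2‖ with h | h <;>
  · rw [Prod.norm_def, h, Real.norm_eq_abs, sq_abs]
    nlinarith [sq_nonneg x.1, sq_nonneg x.2]

theorem abs_eval_le {p : MvPolynomial (Fin 2) ℝ} {n : ℕ} (hp : p.IsHomogeneous n) (x : ℝ × ℝ) :
    |MvPolynomial.eval ![x.1, x.2] p| ≤ (∑ d ∈ p.support, |p.coeff d|) * ‖x‖ ^ n := by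
  rw [MvPolynomial.eval_eq', Finset.sum_mul]
  refine (Finset.abs_sum_le_sum_abs _ _).trans (Finset.sum_le_sum fun d hd => ?_)
  have hd' : d 0 + d 1 = n := by
    have := hp (MvPolynomial.mem_support_iff.1 hd)
    rw [← this, Finsupp.weight_apply, Finsupp.sum_fintype _ _ (by simp)]
    simp
  rw [abs_mul, Fin.prod_univ_two, abs_mul, abs_pow, abs_pow, ← hd', pow_add]
  gcongr
  · exact norm_fst_le x
  · exact norm_snd_le x

theorem HomRat.bound {k : ℕ} {f : ℝ × ℝ → ℝ} (hf : HomRat k f) :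
    ∃ C, ∀ x, x ≠ (0, 0) → |f x| ≤ C * ‖x‖ ^ k := by
  obtain ⟨p, m, hp, hpx⟩ := hf
  refine ⟨∑ d ∈ p.support, |p.coeff d|, fun x hx => ?_⟩
  have h1 := sq_add_sq_pos hx
  have h0 : 0 < ‖x‖ := norm_pos_iff.2 hx
  rw [hpx x hx, abs_div, abs_of_pos (a := (x.1 ^ 2 + x.2 ^ 2) ^ m) (by positivity),
    div_le_iff₀ (by positivity)]
  refine (abs_eval_le hp x).trans ?_
  rw [pow_add, pow_mul, mul_assoc]
  gcongr
  exact norm_sq_le x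

theorem HomRat.isBigO {k : ℕ} {f : ℝ × ℝ → ℝ} (hf : HomRat k f) :
    f =O[𝓝[≠] (0, 0)] (fun x => ‖x‖ ^ k) := by
  obtain ⟨C, hC⟩ := hf.bound
  refine IsBigO.of_bound C ?_
  filter_upwards [self_mem_nhdsWithin] with x hx
  rw [norm_pow, norm_norm]
  exact hC x hx

theorem HomRat.smul {k : ℕ} {f : ℝ × ℝ → ℝ} (hf : HomRat k f) {t : ℝ} (ht : t ≠ 0)
    {x : ℝ × ℝ} (hx : x ≠ (0, 0)) : f (t * x.1, t * x.2) = t ^ k * f x := by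
  obtain ⟨p, m, hp, hpx⟩ := hf
  have htx : ((t * x.1, t * x.2) : ℝ × ℝ) ≠ (0, 0) := by
    intro h
    have h1 := congrArg Prod.fst h
    have h2 := congrArg Prod.snd h
    simp only [mul_eq_zero, ht, false_or] at h1 h2
    exact hx (Prod.ext h1 h2)
  have h1 := (sq_add_sq_pos hx).ne'
  have he : MvPolynomial.eval ![t * x.1, t * x.2] p
      = t ^ (k + 2 * m) * MvPolynomial.eval ![x.1, x.2] p := by
    rw [MvPolynomial.eval_eq', MvPolynomial.eval_eq', Finset.mul_sum]
    refine Finset.sum_congr rfl fun d hd => ?_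
    have hd' : d 0 + d 1 = k + 2 * m := by
      have := hp (MvPolynomial.mem_support_iff.1 hd)
      rw [← this, Finsupp.weight_apply, Finsupp.sum_fintype _ _ (by simp)]
      simp
    rw [Fin.prod_univ_two, Fin.prod_univ_two, ← hd', pow_add]
    simp only [Matrix.cons_val_zero, Matrix.cons_val_one, mul_pow]
    ring
  rw [hpx _ htx, hpx x hx]
  simp only
  rw [he, show (t * x.1) ^ 2 + (t * x.2) ^ 2 = t ^ 2 * (x.1 ^ 2 + x.2 ^ 2) by ring, mul_pow,
    ← pow_mul, pow_add]
  field_simp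

theorem tendsto_ray {x : ℝ × ℝ} (hx : x ≠ (0, 0)) :
    Tendsto (fun t : ℝ => (t * x.1, t * x.2)) (𝓝[>] 0) (𝓝[≠] (0, 0)) := by
  refine tendsto_nhdsWithin_iff.2 ⟨?_, ?_⟩
  · exact (Continuous.tendsto' (by fun_prop) 0 (0, 0) (by simp)).mono_left nhdsWithin_le_nhds
  · filter_upwards [self_mem_nhdsWithin] with t ht h
    have h1 := congrArg Prod.fst h
    have h2 := congrArg Prod.snd h
    simp only [mul_eq_zero, (show t ≠ 0 from ne_of_gt ht), false_or] at h1 h2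
    exact hx (Prod.ext h1 h2)

theorem norm_ray_isBigO (x : ℝ × ℝ) (N : ℕ) :
    (fun t : ℝ => ‖((t * x.1, t * x.2) : ℝ × ℝ)‖ ^ N) =O[𝓝[>] 0] (fun t : ℝ => t ^ N) := by
  refine IsBigO.pow (IsBigO.norm_left ?_) _
  refine IsBigO.prod_left ?_ ?_ <;>
    simpa using (isBigO_refl (fun t : ℝ => t) _).mul (isBigO_const_const _ one_ne_zero _)

/-- The restriction of an asymptotic expansion in homogeneous functions to a ray. -/
theorem isBigO_ray {c : ℕ → ℝ × ℝ → ℝ} (hc : ∀ k, HomRat k (c k)) {f : ℝ × ℝ → ℝ} {N : ℕ}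
    (h : (fun x => f x - ∑ k ∈ Finset.range N, c k x) =O[𝓝[≠] (0, 0)] (fun x => ‖x‖ ^ N))
    {x : ℝ × ℝ} (hx : x ≠ (0, 0)) :
    (fun t : ℝ => f (t * x.1, t * x.2) - ∑ k ∈ Finset.range N, c k x * t ^ k)
      =O[𝓝[>] 0] (fun t => t ^ N) := by
  refine ((h.comp_tendsto (tendsto_ray hx)).trans (norm_ray_isBigO x N)).congr' ?_ EventuallyEq.rfl
  filter_upwards [self_mem_nhdsWithin] with t ht
  simp only [Function.comp_apply]
  congr 1
  exact Finset.sum_congr rfl fun k _ => by rw [(hc k).smul (ne_of_gt ht) hx, mul_comm]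

/-- Along a ray the expansion becomes a polynomial in `t`, whose coefficients are determined up to
the order of the error. -/
theorem HomRat.eq_zero_of_isBigO {c : ℕ → ℝ × ℝ → ℝ} (hc : ∀ k, HomRat k (c k)) {f : ℝ × ℝ → ℝ}
    {N : ℕ} (h : (fun x => f x - ∑ k ∈ Finset.range N, c k x) =O[𝓝[≠] (0, 0)] (fun x => ‖x‖ ^ N))
    (hf : f =O[𝓝[≠] (0, 0)] (fun x => ‖x‖ ^ N)) {k : ℕ} (hk : k < N) {x : ℝ × ℝ}
    (hx : x ≠ (0, 0)) : c k x = 0 := by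
  have h1 := isBigO_ray hc h hx
  have h2 := (hf.comp_tendsto (tendsto_ray hx)).trans (norm_ray_isBigO x N)
  refine eq_zero_of_sum_isBigO (N := N) (a := fun k => c k x) ((h2.sub h1).congr_left fun t => ?_)
    k hk
  simp

/-- The same for complex functions. -/
def HomRatC (k : ℕ) (f : ℝ × ℝ → ℂ) : Prop :=
  HomRat k (fun x => (f x).re) ∧ HomRat k (fun x => (f x).im)

theorem HomRatC.add {k : ℕ} {f g : ℝ × ℝ → ℂ} (hf : HomRatC k f) (hg : HomRatC k g) :
    HomRatC k (fun x => f x + g x) := ⟨hf.1.add hg.1, hf.2.add hg.2⟩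

theorem HomRatC.mul {k l : ℕ} {f g : ℝ × ℝ → ℂ} (hf : HomRatC k f) (hg : HomRatC l g) :
    HomRatC (k + l) (fun x => f x * g x) := by
  refine ⟨((hf.1.mul hg.1).add ((hf.2.mul hg.2).const_mul (-1))).congr fun x _ => ?_,
    (hf.1.mul hg.2).add (hf.2.mul hg.1)⟩
  simp only [Complex.mul_re]
  ring

theorem HomRatC.zero (k : ℕ) : HomRatC k (fun _ => 0) := ⟨HomRat.zero k, HomRat.zero k⟩

theorem HomRatC.one : HomRatC 0 (fun _ => 1) := ⟨HomRat.one, HomRat.zero 0⟩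

theorem HomRatC.const_mul {k : ℕ} {f : ℝ × ℝ → ℂ} (a : ℂ) (hf : HomRatC k f) :
    HomRatC k (fun x => a * f x) := by
  have h : HomRatC 0 (fun _ => a) :=
    ⟨(HomRat.one.const_mul a.re).congr fun _ _ => mul_one _,
      (HomRat.one.const_mul a.im).congr fun _ _ => mul_one _⟩
  have := h.mul hf
  rwa [zero_add] at this

theorem HomRatC.sum {k : ℕ} {ι : Type*} (s : Finset ι) {f : ι → ℝ × ℝ → ℂ}
    (hf : ∀ i ∈ s, HomRatC k (f i)) : HomRatC k (fun x => ∑ i ∈ s, f i x) :=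
  ⟨(HomRat.sum s fun i hi => (hf i hi).1).congr fun _ _ => (Complex.re_sum _ _).symm,
    (HomRat.sum s fun i hi => (hf i hi).2).congr fun _ _ => (Complex.im_sum _ _).symm⟩

theorem HomRatC.isBigO {k : ℕ} {f : ℝ × ℝ → ℂ} (hf : HomRatC k f) :
    f =O[𝓝[≠] (0, 0)] (fun x => ‖x‖ ^ k) := by
  refine IsBigO.trans (g := fun x => |(f x).re| + |(f x).im|) (IsBigO.of_norm_le fun x => ?_) ?_
  · exact Complex.norm_le_abs_re_add_abs_im _
  · exact hf.1.isBigO.norm_left.add hf.2.isBigO.norm_left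

/-- Asymptotic expansions in homogeneous functions at the origin. -/
structure HasExp (f : ℝ × ℝ → ℂ) (c : ℕ → ℝ × ℝ → ℂ) : Prop where
  hom : ∀ k, HomRatC k (c k)
  isBigO : ∀ N, (fun x => f x - ∑ k ∈ Finset.range N, c k x) =O[𝓝[≠] (0, 0)] (fun x => ‖x‖ ^ N)

variable {f g : ℝ × ℝ → ℂ} {c d : ℕ → ℝ × ℝ → ℂ}

theorem isBigO_norm_pow_of_le {m n : ℕ} (h : m ≤ n) :
    (fun x : ℝ × ℝ => ‖x‖ ^ n) =O[𝓝[≠] (0, 0)] (fun x => ‖x‖ ^ m) := by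
  refine IsBigO.of_bound 1 ?_
  filter_upwards [nhdsWithin_le_nhds (Metric.closedBall_mem_nhds ((0, 0) : ℝ × ℝ) one_pos)]
    with x hx
  rw [show ((0, 0) : ℝ × ℝ) = 0 from rfl, mem_closedBall_zero_iff] at hx
  rw [norm_pow, norm_pow, norm_norm, one_mul]
  exact pow_le_pow_of_le_one (norm_nonneg _) hx h

theorem HasExp.of_succ (hc : ∀ k, HomRatC k (c k)) (h : ∀ N,
    (fun x => f x - ∑ k ∈ Finset.range (N + 1), c k x) =O[𝓝[≠] (0, 0)] (fun x => ‖x‖ ^ (N + 1))) :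
    HasExp f c where
  hom := hc
  isBigO N := by
    have h1 := ((h N).trans (isBigO_norm_pow_of_le N.le_succ)).add (hc N).isBigO
    refine h1.congr_left fun x => ?_
    rw [Finset.sum_range_succ]
    ring

theorem HasExp.add (hf : HasExp f c) (hg : HasExp g d) :
    HasExp (fun x => f x + g x) (fun k x => c k x + d k x) where
  hom k := (hf.hom k).add (hg.hom k)
  isBigO N := ((hf.isBigO N).add (hg.isBigO N)).congr_left fun x => by
    rw [Finset.sum_add_distrib]; ring

theorem HasExp.const_mul (a : ℂ) (hf : HasExp f c) :
    HasExp (fun x => a * f x) (fun k x => a * c k x) where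
  hom k := (hf.hom k).const_mul a
  isBigO N := ((hf.isBigO N).const_mul_left a).congr_left fun x => by
    rw [mul_sub, Finset.mul_sum]

theorem HasExp.bounded (hf : HasExp f c) : f =O[𝓝[≠] (0, 0)] (fun _ => (1 : ℝ)) := by
  simpa using hf.isBigO 0

/-- The Cauchy product of two expansions. -/
def cauchy (c d : ℕ → ℝ × ℝ → ℂ) (k : ℕ) (x : ℝ × ℝ) : ℂ :=
  ∑ n ∈ Finset.HasAntidiagonal.antidiagonal k, c n.1 x * d n.2 x

theorem HasExp.mul (hf : HasExp f c) (hg : HasExp g d) :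
    HasExp (fun x => f x * g x) (cauchy c d) where
  hom k := by
    refine HomRatC.sum _ fun n hn => ?_
    rw [← Finset.HasAntidiagonal.mem_antidiagonal.1 hn]
    exact (hf.hom _).mul (hg.hom _)
  isBigO N := by
    -- `f g - ∑ cauchy = ∑_{k < N} c k (g - ∑_{l < N - k} d l) + (f - ∑ c k) g`
    have h1 : (fun x => (f x - ∑ k ∈ Finset.range N, c k x) * g x)
        =O[𝓝[≠] (0, 0)] (fun x => ‖x‖ ^ N) := by
      simpa using (hf.isBigO N).mul hg.bounded
    have h2 : (fun x => ∑ k ∈ Finset.range N,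
        c k x * (g x - ∑ l ∈ Finset.range (N - k), d l x))
        =O[𝓝[≠] (0, 0)] (fun x => ‖x‖ ^ N) := by
      refine IsBigO.fun_sum fun k hk => ?_
      refine ((hf.hom k).isBigO.mul (hg.isBigO (N - k))).congr_right fun x => ?_
      rw [← pow_add, Nat.add_sub_cancel' (Finset.mem_range.1 hk).le]
    refine (h1.add h2).congr_left fun x => ?_
    have h3 : ∑ k ∈ Finset.range N, cauchy c d k x
        = ∑ k ∈ Finset.range N, c k x * ∑ l ∈ Finset.range (N - k), d l x := by
      simp only [cauchy, Finset.Nat.sum_antidiagonal_eq_sum_range_succ (fun i j => c i x * d j x),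
        Finset.mul_sum]
      have := Finset.sum_sigma' (Finset.range N) (fun k => Finset.range (N - k))
        (fun k l => c k x * d l x)
      rw [this, Finset.sum_sigma']
      refine Finset.sum_bij' (fun a _ => ⟨a.2, a.1 - a.2⟩) (fun a _ => ⟨a.1 + a.2, a.1⟩) ?_ ?_ ?_ ?_ ?_
      · rintro ⟨a, b⟩ h; simp at h ⊢; omega
      · rintro ⟨a, b⟩ h; simp at h ⊢; omega
      · rintro ⟨a, b⟩ h; simp at h ⊢; omega
      · rintro ⟨a, b⟩ h; simp at h ⊢
      · rintro ⟨a, b⟩ h; simp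
    rw [h3]
    simp only [mul_sub, Finset.sum_sub_distrib, sub_mul, ← Finset.sum_mul]
    ring

theorem HasExp.of_analyticAt {F : ℝ → ℝ → ℝ}
    (hF : AnalyticAt ℝ (fun x : ℝ × ℝ => F x.1 x.2) (0, 0)) :
    ∃ c, HasExp (fun x => (F x.1 x.2 : ℂ)) c := by
  obtain ⟨C, r, hC⟩ := exists_hasDoubleSeries hF
  refine ⟨fun k x => (homPart C k x.1 x.2 : ℂ), fun k => ⟨?_, ?_⟩, fun N => ?_⟩
  · simpa using homRat_homPart C k
  · simpa using HomRat.zero k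
  · refine IsBigO.of_norm_left (((hC.isBigO N).mono nhdsWithin_le_nhds).norm_left.congr_left
      fun x => ?_)
    rw [← Complex.norm_real]
    push_cast
    rfl

theorem HasExp.eq_zero (hf : HasExp f c) {N : ℕ} (h : f =O[𝓝[≠] (0, 0)] (fun x => ‖x‖ ^ N))
    {k : ℕ} (hk : k < N) {x : ℝ × ℝ} (hx : x ≠ (0, 0)) : c k x = 0 := by
  refine Complex.ext ?_ ?_
  · refine HomRat.eq_zero_of_isBigO (f := fun x => (f x).re) (fun k => (hf.hom k).1)
      (IsBigO.trans (IsBigO.of_bound' (Eventually.of_forall fun y => ?_)) (hf.isBigO N))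
      (IsBigO.trans (IsBigO.of_bound' (Eventually.of_forall fun y => ?_)) h) hk hx
    · rw [← Complex.re_sum, ← Complex.sub_re]; exact Complex.abs_re_le_norm _
    · exact Complex.abs_re_le_norm _
  · refine HomRat.eq_zero_of_isBigO (f := fun x => (f x).im) (fun k => (hf.hom k).2)
      (IsBigO.trans (IsBigO.of_bound' (Eventually.of_forall fun y => ?_)) (hf.isBigO N))
      (IsBigO.trans (IsBigO.of_bound' (Eventually.of_forall fun y => ?_)) h) hk hx
    · rw [← Complex.im_sum, ← Complex.sub_im]; exact Complex.abs_im_le_norm _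
    · exact Complex.abs_im_le_norm _

theorem mk_ne_zero {x : ℝ × ℝ} (hx : x ≠ (0, 0)) : (⟨x.1, x.2⟩ : ℂ) ≠ 0 := fun h =>
  hx (Prod.ext (congrArg Complex.re h) (congrArg Complex.im h))

theorem norm_le_norm_mk (x : ℝ × ℝ) : ‖x‖ ≤ ‖(⟨x.1, x.2⟩ : ℂ)‖ :=
  max_le (Complex.abs_re_le_norm ⟨x.1, x.2⟩) (Complex.abs_im_le_norm ⟨x.1, x.2⟩)

/-- Division by `x + i y` lowers the degree by one. -/
theorem HasExp.div_mk (hf : HasExp f c) (h0 : ∀ x, x ≠ (0, 0) → c 0 x = 0) :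
    HasExp (fun x => f x / ⟨x.1, x.2⟩) (fun k x => c (k + 1) x / ⟨x.1, x.2⟩) where
  hom k := by
    have key : ∀ u : ℝ × ℝ → ℝ, HomRat (k + 1) u →
        HomRat k (fun x => u x * x.1 / (x.1 ^ 2 + x.2 ^ 2)) ∧
        HomRat k (fun x => u x * x.2 / (x.1 ^ 2 + x.2 ^ 2)) := by
      rintro u ⟨p, m, hp, hpx⟩
      constructor
      · refine ⟨p * MvPolynomial.X 0, m + 1, ?_, fun x hx => ?_⟩
        · convert hp.mul (MvPolynomial.isHomogeneous_X ℝ 0) using 1; ring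
        · simp only
          rw [hpx x hx, map_mul, MvPolynomial.eval_X, pow_succ, div_mul_eq_mul_div, div_div]
          rfl
      · refine ⟨p * MvPolynomial.X 1, m + 1, ?_, fun x hx => ?_⟩
        · convert hp.mul (MvPolynomial.isHomogeneous_X ℝ 1) using 1; ring
        · simp only
          rw [hpx x hx, map_mul, MvPolynomial.eval_X, pow_succ, div_mul_eq_mul_div, div_div]
          rfl
    obtain ⟨h1, h2⟩ := key _ (hf.hom (k + 1)).1
    obtain ⟨h3, h4⟩ := key _ (hf.hom (k + 1)).2
    constructor
    · refine (h1.add h4).congr fun x _ => ?_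
      rw [Complex.div_re, Complex.normSq_mk]
      ring
    · refine (h3.add (h2.const_mul (-1))).congr fun x _ => ?_
      rw [Complex.div_im, Complex.normSq_mk]
      ring
  isBigO N := by
    have h1 := hf.isBigO (N + 1)
    obtain ⟨C, hC⟩ := h1.bound
    refine IsBigO.of_bound C ?_
    filter_upwards [hC, self_mem_nhdsWithin] with x hx hne
    have hn : 0 < ‖x‖ := norm_pos_iff.2 hne
    have hm := norm_le_norm_mk x
    have he : f x / ⟨x.1, x.2⟩ - ∑ k ∈ Finset.range N, c (k + 1) x / ⟨x.1, x.2⟩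
        = (f x - ∑ k ∈ Finset.range (N + 1), c k x) / ⟨x.1, x.2⟩ := by
      rw [Finset.sum_range_succ', h0 x hne, add_zero, sub_div, Finset.sum_div]
    rw [he, norm_div, div_le_iff₀ (hn.trans_le hm)]
    refine hx.trans ?_
    rw [norm_pow, norm_norm, norm_pow, norm_norm, pow_succ, ← mul_assoc]
    have hC0 : 0 ≤ C * ‖x‖ ^ N := by
      have h3 := (norm_nonneg _).trans hx
      rw [norm_pow, norm_norm, pow_succ, ← mul_assoc] at h3
      exact nonneg_of_mul_nonneg_left h3 hn
    exact mul_le_mul_of_nonneg_left hm hC0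

/-- The coefficients of the powers of an expansion. -/
def powCoeff (c : ℕ → ℝ × ℝ → ℂ) : ℕ → ℕ → ℝ × ℝ → ℂ
  | 0 => fun k _ => if k = 0 then 1 else 0
  | n + 1 => cauchy (powCoeff c n) c

theorem HasExp.one : HasExp (fun _ => 1) (fun k _ => if k = 0 then 1 else 0) := by
  refine HasExp.of_succ (fun k => ?_) fun N => ?_
  · rcases eq_or_ne k 0 with rfl | h
    · simpa using HomRatC.one
    · simpa [h] using HomRatC.zero k
  · refine (isBigO_zero (fun x : ℝ × ℝ => ‖x‖ ^ (N + 1)) _).congr_left fun x => ?_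
    simp

theorem HasExp.pow (hf : HasExp f c) : ∀ n, HasExp (fun x => f x ^ n) (powCoeff c n)
  | 0 => by simpa only [pow_zero] using! HasExp.one
  | n + 1 => by simpa only [pow_succ] using! (hf.pow n).mul hf

theorem powCoeff_eq_zero {x : ℝ × ℝ} (h0 : c 0 x = 0) : ∀ {n k : ℕ}, k < n → powCoeff c n k x = 0
  | n + 1, k, hk => by
    rw [powCoeff, cauchy]
    refine Finset.sum_eq_zero fun i hi => ?_
    have hi' := Finset.HasAntidiagonal.mem_antidiagonal.1 hi
    rcases lt_or_ge i.1 n with h | h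
    · rw [powCoeff_eq_zero h0 h, zero_mul]
    · rw [show i.2 = 0 by omega, h0, mul_zero]

theorem HasExp.sum {ι : Type*} (s : Finset ι) {F : ι → ℝ × ℝ → ℂ} {C : ι → ℕ → ℝ × ℝ → ℂ}
    (h : ∀ i ∈ s, HasExp (F i) (C i)) :
    HasExp (fun x => ∑ i ∈ s, F i x) (fun k x => ∑ i ∈ s, C i k x) where
  hom k := HomRatC.sum _ fun i hi => (h i hi).hom k
  isBigO N := by
    refine (IsBigO.fun_sum fun i hi => (h i hi).isBigO N).congr_left fun x => ?_
    rw [Finset.sum_sub_distrib, Finset.sum_comm]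

/-- Without a constant term the `n`-th power of the expansion begins in degree `n`. So each degree
of the logarithmic series is a finite sum, and the Taylor remainder is `O(f^(N+1))`. -/
theorem HasExp.log_one_add (hf : HasExp f c) (h0 : ∀ x, x ≠ (0, 0) → c 0 x = 0) :
    ∃ d, HasExp (fun x => Complex.log (1 + f x)) d := by
  -- Division by zero makes `a 0 = 0`.
  set a : ℕ → ℂ := fun n => (-1) ^ (n + 1) / n with ha
  have hfO : f =O[𝓝[≠] (0, 0)] (fun x => ‖x‖) := by
    have h2 := hf.isBigO 1
    simp only [pow_one, Finset.range_one, Finset.sum_singleton] at h2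
    refine h2.congr' ?_ EventuallyEq.rfl
    filter_upwards [self_mem_nhdsWithin] with x hx
    rw [h0 x hx, sub_zero]
  have hf0 : Tendsto f (𝓝[≠] (0, 0)) (𝓝 0) := by
    refine hfO.trans_tendsto ?_
    have : Tendsto (fun x : ℝ × ℝ => ‖x‖) (𝓝 (0, 0)) (𝓝 0) :=
      Continuous.tendsto' continuous_norm _ _ (by simp)
    exact this.mono_left nhdsWithin_le_nhds
  refine ⟨fun k x => ∑ n ∈ Finset.range (k + 1), a n * powCoeff c n k x, HasExp.of_succ
    (fun k => HomRatC.sum _ fun n _ => ((hf.pow n).hom k).const_mul _) fun N => ?_⟩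
  have h1 := ((Complex.log_sub_logTaylor_isBigO N).comp_tendsto hf0).trans (hfO.pow (N + 1))
  have h2 := (HasExp.sum (Finset.range (N + 1)) fun n _ => (hf.pow n).const_mul (a n)).isBigO (N + 1)
  refine (h1.add h2).congr' ?_ EventuallyEq.rfl
  filter_upwards [self_mem_nhdsWithin] with x hx
  have h3 : ∑ k ∈ Finset.range (N + 1), ∑ n ∈ Finset.range (N + 1), a n * powCoeff c n k x
      = ∑ k ∈ Finset.range (N + 1), ∑ n ∈ Finset.range (k + 1), a n * powCoeff c n k x := by
    refine Finset.sum_congr rfl fun k hk => ?_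
    symm
    refine Finset.sum_subset (fun n hn => ?_) fun n hn hn' => ?_
    · simp at hn hk ⊢; omega
    · rw [powCoeff_eq_zero (h0 x hx) (by simp at hn'; omega), mul_zero]
  rw [h3]
  simp only [Function.comp_apply, Complex.logTaylor, ha]
  have h4 : ∑ n ∈ Finset.range (N + 1), (-1 : ℂ) ^ (n + 1) / n * f x ^ n
      = ∑ n ∈ Finset.range (N + 1), (-1) ^ (n + 1) * f x ^ n / n :=
    Finset.sum_congr rfl fun n _ => by ring
  rw [h4]
  ring

end HomogeneousExpansions

/-! ### Existence of the homogeneous expansion of the action. -/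

section ActionExpansion

theorem paramInv_isBigO : paramInv =O[𝓝 (0, 0)] (fun x => ‖x‖) := by
  have h := analyticAt_paramInv.differentiableAt.isBigO_sub
  rw [paramInv_zero] at h
  simpa [show ((0, 0) : ℝ × ℝ) = 0 from rfl] using h.norm_right

theorem isBigO_fst_paramInv : (fun x => (paramInv x).1) =O[𝓝 (0, 0)] (fun x => ‖x‖) :=
  isBigO_fst_prod'.trans paramInv_isBigO

theorem isBigO_snd_paramInv : (fun x => (paramInv x).2) =O[𝓝 (0, 0)] (fun x => ‖x‖) :=
  isBigO_snd_prod'.trans paramInv_isBigO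

/-- The normalised parameters solve fixed point equations. -/
theorem eventually_paramInv_eq : ∀ᶠ x : ℝ × ℝ in 𝓝 (0, 0),
    (paramInv x).1 = x.1 * (1 - (paramInv x).1) ^ 2 - (paramInv x).2 ^ 2 / 4 ∧
    (paramInv x).2 = x.2 * ((1 - (paramInv x).1) * √(1 - (paramInv x).1)) := by
  filter_upwards [eventually_paramMap_paramInv,
    tendsto_paramInv.eventually (eventually_abs_le (r := 1 / 32) (by norm_num))] with x hx hs
  have hb : 0 < 1 - (paramInv x).1 := by linarith [(abs_le.1 hs.1).2]
  have h1 : energy (paramInv x).1 (paramInv x).2 = x.1 := congrArg Prod.fst hx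
  have h2 : angMom (paramInv x).1 (paramInv x).2 = x.2 := congrArg Prod.snd hx
  rw [energy, div_eq_iff (by positivity)] at h1
  rw [angMom, div_eq_iff (by positivity)] at h2
  exact ⟨by linarith, h2⟩

/-- The fixed point equation reads `b - h = h b (b - 2) - c² / 4`, a sum of products of two small
quantities. -/
theorem isBigO_fst_paramInv_sub :
    (fun x => (paramInv x).1 - x.1) =O[𝓝 (0, 0)] (fun x => ‖x‖ ^ 2) := by
  have h1 : (fun x : ℝ × ℝ => x.1) =O[𝓝 (0, 0)] (fun x => ‖x‖) := isBigO_fst_prod'.norm_right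
  have hb := isBigO_fst_paramInv
  have hc := isBigO_snd_paramInv
  have hb1 : (fun x => -2 + (paramInv x).1) =O[𝓝 (0, 0)] (fun _ => (1 : ℝ)) := by
    have h : ContinuousAt (fun x => -2 + (paramInv x).1) (0, 0) :=
      continuousAt_const.add analyticAt_paramInv.continuousAt.fst
    exact h.tendsto.isBigO_one ℝ
  have h3 : (fun x : ℝ × ℝ => x.1 * (paramInv x).1 * (-2 + (paramInv x).1)) =O[𝓝 (0, 0)]
      (fun x => ‖x‖ * ‖x‖) := by simpa using (h1.mul hb).mul hb1
  refine (h3.add ((hc.mul hc).const_mul_left (-1 / 4))).congr' ?_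
    (Eventually.of_forall fun x => by ring)
  filter_upwards [eventually_paramInv_eq] with x hx
  linear_combination -hx.1

theorem isBigO_snd_paramInv_sub :
    (fun x => (paramInv x).2 - x.2) =O[𝓝 (0, 0)] (fun x => ‖x‖ ^ 2) := by
  have h1 : (fun x : ℝ × ℝ => x.2) =O[𝓝 (0, 0)] (fun x => ‖x‖) := isBigO_snd_prod'.norm_right
  have hD : DifferentiableAt ℝ (fun b : ℝ => (1 - b) * √(1 - b)) 0 := by
    have : DifferentiableAt ℝ (fun b : ℝ => 1 - b) 0 := by fun_prop
    exact this.mul (this.sqrt (by norm_num))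
  have h0 : Tendsto (fun x => (paramInv x).1) (𝓝 (0, 0)) (𝓝 0) := tendsto_paramInv.fst_nhds
  have h2 := (hD.isBigO_sub.comp_tendsto h0)
  have h3 : (fun x => (1 - (paramInv x).1) * √(1 - (paramInv x).1) - 1)
      =O[𝓝 (0, 0)] (fun x => ‖x‖) := by
    refine (h2.congr_left fun x => ?_).trans ?_
    · simp
    · simpa only [sub_zero] using! isBigO_fst_paramInv
  refine (h1.mul h3).congr' ?_ (Eventually.of_forall fun x => by ring)
  filter_upwards [eventually_paramInv_eq] with x hx
  linear_combination -hx.2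

/-- The singular part is `Re ((𝒥 + i j) L)` with `L = log ((b + i c) / (h + i j))`. As `b + i c` and
`h + i j` agree up to second order, the quotient is `1` plus an expansion without constant term, and
the logarithm stays in the calculus. -/
theorem exists_hasExp_actionRemainder : ∃ c : ℕ → ℝ × ℝ → ℝ, (∀ k, HomRat k (c k)) ∧
    ∀ N, (fun x : ℝ × ℝ => actionRemainder x.1 x.2 - ∑ k ∈ Finset.range N, c k x)
      =O[𝓝[≠] (0, 0)] (fun x => ‖x‖ ^ N) := by
  have hI : HomRatC 0 (fun _ => Complex.I) := by
    simpa using HomRatC.one.const_mul Complex.I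
  have hb : AnalyticAt ℝ (fun x : ℝ × ℝ => (paramInv x).1 - x.1) (0, 0) :=
    (analyticAt_fst.comp analyticAt_paramInv).sub analyticAt_fst
  have hc : AnalyticAt ℝ (fun x : ℝ × ℝ => (paramInv x).2 - x.2) (0, 0) :=
    (analyticAt_snd.comp analyticAt_paramInv).sub analyticAt_snd
  obtain ⟨β, hβ⟩ := HasExp.of_analyticAt (F := fun a b => (paramInv (a, b)).1 - a) hb
  obtain ⟨γ, hγ⟩ := HasExp.of_analyticAt (F := fun a b => (paramInv (a, b)).2 - b) hc
  have hz := hβ.add (hγ.const_mul Complex.I)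
  have hO : (fun x : ℝ × ℝ => (((paramInv x).1 - x.1 : ℝ) : ℂ)
      + Complex.I * (((paramInv x).2 - x.2 : ℝ) : ℂ)) =O[𝓝[≠] (0, 0)] (fun x => ‖x‖ ^ 2) := by
    refine IsBigO.add ?_ (IsBigO.const_mul_left ?_ _)
    · refine IsBigO.of_norm_left ?_
      simp only [Complex.norm_real]
      exact (isBigO_fst_paramInv_sub.mono nhdsWithin_le_nhds).norm_left
    · refine IsBigO.of_norm_left ?_
      simp only [Complex.norm_real]
      exact (isBigO_snd_paramInv_sub.mono nhdsWithin_le_nhds).norm_left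
  -- The coefficients of degree `0` and `1` vanish: the first permits the division by `h + i j`, the
  -- second removes the constant term of the quotient.
  have hz0 := fun x (hx : x ≠ (0, 0)) => hz.eq_zero hO (k := 0) (by norm_num) hx
  have hz1 := fun x (hx : x ≠ (0, 0)) => hz.eq_zero hO (k := 1) (by norm_num) hx
  have hq := hz.div_mk hz0
  obtain ⟨d, hd⟩ := hq.log_one_add fun x hx => by
    simp only [zero_add]
    have := hz1 x hx
    rw [this, zero_div]
  obtain ⟨v, hv⟩ := HasExp.of_analyticAt analyticAt_vanishingAction
  obtain ⟨s, hs⟩ := HasExp.of_analyticAt (F := fun _ b => b) analyticAt_snd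
  obtain ⟨r, hr⟩ := HasExp.of_analyticAt (F := fun a b => regularRemainder (a, b))
    analyticAt_regularRemainder
  have htot := hr.add (((hv.add (hs.const_mul Complex.I)).mul hd).const_mul (-1))
  refine ⟨_, fun k => (htot.hom k).1, fun N => ?_⟩
  refine IsBigO.trans (IsBigO.of_bound 1 ?_) (htot.isBigO N)
  filter_upwards [actionRemainder_eventuallyEq, self_mem_nhdsWithin] with x hx hne
  have hm := mk_ne_zero hne
  have hL : Complex.log (1 + ((((paramInv x).1 - x.1 : ℝ) : ℂ)
      + Complex.I * (((paramInv x).2 - x.2 : ℝ) : ℂ)) / ⟨x.1, x.2⟩) = paramLog x := by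
    rw [paramLog]
    congr 1
    field_simp
    refine Complex.ext ?_ ?_ <;> simp
  rw [one_mul, ← Complex.re_sum]
  refine le_trans (le_of_eq ?_) (Complex.abs_re_le_norm _)
  rw [Real.norm_eq_abs, Complex.sub_re, hx]
  congr 2
  simp only [hL]
  simp
  ring

end ActionExpansion

/-! ### Pairings of shifted harmonic sequences with the coefficients of the square root. -/

section OuterPartExpansion

open scoped BoundedContinuousFunction

/-- The sequence `1, 1/2, 1/3, …`, shifted to the right by `s`. -/
def tailSeq (s : ℕ) : ℕ →ᵇ ℝ :=
  bseq (fun k => if k < s then 0 else 1 / ((k : ℝ) + 1 - s)) 1 fun k => by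
    split_ifs with h
    · simp
    · have : (s : ℝ) ≤ k := by exact_mod_cast not_lt.1 h
      rw [Real.norm_of_nonneg (div_nonneg zero_le_one (by linarith)),
        div_le_one (by linarith)]
      linarith

theorem tailSeq_apply (s k : ℕ) :
    tailSeq s k = if k < s then 0 else 1 / ((k : ℝ) + 1 - s) := rfl

/-- The unit sequences. -/
def unitSeq (s : ℕ) : ℕ →ᵇ ℝ :=
  bseq (fun k => if k = s then 1 else 0) 1 fun k => by split_ifs <;> simp

theorem unitSeq_apply (s k : ℕ) : unitSeq s k = if k = s then 1 else 0 := rfl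

theorem sqrtPairing_unitSeq (s : ℕ) : sqrtPairing (unitSeq s) = sqrtCoeff s := by
  rw [sqrtPairing_apply, tsum_eq_single s]
  · simp [unitSeq_apply]
  · intro k hk
    simp [unitSeq_apply, hk]

theorem hasSum_sqrtPairing (q : ℕ →ᵇ ℝ) : HasSum (fun k => sqrtCoeff k * q k) (sqrtPairing q) := by
  refine Summable.hasSum (Summable.of_norm_bounded (summable_abs_sqrtCoeff.mul_right ‖q‖)
    fun k => ?_)
  rw [norm_mul]
  gcongr
  · exact le_rfl
  · exact q.norm_coe_le_norm _

theorem sqrtCoeff_succ (k : ℕ) : sqrtCoeff (k + 1) = sqrtCoeff k * (k - 1 / 2) / (k + 1) := rfl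

theorem tendsto_sqrtCoeff : Tendsto sqrtCoeff atTop (𝓝 0) :=
  summable_abs_sqrtCoeff.of_abs.tendsto_atTop_zero

/-- Formally, `sqrtPairing (tailSeq s)` is the integral over `[0, 1]` of `y^(-s)` times `√(1 - y)`
minus its Taylor polynomial of degree below `s`, and an integration by parts relates `s` to `s + 1`.
Here it is carried out as a telescoping sum, using the recursion of `sqrtCoeff`. -/
theorem sqrtPairing_tailSeq_succ (s : ℕ) :
    s * sqrtPairing (tailSeq (s + 1))
      = (s - 3 / 2) * sqrtPairing (tailSeq s) + sqrtCoeff s := by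
  have h1 := ((hasSum_sqrtPairing (tailSeq s)).mul_left ((s : ℝ) - 3 / 2)).sub
    ((hasSum_sqrtPairing (tailSeq (s + 1))).mul_left (s : ℝ))
  have h2 := h1.tendsto_sum_nat
  have h3 : ∀ m : ℕ, ∑ k ∈ Finset.range (m + (s + 1)),
      (((s : ℝ) - 3 / 2) * (sqrtCoeff k * tailSeq s k) - s * (sqrtCoeff k * tailSeq (s + 1) k))
        = sqrtCoeff (m + (s + 1)) * (1 + s * (1 / ((m : ℝ) + 1))) - sqrtCoeff s := by
    intro m
    induction m with
    | zero =>
      have hz : ∑ k ∈ Finset.range s, (((s : ℝ) - 3 / 2) * (sqrtCoeff k * tailSeq s k)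
          - s * (sqrtCoeff k * tailSeq (s + 1) k)) = 0 := by
        refine Finset.sum_eq_zero fun k hk => ?_
        have hk' := Finset.mem_range.1 hk
        simp [tailSeq_apply, hk', hk'.trans (Nat.lt_succ_self s)]
      rw [zero_add, Finset.sum_range_succ, hz]
      simp only [tailSeq_apply, lt_irrefl, Nat.lt_succ_self, if_true, if_false]
      rw [sqrtCoeff_succ]
      push_cast
      rw [show (s : ℝ) + 1 - s = 1 by ring]
      field_simp
      ring
    | succ m ih =>
      rw [show m + 1 + (s + 1) = m + (s + 1) + 1 by ring, Finset.sum_range_succ, ih,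
        sqrtCoeff_succ (m + (s + 1))]
      have c1 : ¬ (m + (s + 1) < s) := by omega
      have c2 : ¬ (m + (s + 1) < s + 1) := by omega
      simp only [tailSeq_apply, c1, c2, if_false]
      push_cast
      rw [show (m : ℝ) + (s + 1) + 1 - s = m + 2 by ring,
        show (m : ℝ) + (s + 1) + 1 - (s + 1) = m + 1 by ring, show (m : ℝ) + 1 + 1 = m + 2 by ring]
      field_simp
      ring
  have h4 : Tendsto (fun m : ℕ => sqrtCoeff (m + (s + 1)) * (1 + s * (1 / ((m : ℝ) + 1)))
      - sqrtCoeff s) atTop (𝓝 (0 * (1 + s * 0) - sqrtCoeff s)) :=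
    (((tendsto_add_atTop_iff_nat (s + 1)).2 tendsto_sqrtCoeff).mul (tendsto_const_nhds.add
      (tendsto_const_nhds.mul tendsto_one_div_add_atTop_nhds_zero_nat))).sub tendsto_const_nhds
  have h5 := (tendsto_add_atTop_iff_nat (s + 1)).2 h2
  have h6 := tendsto_nhds_unique (h5.congr h3) h4
  linarith

theorem sqrtPairing_tailSeq_zero : sqrtPairing (tailSeq 0) = 2 / 3 := by
  -- For `s = 0` the left side vanishes and the recursion yields the value for `tailSeq 0`.
  have := sqrtPairing_tailSeq_succ 0
  norm_num [sqrtCoeff] at this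
  linarith

theorem hasSum_sqrtCoeff_succ {y : ℝ} (h0 : 0 < y) (h1 : y < 1) :
    HasSum (fun k => sqrtCoeff (k + 1) * y ^ k) (-(1 + √(1 - y))⁻¹) := by
  have h := hasSum_sqrtCoeff (x := (y : ℂ)) (by
    rw [Complex.norm_real, Real.norm_of_nonneg h0.le]; exact h1)
  rw [show (1 - (y : ℂ)) = ((1 - y : ℝ) : ℂ) by push_cast; rfl,
    ofReal_cpow_half (by linarith)] at h
  have h2 : HasSum (fun k => sqrtCoeff k * y ^ k) √(1 - y) := by
    have := Complex.hasSum_iff _ _ |>.1 h |>.1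
    refine this.congr_fun fun k => ?_
    rw [← Complex.ofReal_pow, ← Complex.ofReal_mul, Complex.ofReal_re]
  have h3 := ((hasSum_nat_add_iff' 1).2 h2).mul_left y⁻¹
  have hs := Real.mul_self_sqrt (show 0 ≤ 1 - y by linarith)
  have hs0 := Real.sqrt_nonneg (1 - y)
  have h4 : y⁻¹ * (√(1 - y) - ∑ i ∈ Finset.range 1, sqrtCoeff i * y ^ i)
      = -(1 + √(1 - y))⁻¹ := by
    simp only [Finset.range_one, Finset.sum_singleton, sqrtCoeff, pow_zero, mul_one]
    field_simp
    linarith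
  rw [h4] at h3
  refine h3.congr_fun fun k => ?_
  rw [pow_succ]
  field_simp

theorem integral_inv_one_add_sqrt :
    ∫ y in (0 : ℝ)..1, -(1 + √(1 - y))⁻¹ = 2 * Real.log 2 - 2 := by
  have hpos : ∀ y : ℝ, 0 < 1 + √(1 - y) := fun y => by positivity
  have hcont : Continuous fun y : ℝ => -(1 + √(1 - y))⁻¹ :=
    (Continuous.inv₀ (by fun_prop) fun y => (hpos y).ne').neg
  rw [intervalIntegral.integral_eq_sub_of_hasDerivAt_of_le (zero_le_one)
    (f := fun y => 2 * √(1 - y) - 2 * Real.log (1 + √(1 - y))) ?_ (fun y hy => ?_)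
    (hcont.intervalIntegrable _ _)]
  · norm_num
  · exact (Continuous.sub (by fun_prop) (continuous_const.mul
      (Continuous.log (by fun_prop) fun y => (hpos y).ne'))).continuousOn
  · have h1 : 0 < 1 - y := by linarith [hy.2]
    have h2 : HasDerivAt (fun y : ℝ => √(1 - y)) (-1 / (2 * √(1 - y))) y :=
      ((hasDerivAt_id y).const_sub 1).sqrt h1.ne'
    have h3 := (h2.const_mul 2).sub (((h2.const_add 1).log (hpos y).ne').const_mul 2)
    refine h3.congr_deriv ?_
    have h4 : 0 < √(1 - y) := Real.sqrt_pos.2 h1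
    have := hpos y
    field_simp
    ring

/-- The recursion cannot reach `s = 1` from `s = 0`, where its left side is multiplied by `0`. The
value is the integral of `(√(1 - y) - 1) / y = -(1 + √(1 - y))⁻¹`, and this is where `log 2` arises.
-/
theorem sqrtPairing_tailSeq_one : sqrtPairing (tailSeq 1) = 2 * Real.log 2 - 2 := by
  have h1 : HasSum (fun k => ∫ y in (0 : ℝ)..1, sqrtCoeff (k + 1) * y ^ k)
      (∫ y in (0 : ℝ)..1, -(1 + √(1 - y))⁻¹) := by
    refine intervalIntegral.hasSum_integral_of_dominated_convergence
      (fun k _ => |sqrtCoeff (k + 1)|) (fun k => ?_) (fun k => ?_) ?_ ?_ ?_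
    · exact (by fun_prop : Continuous fun y : ℝ => sqrtCoeff (k + 1) * y ^ k).aestronglyMeasurable
    · refine Eventually.of_forall fun y hy => ?_
      rw [Set.uIoc_of_le zero_le_one] at hy
      rw [norm_mul, Real.norm_eq_abs, norm_pow, Real.norm_of_nonneg hy.1.le]
      exact mul_le_of_le_one_right (abs_nonneg _) (pow_le_one₀ hy.1.le hy.2)
    · exact Eventually.of_forall fun y _ => (summable_nat_add_iff 1).2 summable_abs_sqrtCoeff
    · exact intervalIntegrable_const
    · have : ∀ᵐ y : ℝ, y ≠ 1 := by simp [MeasureTheory.ae_iff]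
      filter_upwards [this] with y hy hy'
      rw [Set.uIoc_of_le zero_le_one] at hy'
      exact hasSum_sqrtCoeff_succ hy'.1 (lt_of_le_of_ne hy'.2 hy)
  rw [integral_inv_one_add_sqrt] at h1
  have h2 := (hasSum_nat_add_iff' 1).2 (hasSum_sqrtPairing (tailSeq 1))
  simp only [Finset.range_one, Finset.sum_singleton] at h2
  have h3 := h1.unique (h2.congr_fun fun k => ?_)
  · rw [h3]
    simp [tailSeq_apply]
  · rw [intervalIntegral.integral_const_mul, integral_pow, tailSeq_apply, if_neg (by omega)]
    push_cast
    simp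

theorem sqrtPairing_tailSeq_two : sqrtPairing (tailSeq 2) = 1 / 2 - Real.log 2 := by
  have := sqrtPairing_tailSeq_succ 1
  rw [sqrtPairing_tailSeq_one] at this
  norm_num [sqrtCoeff] at this
  linarith

theorem sqrtPairing_tailSeq_three : sqrtPairing (tailSeq 3) = 1 / 16 - Real.log 2 / 4 := by
  have := sqrtPairing_tailSeq_succ 2
  rw [sqrtPairing_tailSeq_two] at this
  norm_num [sqrtCoeff] at this
  linarith

end OuterPartExpansion

/-! ### The analytic part from the outer turning point to third order. -/

section OuterPartExpansion

set_option linter.unusedSimpArgs false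

open scoped BoundedContinuousFunction

/-- The solution of the moment recursion to third order: the coefficient of the first
parameter. -/
def jetB : ℕ →ᵇ ℝ := (1 / 2 : ℝ) • tailSeq 1 + (1 / 2 : ℝ) • unitSeq 0

/-- The coefficient of the square of the first parameter. -/
def jetBB : ℕ →ᵇ ℝ :=
  (-1 / 8 : ℝ) • tailSeq 2 + (-1 / 8 : ℝ) • unitSeq 0 + (1 / 16 : ℝ) • unitSeq 1

/-- The coefficient of the cube of the first parameter. -/
def jetBBB : ℕ →ᵇ ℝ :=
  (1 / 16 : ℝ) • tailSeq 3 + (1 / 16 : ℝ) • unitSeq 0 + (-5 / 96 : ℝ) • unitSeq 2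

/-- The coefficient of the square of the second parameter. -/
def jetCC : ℕ →ᵇ ℝ :=
  (-1 / 8 : ℝ) • tailSeq 2 + (-1 / 8 : ℝ) • unitSeq 0 + (-1 / 16 : ℝ) • unitSeq 1

/-- The coefficient of the first parameter times the square of the second. -/
def jetBCC : ℕ →ᵇ ℝ :=
  (1 / 16 : ℝ) • tailSeq 3 + (1 / 16 : ℝ) • unitSeq 0 + (-1 / 32 : ℝ) • unitSeq 2

theorem shift₁_apply_zero (q : ℕ →ᵇ ℝ) : shift₁ q 0 = 0 := by
  simp [shift₁, shiftWeight₁]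

theorem shift₁_apply_one (q : ℕ →ᵇ ℝ) : shift₁ q 1 = 0 := by
  simp [shift₁, shiftWeight₁]

theorem shift₁_apply (q : ℕ →ᵇ ℝ) (m : ℕ) :
    shift₁ q (m + 2) = -((m + 3 / 2) / (m + 3)) * q (m + 1) := by
  simp [shift₁, shiftWeight₁]

theorem shift₂_apply_zero (q : ℕ →ᵇ ℝ) : shift₂ q 0 = 0 := by
  simp [shift₂, shiftWeight₂]

theorem shift₂_apply_one (q : ℕ →ᵇ ℝ) : shift₂ q 1 = 0 := by
  simp [shift₂, shiftWeight₂]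

theorem shift₂_apply (q : ℕ →ᵇ ℝ) (m : ℕ) :
    shift₂ q (m + 2) = m / (4 * (m + 3)) * q m := by
  simp [shift₂, shiftWeight₂]

/-- Two sequences agree if they do so at the first indices and from the index `4` on. -/
theorem ext_shift {p q : ℕ →ᵇ ℝ} (h0 : p 0 = q 0) (h1 : p 1 = q 1) (h2 : p (0 + 2) = q (0 + 2))
    (h3 : p (1 + 2) = q (1 + 2)) (h4 : ∀ m : ℕ, p (m + 2 + 2) = q (m + 2 + 2)) : p = q := by
  ext n
  match n with
  | 0 => exact h0
  | 1 => exact h1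
  | 2 => exact h2
  | 3 => exact h3
  | m + 4 => exact h4 m

theorem momentSource_apply_zero (x y s : ℝ) : momentSource x y s 0 = x := rfl

theorem momentSource_apply_one (x y s : ℝ) : momentSource x y s 1 = y := rfl

theorem momentSource_apply (x y s : ℝ) (m : ℕ) : momentSource x y s (m + 2) = s / (m + 3) := rfl

/-- At `b = c = 0` the shifts drop out and the solution is `1 / (k + 1)`, the moments of `y^k` on
`[0, 1]`. -/
theorem tailSeq_zero_eq : tailSeq 0 = momentSource 1 (1 / 2) 1 := by
  apply ext_shift
  all_goals try intro m
  all_goals simp only [momentSource_apply_zero, momentSource_apply_one, momentSource_apply,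
    tailSeq_apply]
  all_goals norm_num
  ring

/-- Each jet of the solution is the shift of earlier jets plus the matching jet of the source. The
source constants are the Taylor coefficients of `R(1)`, `(2 + b) R(1) / 4` and `R(1)³`, where `R(1)²
= 1 + b - c² / 4`; the same holds for the jets below. -/
theorem jetB_eq : jetB = shift₁ (tailSeq 0) + momentSource (1 / 2) (1 / 2) (3 / 2) := by
  apply ext_shift
  all_goals try intro m
  all_goals simp only [jetB, BoundedContinuousFunction.add_apply,
    BoundedContinuousFunction.smul_apply, smul_eq_mul, momentSource_apply_zero,
    momentSource_apply_one, momentSource_apply, shift₁_apply_zero, shift₁_apply_one, shift₁_apply,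
    tailSeq_apply, unitSeq_apply]
  all_goals norm_num
  field_simp
  ring

theorem add_two_index (m : ℕ) : ¬ m + 2 + 2 < 2 ∧ ¬ m + 2 + 2 < 3 ∧ ¬ m + 2 + 1 < 2 ∧
    ¬ m + 2 + 1 < 1 ∧ ¬ m + 2 < 1 ∧
    m + 2 + 2 ≠ 0 ∧ m + 2 + 2 ≠ 1 ∧ m + 2 + 2 ≠ 2 ∧ m + 2 + 1 ≠ 0 ∧ m + 2 + 1 ≠ 1 ∧ m + 2 ≠ 0 := by
  omega

theorem jetBB_eq : jetBB = shift₁ jetB + momentSource (-1 / 8) (1 / 16) (3 / 8) := by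
  apply ext_shift
  all_goals try intro m
  all_goals simp only [jetBB, jetB, BoundedContinuousFunction.add_apply,
    BoundedContinuousFunction.smul_apply, smul_eq_mul, momentSource_apply_zero,
    momentSource_apply_one, momentSource_apply, shift₁_apply_zero, shift₁_apply_one, shift₁_apply,
    shift₂_apply_zero, shift₂_apply_one, shift₂_apply, tailSeq_apply, unitSeq_apply]
  iterate 4 norm_num
  obtain ⟨h1, h2, h3, h4, h5, h6, h7, h8, h9, h10, h11⟩ := add_two_index m
  simp only [h1, h2, h3, h4, h5, h6, h7, h8, h9, h10, h11, if_false, Nat.not_lt_zero]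
  push_cast
  ring_nf
  field_simp
  ring

theorem jetBBB_eq : jetBBB = shift₁ jetBB + momentSource (1 / 16) 0 (-1 / 16) := by
  apply ext_shift
  all_goals try intro m
  all_goals simp only [jetBBB, jetBB, BoundedContinuousFunction.add_apply,
    BoundedContinuousFunction.smul_apply, smul_eq_mul, momentSource_apply_zero,
    momentSource_apply_one, momentSource_apply, shift₁_apply_zero, shift₁_apply_one, shift₁_apply,
    shift₂_apply_zero, shift₂_apply_one, shift₂_apply, tailSeq_apply, unitSeq_apply]
  iterate 4 norm_num
  obtain ⟨h1, h2, h3, h4, h5, h6, h7, h8, h9, h10, h11⟩ := add_two_index m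
  simp only [h1, h2, h3, h4, h5, h6, h7, h8, h9, h10, h11, if_false, Nat.not_lt_zero]
  push_cast
  ring_nf
  field_simp
  ring

theorem jetCC_eq : jetCC = shift₂ (tailSeq 0) + momentSource (-1 / 8) (-1 / 16) (-3 / 8) := by
  apply ext_shift
  all_goals try intro m
  all_goals simp only [jetCC, BoundedContinuousFunction.add_apply,
    BoundedContinuousFunction.smul_apply, smul_eq_mul, momentSource_apply_zero,
    momentSource_apply_one, momentSource_apply, shift₁_apply_zero, shift₁_apply_one, shift₁_apply,
    shift₂_apply_zero, shift₂_apply_one, shift₂_apply, tailSeq_apply, unitSeq_apply]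
  iterate 4 norm_num
  obtain ⟨h1, h2, h3, h4, h5, h6, h7, h8, h9, h10, h11⟩ := add_two_index m
  simp only [h1, h2, h3, h4, h5, h6, h7, h8, h9, h10, h11, if_false, Nat.not_lt_zero]
  push_cast
  ring_nf
  field_simp
  ring

theorem jetBCC_eq : jetBCC = shift₁ jetCC + shift₂ jetB + momentSource (1 / 16) 0 (-3 / 16) := by
  apply ext_shift
  all_goals try intro m
  all_goals simp only [jetBCC, jetCC, jetB, BoundedContinuousFunction.add_apply,
    BoundedContinuousFunction.smul_apply, smul_eq_mul, momentSource_apply_zero,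
    momentSource_apply_one, momentSource_apply, shift₁_apply_zero, shift₁_apply_one, shift₁_apply,
    shift₂_apply_zero, shift₂_apply_one, shift₂_apply, tailSeq_apply, unitSeq_apply]
  iterate 4 norm_num
  obtain ⟨h1, h2, h3, h4, h5, h6, h7, h8, h9, h10, h11⟩ := add_two_index m
  simp only [h1, h2, h3, h4, h5, h6, h7, h8, h9, h10, h11, if_false, Nat.not_lt_zero]
  push_cast
  ring_nf
  field_simp
  ring

theorem sqrtPairing_jets (b c : ℝ) :
    sqrtPairing (tailSeq 0 + b • jetB + b ^ 2 • jetBB + b ^ 3 • jetBBB + c ^ 2 • jetCC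
      + (b * c ^ 2) • jetBCC)
      = 2 / 3 + (Real.log 2 - 1 / 2) * b + (Real.log 2 / 8 - 7 / 32) * b ^ 2
        + (7 / 96 - Real.log 2 / 64) * b ^ 3 + (Real.log 2 / 8 - 5 / 32) * c ^ 2
        + (9 / 128 - Real.log 2 / 64) * (b * c ^ 2) := by
  simp only [jetB, jetBB, jetBBB, jetCC, jetBCC, map_add, map_smul, smul_eq_mul,
    sqrtPairing_tailSeq_zero, sqrtPairing_tailSeq_one, sqrtPairing_tailSeq_two,
    sqrtPairing_tailSeq_three, sqrtPairing_unitSeq]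
  have e0 : sqrtCoeff 0 = 1 := rfl
  have e1 : sqrtCoeff 1 = -1 / 2 := by norm_num [sqrtCoeff]
  have e2 : sqrtCoeff 2 = -1 / 8 := by norm_num [sqrtCoeff]
  rw [e0, e1, e2]
  ring

/-- Polynomial approximations of the inhomogeneous terms. -/
def rootPoly (b c : ℝ) : ℝ :=
  1 + b / 2 - b ^ 2 / 8 + b ^ 3 / 16 - c ^ 2 / 8 + b * c ^ 2 / 16

/-- All terms up to third order cancel by the equations of the jets. The leftover shifts carry
factors divisible by `b⁴`, `b² c²` or `c⁴`. -/
theorem momentOp_jets (b c : ℝ) :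
    momentOp b c (tailSeq 0 + b • jetB + b ^ 2 • jetBB + b ^ 3 • jetBBB + c ^ 2 • jetCC
      + (b * c ^ 2) • jetBCC)
      = momentSource (rootPoly b c) (1 / 2 + b / 2 + b ^ 2 / 16 - c ^ 2 / 16)
          (1 + 3 / 2 * b + 3 / 8 * b ^ 2 - b ^ 3 / 16 - 3 / 8 * c ^ 2 - 3 / 16 * (b * c ^ 2))
        - b ^ 4 • shift₁ jetBBB - (b ^ 2 * c ^ 2) • (shift₁ jetBCC + shift₂ jetBB)
        - (b ^ 3 * c ^ 2) • shift₂ jetBBB - c ^ 4 • shift₂ jetCC - (b * c ^ 4) • shift₂ jetBCC := by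
  have hop : ∀ q : ℕ →ᵇ ℝ, momentOp b c q = q - (b • shift₁ q + c ^ 2 • shift₂ q) := fun q => rfl
  rw [hop]
  simp only [map_add, map_smul]
  have hsrc : momentSource (rootPoly b c) (1 / 2 + b / 2 + b ^ 2 / 16 - c ^ 2 / 16)
          (1 + 3 / 2 * b + 3 / 8 * b ^ 2 - b ^ 3 / 16 - 3 / 8 * c ^ 2 - 3 / 16 * (b * c ^ 2))
      = momentSource 1 (1 / 2) 1 + b • momentSource (1 / 2) (1 / 2) (3 / 2)
        + b ^ 2 • momentSource (-1 / 8) (1 / 16) (3 / 8)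
        + b ^ 3 • momentSource (1 / 16) 0 (-1 / 16)
        + c ^ 2 • momentSource (-1 / 8) (-1 / 16) (-3 / 8)
        + (b * c ^ 2) • momentSource (1 / 16) 0 (-3 / 16) := by
    ext n
    match n with
    | 0 =>
      simp only [BoundedContinuousFunction.add_apply, BoundedContinuousFunction.smul_apply,
        smul_eq_mul, momentSource_apply_zero, rootPoly]
      ring
    | 1 =>
      simp only [BoundedContinuousFunction.add_apply, BoundedContinuousFunction.smul_apply,
        smul_eq_mul, momentSource_apply_one]
      ring
    | m + 2 =>
      simp only [BoundedContinuousFunction.add_apply, BoundedContinuousFunction.smul_apply,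
        smul_eq_mul, momentSource_apply]
      ring
  have e1 := eq_sub_of_add_eq' jetB_eq.symm
  have e2 := eq_sub_of_add_eq' jetBB_eq.symm
  have e3 := eq_sub_of_add_eq' jetBBB_eq.symm
  have e4 := eq_sub_of_add_eq' jetCC_eq.symm
  have e5 := eq_sub_of_add_eq' jetBCC_eq.symm
  rw [hsrc, ← tailSeq_zero_eq, e1, e2, e3, e4, e5]
  module

/-- Remainders of order four. -/
theorem isBigO_four {P Q R : ℝ × ℝ → ℝ} (hP : ContinuousAt P (0, 0)) (hQ : ContinuousAt Q (0, 0))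
    (hR : ContinuousAt R (0, 0)) :
    (fun x : ℝ × ℝ => x.1 ^ 4 * P x + x.1 ^ 2 * x.2 ^ 2 * Q x + x.2 ^ 4 * R x)
      =O[𝓝 (0, 0)] (fun x => ‖x‖ ^ 4) := by
  have h1 : (fun x : ℝ × ℝ => x.1) =O[𝓝 (0, 0)] (fun x => ‖x‖) := isBigO_fst_prod'.norm_right
  have h2 : (fun x : ℝ × ℝ => x.2) =O[𝓝 (0, 0)] (fun x => ‖x‖) := isBigO_snd_prod'.norm_right
  have hP1 := hP.tendsto.isBigO_one ℝ
  have hQ1 := hQ.tendsto.isBigO_one ℝ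
  have hR1 := hR.tendsto.isBigO_one ℝ
  have k1 := (h1.pow 4).mul hP1
  have k2 := ((h1.pow 2).mul (h2.pow 2)).mul hQ1
  have k3 := (h2.pow 4).mul hR1
  simp only [mul_one, ← pow_add, Nat.reduceAdd] at k1 k2 k3
  exact (k1.add k2).add k3

/-- Half of `outerPart` is the pairing of the resolvent with the source whose entries are `R(1)`,
`(2 + b) R(1) / 4` and `R(1)³`. The explicit jets invert the operator up to fourth order, so `μ₁`
and `μ₂` need not be expanded separately; the other error comes from replacing `R(1)` by `rootPoly`.
-/
theorem outerPart_isBigO :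
    (fun x : ℝ × ℝ => outerPart x.1 x.2 - 2 * (2 / 3 + (Real.log 2 - 1 / 2) * x.1
      + (Real.log 2 / 8 - 7 / 32) * x.1 ^ 2 + (7 / 96 - Real.log 2 / 64) * x.1 ^ 3
      + (Real.log 2 / 8 - 5 / 32) * x.2 ^ 2 + (9 / 128 - Real.log 2 / 64) * (x.1 * x.2 ^ 2)))
      =O[𝓝 (0, 0)] (fun x => ‖x‖ ^ 4) := by
  set G : (ℕ →ᵇ ℝ) → ℝ × ℝ → ℝ :=
    fun v x => sqrtPairing (Ring.inverse (momentOp x.1 x.2) v) with hG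
  have hGc : ∀ v, ContinuousAt (G v) (0, 0) := fun v =>
    (analyticAt_inverse_pencil shift₁ shift₂ sqrtPairing v).continuousAt
  have hR := contDiffAt_outerRoot.continuousAt
  set S : ℝ × ℝ → ℝ := fun x => (outerRoot x.1 x.2 + rootPoly x.1 x.2)⁻¹ with hS
  have hSc : ContinuousAt S (0, 0) := by
    refine ContinuousAt.inv₀ (hR.add ?_) (by norm_num [outerRoot_zero, rootPoly])
    simp only [rootPoly]
    fun_prop
  have hg1 : ContinuousAt (fun x : ℝ × ℝ => momentCoeff₁ x.1 x.2) (0, 0) :=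
    analyticAt_momentCoeff₁.continuousAt
  have hg2 : ContinuousAt (fun x : ℝ × ℝ => momentCoeff₂ x.1 x.2) (0, 0) :=
    analyticAt_momentCoeff₂.continuousAt
  -- The functions `p`, `q`, `r` are defined by `rootPoly² - R(1)² = b⁴ p + b² c² q + c⁴ r`;
  -- division by `R(1) + rootPoly` is the factor `S`.
  set p : ℝ × ℝ → ℝ := fun x => 5 / 64 - x.1 / 64 + x.1 ^ 2 / 256 + x.2 ^ 2 / 128 with hp
  set q : ℝ × ℝ → ℝ := fun x => 3 / 32 - x.1 / 32 with hq
  set r : ℝ × ℝ → ℝ := fun x => 1 / 64 - x.1 / 64 + x.1 ^ 2 / 256 with hr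
  have hpc : ContinuousAt p (0, 0) := by fun_prop
  have hqc : ContinuousAt q (0, 0) := by fun_prop
  have hrc : ContinuousAt r (0, 0) := by fun_prop
  set T : ℝ × ℝ → ℝ := fun x => -S x * (1 + (2 + x.1) / 4 * momentCoeff₁ x.1 x.2
    + (1 + x.1 - x.2 ^ 2 / 4) * momentCoeff₂ x.1 x.2) with hT
  have hTc : ContinuousAt T (0, 0) := by fun_prop
  have key := isBigO_four
    (P := fun x => 2 * (p x * T x + 1 / 64 * momentCoeff₁ x.1 x.2 + 1 / 16 * momentCoeff₂ x.1 x.2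
      + G (shift₁ jetBBB) x))
    (Q := fun x => 2 * (q x * T x + 1 / 64 * momentCoeff₁ x.1 x.2
      + (3 / 32 - x.1 / 64) * momentCoeff₂ x.1 x.2
      + G (shift₁ jetBCC + shift₂ jetBB) x + x.1 * G (shift₂ jetBBB) x))
    (R := fun x => 2 * (r x * T x + (1 / 32 - x.1 / 64) * momentCoeff₂ x.1 x.2
      + G (shift₂ jetCC) x + x.1 * G (shift₂ jetBCC) x))
    (by have := hGc (shift₁ jetBBB); fun_prop)
    (by
      have := hGc (shift₁ jetBCC + shift₂ jetBB)
      have := hGc (shift₂ jetBBB)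
      fun_prop)
    (by
      have := hGc (shift₂ jetCC)
      have := hGc (shift₂ jetBCC)
      fun_prop)
  refine key.congr' ?_ EventuallyEq.rfl
  filter_upwards [eventually_abs_le (r := 1 / 32) (by norm_num)] with x hx
  obtain ⟨b, c⟩ := x
  simp only at hx
  have hb := abs_le.1 hx.1
  have hc8 : |c| ≤ 1 / 8 := hx.2.trans (by norm_num)
  have hc2 : c ^ 2 ≤ (1 / 32) ^ 2 := by
    rw [← sq_abs]; exact pow_le_pow_left₀ (abs_nonneg _) hx.2 2
  have hlt : |b| + c ^ 2 < 1 := by linarith [hx.1]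
  have hR2 := outerRoot_sq hx.1 hc8
  have hR0 := outerRoot_pos hx.1 hc8
  have hpoly : 0 < rootPoly b c := by
    have hb2 : b ^ 2 ≤ (1 / 32) ^ 2 := by
      rw [← sq_abs]; exact pow_le_pow_left₀ (abs_nonneg _) hx.1 2
    rw [rootPoly]
    nlinarith [mul_nonneg (sq_nonneg b) (by linarith : 0 ≤ b + 1 / 32),
      mul_nonneg (sq_nonneg c) (by linarith : 0 ≤ b + 1 / 32)]
  have hS1 : S (b, c) * (outerRoot b c + rootPoly b c) = 1 := by
    simp only [hS]
    exact inv_mul_cancel₀ (by positivity)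
  have hroot : outerRoot b c - rootPoly b c
      = -(b ^ 4 * p (b, c) + b ^ 2 * c ^ 2 * q (b, c) + c ^ 4 * r (b, c)) * S (b, c) := by
    have h1 : (outerRoot b c - rootPoly b c) * (outerRoot b c + rootPoly b c)
        = -(b ^ 4 * p (b, c) + b ^ 2 * c ^ 2 * q (b, c) + c ^ 4 * r (b, c)) := by
      simp only [hp, hq, hr]
      rw [rootPoly]
      linear_combination hR2
    linear_combination S (b, c) * h1 - (outerRoot b c - rootPoly b c) * hS1
  have hval := sqrtPairing_jets b c
  rw [← inverse_momentOp_apply hlt (momentOp_jets b c)] at hval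
  simp only [map_sub, map_smul, sqrtPairing_inverse_source hlt, smul_eq_mul] at hval
  have hg : ∀ v, sqrtPairing (Ring.inverse (momentOp b c) v) = G v (b, c) := fun v => rfl
  simp only [hg] at hval
  simp only [outerPart, hT]
  have hR3 : outerRoot b c ^ 3 = outerRoot b c * (1 + b - c ^ 2 / 4) := by rw [← hR2]; ring
  rw [hR3, ← hval]
  rw [rootPoly] at hroot ⊢
  generalize momentCoeff₁ b c = g₁
  generalize momentCoeff₂ b c = g₂
  linear_combination (-2 * (1 + (2 + b) / 4 * g₁ + (1 + b - c ^ 2 / 4) * g₂)) * hroot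

end OuterPartExpansion

/-! ### One-variable Taylor calculus to third order. -/

section Jets

/-- Third order expansions at `0` from the right. -/
def HasJet (f : ℝ → ℝ) (a₀ a₁ a₂ a₃ : ℝ) : Prop :=
  (fun t => f t - (a₀ + a₁ * t + a₂ * t ^ 2 + a₃ * t ^ 3)) =O[𝓝[>] 0] (fun t => t ^ 4)

variable {f g : ℝ → ℝ} {a₀ a₁ a₂ a₃ b₀ b₁ b₂ b₃ : ℝ}

theorem isBigO_one_of_continuous {φ : ℝ → ℝ} (h : Continuous φ) :
    φ =O[𝓝[>] 0] (fun _ => (1 : ℝ)) :=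
  ((h.tendsto 0).mono_left nhdsWithin_le_nhds).isBigO_one ℝ

theorem HasJet.of_isBigO_sub (hf : HasJet f a₀ a₁ a₂ a₃)
    (h : (fun t => g t - f t) =O[𝓝[>] 0] (fun t => t ^ 4)) : HasJet g a₀ a₁ a₂ a₃ :=
  (h.add hf).congr_left fun t => by ring

theorem HasJet.congr (hf : HasJet f a₀ a₁ a₂ a₃) (h : f =ᶠ[𝓝[>] 0] g) : HasJet g a₀ a₁ a₂ a₃ :=
  IsBigO.congr' hf (h.mono fun t ht => by simp only [ht]) EventuallyEq.rfl

theorem HasJet.cast (hf : HasJet f a₀ a₁ a₂ a₃) (h₀ : a₀ = b₀) (h₁ : a₁ = b₁) (h₂ : a₂ = b₂)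
    (h₃ : a₃ = b₃) : HasJet f b₀ b₁ b₂ b₃ := by
  subst h₀ h₁ h₂ h₃
  exact hf

theorem hasJet_poly (a₀ a₁ a₂ a₃ : ℝ) :
    HasJet (fun t => a₀ + a₁ * t + a₂ * t ^ 2 + a₃ * t ^ 3) a₀ a₁ a₂ a₃ := by
  simp only [HasJet, sub_self]
  exact isBigO_zero _ _

theorem hasJet_const (a : ℝ) : HasJet (fun _ => a) a 0 0 0 :=
  (hasJet_poly a 0 0 0).congr (Eventually.of_forall fun t => by ring)

theorem hasJet_linear (a : ℝ) : HasJet (fun t => t * a) 0 a 0 0 :=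
  (hasJet_poly 0 a 0 0).congr (Eventually.of_forall fun t => by ring)

theorem HasJet.add (hf : HasJet f a₀ a₁ a₂ a₃) (hg : HasJet g b₀ b₁ b₂ b₃) :
    HasJet (fun t => f t + g t) (a₀ + b₀) (a₁ + b₁) (a₂ + b₂) (a₃ + b₃) :=
  (IsBigO.add hf hg).congr_left fun t => by ring

theorem HasJet.const_mul (c : ℝ) (hf : HasJet f a₀ a₁ a₂ a₃) :
    HasJet (fun t => c * f t) (c * a₀) (c * a₁) (c * a₂) (c * a₃) :=
  (IsBigO.const_mul_left hf c).congr_left fun t => by ring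

theorem HasJet.sub (hf : HasJet f a₀ a₁ a₂ a₃) (hg : HasJet g b₀ b₁ b₂ b₃) :
    HasJet (fun t => f t - g t) (a₀ - b₀) (a₁ - b₁) (a₂ - b₂) (a₃ - b₃) :=
  (IsBigO.sub hf hg).congr_left fun t => by ring

theorem isBigO_pow_of_le {m n : ℕ} (h : m ≤ n) :
    (fun t : ℝ => t ^ n) =O[𝓝[>] 0] (fun t : ℝ => t ^ m) := by
  have h1 := (isBigO_refl (fun t : ℝ => t ^ m) (𝓝[>] 0)).mul
    (isBigO_one_of_continuous (φ := fun t : ℝ => t ^ (n - m)) (by fun_prop))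
  refine (h1.congr_left fun t => ?_).congr_right fun t => by ring
  rw [← pow_add, Nat.add_sub_cancel' h]

theorem HasJet.tendsto (hf : HasJet f a₀ a₁ a₂ a₃) : Tendsto f (𝓝[>] 0) (𝓝 a₀) := by
  have h1 : Tendsto (fun t : ℝ => t ^ 4) (𝓝[>] 0) (𝓝 0) :=
    (Continuous.tendsto' (by fun_prop) 0 0 (by simp)).mono_left nhdsWithin_le_nhds
  have h2 : Tendsto (fun t : ℝ => a₀ + a₁ * t + a₂ * t ^ 2 + a₃ * t ^ 3) (𝓝[>] 0) (𝓝 a₀) :=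
    (Continuous.tendsto' (by fun_prop) 0 a₀ (by simp)).mono_left nhdsWithin_le_nhds
  have h3 := (IsBigO.trans_tendsto hf h1).add h2
  simpa using h3

theorem HasJet.isBigO_one (hf : HasJet f a₀ a₁ a₂ a₃) : f =O[𝓝[>] 0] (fun _ => (1 : ℝ)) :=
  hf.tendsto.isBigO_one ℝ

theorem HasJet.isBigO_id (hf : HasJet f 0 a₁ a₂ a₃) : f =O[𝓝[>] 0] (fun t => t) := by
  have h1 := (isBigO_refl (fun t : ℝ => t) (𝓝[>] 0)).mul
    (isBigO_one_of_continuous (φ := fun t : ℝ => a₁ + a₂ * t + a₃ * t ^ 2) (by fun_prop))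
  have h2 := IsBigO.trans hf (isBigO_pow_of_le (m := 1) (by norm_num))
  simp only [pow_one] at h2
  refine (h2.add (h1.congr_right fun t => by ring)).congr_left fun t => by ring

theorem HasJet.mul (hf : HasJet f a₀ a₁ a₂ a₃) (hg : HasJet g b₀ b₁ b₂ b₃) :
    HasJet (fun t => f t * g t) (a₀ * b₀) (a₀ * b₁ + a₁ * b₀) (a₀ * b₂ + a₁ * b₁ + a₂ * b₀)
      (a₀ * b₃ + a₁ * b₂ + a₂ * b₁ + a₃ * b₀) := by
  have h1 := IsBigO.mul hf hg.isBigO_one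
  have h2 := (isBigO_one_of_continuous
    (φ := fun t : ℝ => a₀ + a₁ * t + a₂ * t ^ 2 + a₃ * t ^ 3) (by fun_prop)).mul hg
  have h3 := (isBigO_refl (fun t : ℝ => t ^ 4) (𝓝[>] 0)).mul (isBigO_one_of_continuous
    (φ := fun t : ℝ => a₁ * b₃ + a₂ * b₂ + a₃ * b₁ + (a₂ * b₃ + a₃ * b₂) * t + a₃ * b₃ * t ^ 2)
    (by fun_prop))
  simp only [one_mul, mul_one] at h1 h2 h3
  exact ((h1.add h2).add h3).congr_left fun t => by ring

theorem HasJet.unique (hf : HasJet f a₀ a₁ a₂ a₃) (hg : HasJet f b₀ b₁ b₂ b₃) :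
    a₀ = b₀ ∧ a₁ = b₁ ∧ a₂ = b₂ ∧ a₃ = b₃ := by
  have h := eq_zero_of_sum_isBigO (N := 4)
    (a := fun k => ![a₀ - b₀, a₁ - b₁, a₂ - b₂, a₃ - b₃] (Fin.ofNat 4 k))
    ((IsBigO.sub hg hf).congr_left fun t => by
      simp [Finset.sum_range_succ, Fin.ofNat]
      ring)
  have h0 := h 0 (by norm_num)
  have h1 := h 1 (by norm_num)
  have h2 := h 2 (by norm_num)
  have h3 := h 3 (by norm_num)
  simp [Fin.ofNat] at h0 h1 h2 h3
  exact ⟨by linarith, by linarith, by linarith, by linarith⟩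

/-- If `P` is the candidate polynomial, `√f - P = (f - P²) / (√f + P)`: the numerator is of fourth
order and the denominator stays near `2`. -/
theorem HasJet.sqrt (hf : HasJet f 1 a₁ a₂ a₃) :
    HasJet (fun t => √(f t)) 1 (a₁ / 2) (a₂ / 2 - a₁ ^ 2 / 8)
      (a₃ / 2 - a₁ * a₂ / 4 + a₁ ^ 3 / 16) := by
  have hP := hasJet_poly 1 (a₁ / 2) (a₂ / 2 - a₁ ^ 2 / 8) (a₃ / 2 - a₁ * a₂ / 4 + a₁ ^ 3 / 16)
  set P : ℝ → ℝ := fun t => 1 + a₁ / 2 * t + (a₂ / 2 - a₁ ^ 2 / 8) * t ^ 2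
    + (a₃ / 2 - a₁ * a₂ / 4 + a₁ ^ 3 / 16) * t ^ 3 with hPdef
  have h1 := (hf.sub (hP.mul hP)).cast (b₀ := 0) (b₁ := 0) (b₂ := 0) (b₃ := 0) (by ring) (by ring)
    (by ring) (by ring)
  have h2 : (fun t => f t - P t * P t) =O[𝓝[>] 0] (fun t => t ^ 4) :=
    IsBigO.congr_left h1 fun t => by ring
  have h3 : Tendsto (fun t => (√(f t) + P t)⁻¹) (𝓝[>] 0) (𝓝 (√1 + 1)⁻¹) :=
    ((((Real.continuous_sqrt.tendsto 1).comp hf.tendsto).add hP.tendsto).inv₀ (by norm_num))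
  have h4 := h2.mul (h3.isBigO_one ℝ)
  simp only [mul_one] at h4
  refine hP.of_isBigO_sub (h4.congr' ?_ EventuallyEq.rfl)
  filter_upwards [hf.tendsto.eventually (lt_mem_nhds zero_lt_one),
    hP.tendsto.eventually (lt_mem_nhds zero_lt_one)] with t h5 h6
  have h7 := Real.mul_self_sqrt h5.le
  have h8 : 0 < √(f t) := Real.sqrt_pos.2 h5
  have h9 : √(f t) + P t ≠ 0 := by positivity
  rw [← div_eq_mul_inv, div_eq_iff h9]
  linear_combination -h7

theorem HasJet.inv (hf : HasJet f 1 a₁ a₂ a₃) :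
    HasJet (fun t => (f t)⁻¹) 1 (-a₁) (a₁ ^ 2 - a₂) (2 * a₁ * a₂ - a₁ ^ 3 - a₃) := by
  have hP := hasJet_poly 1 (-a₁) (a₁ ^ 2 - a₂) (2 * a₁ * a₂ - a₁ ^ 3 - a₃)
  set P : ℝ → ℝ := fun t => 1 + -a₁ * t + (a₁ ^ 2 - a₂) * t ^ 2
    + (2 * a₁ * a₂ - a₁ ^ 3 - a₃) * t ^ 3 with hPdef
  have h1 := ((hasJet_const 1).sub (hf.mul hP)).cast (b₀ := 0) (b₁ := 0) (b₂ := 0) (b₃ := 0)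
    (by ring) (by ring) (by ring) (by ring)
  have h2 : (fun t => 1 - f t * P t) =O[𝓝[>] 0] (fun t => t ^ 4) :=
    IsBigO.congr_left h1 fun t => by ring
  have h4 := h2.mul ((hf.tendsto.inv₀ one_ne_zero).isBigO_one ℝ)
  simp only [mul_one] at h4
  refine hP.of_isBigO_sub (h4.congr' ?_ EventuallyEq.rfl)
  filter_upwards [hf.tendsto.eventually (lt_mem_nhds zero_lt_one)] with t h5
  have : f t ≠ 0 := h5.ne'
  field_simp

theorem isBigO_log (hf : HasJet f 1 a₁ a₂ a₃) (hg : HasJet g 0 b₁ b₂ b₃) :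
    (fun t => Complex.log ⟨f t, g t⟩ - ((⟨f t - 1, g t⟩ : ℂ) - (⟨f t - 1, g t⟩ : ℂ) ^ 2 / 2
      + (⟨f t - 1, g t⟩ : ℂ) ^ 3 / 3)) =O[𝓝[>] 0] (fun t => t ^ 4) := by
  have hx := ((hf.sub (hasJet_const 1)).cast (b₀ := 0) (sub_self 1) rfl rfl rfl).isBigO_id
  have hz : (fun t => (⟨f t - 1, g t⟩ : ℂ)) =O[𝓝[>] 0] (fun t => t) := by
    refine IsBigO.trans (IsBigO.of_bound' (Eventually.of_forall fun t => ?_))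
      (hx.norm_left.add hg.isBigO_id.norm_left)
    refine (Complex.norm_le_abs_re_add_abs_im _).trans ?_
    exact le_abs_self _
  have hz0 : Tendsto (fun t => (⟨f t - 1, g t⟩ : ℂ)) (𝓝[>] 0) (𝓝 0) := by
    refine hz.trans_tendsto ?_
    exact tendsto_id.mono_left nhdsWithin_le_nhds
  refine (((Complex.log_sub_logTaylor_isBigO 3).comp_tendsto hz0).trans (hz.pow 4)).congr_left
    fun t => ?_
  have h1 : 1 + (⟨f t - 1, g t⟩ : ℂ) = ⟨f t, g t⟩ := by
    refine Complex.ext ?_ ?_ <;> simp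
  simp only [Function.comp_apply, h1, Complex.logTaylor, Finset.sum_range_succ, Finset.range_zero,
    Finset.sum_empty]
  norm_num
  ring

theorem HasJet.log_re (hf : HasJet f 1 a₁ a₂ a₃) (hg : HasJet g 0 b₁ b₂ b₃) :
    HasJet (fun t => (Complex.log ⟨f t, g t⟩).re) 0 a₁ (a₂ - (a₁ ^ 2 - b₁ ^ 2) / 2)
      (a₃ - (a₁ * a₂ - b₁ * b₂) + (a₁ ^ 3 - 3 * a₁ * b₁ ^ 2) / 3) := by
  have hx := (hf.sub (hasJet_const 1)).cast (b₀ := 0) (sub_self 1) rfl rfl rfl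
  have h2 := (hx.mul hx).sub (hg.mul hg)
  have h3 := ((hx.mul (hx.mul hx))).sub ((hx.mul (hg.mul hg)).const_mul 3)
  have h4 := (hx.sub (h2.const_mul (1 / 2))).add (h3.const_mul (1 / 3))
  refine (h4.cast (by ring) (by ring) (by ring) (by ring)).of_isBigO_sub ?_
  refine IsBigO.trans (IsBigO.of_bound' (Eventually.of_forall fun t => ?_)) (isBigO_log hf hg)
  refine le_trans (le_of_eq ?_) (Complex.abs_re_le_norm _)
  rw [Real.norm_eq_abs]
  congr 1
  simp [pow_succ]
  ring

theorem HasJet.log_im (hf : HasJet f 1 a₁ a₂ a₃) (hg : HasJet g 0 b₁ b₂ b₃) :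
    HasJet (fun t => (Complex.log ⟨f t, g t⟩).im) 0 b₁ (b₂ - a₁ * b₁)
      (b₃ - (a₁ * b₂ + a₂ * b₁) + (3 * a₁ ^ 2 * b₁ - b₁ ^ 3) / 3) := by
  have hx := (hf.sub (hasJet_const 1)).cast (b₀ := 0) (sub_self 1) rfl rfl rfl
  have h2 := hx.mul hg
  have h3 := ((hx.mul (hx.mul hg)).const_mul 3).sub (hg.mul (hg.mul hg))
  have h4 := (hg.sub h2).add (h3.const_mul (1 / 3))
  refine (h4.cast (by ring) (by ring) (by ring) (by ring)).of_isBigO_sub ?_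
  refine IsBigO.trans (IsBigO.of_bound' (Eventually.of_forall fun t => ?_)) (isBigO_log hf hg)
  refine le_trans (le_of_eq ?_) (Complex.abs_im_le_norm _)
  rw [Real.norm_eq_abs]
  congr 1
  simp [pow_succ]
  ring

theorem HasJet.log (hf : HasJet f 1 a₁ a₂ a₃) :
    HasJet (fun t => Real.log (f t)) 0 a₁ (a₂ - a₁ ^ 2 / 2)
      (a₃ - a₁ * a₂ + a₁ ^ 3 / 3) := by
  refine ((hf.log_re (hasJet_const 0)).cast rfl rfl (by ring) (by ring)).congr
    (Eventually.of_forall fun t => ?_)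
  exact Complex.log_ofReal_re (f t)

/-- `arctan f` is the argument of `1 + i f`, so its jet is an instance of the complex logarithm. -/
theorem HasJet.arctan (hf : HasJet f 0 a₁ a₂ a₃) :
    HasJet (fun t => Real.arctan (f t)) 0 a₁ a₂ (a₃ - a₁ ^ 3 / 3) := by
  refine (((hasJet_const 1).log_im hf).cast rfl rfl (by ring) (by ring)).congr
    (Eventually.of_forall fun t => ?_)
  simp only [Complex.log_im]
  rw [Complex.arg_of_re_nonneg zero_le_one, Real.arctan_eq_arcsin, Complex.norm_eq_sqrt_sq_add_sq]
  simp

end Jets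

/-! ### The action along rays to third order. -/

section ActionJets

/-- The jet of an analytic function along a ray, divided by the parameter. -/
theorem exists_hasJet_div {F : ℝ → ℝ → ℝ}
    (hF : AnalyticAt ℝ (fun x : ℝ × ℝ => F x.1 x.2) (0, 0)) (h0 : F 0 0 = 0) (u v : ℝ) :
    ∃ b₁ b₂ b₃ b₄, HasJet (fun t => F (t * u) (t * v) / t) b₁ b₂ b₃ b₄ := by
  obtain ⟨C, r, hC⟩ := exists_hasDoubleSeries hF
  have hp : Tendsto (fun t : ℝ => (t * u, t * v)) (𝓝[>] 0) (𝓝 (0, 0)) :=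
    (Continuous.tendsto' (by fun_prop) 0 (0, 0) (by simp)).mono_left nhdsWithin_le_nhds
  have h1 := ((hC.isBigO 5).comp_tendsto hp).trans (norm_ray_isBigO (u, v) 5)
  have hz : homPart C 0 u v = 0 := by
    have h := (hC.isBigO 1).eq_zero_imp.self_of_nhds (by simp)
    simp only [Finset.range_one, Finset.sum_singleton, h0, zero_sub, neg_eq_zero] at h
    simpa [homPart] using h
  refine ⟨homPart C 1 u v, homPart C 2 u v, homPart C 3 u v, homPart C 4 u v, ?_⟩
  have h2 := h1.mul (isBigO_refl (fun t : ℝ => t⁻¹) (𝓝[>] 0))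
  refine (h2.congr' ?_ ?_)
  · filter_upwards [self_mem_nhdsWithin] with t ht
    have ht0 : t ≠ 0 := ne_of_gt ht
    simp only [Function.comp_apply, homPart_smul, Finset.sum_range_succ, Finset.range_zero,
      Finset.sum_empty, hz]
    field_simp
    ring
  · filter_upwards [self_mem_nhdsWithin] with t ht
    have ht0 : t ≠ 0 := ne_of_gt ht
    field_simp

theorem analyticAt_fst_paramInv :
    AnalyticAt ℝ (fun x : ℝ × ℝ => (fun a b => (paramInv (a, b)).1) x.1 x.2) (0, 0) :=
  analyticAt_fst.comp analyticAt_paramInv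

theorem analyticAt_snd_paramInv :
    AnalyticAt ℝ (fun x : ℝ × ℝ => (fun a b => (paramInv (a, b)).2) x.1 x.2) (0, 0) :=
  analyticAt_snd.comp analyticAt_paramInv

theorem tendsto_ray_nhds (u v : ℝ) :
    Tendsto (fun t : ℝ => (t * u, t * v)) (𝓝[>] 0) (𝓝 (0, 0)) :=
  (Continuous.tendsto' (by fun_prop) 0 (0, 0) (by simp)).mono_left nhdsWithin_le_nhds

/-- The jets of the normalised parameters along a ray. -/
theorem exists_hasJet_paramInv (u v : ℝ) : ∃ b₄ c₄ : ℝ,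
    HasJet (fun t => (paramInv (t * u, t * v)).1 / t) u (-2 * u ^ 2 - v ^ 2 / 4)
      (5 * u ^ 3 + 5 / 4 * (u * v ^ 2)) b₄ ∧
    HasJet (fun t => (paramInv (t * u, t * v)).2 / t) v (-3 / 2 * (u * v))
      (27 / 8 * (u ^ 2 * v) + 3 / 8 * v ^ 3) c₄ := by
  obtain ⟨b₁, b₂, b₃, b₄, hB⟩ := exists_hasJet_div (F := fun a b => (paramInv (a, b)).1) analyticAt_fst_paramInv
    (by rw [paramInv_zero]) u v
  obtain ⟨c₁, c₂, c₃, c₄, hC⟩ := exists_hasJet_div (F := fun a b => (paramInv (a, b)).2) analyticAt_snd_paramInv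
    (by rw [paramInv_zero]) u v
  have hmul : ∀ φ : ℝ → ℝ, (fun t : ℝ => t * 1 * (φ t / t)) =ᶠ[𝓝[>] 0] φ := fun φ => by
    filter_upwards [self_mem_nhdsWithin] with t ht
    have ht0 : t ≠ 0 := ne_of_gt ht
    field_simp
  have hb := (((hasJet_linear 1).mul hB).cast (b₀ := 0) (b₁ := b₁) (b₂ := b₂) (b₃ := b₃)
    (by ring) (by ring) (by ring) (by ring)).congr (hmul _)
  have hc := (((hasJet_linear 1).mul hC).cast (b₀ := 0) (b₁ := c₁) (b₂ := c₂) (b₃ := c₃)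
    (by ring) (by ring) (by ring) (by ring)).congr (hmul _)
  have hob := ((hasJet_const 1).sub hb).cast (sub_zero 1) rfl rfl rfl
  have heq := (tendsto_ray_nhds u v).eventually eventually_paramInv_eq
  -- Analyticity supplies jets with unknown coefficients. Substituting them into the fixed point
  -- equations and comparing orders determines these coefficients successively.
  have e1 := ((((hasJet_linear u).mul (hob.mul hob)).sub ((hc.mul hc).const_mul (1 / 4))).congr
    (g := fun t => (paramInv (t * u, t * v)).1) (heq.mono fun t ht => by
      linear_combination -ht.1)).unique hb
  have e2 := (((hasJet_linear v).mul (hob.mul hob.sqrt)).congr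
    (g := fun t => (paramInv (t * u, t * v)).2) (heq.mono fun t ht => by
      linear_combination -ht.2)).unique hc
  obtain ⟨-, e11, e12, e13⟩ := e1
  obtain ⟨-, e21, e22, e23⟩ := e2
  have k1 : b₁ = u := by rw [← e11]; ring
  have k2 : c₁ = v := by rw [← e21]; ring
  subst k1 k2
  have k3 : b₂ = -2 * b₁ ^ 2 - c₁ ^ 2 / 4 := by rw [← e12]; ring
  have k4 : c₂ = -3 / 2 * (b₁ * c₁) := by rw [← e22]; ring
  subst k3 k4
  have k5 : b₃ = 5 * b₁ ^ 3 + 5 / 4 * (b₁ * c₁ ^ 2) := by rw [← e13]; ring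
  have k6 : c₃ = 27 / 8 * (b₁ ^ 2 * c₁) + 3 / 8 * c₁ ^ 3 := by rw [← e23]; ring
  subst k5 k6
  exact ⟨b₄, c₄, hB, hC⟩

theorem hasJet_vanishingAction (u v : ℝ) :
    HasJet (fun t => vanishingAction (t * u) (t * v)) 0 u (-(3 * u ^ 2 + v ^ 2) / 8)
      (u * (35 * u ^ 2 + 15 * v ^ 2) / 64) := by
  have h1 := vanishingAction_isBigO.comp_tendsto (tendsto_ray_nhds u v)
  have h2 : (fun t : ℝ => √((t * u) ^ 2 + (t * v) ^ 2) ^ 5) =O[𝓝[>] 0] (fun t => t ^ 4) := by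
    have h3 := (isBigO_refl (fun t : ℝ => t ^ 5) (𝓝[>] 0)).mul
      (isBigO_const_const (√(u ^ 2 + v ^ 2) ^ 5) (one_ne_zero (α := ℝ)) (𝓝[>] (0 : ℝ)))
    simp only [mul_one] at h3
    refine (h3.trans (isBigO_pow_of_le (by norm_num))).congr' ?_ EventuallyEq.rfl
    filter_upwards [self_mem_nhdsWithin] with t ht
    have ht0 : (0 : ℝ) < t := ht
    rw [show (t * u) ^ 2 + (t * v) ^ 2 = t ^ 2 * (u ^ 2 + v ^ 2) by ring,
      Real.sqrt_mul (sq_nonneg t), Real.sqrt_sq ht0.le, mul_pow]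
  have h4 := (isBigO_refl (fun t : ℝ => t ^ 4) (𝓝[>] 0)).mul
    (isBigO_const_const ((1155 * u ^ 4 + 630 * u ^ 2 * v ^ 2 + 35 * v ^ 4) / 1024)
      (one_ne_zero (α := ℝ)) (𝓝[>] (0 : ℝ)))
  simp only [mul_one] at h4
  refine ((h1.trans h2).sub h4).congr_left fun t => ?_
  simp only [Function.comp_apply]
  ring

theorem HasJet.outerPart {f g : ℝ → ℝ} {a₁ a₂ a₃ b₁ b₂ b₃ : ℝ} (hf : HasJet f 0 a₁ a₂ a₃)
    (hg : HasJet g 0 b₁ b₂ b₃) :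
    HasJet (fun t => outerPart (f t) (g t)) (4 / 3) ((2 * Real.log 2 - 1) * a₁)
      ((2 * Real.log 2 - 1) * a₂ + (Real.log 2 / 4 - 7 / 16) * a₁ ^ 2
        + (Real.log 2 / 4 - 5 / 16) * b₁ ^ 2)
      ((2 * Real.log 2 - 1) * a₃ + (Real.log 2 / 4 - 7 / 16) * (2 * a₁ * a₂)
        + (Real.log 2 / 4 - 5 / 16) * (2 * b₁ * b₂) + (7 / 48 - Real.log 2 / 32) * a₁ ^ 3
        + (9 / 64 - Real.log 2 / 32) * (a₁ * b₁ ^ 2)) := by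
  have ht : Tendsto (fun t => (f t, g t)) (𝓝[>] 0) (𝓝 (0, 0)) :=
    hf.tendsto.prodMk_nhds hg.tendsto
  have h1 := (outerPart_isBigO.comp_tendsto ht).trans
    ((hf.isBigO_id.prod_left hg.isBigO_id).norm_left.pow 4)
  have h2 := hf.mul hf
  have h3 := hg.mul hg
  have h4 := (((((hasJet_const (4 / 3)).add (hf.const_mul (2 * Real.log 2 - 1))).add
    (h2.const_mul (Real.log 2 / 4 - 7 / 16))).add
    ((hf.mul h2).const_mul (7 / 48 - Real.log 2 / 32))).add
    (h3.const_mul (Real.log 2 / 4 - 5 / 16))).add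
    ((hf.mul h3).const_mul (9 / 64 - Real.log 2 / 32))
  refine (h4.cast (by ring) (by ring) (by ring) (by ring)).of_isBigO_sub
    (h1.congr_left fun t => ?_)
  simp only [Function.comp_apply]
  ring

/-- The beginning of the expansion of the action along a ray. -/
theorem hasJet_actionRemainder {u v : ℝ} (huv : (u, v) ≠ (0, 0)) :
    HasJet (fun t => actionRemainder (t * u) (t * v)) 0 u ((17 * u ^ 2 + 3 * v ^ 2) / 16)
      (-(u * (118 * u ^ 6 + 273 * u ^ 4 * v ^ 2 + 194 * u ^ 2 * v ^ 4 + 39 * v ^ 6)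
        / (64 * (u ^ 2 + v ^ 2) ^ 2))) := by
  obtain ⟨b₄, c₄, hB, hC⟩ := exists_hasJet_paramInv u v
  have hs : 0 < u ^ 2 + v ^ 2 := sq_add_sq_pos huv
  have hmul : ∀ φ : ℝ → ℝ, (fun t : ℝ => t * 1 * (φ t / t)) =ᶠ[𝓝[>] 0] φ := fun φ => by
    filter_upwards [self_mem_nhdsWithin] with t ht
    have ht0 : t ≠ 0 := ne_of_gt ht
    field_simp
  set b : ℝ → ℝ := fun t => (paramInv (t * u, t * v)).1 with hbdef
  set c : ℝ → ℝ := fun t => (paramInv (t * u, t * v)).2 with hcdef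
  have hb : HasJet b 0 u (-2 * u ^ 2 - v ^ 2 / 4) (5 * u ^ 3 + 5 / 4 * (u * v ^ 2)) :=
    (((hasJet_linear 1).mul hB).cast (by ring) (by ring) (by ring) (by ring)).congr (hmul _)
  have hc : HasJet c 0 v (-3 / 2 * (u * v)) (27 / 8 * (u ^ 2 * v) + 3 / 8 * v ^ 3) :=
    (((hasJet_linear 1).mul hC).cast (by ring) (by ring) (by ring) (by ring)).congr (hmul _)
  -- the scale
  have hob := ((hasJet_const 1).sub hb).cast (sub_zero 1) rfl rfl rfl
  have hscale : HasJet (fun t => ((1 - b t) * √(1 - b t))⁻¹) 1 (3 / 2 * u)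
      (-9 / 8 * u ^ 2 - 3 / 8 * v ^ 2) (35 / 16 * u ^ 3 + 15 / 16 * (u * v ^ 2)) :=
    (((hob.mul hob.sqrt).cast (mul_one 1) rfl rfl rfl).inv).cast rfl (by ring) (by ring) (by ring)
  -- the outer root
  have hroot : HasJet (fun t => outerRoot (b t) (c t)) 1 (u / 2) (-9 / 8 * u ^ 2 - v ^ 2 / 4)
      (49 / 16 * u ^ 3 + 9 / 8 * (u * v ^ 2)) := by
    have h := (((hasJet_const 1).add hb).sub ((hc.mul hc).const_mul (1 / 4))).cast (b₀ := 1)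
      (by ring) rfl rfl rfl
    refine (h.sqrt.cast rfl (by ring) (by ring) (by ring)).congr (Eventually.of_forall fun t => ?_)
    simp only [outerRoot, quadRoot]
    congr 1
    ring
  -- the logarithm at the outer root
  obtain ⟨l₃, hlog⟩ : ∃ l₃, HasJet
      (fun t => Real.log ((2 + b t + 2 * outerRoot (b t) (c t)) / 16))
      (-2 * Real.log 2) (u / 2) (-19 / 16 * u ^ 2 - 3 / 16 * v ^ 2) l₃ := by
    -- The argument is first divided by its value `4` at the origin, since jets of logarithms are
    -- taken at `1`; the rest of the factor `1 / 16` gives `-log 4 = -2 log 2`.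
    have h := ((((hasJet_const 2).add hb).add (hroot.const_mul 2)).const_mul (1 / 4)).cast (b₀ := 1)
      (by norm_num) rfl rfl rfl
    have h2 := (hasJet_const (-2 * Real.log 2)).add h.log
    refine ⟨_, (h2.congr ?_).cast (add_zero _) (by ring) (by ring) rfl⟩
    filter_upwards [h.tendsto.eventually (lt_mem_nhds zero_lt_one)] with t ht
    have h4 : Real.log 4 = 2 * Real.log 2 := by
      rw [show (4 : ℝ) = 2 ^ 2 by norm_num, Real.log_pow]; norm_num
    rw [show (2 + b t + 2 * outerRoot (b t) (c t)) / 16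
      = (1 / 4 * (2 + b t + 2 * outerRoot (b t) (c t))) / 4 by ring,
      Real.log_div ht.ne' (by norm_num), h4]
    ring
  -- the angle at the outer root
  obtain ⟨θ₃, hθ⟩ : ∃ θ₃, HasJet (fun t => angleShift (b t) (c t)) 0 (v / 2)
      (-7 / 8 * (u * v)) θ₃ := by
    have h := ((hroot.add (hasJet_const 1)).const_mul (1 / 2)).cast (b₀ := 1)
      (by norm_num) rfl rfl rfl
    have h2 := (((hc.mul h.inv).const_mul (1 / 4)).cast (b₀ := 0) (by ring) rfl rfl rfl).arctan
    refine ⟨_, ((h2.const_mul 2).congr (Eventually.of_forall fun t => ?_)).cast (mul_zero 2)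
      (by ring) (by ring) rfl⟩
    simp only [angleShift]
    congr 2
    rw [mul_inv (1 / 2 : ℝ) _, div_eq_mul_inv (c t), mul_inv (2 : ℝ) _]
    ring
  -- the logarithm of the ratio of the parameters
  have hX := (((hB.const_mul u).add (hC.const_mul v)).const_mul (u ^ 2 + v ^ 2)⁻¹).cast (b₀ := 1)
    (by field_simp) rfl rfl rfl
  have hY := (((hC.const_mul u).sub (hB.const_mul v)).const_mul (u ^ 2 + v ^ 2)⁻¹).cast (b₀ := 0)
    (by field_simp; ring) rfl rfl rfl
  have hre := hX.log_re hY
  have him := hX.log_im hY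
  have hv := hasJet_vanishingAction u v
  -- The vanishing action and `j` have no constant term, so the third coefficients of the logarithms
  -- and angles, including the unknown `b₄`, `c₄`, `l₃`, `θ₃`, do not enter.
  have htot := (((((hscale.mul (hb.outerPart hc)).sub (hasJet_const (4 / 3))).add
    (hv.mul hlog)).add ((hasJet_linear v).mul hθ)).sub
    ((hv.mul hre).sub ((hasJet_linear v).mul him)))
  refine (htot.congr ?_).cast (by ring) (by ring) (by field_simp; ring) (by field_simp; ring)
  filter_upwards [(tendsto_ray huv).eventually actionRemainder_eventuallyEq,
    self_mem_nhdsWithin] with t ht ht0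
  have ht1 : t ≠ 0 := ne_of_gt ht0
  have hL : paramLog (t * u, t * v)
      = Complex.log ⟨(u ^ 2 + v ^ 2)⁻¹ * (u * ((paramInv (t * u, t * v)).1 / t)
          + v * ((paramInv (t * u, t * v)).2 / t)),
        (u ^ 2 + v ^ 2)⁻¹ * (u * ((paramInv (t * u, t * v)).2 / t)
          - v * ((paramInv (t * u, t * v)).1 / t))⟩ := by
    rw [paramLog]
    congr 1
    refine Complex.ext ?_ ?_
    · rw [Complex.div_re, Complex.normSq_mk]
      simp only
      field_simp
    · rw [Complex.div_im, Complex.normSq_mk]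
      simp only
      field_simp
  rw [ht, hL, regularRemainder]

end ActionJets

/-! ### The expansion of the action with explicit first terms. -/

section Expansion

theorem norm_isBigO_sqrt (N : ℕ) (l : Filter (ℝ × ℝ)) :
    (fun x : ℝ × ℝ => ‖x‖ ^ N) =O[l] (fun x => √(x.1 ^ 2 + x.2 ^ 2) ^ N) := by
  refine IsBigO.pow (IsBigO.of_bound 1 (Eventually.of_forall fun x => ?_)) N
  rw [one_mul, norm_norm, Real.norm_of_nonneg (Real.sqrt_nonneg _)]
  exact Real.le_sqrt_of_sq_le (norm_sq_le x)

/-- The coefficients of the expansion of the action, with the first three made explicit. -/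
def actionCoeff (c : ℕ → ℝ × ℝ → ℝ) : ℕ → ℝ → ℝ → ℝ
  | 0, _, _ => 0
  | 1, h, _ => h
  | 2, h, j => (17 * h ^ 2 + 3 * j ^ 2) / 16
  | 3, h, j => -(h * (118 * h ^ 6 + 273 * h ^ 4 * j ^ 2 + 194 * h ^ 2 * j ^ 4 + 39 * j ^ 6)
      / (64 * (h ^ 2 + j ^ 2) ^ 2))
  | k + 4, h, j => c (k + 4) (h, j)

/-- Uniqueness of jets along every ray identifies the abstract coefficients of degree `0` to `3`
with the computed ones. The one of degree `0` vanishes, so the sum may start at `1`. -/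
theorem exists_action_expansion : ∃ c : ℕ → ℝ → ℝ → ℝ,
    (∀ k, HomRat k (fun x => c k x.1 x.2)) ∧
    (∀ h j : ℝ, c 1 h j = h) ∧
    (∀ h j : ℝ, c 2 h j = (17 * h ^ 2 + 3 * j ^ 2) / 16) ∧
    (∀ h j : ℝ, c 3 h j =
      -(h * (118 * h ^ 6 + 273 * h ^ 4 * j ^ 2 + 194 * h ^ 2 * j ^ 4 + 39 * j ^ 6)
        / (64 * (h ^ 2 + j ^ 2) ^ 2))) ∧
    ∀ N : ℕ, (fun x : ℝ × ℝ => actionRemainder x.1 x.2 - ∑ k ∈ Finset.Icc 1 N, c k x.1 x.2)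
      =O[𝓝[≠] (0, 0)] (fun x : ℝ × ℝ => √(x.1 ^ 2 + x.2 ^ 2) ^ (N + 1)) := by
  obtain ⟨c, hc, hO⟩ := exists_hasExp_actionRemainder
  have key : ∀ k, ∀ x : ℝ × ℝ, x ≠ (0, 0) → c k x = actionCoeff c k x.1 x.2 := by
    intro k x hx
    have h1 : HasJet (fun t => actionRemainder (t * x.1) (t * x.2)) (c 0 x) (c 1 x) (c 2 x)
        (c 3 x) := by
      refine (isBigO_ray hc (hO 4) hx).congr_left fun t => ?_
      simp [Finset.sum_range_succ]
    obtain ⟨e0, e1, e2, e3⟩ := h1.unique (hasJet_actionRemainder hx)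
    match k with
    | 0 => exact e0
    | 1 => exact e1
    | 2 => exact e2
    | 3 => exact e3
    | k + 4 => rfl
  refine ⟨actionCoeff c, fun k => (hc k).congr (key k), fun _ _ => rfl, fun _ _ => rfl,
    fun _ _ => rfl, fun N => ?_⟩
  refine ((hO (N + 1)).congr' ?_ EventuallyEq.rfl).trans (norm_isBigO_sqrt _ _)
  filter_upwards [self_mem_nhdsWithin] with x hx
  congr 1
  have h0 : c 0 x = 0 := key 0 x hx
  rw [Finset.sum_range_succ', h0, add_zero, Finset.sum_congr rfl fun k _ => key (k + 1) x hx,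
    Finset.range_eq_Ico, Finset.sum_Ico_add' (fun k => actionCoeff c k x.1 x.2) 0 N 1]
  rfl

end Expansion

end Champagne

end

theorem lemma2 :
    ∃ 𝒥 : ℝ → ℝ → ℝ,
      -- the coefficient of the logarithm and the beginning of its convergent expansion
      AnalyticAt ℝ (fun x : ℝ × ℝ => 𝒥 x.1 x.2) (0, 0) ∧
      (fun x : ℝ × ℝ => 𝒥 x.1 x.2 -
          (x.1 - (3 * x.1 ^ 2 + x.2 ^ 2) / 8 + x.1 * (35 * x.1 ^ 2 + 15 * x.2 ^ 2) / 64
            - (1155 * x.1 ^ 4 + 630 * x.1 ^ 2 * x.2 ^ 2 + 35 * x.2 ^ 4) / 1024))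
        =O[𝓝 (0, 0)] (fun x : ℝ × ℝ => √(x.1 ^ 2 + x.2 ^ 2) ^ 5) ∧
      -- it is the integral over the vanishing cycle
      (∀ᶠ x : ℝ × ℝ in 𝓝 (0, 0),
        (𝒥 x.1 x.2 : ℂ) = Champagne.vanishingPeriod x.1 x.2) ∧
      -- it is the inverse of the Birkhoff normal form
      (∃ ν, Champagne.IsBirkhoffNormalForm ν) ∧
      (∀ ν, Champagne.IsBirkhoffNormalForm ν →
        ∀ᶠ x : ℝ × ℝ in 𝓝 (0, 0),
          HasSum (fun n : ℕ × ℕ =>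
            ν n.1 n.2 * (𝒥 x.1 x.2 / √2) ^ n.1 * (x.2 / √2) ^ n.2) x.1) ∧
      -- the expansion of the action
      ∃ c : ℕ → ℝ → ℝ → ℝ,
        (∀ k, ∃ (p : MvPolynomial (Fin 2) ℝ) (m : ℕ), p.IsHomogeneous (k + 2 * m) ∧
          ∀ h j : ℝ, (h, j) ≠ (0, 0) →
            c k h j = MvPolynomial.eval ![h, j] p / (h ^ 2 + j ^ 2) ^ m) ∧
        (∀ h j : ℝ, c 1 h j = h) ∧
        (∀ h j : ℝ, c 2 h j = (17 * h ^ 2 + 3 * j ^ 2) / 16) ∧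
        (∀ h j : ℝ, c 3 h j =
          -(h * (118 * h ^ 6 + 273 * h ^ 4 * j ^ 2 + 194 * h ^ 2 * j ^ 4 + 39 * j ^ 6)
            / (64 * (h ^ 2 + j ^ 2) ^ 2))) ∧
        ∀ N : ℕ,
          (fun x : ℝ × ℝ => 2 * π * Champagne.action x.1 x.2 -
              (4 / 3 - π * |x.2| + x.2 * Complex.arg ⟨x.1, x.2⟩
                + 𝒥 x.1 x.2 * Real.log (16 / √(x.1 ^ 2 + x.2 ^ 2))
                + ∑ k ∈ Finset.Icc 1 N, c k x.1 x.2))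
            =O[𝓝[≠] (0, 0)] (fun x : ℝ × ℝ => √(x.1 ^ 2 + x.2 ^ 2) ^ (N + 1)) := by
  refine ⟨Champagne.vanishingAction, Champagne.analyticAt_vanishingAction,
    Champagne.vanishingAction_isBigO, ?_, Champagne.exists_isBirkhoffNormalForm,
    fun ν hν => hν.hasSum_vanishingAction, ?_⟩
  · filter_upwards [Champagne.eventually_abs_le (r := 1 / 16) (by norm_num)] with x hx
    exact (Champagne.vanishingPeriod_eq_ofReal hx.1 (hx.2.trans (by norm_num))).symm
  · obtain ⟨c, hc, h1, h2, h3, hO⟩ := Champagne.exists_action_expansion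
    refine ⟨c, fun k => ?_, h1, h2, h3, fun N => (hO N).congr_left fun x => ?_⟩
    · obtain ⟨p, m, hp, hx⟩ := hc k
      exact ⟨p, m, hp, fun h j hne => hx (h, j) hne⟩
    · rw [Champagne.actionRemainder]
      ring
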